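/- **Setting.** Fix $d\ge1$, a scaling $\mathfrak s\in[1,\infty)^d$, $\ell>0$; write $|\mathbf k|_{\mathfrak s}=\sum_i\mathfrak s_ik_i$, $\|x\|_{\mathfrak s}=\sum_i|x_i|^{1/\mathfrak s_i}$, $\mathbb N[\mathfrak s]=\{|\mathbf k|_{\mathfrak s}:\mathbf k\in\mathbb N^d\}$, $\varphi(x)=|x_1|^{1/\mathfrak s_1}\wedge1$, $\varphi(x,y)=\varphi(x)\wedge\varphi(y)$, $D=(\mathbb R\setminus\{0\})\times\mathbb R^{d-1}$. Let $G\ge0$ be measurable on $\mathbb R^d$, $G_t(x)=t^{-|\mathfrak s|/\ell}G(t^{-\mathfrak s/\ell}x)$ with $|\mathfrak s|=\sum_i\mathfrak s_i$, and let $\{Q_t\}_{t>0}$ be a $G$-type semigroup: continuous kernels with $\int Q_{t-r}(x,z)Q_r(z,y)\,dz=Q_t(x,y)$ for $0<r<t$, $\lim_{t\downarrow0}\int Q_t(x,y)\,dy=1$, $|Q_t(x,y)|\le C_1G_t(x-y)$, differentiable in $t$ with $|\partial_tQ_t(x,y)|\le C_2t^{-1}G_t(x-y)$. A *$G$-controlled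 weight* is a continuous $w:\mathbb R^d\to(0,1]$ together with a fixed continuous $w^*:\mathbb R^d\to[1,\infty)$ such that $w(x+y)\le w^*(x)w(y)$ and $\sup_{0<t\le T,\,x}\|x\|_{\mathfrak s}^n\,w^*(t^{\mathfrak s/\ell}x)\,G(x)<\infty$ for all $n\ge0$, $T>0$; products of weights carry the products of the controlling functions. $C(w)$ is the space of continuous $f$ with $\sup|f|w<\infty$, and for $\alpha\le0$, $C^{\alpha,Q}(w)$ is its completion under $\sup_{0<t\le1}t^{-\alpha/\ell}\|Q_tf\|_{L^\infty(w)}$. Fix $G$-controlled weights $w,v$ such that $w^2v$ is $G$-controlled, and assume that there are $G$-controlled weights $w_1,w_2$ such that $ww_1,ww_2$ are $G$-controlled and $\sup_x\|x\|_{\mathfrak s}^n(w^*w_1+w_1^*w_2)(x)<\infty$ for all $n\ge 0$. *Models.* Let $\mathscr T=(\mathbf A,\mathbf T,\mathbf G)$ be a regularity structure with $\alpha_0=\min\mathbf A$. A smooth model consists of continuous linear $\Pi_x:\mathbf T\to C(w)$ and $\Gamma_{xy}\in\mathbf G$ with $\Pi_x\Gamma_{xy}=\Pi_y$, $\Gamma_{xx}=\mathrm{id}$,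 $\Gamma_{xy}\Gamma_{yz}=\Gamma_{xz}$ and, for all $\gamma\in\mathbb R$, finite seminorms $$\|\Pi\|_{\gamma,w}=\max_{\alpha<\gamma}\sup_{0<t\le1,\,x,\,\tau\in\mathbf T_\alpha\setminus\{0\}}t^{-\alpha/\ell}w(x)\frac{|Q_t(x,\Pi_x\tau)|}{\|\tau\|_\alpha},\qquad \|\Gamma\|_{\gamma,w}=\max_{\beta<\alpha<\gamma}\sup_{x\ne y,\,\tau\in\mathbf T_\alpha\setminus\{0\}}\frac{w(x)\|\Gamma_{yx}\tau\|_\beta}{w^*(y-x)\|y-x\|_{\mathfrak s}^{\alpha-\beta}\|\tau\|_\alpha}.$$ The space of models $\mathscr M_w(\mathscr T)$ is the completion of the smooth models under the pseudo-metrics $|||M^{(1)};M^{(2)}|||_{\gamma,w}=\|\Pi^{(1)}-\Pi^{(2)}\|_{\gamma,w}+\|\Gamma^{(1)}-\Gamma^{(2)}\|_{\gamma,w}$, $\gamma\in\mathbb R$, and $|||M|||_{\gamma,w}=\|\Pi\|_{\gamma,w}+\|\Gamma\|_{\gamma,w}$. For $\eta\le\gamma$ and $f:D\to\mathbf T_{<\gamma}$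 put $\Delta_{yx}f=f(y)-\Gamma_{yx}f(x)$, $$(\!|f|\!)_{\gamma,\eta,v}=\max_{\alpha<\gamma}\sup_{x\in D}\frac{v(x)\|f(x)\|_\alpha}{\varphi(x)^{(\eta-\alpha)\wedge0}},\qquad \|f\|^\#_{\gamma,\eta,v}=\max_{\alpha<\gamma}\sup_{x\neq y\in D}\frac{v(x)\|\Delta_{yx}f\|_\alpha}{\varphi(x,y)^{\eta-\gamma}v^*(x-y)\|y-x\|_{\mathfrak s}^{\gamma-\alpha}},$$ $|||f|||^\#=(\!|f|\!)+\|f\|^\#$, let $\mathcal D^{\gamma,\eta}_v(\Gamma)^\#$ be the space of $f$ with $|||f|||^\#_{\gamma,\eta,v}<\infty$, and let $|||f^{(1)};f^{(2)}|||^\#$ be defined with $f^{(1)}-f^{(2)}$ and $\Delta_{yx}^{(1)}f^{(1)}-\Delta_{yx}^{(2)}f^{(2)}$ in place of $f$ and $\Delta_{yx}f$. A *reconstruction* of $f$ with respect to a weight $u$ is some $\Lambda\in C^{\zeta,Q}(u)$, $\zeta\le0$, with $$[\![\Lambda]\!]_{\gamma,\eta,u}=\sup_{0<t\le1,\,x\in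 D}t^{-\gamma/\ell}\varphi(x)^{\gamma-\eta}u(x)|Q_t(x,\Lambda_x)|<\infty,\qquad \Lambda_x=\Lambda-\Pi_xf(x);$$ $[\![\Lambda^{(1)};\Lambda^{(2)}]\!]_{\gamma,\eta,u}$ is the same supremum for $\Lambda^{(1)}_x-\Lambda_x^{(2)}$. *Kernel.* Let $\{K_t\}_{t>0}$ be a $\bar\beta$-regularizing kernel with constants $\delta,C_K>0$, $\bar\beta>0$: continuous kernels with $\int K_{t-r}(x,z)Q_r(z,y)\,dz=K_t(x,y)$ for $0<r<t$ and, for $|\mathbf k|_{\mathfrak s}<\delta$, existing partial derivatives with $|\partial_x^{\mathbf k}K_t(x,y)|\le C_Kt^{(\bar\beta-|\mathbf k|_{\mathfrak s})/\ell-1}G_t(x-y)$ and, for $\|h\|_{\mathfrak s}\le t^{1/\ell}$, $|\partial^{\mathbf k}_xK_t(x+h,y)-\sum_{|\mathbf l|_{\mathfrak s}<\delta-|\mathbf k|_{\mathfrak s}}\frac{h^{\mathbf l}}{\mathbf l!}\partial_x^{\mathbf k+\mathbf l}K_t(x,y)|\le C_K\|h\|_{\mathfrak s}^{\delta-|\mathbf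 k|_{\mathfrak s}}t^{(\bar\beta-\delta)/\ell-1}G_t(x-y)$. Write $\partial^{\mathbf k}K(x,F)=\int_0^1\partial^{\mathbf k}K_t(x,F)\,dt$, where $\partial^{\mathbf k}K_t(x,F)=\int\partial_x^{\mathbf k}K_{t/2}(x,z)\,Q_{t/2}(z,F)\,dz$ extends $\int\partial^{\mathbf k}_xK_t(x,y)F(y)\,dy$ to generalized functions, and $KF=\partial^{0}K(\cdot,F)$. *Admissible pairs.* Let $\bar{\mathscr T}=(\bar{\mathbf A},\bar{\mathbf T},\bar{\mathbf G})$ be a regularity structure with $\mathbb N[\mathfrak s]\subset\bar{\mathbf A}$ which contains the polynomials $X^{\mathbf k}\in\bar{\mathbf T}_{|\mathbf k|_{\mathfrak s}}$, with $\mathrm{span}\{X^{\mathbf k}\}$ stable under $\bar{\mathbf G}$, and let $\mathcal I:\mathbf T\to\bar{\mathbf T}$ be continuous linear with $\mathcal I\,\mathbf T_\alpha\subset\bar{\mathbf T}_{\alpha+\beta}$, where $\beta\in(0,\bar\beta]$. For $\tau\in\mathbf T_\alpha$ with $\alpha+\beta<\delta$ let $\mathcal J(x)\tau=\sum_{|\mathbf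 k|_{\mathfrak s}<\alpha+\beta}\frac{X^{\mathbf k}}{\mathbf k!}\partial^{\mathbf k}K(x,\Pi_x\tau)$, extended linearly to $\mathbf T_{<\delta-\beta}$. A pair of models $(M,\bar M)\in\mathscr M_w(\mathscr T)\times\mathscr M_w(\bar{\mathscr T})$ is *$K$-admissible* if $\bar\Pi_xX^{\mathbf k}=(\cdot-x)^{\mathbf k}$, $\bar\Gamma_{yx}X^{\mathbf k}=\sum_{\mathbf l\le\mathbf k}\binom{\mathbf k}{\mathbf l}(y-x)^{\mathbf l}X^{\mathbf k-\mathbf l}$, $\bar\Gamma_{yx}(\mathcal I+\mathcal J(x))\tau=(\mathcal I+\mathcal J(y))\Gamma_{yx}\tau$ on $\mathbf T_{<\delta-\beta}$, $\alpha_0>-\bar\beta$, and $\bar\Pi_x\mathcal I\tau=K(\cdot,\Pi_x\tau)-\sum_{|\mathbf k|_{\mathfrak s}<\alpha+\beta}\frac{(\cdot-x)^{\mathbf k}}{\mathbf k!}\partial^{\mathbf k}K(x,\Pi_x\tau)$ for $\tau\in\mathbf T_\alpha$ with $\alpha+\beta<\delta$. For $f\in\mathcal D^{\gamma,\eta}_v(\Gamma)^\#$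 and a reconstruction $\Lambda\in C^{\zeta,Q}(wv)$ of $f$ put, for $x\in D$, $$\mathcal Kf(x)=\mathcal If(x)+\mathcal J(x)f(x)+\sum_{|\mathbf k|_{\mathfrak s}<\gamma+\beta}\frac{X^{\mathbf k}}{\mathbf k!}\partial^{\mathbf k}K(x,\Lambda_x).$$ **Theorem.** Let $\gamma+\bar\beta<\delta$, $\eta\in(\gamma-\mathfrak s_1,\gamma]$, $\zeta\le\eta\wedge\alpha_0$, $\zeta\le 0$, $\zeta+\bar\beta>0$, and assume either $\beta<\bar\beta$, or $\beta=\bar\beta$ and $\{\alpha+\bar\beta:\alpha\in\mathbf A\cup\{\gamma,\zeta\}\}\cap\mathbb N[\mathfrak s]=\emptyset$. Let $(M,\bar M)$ be $K$-admissible, $f\in\mathcal D^{\gamma,\eta}_v(\Gamma)^\#$, and let $\Lambda\in C^{\zeta,Q}(wv)$ be a reconstruction of $f$ for $M$ (with respect to $wv$). Then the integral $K\Lambda$ converges, $K\Lambda\in C(wv)$, $\mathcal Kf\in\mathcal D^{\gamma+\beta,\zeta+\beta}_{w^2v}(\bar\Gamma)^\#$, and $K\Lambda$ is a reconstruction of $\mathcal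 Kf$ for $\bar M$ (with respect to $w^2v$), with $$[\![K\Lambda]\!]_{\gamma+\beta,\zeta+\beta,w^2v}\le C\,C_K\big([\![\Lambda]\!]_{\gamma,\eta,wv}+\|\Pi\|_{\gamma,w}(1+\|\Gamma\|_{\gamma,w})\|f\|^\#_{\gamma,\eta,v}\big).$$ If $v^*(x+y)\le c_0v^*(x)v^*(y)$ for all $x,y$ and some constant $c_0$ (every $G$-controlled $v$ admits such a choice of $v^*$), then moreover $$[\![K\Lambda]\!]_{\gamma+\beta,\zeta+\beta,w^2v}\le C\,C_K\big([\![\Lambda]\!]_{\gamma,\eta,wv}+\|\Pi\|_{\gamma,w}\|f\|^\#_{\gamma,\eta,v}\big).$$ Finally, there is a quadratic polynomial $C_R$ in $R$ such that for any two such collections of data $(M^{(i)},\bar M^{(i)},f^{(i)},\Lambda^{(i)})$, $i\in\{1,2\}$ (with the same $\mathscr T,\bar{\mathscr T},\mathcal I,\zeta$) with $|||M^{(i)}|||_{\gamma,w}\le R$ and $|||f^{(i)}|||^\#_{\gamma,\eta,v}\le R$, $$[\![K\Lambda^{(1)};K\Lambda^{(2)}]\!]_{\gamma+\beta,\zeta+\beta,w^2v}\le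 C_KC_R\big(|||M^{(1)};M^{(2)}|||_{\gamma,w}+|||f^{(1)};f^{(2)}|||^\#_{\gamma,\eta,v}+[\![\Lambda^{(1)};\Lambda^{(2)}]\!]_{\gamma,\eta,wv}\big),$$ and if $\gamma>0$ the last term on the right can be omitted. The constant $C$ and the coefficients of $C_R$ depend only on $d,\mathfrak s,\ell,G,Q$, the weights (with their controlling functions), $\mathbf A,\gamma,\eta,\beta,\bar\beta,\delta$; in particular not on $K$ and $C_K$, the regularity structures beyond $\mathbf A$, $\mathcal I$, $\zeta$, the models, $f$ or $\Lambda$. -/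

import Mathlib

open Set Filter Topology MeasureTheory
open scoped ENNReal

universe u₁ u₂

noncomputable section

/-! ### Multiindices, partial derivatives -/

/-- Euclidean space `ℝ^d`; only its coordinates, its topology and Lebesgue measure are used. -/
abbrev Pt (d : ℕ) : Type := Fin d → ℝ

/-- The monomial `x^k`. -/
def mpow {d : ℕ} (x : Pt d) (k : Fin d → ℕ) : ℝ := ∏ i, x i ^ k i

/-- The factorial `k!` of a multiindex. -/
def mfact {d : ℕ} (k : Fin d → ℕ) : ℝ := ∏ i, ((k i).factorial : ℝ)

/-- The binomial coefficient of two multiindices. -/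
def mchoose {d : ℕ} (k l : Fin d → ℕ) : ℝ := ∏ i, ((k i).choose (l i) : ℝ)

/-- The partial derivative in the `i`-th coordinate. -/
def pderiv1 {d : ℕ} (i : Fin d) (f : Pt d → ℝ) : Pt d → ℝ :=
  fun x => deriv (fun r : ℝ => f (Function.update x i r)) (x i)

/-- The `k`-th partial derivative `∂^k f`. -/
def mpartial {d : ℕ} (k : Fin d → ℕ) (f : Pt d → ℝ) : Pt d → ℝ :=
  (List.finRange d).foldr (fun i g => (pderiv1 i)^[k i] g) f

/-! ### `G`-type semigroups -/

/-- The rescaled function `G_t(x) = t^{-|s|/ℓ} G(t^{-s/ℓ} x)`. -/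
def rescale {d : ℕ} (s : Fin d → ℝ) (ℓ : ℝ) (G : Pt d → ℝ) (t : ℝ) (x : Pt d) : ℝ :=
  t ^ (-(∑ i, s i) / ℓ) * G (fun i => t ^ (-(s i) / ℓ) * x i)

/-- A scaling `s`, a number `ℓ > 0`, a nonnegative measurable function `G` and a `G`-type
semigroup `Q` of continuous kernels on `ℝ^d` (only the values `Q t` with `0 < t` matter). -/
structure GSemigroup (d : ℕ) where
  s : Fin d → ℝ
  one_le_s : ∀ i, 1 ≤ s i
  ℓ : ℝ
  ℓ_pos : 0 < ℓ
  G : Pt d → ℝ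
  G_nonneg : ∀ x, 0 ≤ G x
  G_measurable : Measurable G
  Q : ℝ → Pt d → Pt d → ℝ
  Q_continuous : ∀ t, 0 < t → Continuous (Function.uncurry (Q t))
  Q_semigroup : ∀ r t, 0 < r → r < t → ∀ x y, ∫ z, Q (t - r) x z * Q r z y = Q t x y
  Q_conservative : ∀ x, Tendsto (fun t => ∫ y, Q t x y) (𝓝[>] 0) (𝓝 1)
  Q_upper : ∃ C₁ > 0, ∀ t, 0 < t → ∀ x y, |Q t x y| ≤ C₁ * rescale s ℓ G t (x - y)
  Q_differentiable : ∀ t, 0 < t → ∀ x y, DifferentiableAt ℝ (fun r => Q r x y) t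
  Q_deriv : ∃ C₂ > 0, ∀ t, 0 < t → ∀ x y,
    |deriv (fun r => Q r x y) t| ≤ C₂ * t⁻¹ * rescale s ℓ G t (x - y)

/-- A weight `w` together with the function `w*` that controls its translates. -/
structure Weight (d : ℕ) where
  w : Pt d → ℝ
  star : Pt d → ℝ

/-- Products of weights; the product weight is controlled by the product function. -/
instance (d : ℕ) : Mul (Weight d) :=
  ⟨fun W V => ⟨fun x => W.w x * V.w x, fun x => W.star x * V.star x⟩⟩

/-- The space `C(w)` of continuous functions `f` with `‖f w‖_{L^∞} < ∞`. -/
def Weight.MemC {d : ℕ} (W : Weight d) (f : Pt d → ℝ) : Prop :=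
  Continuous f ∧ ∃ B : ℝ, ∀ x, |f x| * W.w x ≤ B

namespace GSemigroup

variable {d : ℕ} (S : GSemigroup d)

/-- `G_t`. -/
def Gt (t : ℝ) (x : Pt d) : ℝ := rescale S.s S.ℓ S.G t x

/-- The scaled degree `|k|_s` of a multiindex. -/
def wt (k : Fin d → ℕ) : ℝ := ∑ i, S.s i * (k i : ℝ)

/-- The anisotropic size `‖x‖_s = ∑ |x_i|^{1/s_i}`. -/
def size (x : Pt d) : ℝ := ∑ i, |x i| ^ (1 / S.s i)

/-- The finite set of multiindices `k` with `|k|_s < c`. -/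
def below (c : ℝ) : Finset (Fin d → ℕ) :=
  (Fintype.piFinset fun _ : Fin d => Finset.range (⌈c⌉₊ + 1)).filter (fun k => S.wt k < c)

theorem mem_below {c : ℝ} {k : Fin d → ℕ} : k ∈ S.below c ↔ S.wt k < c := by
  simp only [below, Finset.mem_filter, Fintype.mem_piFinset, Finset.mem_range, and_iff_right_iff_imp]
  intro h i
  have h1 : (k i : ℝ) ≤ S.wt k := by
    have h2 : S.s i * (k i : ℝ) ≤ ∑ j, S.s j * (k j : ℝ) :=
      Finset.single_le_sum (f := fun j => S.s j * (k j : ℝ))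
        (fun j _ => mul_nonneg (by linarith [S.one_le_s j]) (Nat.cast_nonneg _)) (Finset.mem_univ i)
    have h3 : (k i : ℝ) ≤ S.s i * (k i : ℝ) :=
      le_mul_of_one_le_left (Nat.cast_nonneg _) (S.one_le_s i)
    exact h3.trans h2
  have h4 : (k i : ℝ) < (⌈c⌉₊ + 1 : ℕ) := by
    push_cast
    linarith [Nat.le_ceil c]
  exact_mod_cast h4

/-- `W = (w, w*)` is a `G`-controlled weight. -/
def IsGControlled (W : Weight d) : Prop :=
  Continuous W.w ∧ (∀ x, 0 < W.w x ∧ W.w x ≤ 1) ∧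
  Continuous W.star ∧ (∀ x, 1 ≤ W.star x) ∧
  (∀ x y, W.w (x + y) ≤ W.star x * W.w y) ∧
  ∀ (n : ℕ) (T : ℝ), 0 < T → ∃ B : ℝ, ∀ t, 0 < t → t ≤ T → ∀ x,
    S.size x ^ n * W.star (fun i => t ^ (S.s i / S.ℓ) * x i) * S.G x ≤ B

/-- The existence of auxiliary weights `w₁, w₂` which absorb the growth of `w*` and `w₁*`. -/
def HasAuxiliaryWeights (W : Weight d) : Prop :=
  ∃ W₁ W₂ : Weight d, S.IsGControlled W₁ ∧ S.IsGControlled W₂ ∧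
    S.IsGControlled (W * W₁) ∧ S.IsGControlled (W * W₂) ∧
    ∀ n : ℕ, ∃ B : ℝ, ∀ x,
      S.size x ^ n * W.star x * W₁.w x + S.size x ^ n * W₁.star x * W₂.w x ≤ B

/-! ### Generalized functions

An element `F` of a completion of `C(w)` is represented by the family `F t x = Q_t(x, F)`,
`0 < t ≤ 1`. Values at other `t` carry no meaning and are never used. -/

/-- The family `t ↦ Q_t f` of an honest function `f`. -/
def ofFun (f : Pt d → ℝ) : ℝ → Pt d → ℝ := fun t x => ∫ y, S.Q t x y * f y

/-- Membership in the Besov space `C^{α,Q}(w)`: the completion of `C(w)` under the norm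
`sup_{0<t≤1} t^{-α/ℓ} ‖Q_t f‖_{L^∞(w)}`, that is, the closure of `{(Q_t f)_t ; f ∈ C(w)}` in this
norm. -/
def MemBesov (α : ℝ) (W : Weight d) (F : ℝ → Pt d → ℝ) : Prop :=
  α ≤ 0 ∧ ∀ ε : ℝ, 0 < ε → ∃ f, W.MemC f ∧
    ∀ t ∈ Ioc (0 : ℝ) 1, ∀ x, t ^ (-α / S.ℓ) * (|F t x - S.ofFun f t x| * W.w x) ≤ ε

/-! ### The regularizing kernel -/

/-- `K` is a `β̄`-regularizing integral kernel admissible for `Q` with constants `δ` and `C_K`. -/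
def IsRegularizingKernel (βbar δ CK : ℝ) (K : ℝ → Pt d → Pt d → ℝ) : Prop :=
  0 < βbar ∧ 0 < δ ∧ 0 < CK ∧
  (∀ t, 0 < t → Continuous (Function.uncurry (K t))) ∧
  (∀ r t, 0 < r → r < t → ∀ x y, ∫ z, K (t - r) x z * S.Q r z y = K t x y) ∧
  (∀ (k : Fin d → ℕ) (i : Fin d), S.wt (k + Pi.single i 1) < δ → ∀ t, 0 < t → ∀ x y,
    HasDerivAt (fun r : ℝ => mpartial k (fun x' => K t x' y) (Function.update x i r))
      (mpartial (k + Pi.single i 1) (fun x' => K t x' y) x) (x i)) ∧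
  (∀ k : Fin d → ℕ, S.wt k < δ → ∀ t, 0 < t → ∀ x y,
    |mpartial k (fun x' => K t x' y) x| ≤
      CK * t ^ ((βbar - S.wt k) / S.ℓ - 1) * S.Gt t (x - y)) ∧
  (∀ k : Fin d → ℕ, S.wt k < δ → ∀ t, 0 < t → ∀ x y h, S.size h ≤ t ^ (1 / S.ℓ) →
    |mpartial k (fun x' => K t x' y) (x + h) -
        ∑ l ∈ S.below (δ - S.wt k),
          mpow h l / mfact l * mpartial (k + l) (fun x' => K t x' y) x| ≤
      CK * S.size h ^ (δ - S.wt k) * t ^ ((βbar - δ) / S.ℓ - 1) * S.Gt t (x - y))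

end GSemigroup

/-- `∂^k K_t(x, F) = ∂^k K_{t/2}(x, Q_{t/2} F)`, for `0 < t ≤ 1`. For a function `F` this is
`∫ ∂_x^k K_t(x,y) F(y) dy` because `∂^k K_{t/2} Q_{t/2} = ∂^k K_t`, and it extends that operation
continuously to generalized functions. -/
def kernelAt {d : ℕ} (K : ℝ → Pt d → Pt d → ℝ) (k : Fin d → ℕ) (t : ℝ) (x : Pt d)
    (F : ℝ → Pt d → ℝ) : ℝ :=
  ∫ z, mpartial k (fun x' => K (t / 2) x' z) x * F (t / 2) z

/-- `∂^k K(x, F) = ∫_0^1 ∂^k K_t(x, F) dt`. -/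
def kernelInt {d : ℕ} (K : ℝ → Pt d → Pt d → ℝ) (k : Fin d → ℕ) (x : Pt d)
    (F : ℝ → Pt d → ℝ) : ℝ :=
  ∫ t in Ioc (0 : ℝ) 1, kernelAt K k t x F

/-- The function `K F = ∫_0^1 K_t F dt`. -/
def kernelFun {d : ℕ} (K : ℝ → Pt d → Pt d → ℝ) (F : ℝ → Pt d → ℝ) : Pt d → ℝ :=
  fun x => kernelInt K 0 x F

/-- The integrals which define `∂^k K(x, F)` converge absolutely. -/
def KernelConverges {d : ℕ} (K : ℝ → Pt d → Pt d → ℝ) (k : Fin d → ℕ) (x : Pt d)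
    (F : ℝ → Pt d → ℝ) : Prop :=
  (∀ t ∈ Ioc (0 : ℝ) 1,
    Integrable (fun z => mpartial k (fun x' => K (t / 2) x' z) x * F (t / 2) z)) ∧
  IntegrableOn (fun t => kernelAt K k t x F) (Ioc 0 1)

/-! ### Regularity structures -/

/-- A regularity structure with index set `A`. The Banach space `T α` is trivial for `α ∉ A`, and
the model space is the algebraic direct sum `Π₀ α, T α`. -/
structure RegularityStructure (A : Set ℝ) : Type (u₁ + 1) where
  nonempty : A.Nonempty
  finite_lt : ∀ c : ℝ, (A ∩ Iio c).Finite
  T : ℝ → Type u₁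
  [normed : ∀ α, NormedAddCommGroup (T α)]
  [normedSpace : ∀ α, NormedSpace ℝ (T α)]
  [complete : ∀ α, CompleteSpace (T α)]
  subsingleton : ∀ α, α ∉ A → Subsingleton (T α)
  G : Subgroup ((Π₀ α : ℝ, T α) ≃ₗ[ℝ] (Π₀ α : ℝ, T α))
  G_continuous : ∀ Γ ∈ G, ∀ α β : ℝ, Continuous fun τ : T α => Γ (DFinsupp.single α τ) β
  G_triangular : ∀ Γ ∈ G, ∀ (α : ℝ) (τ : T α) (β : ℝ), α ≤ β →
    (Γ (DFinsupp.single α τ) - DFinsupp.single α τ) β = 0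

attribute [instance] RegularityStructure.normed RegularityStructure.normedSpace
  RegularityStructure.complete

namespace RegularityStructure

variable {A : Set ℝ} (𝒯 : RegularityStructure.{u₁} A)

/-- The model space `T`, the algebraic sum of the spaces `T α`. -/
abbrev Sp : Type u₁ := Π₀ α : ℝ, 𝒯.T α

/-- `τ ∈ T_{<γ}`. -/
def Below (γ : ℝ) (τ : 𝒯.Sp) : Prop := ∀ α, γ ≤ α → τ α = 0

variable {d : ℕ} (S : GSemigroup d) (W : Weight d)

/-- The seminorm `‖Π‖_{γ,w}`, with `P x τ t y = Q_t(y, Π_x τ)`. -/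
def piNorm (γ : ℝ) (P : Pt d → 𝒯.Sp → ℝ → Pt d → ℝ) : ℝ≥0∞ :=
  ⨆ (α : ℝ) (_ : α ∈ A) (_ : α < γ) (t : ℝ) (_ : t ∈ Ioc (0 : ℝ) 1) (x : Pt d) (τ : 𝒯.T α)
    (_ : τ ≠ 0),
    ENNReal.ofReal (t ^ (-α / S.ℓ) * W.w x * (|P x (DFinsupp.single α τ) t x| / ‖τ‖))

/-- The seminorm `‖Γ‖_{γ,w}`. -/
def gammaNorm (γ : ℝ) (Γ : Pt d → Pt d → 𝒯.Sp → 𝒯.Sp) : ℝ≥0∞ :=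
  ⨆ (α : ℝ) (_ : α ∈ A) (β : ℝ) (_ : β ∈ A) (_ : β < α) (_ : α < γ) (x : Pt d) (y : Pt d)
    (_ : x ≠ y) (τ : 𝒯.T α) (_ : τ ≠ 0),
    ENNReal.ofReal (W.w x * ‖Γ y x (DFinsupp.single α τ) β‖ /
      (W.star (y - x) * S.size (y - x) ^ (α - β) * ‖τ‖))

/-- A smooth model `(Π, Γ)`. -/
structure SmoothModel where
  Pi : Pt d → 𝒯.Sp →ₗ[ℝ] (Pt d → ℝ)
  Pi_memC : ∀ x τ, W.MemC (Pi x τ)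
  Pi_continuous : ∀ x α, ∃ B : ℝ, ∀ (τ : 𝒯.T α) (y : Pt d),
    |Pi x (DFinsupp.single α τ) y| * W.w y ≤ B * ‖τ‖
  Gam : Pt d → Pt d → 𝒯.Sp ≃ₗ[ℝ] 𝒯.Sp
  Gam_mem : ∀ x y, Gam x y ∈ 𝒯.G
  Pi_Gam : ∀ x y τ, Pi x (Gam x y τ) = Pi y τ
  Gam_self : ∀ x τ, Gam x x τ = τ
  Gam_comp : ∀ x y z τ, Gam x y (Gam y z τ) = Gam x z τ
  piNorm_lt : ∀ γ : ℝ, 𝒯.piNorm S W γ (fun x τ => S.ofFun (Pi x τ)) < ⊤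
  gammaNorm_lt : ∀ γ : ℝ, 𝒯.gammaNorm S W γ (fun x y τ => Gam x y τ) < ⊤

/-- A model `(Π, Γ)`: an element of the completion of the smooth models under the pseudo-metrics
`‖Π - Π'‖_{γ,w} + ‖Γ - Γ'‖_{γ,w}`, `γ ∈ ℝ`. Here `Pi x τ t y = Q_t(y, Π_x τ)`. The algebraic
conditions pass to the completion, and they determine `Q_t(y, Π_x τ) = Q_t(y, Π_y Γ_{yx} τ)` from
the values that the pseudo-metrics control. -/
structure Model where
  Pi : Pt d → 𝒯.Sp →ₗ[ℝ] (ℝ → Pt d → ℝ)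
  Gam : Pt d → Pt d → 𝒯.Sp →ₗ[ℝ] 𝒯.Sp
  Pi_Gam : ∀ x y τ, ∀ t ∈ Ioc (0 : ℝ) 1, ∀ z, Pi x (Gam x y τ) t z = Pi y τ t z
  Gam_self : ∀ x τ, Gam x x τ = τ
  Gam_comp : ∀ x y z τ, Gam x y (Gam y z τ) = Gam x z τ
  Gam_triangular : ∀ (x y : Pt d) (α : ℝ) (τ : 𝒯.T α) (β : ℝ), α ≤ β →
    (Gam x y (DFinsupp.single α τ) - DFinsupp.single α τ) β = 0
  approx : ∀ (γ ε : ℝ), 0 < ε → ∃ N : 𝒯.SmoothModel S W,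
    𝒯.piNorm S W γ (fun x τ => Pi x τ - S.ofFun (N.Pi x τ)) +
      𝒯.gammaNorm S W γ (fun x y τ => Gam x y τ - N.Gam x y τ) ≤ ENNReal.ofReal ε

end RegularityStructure

namespace RegularityStructure.Model

variable {A : Set ℝ} {𝒯 : RegularityStructure.{u₁} A} {d : ℕ} {S : GSemigroup d} {W : Weight d}

/-- `‖Π‖_{γ,w}`. -/
def normPi (M : 𝒯.Model S W) (γ : ℝ) : ℝ≥0∞ := 𝒯.piNorm S W γ (fun x τ => M.Pi x τ)

/-- `‖Γ‖_{γ,w}`. -/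
def normGam (M : 𝒯.Model S W) (γ : ℝ) : ℝ≥0∞ := 𝒯.gammaNorm S W γ (fun x y τ => M.Gam x y τ)

/-- `|||M|||_{γ,w}`. -/
def size (M : 𝒯.Model S W) (γ : ℝ) : ℝ≥0∞ := M.normPi γ + M.normGam γ

/-- `|||M₁; M₂|||_{γ,w}`. -/
def dist (M₁ M₂ : 𝒯.Model S W) (γ : ℝ) : ℝ≥0∞ :=
  𝒯.piNorm S W γ (fun x τ => M₁.Pi x τ - M₂.Pi x τ) +
    𝒯.gammaNorm S W γ (fun x y τ => M₁.Gam x y τ - M₂.Gam x y τ)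

end RegularityStructure.Model

/-! ### Singular modelled distributions

The first coordinate `x 0` is the temporal one. Functions on `(ℝ ∖ {0}) × ℝ^{d-1}` are represented by functions on `ℝ^d` whose values on the
hyperplane `x₁ = 0` are never used. -/

/-- The temporal weight `φ(x) = |x₁|^{1/s₁} ∧ 1`. -/
def GSemigroup.phi {d : ℕ} [NeZero d] (S : GSemigroup d) (x : Pt d) : ℝ :=
  min (|x 0| ^ (1 / S.s 0)) 1

namespace RegularityStructure

variable {A : Set ℝ} (𝒯 : RegularityStructure.{u₁} A) {d : ℕ} [NeZero d] (S : GSemigroup d)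
  (V : Weight d)

/-- `⦇f⦈_{γ,η,v}`. -/
def growthNorm (γ η : ℝ) (f : Pt d → 𝒯.Sp) : ℝ≥0∞ :=
  ⨆ (α : ℝ) (_ : α < γ) (x : Pt d) (_ : x 0 ≠ 0),
    ENNReal.ofReal (V.w x * ‖f x α‖ / S.phi x ^ min (η - α) 0)

/-- The norm `‖·‖^#_{γ,η,v}` of a family of increments `D y x`. -/
def sharpNorm (γ η : ℝ) (D : Pt d → Pt d → 𝒯.Sp) : ℝ≥0∞ :=
  ⨆ (α : ℝ) (_ : α < γ) (x : Pt d) (_ : x 0 ≠ 0) (y : Pt d) (_ : y 0 ≠ 0) (_ : x ≠ y),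
    ENNReal.ofReal (V.w x * ‖D y x α‖ /
      (min (S.phi x) (S.phi y) ^ (η - γ) * V.star (x - y) * S.size (y - x) ^ (γ - α)))

end RegularityStructure

namespace RegularityStructure.Model

variable {A : Set ℝ} {𝒯 : RegularityStructure.{u₁} A} {d : ℕ} [NeZero d] {S : GSemigroup d}
  {W : Weight d}

/-- The increment `Δ^Γ_{yx} f = f(y) - Γ_{yx} f(x)`. -/
def incr (M : 𝒯.Model S W) (f : Pt d → 𝒯.Sp) (y x : Pt d) : 𝒯.Sp := f y - M.Gam y x (f x)

/-- `‖f‖^#_{γ,η,v}`. -/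
def normSharp (M : 𝒯.Model S W) (V : Weight d) (γ η : ℝ) (f : Pt d → 𝒯.Sp) : ℝ≥0∞ :=
  𝒯.sharpNorm S V γ η (M.incr f)

/-- `|||f|||^#_{γ,η,v}`. -/
def fullSharp (M : 𝒯.Model S W) (V : Weight d) (γ η : ℝ) (f : Pt d → 𝒯.Sp) : ℝ≥0∞ :=
  𝒯.growthNorm S V γ η f + M.normSharp V γ η f

/-- `|||f₁; f₂|||^#_{γ,η,v}`. -/
def distSharp (M₁ M₂ : 𝒯.Model S W) (V : Weight d) (γ η : ℝ) (f₁ f₂ : Pt d → 𝒯.Sp) : ℝ≥0∞ :=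
  𝒯.growthNorm S V γ η (fun x => f₁ x - f₂ x) +
    𝒯.sharpNorm S V γ η (fun y x => M₁.incr f₁ y x - M₂.incr f₂ y x)

/-- `f ∈ D_v^{γ,η}(Γ)^#`. -/
def MemDSharp (M : 𝒯.Model S W) (V : Weight d) (γ η : ℝ) (f : Pt d → 𝒯.Sp) : Prop :=
  η ≤ γ ∧ (∀ x, x 0 ≠ 0 → 𝒯.Below γ (f x)) ∧ M.fullSharp V γ η f < ⊤

/-- `Λ_x = Λ - Π_x f(x)`. -/
def remainder (M : 𝒯.Model S W) (f : Pt d → 𝒯.Sp) (Λ : ℝ → Pt d → ℝ) (x : Pt d) :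
    ℝ → Pt d → ℝ :=
  Λ - M.Pi x (f x)

end RegularityStructure.Model

/-- `sup_{0<t≤1} sup_{x₁≠0} t^{-γ/ℓ} φ(x)^{γ-η} u(x) |Q_t(x, F_x)|` for a family `F` of generalized
functions. -/
def GSemigroup.bracketNorm {d : ℕ} [NeZero d] (S : GSemigroup d) (U : Weight d) (γ η : ℝ)
    (F : Pt d → ℝ → Pt d → ℝ) : ℝ≥0∞ :=
  ⨆ (t : ℝ) (_ : t ∈ Ioc (0 : ℝ) 1) (x : Pt d) (_ : x 0 ≠ 0),
    ENNReal.ofReal (t ^ (-γ / S.ℓ) * S.phi x ^ (γ - η) * U.w x * |F x t x|)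

namespace RegularityStructure.Model

variable {A : Set ℝ} {𝒯 : RegularityStructure.{u₁} A} {d : ℕ} [NeZero d] {S : GSemigroup d}
  {W : Weight d}

/-- `⟦Λ⟧_{γ,η,u}`. -/
def bracket (M : 𝒯.Model S W) (U : Weight d) (γ η : ℝ) (f : Pt d → 𝒯.Sp) (Λ : ℝ → Pt d → ℝ) :
    ℝ≥0∞ :=
  S.bracketNorm U γ η (M.remainder f Λ)

/-- `⟦Λ₁; Λ₂⟧_{γ,η,u}`. -/
def bracketDist (M₁ M₂ : 𝒯.Model S W) (U : Weight d) (γ η : ℝ) (f₁ f₂ : Pt d → 𝒯.Sp)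
    (Λ₁ Λ₂ : ℝ → Pt d → ℝ) : ℝ≥0∞ :=
  S.bracketNorm U γ η (fun x => M₁.remainder f₁ Λ₁ x - M₂.remainder f₂ Λ₂ x)

/-- `Λ ∈ C^{ζ,Q}(u)` is a reconstruction of `f` for the model `M`. -/
def IsReconstruction (M : 𝒯.Model S W) (ζ : ℝ) (U : Weight d) (γ η : ℝ) (f : Pt d → 𝒯.Sp)
    (Λ : ℝ → Pt d → ℝ) : Prop :=
  S.MemBesov ζ U Λ ∧ M.bracket U γ η f Λ < ⊤

end RegularityStructure.Model

/-! ### Abstract integration and admissible pairs of models -/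

/-- The polynomials `X^k` inside a regularity structure: they are linearly independent, lie in the
spaces of index `|k|_s`, and span a subspace which is stable under the structure group. -/
structure PolynomialSector {Abar : Set ℝ} (𝒯bar : RegularityStructure.{u₂} Abar) {d : ℕ}
    (S : GSemigroup d) where
  mem : ∀ k : Fin d → ℕ, S.wt k ∈ Abar
  X : ∀ k : Fin d → ℕ, 𝒯bar.T (S.wt k)
  linearIndependent : LinearIndependent ℝ fun k : Fin d → ℕ =>
    (DFinsupp.single (S.wt k) (X k) : 𝒯bar.Sp)
  invariant : ∀ Γ ∈ 𝒯bar.G, ∀ k : Fin d → ℕ, Γ (DFinsupp.single (S.wt k) (X k)) ∈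
    Submodule.span ℝ (range fun k : Fin d → ℕ => (DFinsupp.single (S.wt k) (X k) : 𝒯bar.Sp))

/-- `X^k` as an element of the model space. -/
def PolynomialSector.mono {Abar : Set ℝ} {𝒯bar : RegularityStructure.{u₂} Abar} {d : ℕ}
    {S : GSemigroup d} (X : PolynomialSector 𝒯bar S) (k : Fin d → ℕ) : 𝒯bar.Sp :=
  DFinsupp.single (S.wt k) (X.X k)

/-- An abstract integration of order `β`: a continuous linear operator which maps `T_α` to
`T̄_{α+β}`, given by its restrictions to the spaces `T_α`. -/
abbrev AbstractIntegration {A Abar : Set ℝ} (𝒯 : RegularityStructure.{u₁} A)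
    (𝒯bar : RegularityStructure.{u₂} Abar) (β : ℝ) : Type (max u₁ u₂) :=
  ∀ α : ℝ, 𝒯.T α →L[ℝ] 𝒯bar.T (α + β)

/-- The linear map `ℐ : T → T̄` of an abstract integration. -/
def AbstractIntegration.map {A Abar : Set ℝ} {𝒯 : RegularityStructure.{u₁} A}
    {𝒯bar : RegularityStructure.{u₂} Abar} {β : ℝ} (I : AbstractIntegration 𝒯 𝒯bar β) :
    𝒯.Sp →ₗ[ℝ] 𝒯bar.Sp :=
  DFinsupp.lsum ℕ fun α => (DFinsupp.lsingle (α + β)).comp (I α).toLinearMap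

section Schauder

variable {A Abar : Set ℝ} {𝒯 : RegularityStructure.{u₁} A} {𝒯bar : RegularityStructure.{u₂} Abar}
  {d : ℕ} {S : GSemigroup d} {W : Weight d}

/-- `𝒥(x)τ = ∑_α ∑_{|k|_s < α+β} X^k / k! ∂^k K(x, Π_x P_α τ)` for `τ ∈ T_{<δ-β}`. -/
def schauderJ (K : ℝ → Pt d → Pt d → ℝ) (β δ : ℝ) (X : PolynomialSector 𝒯bar S)
    (M : 𝒯.Model S W) (x : Pt d) (τ : 𝒯.Sp) : 𝒯bar.Sp :=
  ∑ α ∈ (𝒯.finite_lt (δ - β)).toFinset, ∑ k ∈ S.below (α + β),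
    (kernelInt K k x (M.Pi x (DFinsupp.single α (τ α))) / mfact k) • X.mono k

/-- `𝒩(x; f, Λ) = ∑_{|k|_s < γ+β} X^k / k! ∂^k K(x, Λ_x)`. -/
def schauderN (K : ℝ → Pt d → Pt d → ℝ) (β γ : ℝ) (X : PolynomialSector 𝒯bar S)
    (M : 𝒯.Model S W) (f : Pt d → 𝒯.Sp) (Λ : ℝ → Pt d → ℝ) (x : Pt d) : 𝒯bar.Sp :=
  ∑ k ∈ S.below (γ + β), (kernelInt K k x (Λ - M.Pi x (f x)) / mfact k) • X.mono k

/-- `𝒦f(x) = ℐ f(x) + 𝒥(x) f(x) + 𝒩(x; f, Λ)`. -/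
def schauderK (K : ℝ → Pt d → Pt d → ℝ) (β δ γ : ℝ) (X : PolynomialSector 𝒯bar S)
    (I : AbstractIntegration 𝒯 𝒯bar β) (M : 𝒯.Model S W) (f : Pt d → 𝒯.Sp)
    (Λ : ℝ → Pt d → ℝ) (x : Pt d) : 𝒯bar.Sp :=
  I.map (f x) + schauderJ K β δ X M x (f x) + schauderN K β γ X M f Λ x

/-- The pair of models `(M, M̄)` is compatible for `ℐ`. -/
def IsCompatible (K : ℝ → Pt d → Pt d → ℝ) (β δ : ℝ) (X : PolynomialSector 𝒯bar S)
    (I : AbstractIntegration 𝒯 𝒯bar β) (M : 𝒯.Model S W) (Mbar : 𝒯bar.Model S W) : Prop :=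
  (∀ (k : Fin d → ℕ) (x : Pt d), ∀ t ∈ Ioc (0 : ℝ) 1, ∀ y,
    Mbar.Pi x (X.mono k) t y = S.ofFun (fun z => mpow (z - x) k) t y) ∧
  (∀ (k : Fin d → ℕ) (x y : Pt d),
    Mbar.Gam y x (X.mono k) =
      ∑ l ∈ Finset.Iic k, (mchoose k l * mpow (y - x) l) • X.mono (k - l)) ∧
  ∀ (x y : Pt d) (τ : 𝒯.Sp), 𝒯.Below (δ - β) τ →
    Mbar.Gam y x (I.map τ + schauderJ K β δ X M x τ) =
      I.map (M.Gam y x τ) + schauderJ K β δ X M y (M.Gam y x τ)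

/-- The pair of models `(M, M̄)` is `K`-admissible for `ℐ`. -/
def IsKAdmissible (K : ℝ → Pt d → Pt d → ℝ) (βbar β δ : ℝ) (X : PolynomialSector 𝒯bar S)
    (I : AbstractIntegration 𝒯 𝒯bar β) (M : 𝒯.Model S W) (Mbar : 𝒯bar.Model S W) : Prop :=
  IsCompatible K β δ X I M Mbar ∧
  (∀ α ∈ A, -βbar < α) ∧
  ∀ α ∈ A, α + β < δ → ∀ (τ : 𝒯.T α) (x : Pt d), ∀ t ∈ Ioc (0 : ℝ) 1, ∀ y,
    Mbar.Pi x (I.map (DFinsupp.single α τ)) t y =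
      S.ofFun (fun z => kernelFun K (M.Pi x (DFinsupp.single α τ)) z -
        ∑ k ∈ S.below (α + β),
          mpow (z - x) k / mfact k * kernelInt K k x (M.Pi x (DFinsupp.single α τ))) t y

end Schauder

end

/-! Write Λ_x = Λ − Π_x f(x). By admissibility, the polynomial that Π̄_x ℐ subtracts cancels against
the one that 𝒥(x) adds. Hence Q_t(x, KΛ − Π̄_x 𝒦f(x)) = ∫ Q_t(x,y) R_x(y) dy, where R_x is the
Taylor remainder of order γ+β of K(·, Λ_x) about x (`remainder_schauderK`). The quantity to estimate
is linear in the family (Λ_x)_x, so one abstract Schauder estimate for families serves both a single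
datum and the difference of two data.

The input of that estimate is a bound on Q_r(z, Λ_x) away from the centre (`OffCentreBound`). It
comes from Λ_x = Λ_z + Π_z Δ_{zy}f + Π_y Δ_{yx}f: the three terms are controlled by the bracket of
Λ, by Π, and by Π with Γ. The intermediate point y is needed because z will be integrated against a
kernel centred at y, and y against Q_t(x, ·). Every weight and every power then depends on x−y or on
y−z alone, and moments of G suffice. If v* is submultiplicative, one can pass from x to z in one
step, and Γ does not enter (`offCentreBound_of_submul`). The singular factors φ^{-(γ−η)} survive
these integrations because γ−η < s_1 makes |z_1|^{-(γ−η)/s_1} locally integrable, with bounds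
uniform in the time scale (`phi_moment`).

Given the off-centre bound, the integral over r ∈ (0,1] that defines R_x(y) is split at r =
2‖y−x‖^ℓ. Below this scale the terms are bounded one by one, which converges since β̄+α > 0 for all
relevant α and |k| < γ+β. Above it, the Taylor estimate for the kernel up to order δ is used. The
surplus monomials, with γ+β ≤ |k| < δ, contribute powers of r that are dominated by the lower
endpoint. A resonance |k| = γ+β would produce a logarithm; it is harmless if β < β̄ and excluded by
hypothesis if β = β̄ (`exists_upper_le`, `exists_taylorRemainder_le`). Integration against Q_t(x, ·)
gives `exists_bracket_le`.

That 𝒦f is a modelled distribution is seen component by component. The ℐ-part inherits its bounds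
from f. The polynomial part is handled by the same kind of splitting: at r = φ(x)^ℓ for its size,
where above this scale the Besov bound on Λ with exponent ζ is used instead of the remainder
(`exists_polyCoeff_le`), and at r = 2‖y−x‖^ℓ for its increments (`exists_incrCoeff_le`). Convergence
and linearity of all the integrals rest on `memBesov_Pi`: Π_x τ lies in a Besov space whose weight
absorbs the growth of w*.

For γ > 0 the distance of the reconstructions is controlled by the other distances. Writing Q_t =
Q_{t−θt} Q_{θt} and recentring under the integral bounds the bracket by half of itself plus those
distances, if θ is small (`exists_bracket_improve`). -/

/-! ### One-dimensional integrals -/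

/-- The Cauchy-type profile `τ⁻¹ (1 + (u/τ)²)⁻¹`. -/
noncomputable def bump (τ u : ℝ) : ℝ := τ⁻¹ * (1 + (u / τ) ^ 2)⁻¹

theorem bump_nonneg {τ : ℝ} (hτ : 0 < τ) (u : ℝ) : 0 ≤ bump τ u := by
  unfold bump; positivity

theorem continuous_bump (τ : ℝ) : Continuous (bump τ) := by
  unfold bump
  refine continuous_const.mul (Continuous.inv₀ (by fun_prop) fun u => ?_)
  positivity

theorem integrable_bump {τ : ℝ} (hτ : 0 < τ) : Integrable (bump τ) := by
  unfold bump
  exact (integrable_inv_one_add_sq.comp_div hτ.ne').const_mul _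

theorem integral_bump {τ : ℝ} (hτ : 0 < τ) : ∫ u, bump τ u = Real.pi := by
  unfold bump
  rw [integral_const_mul, Measure.integral_comp_div (fun u : ℝ => (1 + u ^ 2)⁻¹) τ,
    integral_univ_inv_one_add_sq, abs_of_pos hτ, smul_eq_mul, inv_mul_cancel_left₀ hτ.ne']

/-- This is 2τ|u| ≤ τ² + u². The point is that the bound does not see the scale τ. -/
theorem bump_le_inv {τ u : ℝ} (hτ : 0 < τ) (hu : u ≠ 0) : bump τ u ≤ |u|⁻¹ / 2 := by
  have hu' : 0 < |u| := abs_pos.mpr hu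
  have h1 : bump τ u = τ / (τ ^ 2 + |u| ^ 2) := by
    unfold bump
    rw [sq_abs]
    field_simp
  rw [h1, div_le_div_iff₀ (by positivity) (by positivity)]
  have : τ * 2 ≤ |u|⁻¹ * (τ ^ 2 + |u| ^ 2) := by
    rw [inv_mul_eq_div, le_div_iff₀ hu']
    nlinarith [sq_nonneg (τ - |u|)]
  exact this

theorem integral_abs_rpow {a b : ℝ} (ha : a < 1) (hb : 0 < b) :
    Integrable (fun u : ℝ => (Ioo (-b) b).indicator (fun u => |u| ^ (-a)) u) ∧
      ∫ u : ℝ, (Ioo (-b) b).indicator (fun u => |u| ^ (-a)) u = 2 * (b ^ (1 - a) / (1 - a)) := by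
  have h0 : IntervalIntegrable (fun u : ℝ => |u| ^ (-a)) volume 0 b := by
    refine (intervalIntegral.intervalIntegrable_rpow' (by linarith : -1 < -a)).congr ?_
    intro u hu
    rw [uIoc_of_le hb.le] at hu
    simp only [abs_of_pos hu.1]
  have h1 : IntervalIntegrable (fun u : ℝ => |u| ^ (-a)) volume (-b) 0 := by
    have := h0.comp_sub_left 0
    simpa using this.symm
  have h2 := (h1.trans h0)
  constructor
  · rw [integrable_indicator_iff measurableSet_Ioo]
    exact ((intervalIntegrable_iff_integrableOn_Ioo_of_le (by linarith)).1 h2)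
  · have e : (fun u : ℝ => (Ioo (-b) b).indicator (fun u => |u| ^ (-a)) u) =
        fun u => (Iio b).indicator (fun u => u ^ (-a)) |u| := by
      ext u
      simp only [indicator_apply, mem_Ioo, mem_Iio, abs_lt]
    rw [e, integral_comp_abs, integral_indicator measurableSet_Iio,
      Measure.restrict_restrict measurableSet_Iio, Iio_inter_Ioi, ← integral_Ioc_eq_integral_Ioo,
      ← intervalIntegral.integral_of_le hb.le, integral_rpow (Or.inl (by linarith)),
      Real.zero_rpow (by linarith), sub_zero]
    rw [show -a + 1 = 1 - a by ring]

/-- Averaging does not worsen the singularity |u|^{-a}, uniformly in the width τ. Where |u| ≥ |x|/2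
the singular factor is at most 2^a|x|^{-a} and the bump has mass π. Where |u| < |x|/2 the bump is at
most |x|⁻¹, and |u|^{-a} is integrable near zero because a < 1. -/
theorem integral_bump_mul_abs_rpow {a : ℝ} (ha0 : 0 ≤ a) (ha : a < 1) :
    ∃ C : ℝ, 0 ≤ C ∧ ∀ τ : ℝ, 0 < τ → ∀ x : ℝ, x ≠ 0 →
      Integrable (fun u => bump τ (x - u) * |u| ^ (-a)) ∧
        ∫ u, bump τ (x - u) * |u| ^ (-a) ≤ C * |x| ^ (-a) := by
  have h1a : 0 < 1 - a := by linarith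
  refine ⟨2 ^ a * Real.pi + 2 * (1 / 2) ^ (1 - a) / (1 - a), by positivity, fun τ hτ x hx => ?_⟩
  have hx' : 0 < |x| := abs_pos.mpr hx
  have hb : 0 < |x| / 2 := by positivity
  obtain ⟨hI, hval⟩ := integral_abs_rpow ha hb
  have hbi : Integrable (fun u => bump τ (x - u)) := (integrable_bump hτ).comp_sub_left x
  have hdom : Integrable (fun u => 2 ^ a * |x| ^ (-a) * bump τ (x - u) +
      |x|⁻¹ * (Ioo (-(|x| / 2)) (|x| / 2)).indicator (fun u => |u| ^ (-a)) u) :=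
    (hbi.const_mul _).add (hI.const_mul _)
  have hle : ∀ u, bump τ (x - u) * |u| ^ (-a) ≤ 2 ^ a * |x| ^ (-a) * bump τ (x - u) +
      |x|⁻¹ * (Ioo (-(|x| / 2)) (|x| / 2)).indicator (fun u => |u| ^ (-a)) u := by
    intro u
    by_cases hu : u ∈ Ioo (-(|x| / 2)) (|x| / 2)
    · rw [indicator_of_mem hu]
      have hu2 : |u| < |x| / 2 := abs_lt.2 hu
      have h3 : |x| / 2 ≤ |x - u| := by
        have := abs_sub_abs_le_abs_sub x u
        linarith
      have h4 : bump τ (x - u) ≤ |x|⁻¹ := by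
        refine (bump_le_inv hτ (abs_pos.1 (hb.trans_le h3))).trans ?_
        have : |x - u|⁻¹ ≤ (|x| / 2)⁻¹ := inv_anti₀ hb h3
        rw [inv_div] at this
        have h5 : (2 : ℝ) / |x| = 2 * |x|⁻¹ := by rw [div_eq_mul_inv]
        linarith
      have h5 : 0 ≤ 2 ^ a * |x| ^ (-a) * bump τ (x - u) := by
        have := bump_nonneg hτ (x - u)
        positivity
      have h6 : bump τ (x - u) * |u| ^ (-a) ≤ |x|⁻¹ * |u| ^ (-a) :=
        mul_le_mul_of_nonneg_right h4 (by positivity)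
      linarith
    · rw [indicator_of_notMem hu, mul_zero, add_zero]
      have hu2 : |x| / 2 ≤ |u| := not_lt.1 fun h => hu (abs_lt.1 h)
      have h3 : |u| ^ (-a) ≤ (|x| / 2) ^ (-a) :=
        Real.rpow_le_rpow_of_nonpos hb hu2 (by linarith)
      have h4 : (|x| / 2) ^ (-a) = 2 ^ a * |x| ^ (-a) := by
        rw [Real.div_rpow hx'.le (by norm_num), Real.rpow_neg (by norm_num : (0:ℝ) ≤ 2)]
        field_simp
      rw [h4] at h3
      rw [mul_comm]
      exact mul_le_mul_of_nonneg_right h3 (bump_nonneg hτ _)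
  have hnn : ∀ u, 0 ≤ bump τ (x - u) * |u| ^ (-a) := fun u =>
    mul_nonneg (bump_nonneg hτ _) (by positivity)
  have hint : Integrable (fun u => bump τ (x - u) * |u| ^ (-a)) := by
    refine hdom.mono' ?_ (Eventually.of_forall fun u => ?_)
    · refine Measurable.aestronglyMeasurable ?_
      have := (continuous_bump τ).measurable
      fun_prop
    · rw [Real.norm_of_nonneg (hnn u)]
      exact hle u
  refine ⟨hint, (integral_mono hint hdom hle).trans ?_⟩
  rw [integral_add (hbi.const_mul _) (hI.const_mul _), integral_const_mul, integral_const_mul,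
    integral_sub_left_eq_self (bump τ) volume x, integral_bump hτ, hval]
  have h7 : |x|⁻¹ * (2 * ((|x| / 2) ^ (1 - a) / (1 - a))) =
      2 * (1 / 2) ^ (1 - a) / (1 - a) * |x| ^ (-a) := by
    have : (|x| / 2) ^ (1 - a) = |x| * |x| ^ (-a) * (1 / 2) ^ (1 - a) := by
      rw [div_eq_mul_one_div, Real.mul_rpow hx'.le (by norm_num), sub_eq_add_neg,
        Real.rpow_add hx', Real.rpow_one]
    rw [this]
    field_simp
  rw [h7]
  exact le_of_eq (by ring)

/-! ### Anisotropic sizes and monomials -/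

theorem one_add_pow_le (σ : ℝ) (hσ : 0 ≤ σ) (M : ℕ) : (1 + σ) ^ M ≤ 2 ^ M * (1 + σ ^ M) := by
  have h1 : 1 + σ ≤ 2 * max 1 σ := by
    have := le_max_left 1 σ; have := le_max_right 1 σ; linarith
  calc (1 + σ) ^ M ≤ (2 * max 1 σ) ^ M := pow_le_pow_left₀ (by positivity) h1 M
    _ = 2 ^ M * (max 1 σ) ^ M := mul_pow _ _ _
    _ ≤ 2 ^ M * (1 + σ ^ M) := by
      gcongr
      rcases max_choice 1 σ with h | h <;> rw [h]
      · rw [one_pow]; have := pow_nonneg hσ M; linarith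
      · linarith

theorem rpow_add_le_two_rpow {p a b : ℝ} (ha : 0 ≤ a) (hb : 0 ≤ b) (hp : 0 ≤ p) :
    (a + b) ^ p ≤ 2 ^ p * (a ^ p + b ^ p) := by
  have h1 : a + b ≤ 2 * max a b := by
    have := le_max_left a b; have := le_max_right a b; linarith
  calc (a + b) ^ p ≤ (2 * max a b) ^ p := Real.rpow_le_rpow (by positivity) h1 hp
    _ = 2 ^ p * (max a b) ^ p := Real.mul_rpow (by norm_num) (le_max_of_le_left ha)
    _ ≤ 2 ^ p * (a ^ p + b ^ p) := by
      gcongr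
      have := Real.rpow_nonneg ha p
      have := Real.rpow_nonneg hb p
      rcases max_choice a b with h | h <;> rw [h] <;> linarith

namespace GSemigroup

variable {d : ℕ} (S : GSemigroup d)

theorem s_pos (i : Fin d) : 0 < S.s i := zero_lt_one.trans_le (S.one_le_s i)

theorem size_nonneg (x : Pt d) : 0 ≤ S.size x :=
  Finset.sum_nonneg fun _ _ => Real.rpow_nonneg (abs_nonneg _) _

theorem size_zero : S.size 0 = 0 := by
  unfold size
  refine Finset.sum_eq_zero fun i _ => ?_
  have := S.s_pos i
  rw [Pi.zero_apply, abs_zero, Real.zero_rpow (by positivity)]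

theorem size_neg (x : Pt d) : S.size (-x) = S.size x := by
  unfold size; simp

theorem size_sub_comm (x y : Pt d) : S.size (x - y) = S.size (y - x) := by
  rw [← S.size_neg, neg_sub]

/-- The exponents 1/s_i lie in (0,1] because s_i ≥ 1, and such powers are subadditive. -/
theorem size_add_le (x y : Pt d) : S.size (x + y) ≤ S.size x + S.size y := by
  unfold size
  rw [← Finset.sum_add_distrib]
  refine Finset.sum_le_sum fun i _ => ?_
  have h1 := S.one_le_s i
  refine (Real.rpow_le_rpow (abs_nonneg _) (abs_add_le (x i) (y i)) (by positivity)).trans ?_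
  exact Real.rpow_add_le_add_rpow (abs_nonneg _) (abs_nonneg _) (by positivity)
    (by rw [div_le_one (by linarith)]; exact h1)

theorem size_sub_le (x y z : Pt d) : S.size (x - z) ≤ S.size (x - y) + S.size (y - z) := by
  have := S.size_add_le (x - y) (y - z)
  rwa [sub_add_sub_cancel] at this

theorem abs_le_size (x : Pt d) (i : Fin d) : |x i| ≤ S.size x ^ S.s i := by
  have h0 := S.s_pos i
  have h1 : |x i| ^ (1 / S.s i) ≤ S.size x :=
    Finset.single_le_sum (f := fun j => |x j| ^ (1 / S.s j))
      (fun j _ => Real.rpow_nonneg (abs_nonneg _) _) (Finset.mem_univ i)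
  have h2 := Real.rpow_le_rpow (Real.rpow_nonneg (abs_nonneg _) _) h1 h0.le
  rwa [← Real.rpow_mul (abs_nonneg _), one_div, inv_mul_cancel₀ h0.ne', Real.rpow_one] at h2

theorem size_pos {x : Pt d} (hx : x ≠ 0) : 0 < S.size x := by
  refine lt_of_le_of_ne (S.size_nonneg x) fun h => hx ?_
  ext i
  have h1 := S.abs_le_size x i
  rw [← h, Real.zero_rpow (S.s_pos i).ne'] at h1
  exact abs_nonpos_iff.1 h1

theorem wt_nonneg (k : Fin d → ℕ) : 0 ≤ S.wt k :=
  Finset.sum_nonneg fun i _ => mul_nonneg (S.s_pos i).le (Nat.cast_nonneg _)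

theorem wt_zero : S.wt 0 = 0 := by simp [wt]

theorem wt_add (k l : Fin d → ℕ) : S.wt (k + l) = S.wt k + S.wt l := by
  unfold wt
  rw [← Finset.sum_add_distrib]
  refine Finset.sum_congr rfl fun i _ => ?_
  simp only [Pi.add_apply]; push_cast; ring

theorem abs_mpow_le (h : Pt d) (k : Fin d → ℕ) : |mpow h k| ≤ S.size h ^ S.wt k := by
  unfold mpow wt
  rw [Finset.abs_prod, Real.rpow_sum_of_nonneg (S.size_nonneg h)
    (fun i _ => mul_nonneg (S.s_pos i).le (Nat.cast_nonneg _))]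
  refine Finset.prod_le_prod (fun i _ => abs_nonneg _) fun i _ => ?_
  rw [abs_pow, Real.rpow_mul (S.size_nonneg h), Real.rpow_natCast]
  exact pow_le_pow_left₀ (abs_nonneg _) (S.abs_le_size h i) _

theorem one_le_mfact (k : Fin d → ℕ) : 1 ≤ mfact k := by
  unfold mfact
  exact_mod_cast Nat.one_le_iff_ne_zero.2
    (Finset.prod_ne_zero_iff.2 fun i _ => Nat.factorial_ne_zero (k i))

theorem continuous_size : Continuous S.size := by
  unfold size
  refine continuous_finsetSum _ fun i _ => ?_
  have := S.s_pos i
  exact (continuous_abs.comp (continuous_apply i)).rpow_const fun x => Or.inr (by positivity)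

/-- The anisotropic dilation `t^{s/ℓ} x`. -/
noncomputable def dil (t : ℝ) (x : Pt d) : Pt d := fun i => t ^ (S.s i / S.ℓ) * x i

theorem size_dil {t : ℝ} (ht : 0 < t) (x : Pt d) :
    S.size (S.dil t x) = t ^ (1 / S.ℓ) * S.size x := by
  unfold size dil
  rw [Finset.mul_sum]
  refine Finset.sum_congr rfl fun i _ => ?_
  have h1 := S.s_pos i
  have h2 := S.ℓ_pos
  rw [abs_mul, abs_of_pos (Real.rpow_pos_of_pos ht _),
    Real.mul_rpow (Real.rpow_pos_of_pos ht _).le (abs_nonneg _), ← Real.rpow_mul ht.le]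
  congr 2
  field_simp

theorem dil_dil_inv {t : ℝ} (ht : 0 < t) (y : Pt d) :
    S.dil t (fun i => t ^ (-(S.s i) / S.ℓ) * y i) = y := by
  ext i
  simp only [dil]
  rw [← mul_assoc, ← Real.rpow_add ht]
  simp [neg_div]

/-! ### Functions controlled by `G` -/

/-- `g` is continuous, nonnegative and controlled by `G` in the sense of a controlling function
of a weight. -/
def Controls (g : Pt d → ℝ) : Prop :=
  Continuous g ∧ (∀ x, 0 ≤ g x) ∧
    ∀ n : ℕ, ∃ B : ℝ, ∀ t, 0 < t → t ≤ 1 → ∀ x, S.size x ^ n * g (S.dil t x) * S.G x ≤ B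

variable {S}

theorem IsGControlled.controls {U : Weight d} (hU : S.IsGControlled U) : S.Controls U.star :=
  ⟨hU.2.2.1, fun x => zero_le_one.trans (hU.2.2.2.1 x), fun n => hU.2.2.2.2.2 n 1 one_pos⟩

theorem IsGControlled.w_pos {U : Weight d} (hU : S.IsGControlled U) (x : Pt d) : 0 < U.w x :=
  (hU.2.1 x).1

theorem IsGControlled.w_le_one {U : Weight d} (hU : S.IsGControlled U) (x : Pt d) : U.w x ≤ 1 :=
  (hU.2.1 x).2

theorem IsGControlled.one_le_star {U : Weight d} (hU : S.IsGControlled U) (x : Pt d) :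
    1 ≤ U.star x := hU.2.2.2.1 x

theorem IsGControlled.w_le {U : Weight d} (hU : S.IsGControlled U) (x y : Pt d) :
    U.w x ≤ U.star (x - y) * U.w y := by
  have := hU.2.2.2.2.1 (x - y) y
  rwa [sub_add_cancel] at this

theorem IsGControlled.inv_le {U : Weight d} (hU : S.IsGControlled U) (x y : Pt d) :
    (U.w y)⁻¹ ≤ U.star (x - y) * (U.w x)⁻¹ := by
  have h1 := hU.w_pos x
  have h2 := hU.w_pos y
  have := hU.w_le x y
  rw [inv_eq_one_div, div_le_iff₀ h2, mul_assoc, mul_comm _ (U.w y), ← mul_assoc,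
    ← div_eq_mul_inv, one_le_div h1]
  exact this

theorem Controls.add {g h : Pt d → ℝ} (hg : S.Controls g) (hh : S.Controls h) :
    S.Controls (fun x => g x + h x) := by
  refine ⟨hg.1.add hh.1, fun x => add_nonneg (hg.2.1 x) (hh.2.1 x), fun n => ?_⟩
  obtain ⟨B, hB⟩ := hg.2.2 n
  obtain ⟨B', hB'⟩ := hh.2.2 n
  refine ⟨B + B', fun t ht ht1 x => ?_⟩
  have h1 := hB t ht ht1 x
  have h2 := hB' t ht ht1 x
  rw [mul_add, add_mul]
  exact add_le_add h1 h2

theorem Controls.mono {g h : Pt d → ℝ} (hg : S.Controls g) (hc : Continuous h)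
    (h0 : ∀ x, 0 ≤ h x) (hle : ∀ x, h x ≤ g x) : S.Controls h := by
  refine ⟨hc, h0, fun n => ?_⟩
  obtain ⟨B, hB⟩ := hg.2.2 n
  refine ⟨B, fun t ht ht1 x => le_trans ?_ (hB t ht ht1 x)⟩
  have h1 := S.G_nonneg x
  have h2 := S.size_nonneg x
  have h3 := hle (S.dil t x)
  gcongr

variable (S)

theorem Gt_nonneg {t : ℝ} (ht : 0 < t) (x : Pt d) : 0 ≤ S.Gt t x :=
  mul_nonneg (Real.rpow_nonneg ht.le _) (S.G_nonneg _)

theorem measurable_Gt (t : ℝ) : Measurable (S.Gt t) := by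
  unfold Gt rescale
  refine measurable_const.mul (S.G_measurable.comp ?_)
  exact measurable_pi_lambda _ fun i => (measurable_pi_apply i).const_mul _

/-- Bumps of widths t^{s_i/ℓ} are the rescaled form of the profile ∏(1+x_i²)⁻¹, with the same
prefactor as G_t. Comparing G_t with such a product makes integrals over ℝ^d factor into
one-dimensional ones. -/
theorem prod_bump {t : ℝ} (ht : 0 < t) (y : Pt d) :
    ∏ i, bump (t ^ (S.s i / S.ℓ)) (y i) =
      t ^ (-(∑ i, S.s i) / S.ℓ) * ∏ i, (1 + (t ^ (-(S.s i) / S.ℓ) * y i) ^ 2)⁻¹ := by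
  have h1 : t ^ (-(∑ i, S.s i) / S.ℓ) = ∏ i, (t ^ (S.s i / S.ℓ))⁻¹ := by
    rw [← Finset.sum_neg_distrib, Finset.sum_div, Real.rpow_sum_of_pos ht]
    refine Finset.prod_congr rfl fun i _ => ?_
    rw [neg_div, Real.rpow_neg ht.le]
  rw [h1, ← Finset.prod_mul_distrib]
  refine Finset.prod_congr rfl fun i _ => ?_
  unfold bump
  rw [neg_div, Real.rpow_neg ht.le, div_eq_inv_mul (y i)]

/-- From |x_i| ≤ ‖x‖^{s_i} the product has at most polynomial growth in ‖x‖. This turns the moment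
condition on controlled weights into pointwise decay of order ∏(1+x_i²)⁻¹. -/
theorem prod_one_add_sq_mul_le {p : ℝ} (hp : 0 ≤ p) :
    ∃ M : ℕ, ∀ x : Pt d, (∏ i, (1 + x i ^ 2)) * S.size x ^ p ≤
      2 ^ d * 2 ^ M * (1 + S.size x ^ M) := by
  obtain ⟨M, hM⟩ := exists_nat_ge (∑ i, 2 * S.s i + p)
  refine ⟨M, fun x => ?_⟩
  set σ := S.size x with hσ
  have h0 : 0 ≤ σ := S.size_nonneg x
  have h1 : ∀ i, 1 + x i ^ 2 ≤ 2 * (1 + σ) ^ (2 * S.s i) := by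
    intro i
    have hs := S.s_pos i
    have h2 : x i ^ 2 ≤ (1 + σ) ^ (2 * S.s i) := by
      rw [mul_comm, Real.rpow_mul (by positivity), ← sq_abs]
      have : |x i| ≤ (1 + σ) ^ S.s i :=
        (S.abs_le_size x i).trans (Real.rpow_le_rpow h0 (by linarith) hs.le)
      have h3 := pow_le_pow_left₀ (abs_nonneg _) this 2
      exact_mod_cast h3
    have h3 : 1 ≤ (1 + σ) ^ (2 * S.s i) := Real.one_le_rpow (by linarith) (by positivity)
    linarith
  calc (∏ i, (1 + x i ^ 2)) * σ ^ p ≤ (∏ i, 2 * (1 + σ) ^ (2 * S.s i)) * (1 + σ) ^ p := by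
        refine mul_le_mul (Finset.prod_le_prod (fun i _ => by positivity) fun i _ => h1 i)
          (Real.rpow_le_rpow h0 (by linarith) hp) (Real.rpow_nonneg h0 _)
          (Finset.prod_nonneg fun i _ => by positivity)
    _ = 2 ^ d * (1 + σ) ^ (∑ i, 2 * S.s i + p) := by
        rw [Finset.prod_mul_distrib, Finset.prod_const, Finset.card_univ, Fintype.card_fin,
          Real.rpow_add (by positivity), Real.rpow_sum_of_pos (by positivity), mul_assoc]
    _ ≤ 2 ^ d * (1 + σ) ^ (M : ℝ) := by
        gcongr
        linarith
    _ ≤ 2 ^ d * (2 ^ M * (1 + σ ^ M)) := by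
        rw [Real.rpow_natCast]
        gcongr
        exact one_add_pow_le σ h0 M
    _ = _ := by ring

variable {S}

/-- All moment estimates come from this bound. The conditions of orders 0 and M on g·G give the
decay in the unscaled variable, and ‖t^{s/ℓ}x‖ = t^{1/ℓ}‖x‖ turns the factor ‖y‖^p into t^{p/ℓ}. -/
theorem Controls.exists_le_prod_bump {g : Pt d → ℝ} (hg : S.Controls g) {p : ℝ} (hp : 0 ≤ p) :
    ∃ B : ℝ, 0 ≤ B ∧ ∀ t ∈ Ioc (0 : ℝ) 1, ∀ y,
      S.Gt t y * g y * S.size y ^ p ≤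
        B * t ^ (p / S.ℓ) * ∏ i, bump (t ^ (S.s i / S.ℓ)) (y i) := by
  obtain ⟨M, hM⟩ := S.prod_one_add_sq_mul_le hp
  obtain ⟨B0, hB0⟩ := hg.2.2 0
  obtain ⟨BM, hBM⟩ := hg.2.2 M
  refine ⟨2 ^ d * 2 ^ M * (|B0| + |BM|), by positivity, fun t ht y => ?_⟩
  -- The unscaled variable: y is the dilation of x by t, and G_t(y) is t^{-|s|/ℓ} G(x).
  set x : Pt d := fun i => t ^ (-(S.s i) / S.ℓ) * y i with hx
  have hy : S.dil t x = y := S.dil_dil_inv ht.1 y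
  have h1 := hB0 t ht.1 ht.2 x
  have h2 := hBM t ht.1 ht.2 x
  rw [hy] at h1 h2
  have hG := S.G_nonneg x
  have hgy := hg.2.1 y
  have hsz : S.size y = t ^ (1 / S.ℓ) * S.size x := by rw [← hy, S.size_dil ht.1]
  have hσ := S.size_nonneg x
  have hprod : 0 < ∏ i, (1 + x i ^ 2) := Finset.prod_pos fun i _ => by positivity
  have key : S.G x * g y * S.size x ^ p ≤
      2 ^ d * 2 ^ M * (|B0| + |BM|) * ∏ i, (1 + x i ^ 2)⁻¹ := by
    rw [Finset.prod_inv_distrib, ← div_eq_mul_inv, le_div_iff₀ hprod]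
    calc S.G x * g y * S.size x ^ p * ∏ i, (1 + x i ^ 2)
        = S.G x * g y * ((∏ i, (1 + x i ^ 2)) * S.size x ^ p) := by ring
      _ ≤ S.G x * g y * (2 ^ d * 2 ^ M * (1 + S.size x ^ M)) := by
        exact mul_le_mul_of_nonneg_left (hM x) (mul_nonneg hG hgy)
      _ = 2 ^ d * 2 ^ M * (S.size x ^ 0 * g y * S.G x + S.size x ^ M * g y * S.G x) := by ring
      _ ≤ _ := by
        gcongr
        · exact h1.trans (le_abs_self _)
        · exact h2.trans (le_abs_self _)
  rw [S.prod_bump ht.1, hsz, Real.mul_rpow (Real.rpow_nonneg ht.1.le _) hσ,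
    ← Real.rpow_mul ht.1.le]
  have h3 : S.Gt t y = t ^ (-(∑ i, S.s i) / S.ℓ) * S.G x := rfl
  rw [h3, show 1 / S.ℓ * p = p / S.ℓ by ring]
  have h4 : 0 ≤ t ^ (-(∑ i, S.s i) / S.ℓ) * t ^ (p / S.ℓ) :=
    mul_nonneg (Real.rpow_nonneg ht.1.le _) (Real.rpow_nonneg ht.1.le _)
  calc _ = t ^ (-(∑ i, S.s i) / S.ℓ) * t ^ (p / S.ℓ) * (S.G x * g y * S.size x ^ p) := by ring
    _ ≤ t ^ (-(∑ i, S.s i) / S.ℓ) * t ^ (p / S.ℓ) *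
        (2 ^ d * 2 ^ M * (|B0| + |BM|) * ∏ i, (1 + x i ^ 2)⁻¹) :=
      mul_le_mul_of_nonneg_left key h4
    _ = _ := by ring

end GSemigroup

/-! ### Moments of controlled functions -/

/-- The integrable profile `∏ (1 + y_i²)⁻¹`. -/
noncomputable def decay {d : ℕ} (y : Pt d) : ℝ := ∏ i, (1 + y i ^ 2)⁻¹

theorem decay_nonneg {d : ℕ} (y : Pt d) : 0 ≤ decay y :=
  Finset.prod_nonneg fun i _ => by positivity

theorem continuous_decay {d : ℕ} : Continuous (decay (d := d)) := by
  unfold decay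
  refine continuous_finsetProd _ fun i _ => Continuous.inv₀ (by fun_prop) fun y => ?_
  positivity

theorem integrable_decay {d : ℕ} : Integrable (decay (d := d)) :=
  Integrable.fintype_prod (f := fun (_ : Fin d) (u : ℝ) => (1 + u ^ 2)⁻¹)
    fun _ => integrable_inv_one_add_sq

theorem integrable_decay_sub {d : ℕ} (x : Pt d) : Integrable (fun z => decay (x - z)) :=
  integrable_decay.comp_sub_left x

/-- In each coordinate 1 + (x₀−z)² ≤ 3(1 + (x−z)²) when |x−x₀| ≤ 1. It supplies a majorant
independent of the base point for dominated convergence near x₀. -/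
theorem decay_shift {d : ℕ} {x x₀ : Pt d} (h : ∀ i, |x i - x₀ i| ≤ 1) (z : Pt d) :
    decay (x - z) ≤ 3 ^ d * decay (x₀ - z) := by
  unfold decay
  have h3 : (3 : ℝ) ^ d = ∏ _i : Fin d, 3 := by simp
  rw [h3, ← Finset.prod_mul_distrib]
  refine Finset.prod_le_prod (fun i _ => by positivity) fun i _ => ?_
  simp only [Pi.sub_apply]
  rw [← div_eq_mul_inv, inv_eq_one_div, div_le_div_iff₀ (by positivity) (by positivity)]
  have h1 := sq_le_sq' (abs_le.1 (h i)).1 (abs_le.1 (h i)).2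
  nlinarith [sq_nonneg (x i - z i + (x i - x₀ i)), sq_nonneg (x i - z i)]

namespace GSemigroup

variable {d : ℕ} {S : GSemigroup d}

/-- For t ≤ 1 all bump widths are at most one, so the profile of unit width dominates. The constant
blows up as t → 0, which is harmless in the qualitative arguments (continuity, Fubini) that use it.
-/
theorem Controls.exists_le_decay {g : Pt d → ℝ} (hg : S.Controls g) :
    ∃ B : ℝ, 0 ≤ B ∧ ∀ t ∈ Ioc (0 : ℝ) 1, ∀ y,
      S.Gt t y * g y ≤ B * t ^ (-(∑ i, S.s i) / S.ℓ) * decay y := by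
  obtain ⟨B, hB0, hB⟩ := hg.exists_le_prod_bump le_rfl
  refine ⟨B, hB0, fun t ht y => ?_⟩
  have h := hB t ht y
  rw [Real.rpow_zero, mul_one, zero_div, Real.rpow_zero, mul_one] at h
  refine h.trans ?_
  rw [S.prod_bump ht.1, mul_assoc]
  refine mul_le_mul_of_nonneg_left (mul_le_mul_of_nonneg_left ?_ (Real.rpow_nonneg ht.1.le _)) hB0
  refine Finset.prod_le_prod (fun i _ => by positivity) fun i _ => ?_
  refine inv_anti₀ (by positivity) ?_
  have h1 : 1 ≤ t ^ (-(S.s i) / S.ℓ) := by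
    refine Real.one_le_rpow_of_pos_of_le_one_of_nonpos ht.1 ht.2 ?_
    have := S.s_pos i
    have := S.ℓ_pos
    rw [neg_div]
    have : 0 < S.s i / S.ℓ := by positivity
    linarith
  rw [mul_pow]
  have h2 : 1 ≤ (t ^ (-(S.s i) / S.ℓ)) ^ 2 := one_le_pow₀ h1
  nlinarith [sq_nonneg (y i)]

theorem Controls.measurable_moment {g : Pt d → ℝ} (hg : S.Controls g) (t p : ℝ) (x : Pt d) :
    Measurable fun z => S.Gt t (x - z) * g (x - z) * S.size (x - z) ^ p := by
  have h1 := S.measurable_Gt t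
  have h2 := hg.1.measurable
  have h3 := S.continuous_size.measurable
  have hx : Measurable fun z : Pt d => x - z := measurable_const.sub measurable_id
  exact ((h1.comp hx).mul (h2.comp hx)).mul ((h3.comp hx).pow_const p)

theorem Controls.moment_nonneg {g : Pt d → ℝ} (hg : S.Controls g) {t : ℝ} (ht : 0 < t)
    (p : ℝ) (x z : Pt d) : 0 ≤ S.Gt t (x - z) * g (x - z) * S.size (x - z) ^ p :=
  mul_nonneg (mul_nonneg (S.Gt_nonneg ht _) (hg.2.1 _)) (Real.rpow_nonneg (S.size_nonneg _) _)

theorem integrable_prod_bump {t : ℝ} (ht : 0 < t) (x : Pt d) :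
    Integrable (fun z : Pt d => ∏ i, bump (t ^ (S.s i / S.ℓ)) ((x - z) i)) ∧
      ∫ z : Pt d, ∏ i, bump (t ^ (S.s i / S.ℓ)) ((x - z) i) = Real.pi ^ d := by
  constructor
  · exact Integrable.fintype_prod (f := fun (i : Fin d) u => bump (t ^ (S.s i / S.ℓ)) (x i - u))
      fun i => (integrable_bump (Real.rpow_pos_of_pos ht _)).comp_sub_left _
  · have h := integral_fintype_prod_volume_eq_prod
      (fun (i : Fin d) u => bump (t ^ (S.s i / S.ℓ)) (x i - u))
    simp only [Pi.sub_apply]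
    rw [h]
    simp only [integral_sub_left_eq_self (bump _) volume,
      integral_bump (Real.rpow_pos_of_pos ht _), Finset.prod_const, Finset.card_univ,
      Fintype.card_fin]

/-- Integrated against G_t, a factor ‖x−z‖^p is worth t^{p/ℓ}, and any controlled g comes for free.
-/
theorem Controls.moment {g : Pt d → ℝ} (hg : S.Controls g) {p : ℝ} (hp : 0 ≤ p) :
    ∃ C : ℝ, 0 ≤ C ∧ ∀ t ∈ Ioc (0 : ℝ) 1, ∀ x,
      Integrable (fun z => S.Gt t (x - z) * g (x - z) * S.size (x - z) ^ p) ∧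
        ∫ z, S.Gt t (x - z) * g (x - z) * S.size (x - z) ^ p ≤ C * t ^ (p / S.ℓ) := by
  obtain ⟨B, hB0, hB⟩ := hg.exists_le_prod_bump hp
  refine ⟨B * Real.pi ^ d, by positivity, fun t ht x => ?_⟩
  obtain ⟨hI, hval⟩ := integrable_prod_bump (S := S) ht.1 x
  have hdom := hI.const_mul (B * t ^ (p / S.ℓ))
  have hint : Integrable (fun z => S.Gt t (x - z) * g (x - z) * S.size (x - z) ^ p) := by
    refine hdom.mono' (hg.measurable_moment t p x).aestronglyMeasurable
      (Eventually.of_forall fun z => ?_)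
    rw [Real.norm_of_nonneg (hg.moment_nonneg ht.1 p x z)]
    exact hB t ht (x - z)
  refine ⟨hint, (integral_mono hint hdom fun z => hB t ht (x - z)).trans ?_⟩
  rw [integral_const_mul, hval]
  exact le_of_eq (by ring)

/-! ### Moments with the singular temporal weight. -/

section phi

variable [NeZero d] (S)

theorem phi_nonneg (x : Pt d) : 0 ≤ S.phi x :=
  le_min (Real.rpow_nonneg (abs_nonneg _) _) zero_le_one

theorem phi_le_one (x : Pt d) : S.phi x ≤ 1 := min_le_right _ _

theorem phi_pos {x : Pt d} (hx : x 0 ≠ 0) : 0 < S.phi x :=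
  lt_min (Real.rpow_pos_of_pos (abs_pos.2 hx) _) one_pos

theorem continuous_phi : Continuous S.phi := by
  unfold phi
  refine Continuous.min ?_ continuous_const
  have := S.s_pos 0
  exact (continuous_abs.comp (continuous_apply 0)).rpow_const fun x => Or.inr (by positivity)

theorem one_le_phi_rpow {x : Pt d} (hx : x 0 ≠ 0) {a : ℝ} (ha : 0 ≤ a) : 1 ≤ S.phi x ^ (-a) :=
  Real.one_le_rpow_of_pos_of_le_one_of_nonpos (S.phi_pos hx) (S.phi_le_one x) (by linarith)

theorem abs_rpow_le_phi_rpow {x : Pt d} (hx : x 0 ≠ 0) {a : ℝ} (ha : 0 ≤ a) :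
    |x 0| ^ (-(a / S.s 0)) ≤ S.phi x ^ (-a) := by
  have h1 : |x 0| ^ (-(a / S.s 0)) = (|x 0| ^ (1 / S.s 0)) ^ (-a) := by
    rw [← Real.rpow_mul (abs_nonneg _)]
    congr 1; ring
  rw [h1]
  exact Real.rpow_le_rpow_of_nonpos (S.phi_pos hx) (min_le_left _ _) (by linarith)

theorem phi_rpow_le (a : ℝ) (x : Pt d) :
    S.phi x ^ (-a) ≤ 1 + |x 0| ^ (-(a / S.s 0)) := by
  have h0 : 0 ≤ |x 0| ^ (-(a / S.s 0)) := Real.rpow_nonneg (abs_nonneg _) _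
  unfold phi
  rcases min_choice (|x 0| ^ (1 / S.s 0)) 1 with h | h <;> rw [h]
  · rw [← Real.rpow_mul (abs_nonneg _), show 1 / S.s 0 * -a = -(a / S.s 0) by ring]
    linarith
  · rw [Real.one_rpow]; linarith

theorem ae_ne_zero : ∀ᵐ z : Pt d, z 0 ≠ 0 := by
  have h : (volume : Measure (Pt d)) {z | z 0 = 0} = 0 :=
    Measure.pi_hyperplane (fun _ : Fin d => (volume : Measure ℝ)) 0 0
  rw [ae_iff]
  simpa using h

variable {S}

/-- Only the first coordinate sees the singularity, through φ(z)^{-a} ≤ 1 + |z_1|^{-a/s_1}. The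
majorant therefore factors, and the one-dimensional averaging lemma applies with exponent a/s_1 < 1.
The number b leaves room for the weight at a further base point. -/
theorem Controls.phi_moment {g : Pt d → ℝ} (hg : S.Controls g) {p a : ℝ} (hp : 0 ≤ p)
    (ha : 0 ≤ a) (has : a < S.s 0) :
    ∃ C : ℝ, 0 ≤ C ∧ ∀ t ∈ Ioc (0 : ℝ) 1, ∀ x : Pt d, x 0 ≠ 0 → ∀ b : ℝ, 0 ≤ b →
      Integrable (fun z => S.Gt t (x - z) * g (x - z) * S.size (x - z) ^ p *
        (b + S.phi x ^ (-a) + S.phi z ^ (-a))) ∧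
      ∫ z, S.Gt t (x - z) * g (x - z) * S.size (x - z) ^ p *
        (b + S.phi x ^ (-a) + S.phi z ^ (-a)) ≤ C * t ^ (p / S.ℓ) * (b + S.phi x ^ (-a)) := by
  have hs0 := S.s_pos 0
  obtain ⟨B, hB0, hB⟩ := hg.exists_le_prod_bump hp
  obtain ⟨C1, hC10, hC1⟩ := integral_bump_mul_abs_rpow (a := a / S.s 0) (by positivity)
    (by rw [div_lt_one hs0]; exact has)
  refine ⟨B * Real.pi ^ (d - 1) * (2 * Real.pi + C1), by positivity, fun t ht x hx b hb => ?_⟩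
  set τ : Fin d → ℝ := fun i => t ^ (S.s i / S.ℓ) with hτ
  have hτ0 : ∀ i, 0 < τ i := fun i => Real.rpow_pos_of_pos ht.1 _
  -- Since φ ≤ 1, c is at least 1, so the constant 1 in the bound on φ(z)^{-a} costs only a factor
  -- 2.
  set c := b + S.phi x ^ (-a) with hc
  have hφ1 := S.one_le_phi_rpow hx ha
  have hc0 : 0 ≤ c := by linarith
  -- Coordinate 0 carries the whole singular factor; each of the other d−1 coordinates contributes
  -- the mass π of a bump.
  let f : Fin d → ℝ → ℝ := fun i u => bump (τ i) (x i - u) *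
    (if i = 0 then c + 1 + |u| ^ (-(a / S.s 0)) else 1)
  obtain ⟨hI1, hV1⟩ := hC1 (τ 0) (hτ0 0) (x 0) hx
  have hb0 : Integrable (fun u => bump (τ 0) (x 0 - u) * (c + 1)) :=
    ((integrable_bump (hτ0 0)).comp_sub_left _).mul_const _
  have e0 : f 0 = fun u => bump (τ 0) (x 0 - u) * (c + 1) +
      bump (τ 0) (x 0 - u) * |u| ^ (-(a / S.s 0)) := by
    ext u; simp only [f, if_true]; ring
  have ei : ∀ i, i ≠ 0 → f i = fun u => bump (τ i) (x i - u) := by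
    intro i hi; ext u; simp only [f, if_neg hi, mul_one]
  have hfi : ∀ i, Integrable (f i) := by
    intro i
    by_cases hi : i = 0
    · subst hi
      rw [e0]
      exact hb0.add hI1
    · rw [ei i hi]
      exact (integrable_bump (hτ0 i)).comp_sub_left _
  have hprodI : Integrable (fun z : Pt d => ∏ i, f i (z i)) := Integrable.fintype_prod_dep hfi
  have hprodV : ∫ z : Pt d, ∏ i, f i (z i) ≤ Real.pi ^ (d - 1) * ((2 * Real.pi + C1) * c) := by
    rw [integral_fintype_prod_volume_eq_prod, ← Finset.prod_erase_mul _ _ (Finset.mem_univ 0)]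
    have h1 : ∏ i ∈ Finset.univ.erase (0 : Fin d), ∫ u, f i u = Real.pi ^ (d - 1) := by
      rw [Finset.prod_congr rfl (g := fun _ => Real.pi), Finset.prod_const,
        Finset.card_erase_of_mem (Finset.mem_univ _), Finset.card_univ, Fintype.card_fin]
      intro i hi
      rw [ei i (Finset.ne_of_mem_erase hi), integral_sub_left_eq_self (bump _) volume,
        integral_bump (hτ0 i)]
    rw [h1]
    refine mul_le_mul_of_nonneg_left ?_ (by positivity)
    rw [e0, integral_add hb0 hI1, integral_mul_const, integral_sub_left_eq_self (bump _) volume,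
      integral_bump (hτ0 0)]
    have h2 := S.abs_rpow_le_phi_rpow hx ha
    have h3 : C1 * |x 0| ^ (-(a / S.s 0)) ≤ C1 * c :=
      mul_le_mul_of_nonneg_left (by linarith) hC10
    nlinarith [Real.pi_pos, hV1]
  have hdom := hprodI.const_mul (B * t ^ (p / S.ℓ))
  have hle : ∀ z, S.Gt t (x - z) * g (x - z) * S.size (x - z) ^ p *
      (c + S.phi z ^ (-a)) ≤ B * t ^ (p / S.ℓ) * ∏ i, f i (z i) := by
    intro z
    have h1 := hB t ht (x - z)
    have h2 := S.phi_rpow_le a z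
    have h3 : ∏ i, f i (z i) = (∏ i, bump (τ i) ((x - z) i)) *
        (c + 1 + |z 0| ^ (-(a / S.s 0))) := by
      simp only [f]
      rw [Finset.prod_mul_distrib, Finset.prod_ite_eq']
      simp
    have h4 : 0 ≤ c + S.phi z ^ (-a) := add_nonneg hc0 (Real.rpow_nonneg (S.phi_nonneg z) _)
    rw [h3, ← mul_assoc]
    refine mul_le_mul h1 (by linarith) h4 ?_
    exact (hg.moment_nonneg ht.1 p x z).trans h1
  have hnn : ∀ z, 0 ≤ S.Gt t (x - z) * g (x - z) * S.size (x - z) ^ p *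
      (c + S.phi z ^ (-a)) := fun z => mul_nonneg (hg.moment_nonneg ht.1 p x z)
        (add_nonneg hc0 (Real.rpow_nonneg (S.phi_nonneg z) _))
  have hint : Integrable (fun z => S.Gt t (x - z) * g (x - z) * S.size (x - z) ^ p *
      (c + S.phi z ^ (-a))) := by
    refine hdom.mono' (Measurable.aestronglyMeasurable ?_) (Eventually.of_forall fun z => ?_)
    · exact (hg.measurable_moment t p x).mul
        ((S.continuous_phi.measurable.pow_const _).const_add _)
    · rw [Real.norm_of_nonneg (hnn z)]
      exact hle z
  refine ⟨hint, (integral_mono hint hdom hle).trans ?_⟩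
  rw [integral_const_mul]
  refine (mul_le_mul_of_nonneg_left hprodV
    (mul_nonneg hB0 (Real.rpow_nonneg ht.1.le _))).trans (le_of_eq (by ring))

end phi

end GSemigroup

/-! ### Integrals of powers over `(0, 1]` -/

theorem abs_setIntegral_Ioc_zero_le {g : ℝ → ℝ} {B p c : ℝ} (hp : 0 < p) (hc : 0 ≤ c)
    (hg : ∀ r ∈ Ioc 0 c, |g r| ≤ B * r ^ (p - 1)) :
    |∫ r in Ioc 0 c, g r| ≤ B * (p⁻¹ * c ^ p) := by
  have hint : IntegrableOn (fun r : ℝ => B * r ^ (p - 1)) (Ioc 0 c) := by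
    have := intervalIntegral.intervalIntegrable_rpow' (a := 0) (b := c) (by linarith : -1 < p - 1)
    exact ((intervalIntegrable_iff_integrableOn_Ioc_of_le hc).1 this).const_mul _
  have h1 := norm_integral_le_of_norm_le (f := g) hint
    ((ae_restrict_iff' measurableSet_Ioc).2 (Eventually.of_forall fun r hr => hg r hr))
  rw [Real.norm_eq_abs] at h1
  refine h1.trans (le_of_eq ?_)
  rw [integral_const_mul, ← intervalIntegral.integral_of_le hc, integral_rpow
    (Or.inl (by linarith)), sub_add_cancel, Real.zero_rpow hp.ne']
  ring

theorem integrableOn_of_le_rpow {g : ℝ → ℝ} {B p : ℝ} (hp : 0 < p)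
    (hm : AEStronglyMeasurable g (volume.restrict (Ioc 0 1)))
    (hg : ∀ r ∈ Ioc (0 : ℝ) 1, |g r| ≤ B * r ^ (p - 1)) : IntegrableOn g (Ioc 0 1) := by
  have hint : IntegrableOn (fun r : ℝ => B * r ^ (p - 1)) (Ioc 0 1) := by
    have := intervalIntegral.intervalIntegrable_rpow' (a := 0) (b := 1) (by linarith : -1 < p - 1)
    exact ((intervalIntegrable_iff_integrableOn_Ioc_of_le zero_le_one).1 this).const_mul _
  exact Integrable.mono' hint hm
    ((ae_restrict_iff' measurableSet_Ioc).2 (Eventually.of_forall fun r hr => hg r hr))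

/-! ### Generalized functions in Besov spaces -/

namespace GSemigroup

variable {d : ℕ} {S : GSemigroup d}

theorem decay_le_one (y : Pt d) : decay y ≤ 1 :=
  Finset.prod_le_one (fun i _ => by positivity) fun i _ => inv_le_one_of_one_le₀ (by nlinarith [sq_nonneg (y i)])

theorem IsGControlled.controls_one {U : Weight d} (hU : S.IsGControlled U) :
    S.Controls (fun _ => 1) :=
  hU.controls.mono continuous_const (fun _ => zero_le_one) hU.one_le_star

/-- The inequality 1/U(z) ≤ U*(x−z)/U(x) moves the weight from the integration variable to the base
point. The price U*(x−z) is absorbed by the moments of G_t. -/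
theorem abs_mul_le_of_weight {U : Weight d} (hU : S.IsGControlled U) {t M B : ℝ} (ht : 0 < t)
    (hM : 0 ≤ M) {x : Pt d} {k F : Pt d → ℝ} (hk : ∀ z, |k z| ≤ M * S.Gt t (x - z))
    (hF : ∀ z, |F z| * U.w z ≤ B) (z : Pt d) :
    |k z * F z| ≤ M * B * (U.w x)⁻¹ * (S.Gt t (x - z) * U.star (x - z)) := by
  have h1 := hU.w_pos z
  have h2 := hU.inv_le x z
  have hG := S.Gt_nonneg ht (x - z)
  have hB : 0 ≤ B := (mul_nonneg (abs_nonneg _) h1.le).trans (hF z)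
  have h3 : |F z| ≤ B * (U.star (x - z) * (U.w x)⁻¹) :=
    calc |F z| ≤ B * (U.w z)⁻¹ := by rw [← div_eq_mul_inv, le_div_iff₀ h1]; exact hF z
      _ ≤ _ := mul_le_mul_of_nonneg_left h2 hB
  rw [abs_mul]
  calc |k z| * |F z| ≤ (M * S.Gt t (x - z)) * (B * (U.star (x - z) * (U.w x)⁻¹)) :=
        mul_le_mul (hk z) h3 (abs_nonneg _) (mul_nonneg hM hG)
    _ = _ := by ring

/-- Integration of a kernel dominated by `G_t` against a function of growth `1/U`. -/
theorem weighted_integral_bound {U : Weight d} (hU : S.IsGControlled U) :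
    ∃ C : ℝ, 0 ≤ C ∧ ∀ t ∈ Ioc (0 : ℝ) 1, ∀ (M B : ℝ), 0 ≤ M → ∀ (x : Pt d) (k F : Pt d → ℝ),
      (∀ z, |k z| ≤ M * S.Gt t (x - z)) → (∀ z, |F z| * U.w z ≤ B) →
      (Measurable k → Measurable F → Integrable (fun z => k z * F z)) ∧
      |∫ z, k z * F z| * U.w x ≤ C * M * B := by
  obtain ⟨C, hC0, hC⟩ := hU.controls.moment (le_refl (0 : ℝ))
  refine ⟨C, hC0, fun t ht M B hM x k F hk hF => ?_⟩
  have hB : 0 ≤ B := (mul_nonneg (abs_nonneg _) (hU.w_pos x).le).trans (hF x)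
  obtain ⟨hI, hV⟩ := hC t ht x
  simp only [Real.rpow_zero, mul_one, zero_div] at hI hV
  have hle := abs_mul_le_of_weight hU ht.1 hM hk hF
  have hdom := hI.const_mul (M * B * (U.w x)⁻¹)
  constructor
  · intro h1 h2
    exact hdom.mono' (h1.mul h2).aestronglyMeasurable (Eventually.of_forall hle)
  · have h1 := norm_integral_le_of_norm_le (f := fun z => k z * F z) hdom
      (Eventually.of_forall hle)
    rw [integral_const_mul, Real.norm_eq_abs] at h1
    have hw := hU.w_pos x
    calc _ ≤ M * B * (U.w x)⁻¹ * C * U.w x := by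
          refine mul_le_mul_of_nonneg_right (h1.trans ?_) hw.le
          exact mul_le_mul_of_nonneg_left hV (by positivity)
      _ = C * M * B := by field_simp

theorem continuous_weighted_integral {U : Weight d} (hU : S.IsGControlled U) {t M B : ℝ}
    (ht : t ∈ Ioc (0 : ℝ) 1) (hM : 0 ≤ M) {k : Pt d → Pt d → ℝ} {F : Pt d → ℝ}
    (hk : ∀ x z, |k x z| ≤ M * S.Gt t (x - z)) (hF : ∀ z, |F z| * U.w z ≤ B)
    (hkc : ∀ z, Continuous fun x => k x z) (hkm : ∀ x, Measurable (k x)) (hFm : Measurable F) :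
    Continuous fun x => ∫ z, k x z * F z := by
  obtain ⟨D, hD0, hD⟩ := hU.controls.exists_le_decay
  rw [continuous_iff_continuousAt]
  intro x₀
  have hB : 0 ≤ B := (mul_nonneg (abs_nonneg _) (hU.w_pos x₀).le).trans (hF x₀)
  have hw0 := hU.w_pos x₀
  -- Near x₀ the weight stays above U(x₀)/2, whence the 2, and the profile centred at x is at most
  -- 3^d times the one centred at x₀.
  set A := M * B * (2 * (U.w x₀)⁻¹) * (D * t ^ (-(∑ i, S.s i) / S.ℓ) * 3 ^ d) with hA
  refine continuousAt_of_dominated (bound := fun z => A * decay (x₀ - z))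
    (Eventually.of_forall fun x => ((hkm x).mul hFm).aestronglyMeasurable) ?_
    ((integrable_decay_sub x₀).const_mul _)
    (Eventually.of_forall fun z => ((hkc z).mul continuous_const).continuousAt)
  have e1 : ∀ᶠ x in 𝓝 x₀, U.w x₀ / 2 < U.w x :=
    hU.1.continuousAt.eventually (lt_mem_nhds (by linarith))
  have e2 : ∀ᶠ x in 𝓝 x₀, ∀ i, |x i - x₀ i| ≤ 1 := by
    refine eventually_all.2 fun i => ?_
    have h : Continuous fun x : Pt d => |x i - x₀ i| := by fun_prop
    have := h.continuousAt (x := x₀)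
    refine this.eventually (ge_mem_nhds ?_)
    simp
  filter_upwards [e1, e2] with x h1 h2
  refine Eventually.of_forall fun z => ?_
  have h3 := abs_mul_le_of_weight hU ht.1 hM (hk x) hF z
  rw [Real.norm_eq_abs]
  refine h3.trans ?_
  have h4 : (U.w x)⁻¹ ≤ 2 * (U.w x₀)⁻¹ := by
    have := inv_anti₀ (by linarith : 0 < U.w x₀ / 2) h1.le
    rwa [inv_div, div_eq_mul_inv] at this
  have h5 := hD t ht (x - z)
  have h6 : 0 ≤ D * t ^ (-(∑ i, S.s i) / S.ℓ) := mul_nonneg hD0 (Real.rpow_nonneg ht.1.le _)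
  have h7 := mul_le_mul_of_nonneg_left (decay_shift h2 z) h6
  have h8 : 0 ≤ S.Gt t (x - z) * U.star (x - z) :=
    mul_nonneg (S.Gt_nonneg ht.1 _) (hU.controls.2.1 _)
  calc _ ≤ M * B * (2 * (U.w x₀)⁻¹) * (S.Gt t (x - z) * U.star (x - z)) := by gcongr
    _ ≤ M * B * (2 * (U.w x₀)⁻¹) *
        (D * t ^ (-(∑ i, S.s i) / S.ℓ) * (3 ^ d * decay (x₀ - z))) :=
      mul_le_mul_of_nonneg_left (h5.trans h7) (by positivity)
    _ = _ := by rw [hA]; ring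

theorem Q_meas {t : ℝ} (ht : 0 < t) (x : Pt d) : Measurable (S.Q t x) :=
  ((S.Q_continuous t ht).comp (Continuous.prodMk_right x)).measurable

theorem Q_cont_left {t : ℝ} (ht : 0 < t) (z : Pt d) : Continuous fun x => S.Q t x z :=
  (S.Q_continuous t ht).comp (Continuous.prodMk_left z)

theorem Q_continuousAt {t : ℝ} (ht : 0 < t) (x y : Pt d) : ContinuousAt (fun r => S.Q r x y) t :=
  (S.Q_differentiable t ht x y).continuousAt

theorem ofFun_bound {U : Weight d} (hU : S.IsGControlled U) {f : Pt d → ℝ} (hf : U.MemC f) :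
    ∃ B : ℝ, 0 ≤ B ∧ ∀ t ∈ Ioc (0 : ℝ) 1, ∀ x, |S.ofFun f t x| * U.w x ≤ B := by
  obtain ⟨hfc, B, hB⟩ := hf
  obtain ⟨C₁, hC₁, hQ⟩ := S.Q_upper
  obtain ⟨C, hC0, hC⟩ := weighted_integral_bound hU
  have hB0 : 0 ≤ B := (mul_nonneg (abs_nonneg _) (hU.w_pos 0).le).trans (hB 0)
  exact ⟨C * C₁ * B, by positivity, fun t ht x =>
    (hC t ht C₁ B hC₁.le x (S.Q t x) f (hQ t ht.1 x) hB).2⟩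

theorem integrable_Q_mul {U : Weight d} (hU : S.IsGControlled U) {f : Pt d → ℝ} {B : ℝ}
    (hfm : Measurable f) (hf : ∀ z, |f z| * U.w z ≤ B) {t : ℝ} (ht : t ∈ Ioc (0 : ℝ) 1)
    (x : Pt d) : Integrable (fun z => S.Q t x z * f z) := by
  obtain ⟨C₁, hC₁, hQ⟩ := S.Q_upper
  obtain ⟨C, hC0, hC⟩ := weighted_integral_bound hU
  exact (hC t ht C₁ B hC₁.le x (S.Q t x) f (hQ t ht.1 x) hf).1 (Q_meas ht.1 x) hfm

theorem continuous_ofFun {U : Weight d} (hU : S.IsGControlled U) {f : Pt d → ℝ} (hf : U.MemC f)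
    {t : ℝ} (ht : t ∈ Ioc (0 : ℝ) 1) : Continuous (S.ofFun f t) := by
  obtain ⟨hfc, B, hB⟩ := hf
  obtain ⟨C₁, hC₁, hQ⟩ := S.Q_upper
  exact continuous_weighted_integral hU ht hC₁.le (hQ t ht.1) hB (Q_cont_left ht.1)
    (Q_meas ht.1) hfc.measurable

theorem neg_sum_div_nonpos : -(∑ i, S.s i) / S.ℓ ≤ 0 := by
  rw [neg_div, neg_nonpos]
  exact div_nonneg (Finset.sum_nonneg fun i _ => (S.s_pos i).le) S.ℓ_pos.le

theorem continuousOn_ofFun {U : Weight d} (hU : S.IsGControlled U) {f : Pt d → ℝ} (hf : U.MemC f)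
    (x : Pt d) : ContinuousOn (fun t => S.ofFun f t x) (Ioc 0 1) := by
  obtain ⟨hfc, B, hB⟩ := hf
  obtain ⟨C₁, hC₁, hQ⟩ := S.Q_upper
  obtain ⟨D, hD0, hD⟩ := hU.controls.exists_le_decay
  have hB0 : 0 ≤ B := (mul_nonneg (abs_nonneg _) (hU.w_pos 0).le).trans (hB 0)
  have hw0 := hU.w_pos x
  intro t₀ ht₀
  have ht₀' := ht₀.1
  refine continuousWithinAt_of_dominated (bound := fun z => C₁ * B * (U.w x)⁻¹ *
      (D * (t₀ / 2) ^ (-(∑ i, S.s i) / S.ℓ)) * decay (x - z)) ?_ ?_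
      ((integrable_decay_sub x).const_mul _) ?_
  · filter_upwards [self_mem_nhdsWithin] with t ht
    exact ((Q_meas ht.1 x).mul hfc.measurable).aestronglyMeasurable
  · filter_upwards [self_mem_nhdsWithin, mem_nhdsWithin_of_mem_nhds
      (lt_mem_nhds (by linarith : t₀ / 2 < t₀))] with t ht ht2
    refine Eventually.of_forall fun z => ?_
    have h1 := abs_mul_le_of_weight hU ht.1 hC₁.le (hQ t ht.1 x) hB z
    rw [Real.norm_eq_abs, mul_assoc (C₁ * B * (U.w x)⁻¹)]
    refine h1.trans (mul_le_mul_of_nonneg_left ((hD t ht (x - z)).trans ?_) (by positivity))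
    have h2 := Real.rpow_le_rpow_of_nonpos (by linarith : 0 < t₀ / 2) (le_of_lt ht2)
      (neg_sum_div_nonpos (S := S))
    have := decay_nonneg (x - z)
    gcongr
  · refine Eventually.of_forall fun z => ?_
    exact ((Q_continuousAt ht₀.1 x z).continuousWithinAt).mul continuousWithinAt_const

/-- Fubini and the semigroup property of the kernels. For fixed r < t ≤ 1 the double integrand is
dominated by a product of two unit profiles, after the weight has been moved from the inner variable
to x in two steps. -/
theorem ofFun_semigroup {U : Weight d} (hU : S.IsGControlled U) {f : Pt d → ℝ} (hf : U.MemC f)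
    {r t : ℝ} (hr : 0 < r) (hrt : r < t) (ht : t ≤ 1) (x : Pt d) :
    ∫ z, S.Q (t - r) x z * S.ofFun f r z = S.ofFun f t x := by
  obtain ⟨hfc, B, hB⟩ := hf
  obtain ⟨C₁, hC₁, hQ⟩ := S.Q_upper
  obtain ⟨D, hD0, hD⟩ := hU.controls.exists_le_decay
  have hB0 : 0 ≤ B := (mul_nonneg (abs_nonneg _) (hU.w_pos 0).le).trans (hB 0)
  have hr1 : r ∈ Ioc (0 : ℝ) 1 := ⟨hr, by linarith⟩
  have htr : t - r ∈ Ioc (0 : ℝ) 1 := ⟨by linarith, by linarith⟩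
  have hw := hU.w_pos x
  set q := -(∑ i, S.s i) / S.ℓ with hq
  have hdI : Integrable (fun p : Pt d × Pt d => decay (x - p.1) * decay (p.1 - p.2)) := by
    rw [Measure.volume_eq_prod, integrable_prod_iff]
    · refine ⟨Eventually.of_forall fun z => (integrable_decay_sub z).const_mul (decay (x - z)), ?_⟩
      have : (fun z => ∫ y, ‖decay (x - z) * decay (z - y)‖) =
          fun z => decay (x - z) * ∫ y, decay (d := d) y := by
        ext z
        rw [← integral_sub_left_eq_self decay volume z, ← integral_const_mul]
        refine integral_congr_ae (Eventually.of_forall fun y => ?_)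
        exact Real.norm_of_nonneg (mul_nonneg (decay_nonneg _) (decay_nonneg _))
      rw [this]
      exact (integrable_decay_sub x).mul_const _
    · refine Continuous.aestronglyMeasurable ?_
      have := continuous_decay (d := d)
      fun_prop
  have hI : Integrable (fun p : Pt d × Pt d => S.Q (t - r) x p.1 * (S.Q r p.1 p.2 * f p.2)) := by
    refine (hdI.const_mul (C₁ * (C₁ * B * (U.w x)⁻¹) * (D * (t - r) ^ q) * (D * r ^ q))).mono'
      ?_ (Eventually.of_forall fun p => ?_)
    · refine Continuous.aestronglyMeasurable ?_
      have h1 : Continuous fun p : Pt d × Pt d => S.Q (t - r) x p.1 :=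
        (S.Q_continuous _ htr.1).comp (continuous_const.prodMk continuous_fst)
      have h2 : Continuous fun p : Pt d × Pt d => S.Q r p.1 p.2 := S.Q_continuous _ hr
      exact h1.mul (h2.mul (hfc.comp continuous_snd))
    · have h1 := abs_mul_le_of_weight hU hr hC₁.le (hQ r hr p.1) hB p.2
      have h2 := hQ _ htr.1 x p.1
      have h3 := hU.inv_le x p.1
      have h4 := hD _ htr (x - p.1)
      have h5 := hD _ hr1 (p.1 - p.2)
      have hG1 := S.Gt_nonneg htr.1 (x - p.1)
      have hG2 := S.Gt_nonneg hr (p.1 - p.2)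
      have hs1 := hU.controls.2.1 (x - p.1)
      have hs2 := hU.controls.2.1 (p.1 - p.2)
      have hw1 := hU.w_pos p.1
      rw [Real.norm_eq_abs, abs_mul]
      calc |S.Q (t - r) x p.1| * |S.Q r p.1 p.2 * f p.2|
          ≤ (C₁ * S.Gt (t - r) (x - p.1)) * (C₁ * B * (U.star (x - p.1) * (U.w x)⁻¹) *
            (S.Gt r (p.1 - p.2) * U.star (p.1 - p.2))) := by
              refine mul_le_mul h2 (h1.trans ?_) (abs_nonneg _) (mul_nonneg hC₁.le hG1)
              gcongr
        _ = C₁ * (C₁ * B * (U.w x)⁻¹) * (S.Gt (t - r) (x - p.1) * U.star (x - p.1)) *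
            (S.Gt r (p.1 - p.2) * U.star (p.1 - p.2)) := by ring
        _ ≤ C₁ * (C₁ * B * (U.w x)⁻¹) * (D * (t - r) ^ q * decay (x - p.1)) *
            (D * r ^ q * decay (p.1 - p.2)) := by
              refine mul_le_mul (mul_le_mul_of_nonneg_left h4 (by positivity)) h5
                (mul_nonneg hG2 hs2) ?_
              exact mul_nonneg (by positivity) (mul_nonneg (mul_nonneg hD0
                (Real.rpow_nonneg htr.1.le _)) (decay_nonneg _))
        _ = _ := by ring
  have e1 : ∀ z, S.Q (t - r) x z * S.ofFun f r z =
      ∫ y, S.Q (t - r) x z * (S.Q r z y * f y) := fun z => (integral_const_mul _ _).symm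
  simp only [e1]
  rw [integral_integral_swap hI]
  unfold ofFun
  refine integral_congr_ae (Eventually.of_forall fun y => ?_)
  simp only [← mul_assoc]
  rw [integral_mul_const, S.Q_semigroup r t hr hrt x y]

section Besov

variable {α : ℝ} {U : Weight d} {F : ℝ → Pt d → ℝ}

theorem MemBesov.approx (hF : S.MemBesov α U F) {ε : ℝ} (hε : 0 < ε) :
    ∃ f, U.MemC f ∧ ∀ t ∈ Ioc (0 : ℝ) 1, ∀ x,
      |F t x - S.ofFun f t x| * U.w x ≤ ε * t ^ (α / S.ℓ) := by
  obtain ⟨f, hf, h⟩ := hF.2 ε hε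
  refine ⟨f, hf, fun t ht x => ?_⟩
  have h1 := h t ht x
  rwa [neg_div, Real.rpow_neg ht.1.le, inv_mul_le_iff₀ (Real.rpow_pos_of_pos ht.1 _),
    mul_comm _ ε] at h1

theorem one_le_rpow_div (hα : α ≤ 0) {t : ℝ} (ht : t ∈ Ioc (0 : ℝ) 1) : 1 ≤ t ^ (α / S.ℓ) :=
  Real.one_le_rpow_of_pos_of_le_one_of_nonpos ht.1 ht.2
    (div_nonpos_of_nonpos_of_nonneg hα S.ℓ_pos.le)

/-- F is within distance 1 of some f ∈ C(U), for which Q_t f is bounded uniformly in t. Since α ≤ 0,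
the power t^{α/ℓ} is at least 1 and absorbs that bound. -/
theorem MemBesov.bound (hU : S.IsGControlled U) (hF : S.MemBesov α U F) :
    ∃ B : ℝ, 0 ≤ B ∧ ∀ t ∈ Ioc (0 : ℝ) 1, ∀ x, |F t x| * U.w x ≤ B * t ^ (α / S.ℓ) := by
  obtain ⟨f, hf, h⟩ := hF.approx one_pos
  obtain ⟨B, hB0, hB⟩ := ofFun_bound hU hf
  refine ⟨1 + B, by positivity, fun t ht x => ?_⟩
  have h1 := h t ht x
  have h2 := hB t ht x
  have h3 := hU.w_pos x
  have h4 := one_le_rpow_div (S := S) hF.1 ht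
  have h5 : |F t x| ≤ |F t x - S.ofFun f t x| + |S.ofFun f t x| := by
    have := abs_add_le (F t x - S.ofFun f t x) (S.ofFun f t x)
    rwa [sub_add_cancel] at this
  calc |F t x| * U.w x ≤ |F t x - S.ofFun f t x| * U.w x + |S.ofFun f t x| * U.w x := by
        rw [← add_mul]; exact mul_le_mul_of_nonneg_right h5 h3.le
    _ ≤ 1 * t ^ (α / S.ℓ) + B * t ^ (α / S.ℓ) := by
        refine add_le_add h1 (h2.trans (le_mul_of_one_le_right hB0 h4))
    _ = _ := by ring

/-- At fixed t, the product with U is a uniform limit of continuous functions. -/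
theorem MemBesov.continuous (hU : S.IsGControlled U) (hF : S.MemBesov α U F) {t : ℝ}
    (ht : t ∈ Ioc (0 : ℝ) 1) : Continuous (F t) := by
  have h1 : Continuous fun x => F t x * U.w x := by
    refine continuous_of_uniform_approx_of_continuous fun u hu => ?_
    obtain ⟨ε, hε, hεu⟩ := Metric.mem_uniformity_dist.1 hu
    have ht0 := Real.rpow_pos_of_pos ht.1 (α / S.ℓ)
    obtain ⟨f, hf, h⟩ := hF.approx (ε := ε / 2 / t ^ (α / S.ℓ)) (by positivity)
    refine ⟨fun x => S.ofFun f t x * U.w x, (continuous_ofFun hU hf ht).mul hU.1, fun x => ?_⟩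
    apply hεu
    rw [Real.dist_eq, ← sub_mul, abs_mul, abs_of_pos (hU.w_pos x)]
    have h2 := h t ht x
    rw [div_mul_cancel₀ _ ht0.ne'] at h2
    linarith
  have h2 : F t = fun x => F t x * U.w x / U.w x := by
    ext x
    rw [mul_div_cancel_right₀ _ (hU.w_pos x).ne']
  rw [h2]
  exact h1.div hU.1 fun x => (hU.w_pos x).ne'

/-- The approximation is uniform in t only after multiplication by t^{-α/ℓ}; this power is removed
at the end. -/
theorem MemBesov.continuousOn (hU : S.IsGControlled U) (hF : S.MemBesov α U F) (x : Pt d) :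
    ContinuousOn (fun t => F t x) (Ioc 0 1) := by
  have hpow : ∀ q : ℝ, ContinuousOn (fun t : ℝ => t ^ q) (Ioc 0 1) := fun q =>
    continuousOn_id.rpow_const fun t ht => Or.inl ht.1.ne'
  have h1 : ContinuousOn (fun t => F t x * t ^ (-(α / S.ℓ))) (Ioc 0 1) := by
    refine continuousOn_of_uniform_approx_of_continuousOn fun u hu => ?_
    obtain ⟨ε, hε, hεu⟩ := Metric.mem_uniformity_dist.1 hu
    have hw := hU.w_pos x
    obtain ⟨f, hf, h⟩ := hF.approx (ε := ε / 2 * U.w x) (by positivity)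
    refine ⟨fun t => S.ofFun f t x * t ^ (-(α / S.ℓ)),
      (continuousOn_ofFun hU hf x).mul (hpow _), fun t ht => ?_⟩
    apply hεu
    have ht0 := Real.rpow_pos_of_pos ht.1 (α / S.ℓ)
    rw [Real.dist_eq, ← sub_mul, abs_mul, Real.rpow_neg ht.1.le, abs_of_pos (inv_pos.2 ht0),
      ← div_eq_mul_inv, div_lt_iff₀ ht0]
    have h2 := h t ht x
    have h3 : |F t x - S.ofFun f t x| ≤ ε / 2 * t ^ (α / S.ℓ) := by
      refine le_of_mul_le_mul_right (h2.trans (le_of_eq (by ring))) hw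
    have : 0 < ε / 2 * t ^ (α / S.ℓ) := by positivity
    linarith
  refine (h1.mul (hpow (α / S.ℓ))).congr fun t ht => ?_
  have ht0 := Real.rpow_pos_of_pos ht.1 (α / S.ℓ)
  simp only [Pi.mul_apply]
  rw [Real.rpow_neg ht.1.le, inv_mul_cancel_right₀ ht0.ne']

/-- Both sides depend continuously on F in the Besov norm when r and t are fixed, and they agree for
honest functions. -/
theorem MemBesov.semigroup (hU : S.IsGControlled U) (hF : S.MemBesov α U F) {r t : ℝ}
    (hr : 0 < r) (hrt : r < t) (ht : t ≤ 1) (x : Pt d) :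
    Integrable (fun z => S.Q (t - r) x z * F r z) ∧
      ∫ z, S.Q (t - r) x z * F r z = F t x := by
  have hr1 : r ∈ Ioc (0 : ℝ) 1 := ⟨hr, by linarith⟩
  have ht1 : t ∈ Ioc (0 : ℝ) 1 := ⟨by linarith, ht⟩
  have htr : t - r ∈ Ioc (0 : ℝ) 1 := ⟨by linarith, by linarith⟩
  obtain ⟨C₁, hC₁, hQ⟩ := S.Q_upper
  obtain ⟨C, hC0, hC⟩ := weighted_integral_bound hU
  obtain ⟨B, hB0, hB⟩ := hF.bound hU
  have hI := integrable_Q_mul hU (hF.continuous hU hr1).measurable (hB r hr1) htr x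
  refine ⟨hI, ?_⟩
  have hw := hU.w_pos x
  have key : ∀ ε : ℝ, 0 < ε → |(∫ z, S.Q (t - r) x z * F r z) - F t x| * U.w x ≤ ε := by
    intro ε hε
    -- The sum of the Lipschitz constants of the two sides with respect to the Besov norm, so an
    -- approximation within ε/A gives a total error of at most ε.
    set A := C * C₁ * r ^ (α / S.ℓ) + t ^ (α / S.ℓ) with hA
    have hA0 : 0 < A := by
      have := Real.rpow_pos_of_pos hr (α / S.ℓ)
      have := Real.rpow_pos_of_pos ht1.1 (α / S.ℓ)
      positivity
    obtain ⟨f, hf, h⟩ := hF.approx (ε := ε / A) (by positivity)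
    obtain ⟨Bf, hBf0, hBf⟩ := ofFun_bound hU hf
    have hIf := integrable_Q_mul hU (continuous_ofFun hU hf hr1).measurable (hBf r hr1) htr x
    have h1 := (hC _ htr C₁ (ε / A * r ^ (α / S.ℓ)) hC₁.le x (S.Q (t - r) x)
      (fun z => F r z - S.ofFun f r z) (hQ _ htr.1 x) (h r hr1)).2
    have e1 : ∫ z, S.Q (t - r) x z * (F r z - S.ofFun f r z) =
        (∫ z, S.Q (t - r) x z * F r z) - S.ofFun f t x := by
      rw [← ofFun_semigroup hU hf hr hrt ht x, ← integral_sub hI hIf]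
      simp only [mul_sub]
    rw [e1] at h1
    have h2 := h t ht1 x
    have h3 : |(∫ z, S.Q (t - r) x z * F r z) - F t x| ≤
        |(∫ z, S.Q (t - r) x z * F r z) - S.ofFun f t x| + |F t x - S.ofFun f t x| := by
      have := abs_sub_le (∫ z, S.Q (t - r) x z * F r z) (S.ofFun f t x) (F t x)
      rwa [abs_sub_comm (S.ofFun f t x)] at this
    calc _ ≤ (|(∫ z, S.Q (t - r) x z * F r z) - S.ofFun f t x| + |F t x - S.ofFun f t x|) *
          U.w x := mul_le_mul_of_nonneg_right h3 hw.le
      _ ≤ C * C₁ * (ε / A * r ^ (α / S.ℓ)) + ε / A * t ^ (α / S.ℓ) := by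
          rw [add_mul]; exact add_le_add h1 h2
      _ = ε / A * A := by rw [hA]; ring
      _ = ε := div_mul_cancel₀ _ hA0.ne'
  have h0 : |(∫ z, S.Q (t - r) x z * F r z) - F t x| * U.w x ≤ 0 :=
    le_of_forall_pos_le_add fun ε hε => by simpa using key ε hε
  have h1 : |(∫ z, S.Q (t - r) x z * F r z) - F t x| ≤ 0 := by
    by_contra hcon
    exact absurd h0 (not_le.2 (mul_pos (not_le.1 hcon) hw))
  exact sub_eq_zero.1 (abs_nonpos_iff.1 h1)

end Besov

end GSemigroup

/-! ### Regularizing kernels -/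

/-- The derivative `∂_x^k K_t(x, z)`. -/
noncomputable abbrev kernelDeriv {d : ℕ} (K : ℝ → Pt d → Pt d → ℝ) (k : Fin d → ℕ) (t : ℝ)
    (x z : Pt d) : ℝ := mpartial k (fun x' => K t x' z) x

theorem mpartial_zero {d : ℕ} (f : Pt d → ℝ) : mpartial 0 f = f := by
  unfold mpartial
  simp

namespace GSemigroup

variable {d : ℕ} {S : GSemigroup d} {βbar δ CK : ℝ} {K : ℝ → Pt d → Pt d → ℝ}

section Kernel

variable (hK : S.IsRegularizingKernel βbar δ CK K)
include hK

theorem IsRegularizingKernel.CK_pos : 0 < CK := hK.2.2.1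

theorem IsRegularizingKernel.bound {k : Fin d → ℕ} (hk : S.wt k < δ) {t : ℝ} (ht : 0 < t)
    (x z : Pt d) : |kernelDeriv K k t x z| ≤
      CK * t ^ ((βbar - S.wt k) / S.ℓ - 1) * S.Gt t (x - z) :=
  hK.2.2.2.2.2.2.1 k hk t ht x z

theorem IsRegularizingKernel.taylor {k : Fin d → ℕ} (hk : S.wt k < δ) {t : ℝ} (ht : 0 < t)
    (x z h : Pt d) (hh : S.size h ≤ t ^ (1 / S.ℓ)) :
    |kernelDeriv K k t (x + h) z - ∑ l ∈ S.below (δ - S.wt k),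
        mpow h l / mfact l * kernelDeriv K (k + l) t x z| ≤
      CK * S.size h ^ (δ - S.wt k) * t ^ ((βbar - δ) / S.ℓ - 1) * S.Gt t (x - z) :=
  hK.2.2.2.2.2.2.2 k hk t ht x z h hh

/-- The definition of a regularizing kernel does not mention regularity in time. It is inherited
from Q through K_r = K_{t/2} Q_{r−t/2} for r near t, by dominated convergence. It is needed for
measurability in t. -/
theorem IsRegularizingKernel.continuousAt (h1 : S.Controls (fun _ => 1)) {t : ℝ}
    (ht : t ∈ Ioc (0 : ℝ) 1) (x z : Pt d) : ContinuousAt (fun r => K r x z) t := by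
  obtain ⟨C₁, hC₁, hQ⟩ := S.Q_upper
  obtain ⟨D, hD0, hD⟩ := h1.exists_le_decay
  simp only [mul_one] at hD
  have ht0 := ht.1
  have hcK := hK.CK_pos
  have hwt : S.wt 0 < δ := by rw [S.wt_zero]; exact hK.2.1
  have ht2 : t / 2 ∈ Ioc (0 : ℝ) 1 := ⟨by linarith, by linarith [ht.2]⟩
  have e : (fun r => K r x z) =ᶠ[𝓝 t] fun r => ∫ y, K (t / 2) x y * S.Q (r - t / 2) y z := by
    filter_upwards [lt_mem_nhds (by linarith : t / 2 < t)] with r hr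
    have := hK.2.2.2.2.1 (r - t / 2) r (by linarith) (by linarith) x z
    rw [← this, sub_sub_cancel]
  rw [continuousAt_congr e]
  set q := -(∑ i, S.s i) / S.ℓ with hq
  have hb : ∀ y, |K (t / 2) x y| ≤ CK * (t / 2) ^ ((βbar - S.wt 0) / S.ℓ - 1) *
      (D * (t / 2) ^ q * decay (x - y)) := fun y => by
    have := hK.bound hwt ht2.1 x y
    unfold kernelDeriv at this
    rw [mpartial_zero] at this
    refine this.trans (mul_le_mul_of_nonneg_left (hD _ ht2 _) ?_)
    exact mul_nonneg hcK.le (Real.rpow_nonneg ht2.1.le _)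
  refine continuousAt_of_dominated (bound := fun y => (CK * (t / 2) ^ ((βbar - S.wt 0) / S.ℓ - 1) *
      (D * (t / 2) ^ q) * (C₁ * (D * (t / 4) ^ q))) * decay (x - y)) ?_ ?_
      ((integrable_decay_sub x).const_mul _) ?_
  · filter_upwards [lt_mem_nhds (by linarith : t / 2 < t)] with r hr
    have a1 : Continuous (K (t / 2) x) :=
      (hK.2.2.2.1 (t / 2) ht2.1).comp (Continuous.prodMk_right x)
    exact (a1.measurable.mul (Q_cont_left (by linarith) z).measurable).aestronglyMeasurable
  · filter_upwards [lt_mem_nhds (by linarith : 3 * t / 4 < t),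
      gt_mem_nhds (by linarith : t < 3 * t / 2)] with r hr1 hr2
    refine Eventually.of_forall fun y => ?_
    have a0 : r - t / 2 ∈ Ioc (0 : ℝ) 1 := ⟨by linarith, by linarith [ht.2]⟩
    have a1 : |S.Q (r - t / 2) y z| ≤ C₁ * (D * (t / 4) ^ q) := by
      refine (hQ _ a0.1 y z).trans (mul_le_mul_of_nonneg_left ((hD _ a0 (y - z)).trans ?_) hC₁.le)
      have b1 : (r - t / 2) ^ q ≤ (t / 4) ^ q :=
        Real.rpow_le_rpow_of_nonpos (by linarith) (by linarith) neg_sum_div_nonpos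
      have b2 := decay_le_one (y - z)
      have b3 := Real.rpow_nonneg a0.1.le q
      calc D * (r - t / 2) ^ q * decay (y - z) ≤ D * (r - t / 2) ^ q * 1 := by gcongr
        _ ≤ _ := by rw [mul_one]; gcongr
    rw [Real.norm_eq_abs, abs_mul]
    refine (mul_le_mul (hb y) a1 (abs_nonneg _) ((abs_nonneg _).trans (hb y))).trans
      (le_of_eq (by ring))
  · refine Eventually.of_forall fun y => ?_
    refine ContinuousAt.mul continuousAt_const ?_
    have := Q_continuousAt (S := S) (by linarith : 0 < t - t / 2) y z
    exact ContinuousAt.comp (f := fun r => r - t / 2) this (by fun_prop)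

/-- Induction on the order of k. At order zero the kernel is continuous in t and measurable in z,
hence jointly measurable. A derivative of the next order is a pointwise limit of difference
quotients, in which only the point x moves. -/
theorem IsRegularizingKernel.measurable_deriv (h1 : S.Controls (fun _ => 1)) (k : Fin d → ℕ)
    (hk : S.wt k < δ) (x : Pt d) :
    Measurable fun p : Ioc (0 : ℝ) 1 × Pt d => kernelDeriv K k p.1 x p.2 := by
  obtain ⟨n, hn⟩ : ∃ n, ∑ i, k i = n := ⟨_, rfl⟩
  induction n generalizing k x with
  | zero =>
    have hk0 : k = 0 := by
      ext i
      exact (Finset.sum_eq_zero_iff.1 hn) i (Finset.mem_univ i)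
    subst hk0
    unfold kernelDeriv
    simp only [mpartial_zero]
    refine measurable_uncurry_of_continuous_of_measurable
      (u := fun (t : Ioc (0 : ℝ) 1) (z : Pt d) => K t x z) (fun z => ?_) fun t => ?_
    · rw [continuous_iff_continuousAt]
      intro t
      exact ContinuousAt.comp (f := fun r : Ioc (0 : ℝ) 1 => (r : ℝ))
        (hK.continuousAt h1 t.2 x z) continuous_subtype_val.continuousAt
    · exact ((hK.2.2.2.1 t t.2.1).comp (Continuous.prodMk_right x)).measurable
  | succ n ih =>
    obtain ⟨i, hi⟩ : ∃ i, k i ≠ 0 := by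
      by_contra! hcon
      simp [hcon] at hn
    set k' : Fin d → ℕ := k - Pi.single i 1 with hk'
    have hkk : k = k' + Pi.single i 1 := by
      ext j
      by_cases hj : j = i
      · subst hj; simp [hk']; omega
      · simp [hk', hj]
    have hsum : ∑ i, k' i = n := by
      rw [hkk] at hn
      simp only [Pi.add_apply, Finset.sum_add_distrib] at hn
      simpa using hn
    have hwt : S.wt k' < δ := by
      rw [hkk, S.wt_add] at hk
      linarith [S.wt_nonneg (Pi.single i 1)]
    have hder := hK.2.2.2.2.2.1 k' i (hkk ▸ hk)
    refine measurable_of_tendsto_metrizable (f := fun (n : ℕ) (p : Ioc (0 : ℝ) 1 × Pt d) =>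
      (1 / ((n : ℝ) + 1))⁻¹ * (kernelDeriv K k' p.1 (Function.update x i (x i + 1 / ((n : ℝ) + 1)))
        p.2 - kernelDeriv K k' p.1 (Function.update x i (x i)) p.2))
      (fun m => ((ih k' hwt _ hsum).sub (ih k' hwt _ hsum)).const_mul _) ?_
    rw [tendsto_pi_nhds]
    intro p
    have h2 := hasDerivAt_iff_tendsto_slope_zero.1 (hder p.1 p.1.2.1 x p.2)
    have h3 : Tendsto (fun n : ℕ => 1 / ((n : ℝ) + 1)) atTop (𝓝[≠] 0) := by
      refine tendsto_nhdsWithin_iff.2 ⟨tendsto_one_div_add_atTop_nhds_zero_nat,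
        Eventually.of_forall fun n => ?_⟩
      have : (0 : ℝ) < 1 / ((n : ℝ) + 1) := by positivity
      exact this.ne'
    have h4 := h2.comp h3
    rw [← hkk] at h4
    exact h4

theorem IsRegularizingKernel.measurable_deriv_right (h1 : S.Controls (fun _ => 1))
    {k : Fin d → ℕ} (hk : S.wt k < δ) {t : ℝ} (ht : t ∈ Ioc (0 : ℝ) 1) (x : Pt d) :
    Measurable (kernelDeriv K k t x) :=
  (hK.measurable_deriv h1 k hk x).comp (measurable_prodMk_left (x := (⟨t, ht⟩ : Ioc (0 : ℝ) 1)))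

end Kernel

theorem half_mem {t : ℝ} (ht : t ∈ Ioc (0 : ℝ) 1) : t / 2 ∈ Ioc (0 : ℝ) 1 :=
  ⟨by linarith [ht.1], by linarith [ht.1, ht.2]⟩

/-- The integrals `∂^k K_t(x, F)` converge and are measurable in `t`. -/
def KernelRegular (S : GSemigroup d) (δ : ℝ) (K : ℝ → Pt d → Pt d → ℝ) (F : ℝ → Pt d → ℝ) : Prop :=
  ∀ k, S.wt k < δ → ∀ x, (∀ t ∈ Ioc (0 : ℝ) 1,
    Integrable (fun z => kernelDeriv K k (t / 2) x z * F (t / 2) z)) ∧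
    AEStronglyMeasurable (fun t => kernelAt K k t x F) (volume.restrict (Ioc 0 1))

theorem KernelRegular.zero : S.KernelRegular δ K 0 := by
  intro k _ x
  have : (fun t => kernelAt K k t x 0) = fun _ => 0 := by
    ext t; simp [kernelAt]
  rw [this]
  exact ⟨fun t _ => by simp, aestronglyMeasurable_const⟩

theorem KernelRegular.kernelAt_add {F F' : ℝ → Pt d → ℝ} (hF : S.KernelRegular δ K F)
    (hF' : S.KernelRegular δ K F') {k : Fin d → ℕ} (hk : S.wt k < δ) {t : ℝ}
    (ht : t ∈ Ioc (0 : ℝ) 1) (x : Pt d) :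
    kernelAt K k t x (F + F') = kernelAt K k t x F + kernelAt K k t x F' := by
  unfold kernelAt
  rw [← integral_add ((hF k hk x).1 t ht) ((hF' k hk x).1 t ht)]
  simp only [Pi.add_apply, mul_add]

theorem KernelRegular.kernelAt_sub {F F' : ℝ → Pt d → ℝ} (hF : S.KernelRegular δ K F)
    (hF' : S.KernelRegular δ K F') {k : Fin d → ℕ} (hk : S.wt k < δ) {t : ℝ}
    (ht : t ∈ Ioc (0 : ℝ) 1) (x : Pt d) :
    kernelAt K k t x (F - F') = kernelAt K k t x F - kernelAt K k t x F' := by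
  unfold kernelAt
  rw [← integral_sub ((hF k hk x).1 t ht) ((hF' k hk x).1 t ht)]
  simp only [Pi.sub_apply, mul_sub]

theorem KernelRegular.add {F F' : ℝ → Pt d → ℝ} (hF : S.KernelRegular δ K F)
    (hF' : S.KernelRegular δ K F') : S.KernelRegular δ K (F + F') := by
  intro k hk x
  refine ⟨fun t ht => ?_, ?_⟩
  · have := ((hF k hk x).1 t ht).add ((hF' k hk x).1 t ht)
    refine this.congr (Eventually.of_forall fun z => ?_)
    simp only [Pi.add_apply, mul_add]
  · refine ((hF k hk x).2.add (hF' k hk x).2).congr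
      ((ae_restrict_iff' measurableSet_Ioc).2 (Eventually.of_forall fun t ht => ?_))
    exact (hF.kernelAt_add hF' hk ht x).symm

theorem KernelRegular.sub {F F' : ℝ → Pt d → ℝ} (hF : S.KernelRegular δ K F)
    (hF' : S.KernelRegular δ K F') : S.KernelRegular δ K (F - F') := by
  intro k hk x
  refine ⟨fun t ht => ?_, ?_⟩
  · have := ((hF k hk x).1 t ht).sub ((hF' k hk x).1 t ht)
    refine this.congr (Eventually.of_forall fun z => ?_)
    simp only [Pi.sub_apply, mul_sub]
  · refine ((hF k hk x).2.sub (hF' k hk x).2).congr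
      ((ae_restrict_iff' measurableSet_Ioc).2 (Eventually.of_forall fun t ht => ?_))
    exact (hF.kernelAt_sub hF' hk ht x).symm

theorem KernelRegular.sum {ι : Type*} (s : Finset ι) {F : ι → ℝ → Pt d → ℝ}
    (hF : ∀ i ∈ s, S.KernelRegular δ K (F i)) : S.KernelRegular δ K (∑ i ∈ s, F i) :=
  Finset.sum_induction F (fun G => S.KernelRegular δ K G) (fun _ _ h h' => h.add h') .zero hF

theorem KernelRegular.kernelAt_sum {ι : Type*} (s : Finset ι) {F : ι → ℝ → Pt d → ℝ}
    (hF : ∀ i ∈ s, S.KernelRegular δ K (F i)) {k : Fin d → ℕ} (hk : S.wt k < δ) {t : ℝ}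
    (ht : t ∈ Ioc (0 : ℝ) 1) (x : Pt d) :
    kernelAt K k t x (∑ i ∈ s, F i) = ∑ i ∈ s, kernelAt K k t x (F i) := by
  classical
  induction s using Finset.induction_on with
  | empty => simp [kernelAt]
  | insert a s ha ih =>
    rw [Finset.sum_insert ha, Finset.sum_insert ha,
      (hF a (Finset.mem_insert_self a s)).kernelAt_add
        (KernelRegular.sum s fun i hi => hF i (Finset.mem_insert_of_mem hi)) hk ht x,
      ih fun i hi => hF i (Finset.mem_insert_of_mem hi)]

theorem kernelAt_congr {F F' : ℝ → Pt d → ℝ} (h : ∀ t ∈ Ioc (0 : ℝ) 1, ∀ z, F t z = F' t z)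
    (k : Fin d → ℕ) {t : ℝ} (ht : t ∈ Ioc (0 : ℝ) 1) (x : Pt d) :
    kernelAt K k t x F = kernelAt K k t x F' := by
  unfold kernelAt
  simp only [h _ (half_mem ht)]

section Besov

variable {α : ℝ} {U : Weight d} {F : ℝ → Pt d → ℝ}

theorem MemBesov.kernelRegular (hF : S.MemBesov α U F) (hU : S.IsGControlled U)
    (hK : S.IsRegularizingKernel βbar δ CK K) : S.KernelRegular δ K F := by
  have h1 := hU.controls_one
  obtain ⟨B, hB0, hB⟩ := hF.bound hU
  obtain ⟨C, hC0, hC⟩ := weighted_integral_bound hU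
  intro k hk x
  constructor
  · intro t ht
    have ht2 := half_mem ht
    exact (hC _ ht2 _ _ (mul_nonneg hK.CK_pos.le (Real.rpow_nonneg ht2.1.le _)) x
      (kernelDeriv K k (t / 2) x) (F (t / 2)) (hK.bound hk ht2.1 x) (hB _ ht2)).1
      (hK.measurable_deriv_right h1 hk ht2 x) (hF.continuous hU ht2).measurable
  -- Joint measurability in (t,z) makes the z-integral measurable in t; this map inserts the time
  -- t/2 at which both the kernel and F are evaluated.
  · have m1 : Measurable fun p : Ioc (0 : ℝ) 1 × Pt d =>
        ((⟨p.1 / 2, half_mem p.1.2⟩ : Ioc (0 : ℝ) 1), p.2) := by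
      refine Measurable.prodMk (Measurable.subtype_mk ?_) measurable_snd
      exact (measurable_subtype_coe.comp measurable_fst).div_const 2
    have m2 := (hK.measurable_deriv h1 k hk x).comp m1
    have m3 : Measurable fun p : Ioc (0 : ℝ) 1 × Pt d => F p.1 p.2 :=
      measurable_uncurry_of_continuous_of_measurable
        (u := fun (t : Ioc (0 : ℝ) 1) (z : Pt d) => F t z)
        (fun z => (hF.continuousOn hU z).domRestrict) fun t => (hF.continuous hU t.2).measurable
    have m4 := m2.mul (m3.comp m1)
    have m5 : Measurable fun t : Ioc (0 : ℝ) 1 => kernelAt K k t x F := by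
      have := m4.stronglyMeasurable.integral_prod_right' (ν := (volume : Measure (Pt d)))
      exact this.measurable
    have m6 : AEMeasurable (fun t => kernelAt K k t x F) (volume.restrict (Ioc 0 1)) := by
      rw [aemeasurable_restrict_iff_comap_subtype measurableSet_Ioc]
      exact m5.aemeasurable
    exact m6.aestronglyMeasurable

/-- Kernel and generalized function are both taken at time t/2, so their exponents (β̄−|k|)/ℓ−1 and
α/ℓ add up. -/
theorem MemBesov.kernelAt_bound (hF : S.MemBesov α U F) (hU : S.IsGControlled U)
    (hK : S.IsRegularizingKernel βbar δ CK K) {k : Fin d → ℕ} (hk : S.wt k < δ) :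
    ∃ B : ℝ, 0 ≤ B ∧ ∀ t ∈ Ioc (0 : ℝ) 1, ∀ x, |kernelAt K k t x F| * U.w x ≤
      B * t ^ ((βbar - S.wt k + α) / S.ℓ - 1) := by
  obtain ⟨B, hB0, hB⟩ := hF.bound hU
  obtain ⟨C, hC0, hC⟩ := weighted_integral_bound hU
  have hcK := hK.CK_pos
  set q := (βbar - S.wt k + α) / S.ℓ - 1 with hq
  refine ⟨C * CK * B * (1 / 2) ^ q, by positivity, fun t ht x => ?_⟩
  have ht2 := half_mem ht
  have h1 := (hC _ ht2 _ _ (mul_nonneg hK.CK_pos.le (Real.rpow_nonneg ht2.1.le _)) x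
      (kernelDeriv K k (t / 2) x) (F (t / 2)) (hK.bound hk ht2.1 x) (hB _ ht2)).2
  refine h1.trans (le_of_eq ?_)
  have h2 : (t / 2) ^ ((βbar - S.wt k) / S.ℓ - 1) * (t / 2) ^ (α / S.ℓ) = (1 / 2) ^ q * t ^ q := by
    rw [← Real.rpow_add ht2.1, ← Real.mul_rpow (by norm_num) ht.1.le]
    congr 1
    · ring
    · rw [hq]; ring
  calc _ = C * CK * B * ((t / 2) ^ ((βbar - S.wt k) / S.ℓ - 1) * (t / 2) ^ (α / S.ℓ)) := by ring
    _ = _ := by rw [h2]; ring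

theorem MemBesov.kernelConverges (hF : S.MemBesov α U F) (hU : S.IsGControlled U)
    (hK : S.IsRegularizingKernel βbar δ CK K) {k : Fin d → ℕ} (hk : S.wt k < δ)
    (hα : 0 < βbar - S.wt k + α) (x : Pt d) : KernelConverges K k x F := by
  have h1 := hF.kernelRegular hU hK k hk x
  obtain ⟨B, hB0, hB⟩ := hF.kernelAt_bound hU hK hk
  refine ⟨h1.1, integrableOn_of_le_rpow (B := B * (U.w x)⁻¹) (div_pos hα S.ℓ_pos) h1.2
    fun r hr => ?_⟩
  have := hB r hr x
  rw [← le_div_iff₀ (hU.w_pos x)] at this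
  exact this.trans (le_of_eq (by ring))

/-- Each K_tF is continuous in x, and t^{(β̄+α)/ℓ−1} is an integrable majorant locally uniformly in
x because β̄+α > 0. -/
theorem MemBesov.kernelFun_memC (hF : S.MemBesov α U F) (hU : S.IsGControlled U)
    (hK : S.IsRegularizingKernel βbar δ CK K) (hα : 0 < βbar + α) :
    U.MemC (kernelFun K F) := by
  have hk : S.wt 0 < δ := by rw [S.wt_zero]; exact hK.2.1
  obtain ⟨B, hB0, hB⟩ := hF.kernelAt_bound hU hK hk
  obtain ⟨B', hB0', hB'⟩ := hF.bound hU
  have h1 := hF.kernelRegular hU hK 0 hk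
  rw [S.wt_zero, sub_zero] at hB
  have hp : 0 < (βbar + α) / S.ℓ := div_pos hα S.ℓ_pos
  have hb : ∀ t ∈ Ioc (0 : ℝ) 1, ∀ x, |kernelAt K 0 t x F| ≤
      B * (U.w x)⁻¹ * t ^ ((βbar + α) / S.ℓ - 1) := fun t ht x => by
    have := hB t ht x
    rw [← le_div_iff₀ (hU.w_pos x)] at this
    exact this.trans (le_of_eq (by ring))
  constructor
  · rw [continuous_iff_continuousAt]
    intro x₀
    have hw0 := hU.w_pos x₀
    have hint : IntegrableOn (fun r : ℝ => B * (2 * (U.w x₀)⁻¹) * r ^ ((βbar + α) / S.ℓ - 1))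
        (Ioc 0 1) := by
      have := intervalIntegral.intervalIntegrable_rpow' (a := 0) (b := 1)
        (by linarith : -1 < (βbar + α) / S.ℓ - 1)
      exact ((intervalIntegrable_iff_integrableOn_Ioc_of_le zero_le_one).1 this).const_mul _
    refine continuousAt_of_dominated (Eventually.of_forall fun x => (h1 x).2) ?_ hint ?_
    · have e1 : ∀ᶠ x in 𝓝 x₀, U.w x₀ / 2 < U.w x :=
        hU.1.continuousAt.eventually (lt_mem_nhds (by linarith))
      filter_upwards [e1] with x hx
      refine (ae_restrict_iff' measurableSet_Ioc).2 (Eventually.of_forall fun t ht => ?_)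
      have h4 : (U.w x)⁻¹ ≤ 2 * (U.w x₀)⁻¹ := by
        have := inv_anti₀ (by linarith : 0 < U.w x₀ / 2) hx.le
        rwa [inv_div, div_eq_mul_inv] at this
      refine (hb t ht x).trans ?_
      have := Real.rpow_nonneg ht.1.le ((βbar + α) / S.ℓ - 1)
      gcongr
    · refine (ae_restrict_iff' measurableSet_Ioc).2 (Eventually.of_forall fun t ht => ?_)
      have ht2 := half_mem ht
      refine Continuous.continuousAt (continuous_weighted_integral hU ht2
        (mul_nonneg hK.CK_pos.le (Real.rpow_nonneg ht2.1.le _)) (hK.bound hk ht2.1) (hB' _ ht2)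
        (fun z => ?_) (hK.measurable_deriv_right hU.controls_one hk ht2)
        (hF.continuous hU ht2).measurable)
      simp only [mpartial_zero]
      exact (hK.2.2.2.1 _ ht2.1).comp (Continuous.prodMk_left z)
  · refine ⟨B * (((βbar + α) / S.ℓ)⁻¹ * 1 ^ ((βbar + α) / S.ℓ)), fun x => ?_⟩
    have hw := hU.w_pos x
    have h3 := abs_setIntegral_Ioc_zero_le hp zero_le_one fun t ht => hb t ht x
    calc |kernelFun K F x| * U.w x ≤ _ := mul_le_mul_of_nonneg_right h3 hw.le
      _ = _ := by field_simp

end Besov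

end GSemigroup

/-! ### Sums of powers over subintervals of `(0, 1]` -/

theorem abs_setIntegral_le_sum_powers {ι : Type*} (s : Finset ι) {g : ℝ → ℝ} {B p : ι → ℝ} {c : ℝ}
    (hp : ∀ i ∈ s, 0 < p i) (hc : 0 ≤ c)
    (hg : ∀ r ∈ Ioc 0 c, |g r| ≤ ∑ i ∈ s, B i * r ^ (p i - 1)) :
    |∫ r in Ioc 0 c, g r| ≤ ∑ i ∈ s, B i * ((p i)⁻¹ * c ^ p i) := by
  have hint : ∀ i ∈ s, IntegrableOn (fun r : ℝ => B i * r ^ (p i - 1)) (Ioc 0 c) := fun i hi => by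
    have := hp i hi
    have := intervalIntegral.intervalIntegrable_rpow' (a := 0) (b := c) (by linarith : -1 < p i - 1)
    exact ((intervalIntegrable_iff_integrableOn_Ioc_of_le hc).1 this).const_mul _
  have h1 := norm_integral_le_of_norm_le (f := g) (integrable_finsetSum s hint)
    ((ae_restrict_iff' measurableSet_Ioc).2 (Eventually.of_forall fun r hr => hg r hr))
  rw [Real.norm_eq_abs, integral_finsetSum s hint] at h1
  refine h1.trans (le_of_eq (Finset.sum_congr rfl fun i hi => ?_))
  have h2 := hp i hi
  rw [integral_const_mul, ← intervalIntegral.integral_of_le hc, integral_rpow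
    (Or.inl (by linarith)), sub_add_cancel, Real.zero_rpow h2.ne']
  ring

/-- For p < 0 the integral is governed by the lower endpoint c, for p > 0 by the endpoint 1; hence
the power min(p,0). The value p = 0, which would give a logarithm, is excluded. -/
theorem abs_setIntegral_upper_le_sum_powers {ι : Type*} (s : Finset ι) {g : ℝ → ℝ} {B p : ι → ℝ}
    {c : ℝ} (hB : ∀ i ∈ s, 0 ≤ B i) (hp : ∀ i ∈ s, p i ≠ 0) (hc : 0 < c) (hc1 : c ≤ 1)
    (hg : ∀ r ∈ Ioc c 1, |g r| ≤ ∑ i ∈ s, B i * r ^ (p i - 1)) :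
    |∫ r in Ioc c 1, g r| ≤ ∑ i ∈ s, B i * (|p i|⁻¹ * c ^ min (p i) 0) := by
  have h0 : (0 : ℝ) ∉ uIcc c 1 := by
    rw [uIcc_of_le hc1]; exact fun h => absurd h.1 (not_le.2 hc)
  have hint : ∀ i ∈ s, IntegrableOn (fun r : ℝ => B i * r ^ (p i - 1)) (Ioc c 1) := fun i _ => by
    have := intervalIntegral.intervalIntegrable_rpow (μ := volume) (r := p i - 1) (Or.inr h0)
    exact ((intervalIntegrable_iff_integrableOn_Ioc_of_le hc1).1 this).const_mul _
  have h1 := norm_integral_le_of_norm_le (f := g) (integrable_finsetSum s hint)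
    ((ae_restrict_iff' measurableSet_Ioc).2 (Eventually.of_forall fun r hr => hg r hr))
  rw [Real.norm_eq_abs, integral_finsetSum s hint] at h1
  refine h1.trans (Finset.sum_le_sum fun i hi => ?_)
  have h2 := hp i hi
  rw [integral_const_mul, ← intervalIntegral.integral_of_le hc1, integral_rpow
    (Or.inr ⟨fun h => h2 (by linarith), h0⟩), sub_add_cancel, Real.one_rpow]
  refine mul_le_mul_of_nonneg_left ?_ (hB i hi)
  have hcp := Real.rpow_pos_of_pos hc (p i)
  rcases lt_or_gt_of_ne h2 with h | h
  · rw [min_eq_left h.le, abs_of_neg h]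
    have : (1 - c ^ p i) / p i = (-p i)⁻¹ * c ^ p i - (-p i)⁻¹ := by
      field_simp
      ring
    rw [this]
    have : 0 < (-p i)⁻¹ := inv_pos.2 (by linarith)
    linarith
  · rw [min_eq_right h.le, abs_of_pos h, Real.rpow_zero, mul_one, inv_eq_one_div]
    exact div_le_div_of_nonneg_right (by linarith) h.le

namespace GSemigroup

variable {d : ℕ} {S : GSemigroup d}

/-! ### Families of generalized functions with off-centre bounds -/

/-- A bound on `Q_r(z, F_x)` through an intermediate point `y`. -/
def OffCentreBound [NeZero d] (S : GSemigroup d) (E : Finset ℝ) (γ a : ℝ) (g P u : Pt d → ℝ)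
    (Θ : ℝ) (F : Pt d → ℝ → Pt d → ℝ) : Prop :=
  ∀ x y z : Pt d, x 0 ≠ 0 → y 0 ≠ 0 → z 0 ≠ 0 → ∀ r ∈ Ioc (0 : ℝ) 1,
    |F x r z| ≤ Θ * (P (x - y) * (u x)⁻¹) * g (y - z) *
      (S.phi x ^ (-a) + S.phi y ^ (-a) + S.phi z ^ (-a)) *
      ∑ p ∈ (E ×ˢ E).filter (fun p => p.2 ≤ p.1),
        r ^ (p.2 / S.ℓ) * S.size (y - z) ^ (p.1 - p.2) * S.size (x - y) ^ (γ - p.1)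

section Core

variable [NeZero d] {E : Finset ℝ} {γ a : ℝ} {g P u : Pt d → ℝ}

/-- Integration in z against a kernel centred at y turns ‖y−z‖^{α−α'} into r^{(α−α')/ℓ}, which
merges with r^{α'/ℓ} into r^{α/ℓ}. The double sum of the off-centre bound thereby collapses to a sum
over α. -/
theorem exists_integral_offCentre_le (hg : S.Controls g) (hP : ∀ x, 0 ≤ P x) (hu : ∀ x, 0 < u x)
    (ha : 0 ≤ a) (has : a < S.s 0) :
    ∃ C : ℝ, 0 ≤ C ∧ ∀ (Θ : ℝ) (F : Pt d → ℝ → Pt d → ℝ), 0 ≤ Θ →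
      S.OffCentreBound E γ a g P u Θ F →
      ∀ x y : Pt d, x 0 ≠ 0 → y 0 ≠ 0 → ∀ r ∈ Ioc (0 : ℝ) 1, ∀ (M : ℝ) (k : Pt d → ℝ), 0 ≤ M →
        (∀ z, |k z| ≤ M * S.Gt r (y - z)) →
        |∫ z, k z * F x r z| ≤ C * M * Θ * (P (x - y) * (u x)⁻¹) *
          (S.phi x ^ (-a) + S.phi y ^ (-a)) *
          ∑ α ∈ E, r ^ (α / S.ℓ) * S.size (x - y) ^ (γ - α) := by
  -- For negative p the constant is the dummy value 0, so that a constant can be chosen as a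
  -- function of every real p.
  have hm : ∀ p : ℝ, ∃ C : ℝ, 0 ≤ C ∧ (0 ≤ p → ∀ t ∈ Ioc (0 : ℝ) 1, ∀ x : Pt d, x 0 ≠ 0 →
      ∀ b : ℝ, 0 ≤ b →
      Integrable (fun z => S.Gt t (x - z) * g (x - z) * S.size (x - z) ^ p *
        (b + S.phi x ^ (-a) + S.phi z ^ (-a))) ∧
      ∫ z, S.Gt t (x - z) * g (x - z) * S.size (x - z) ^ p *
        (b + S.phi x ^ (-a) + S.phi z ^ (-a)) ≤ C * t ^ (p / S.ℓ) * (b + S.phi x ^ (-a))) := by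
    intro p
    by_cases hp : 0 ≤ p
    · obtain ⟨C, h0, h⟩ := hg.phi_moment hp ha has
      exact ⟨C, h0, fun _ => h⟩
    · exact ⟨0, le_rfl, fun h => absurd h hp⟩
  choose Cm hCm0 hCm using hm
  set T := (E ×ˢ E).filter (fun p : ℝ × ℝ => p.2 ≤ p.1) with hT
  refine ⟨∑ p ∈ T, Cm (p.1 - p.2), Finset.sum_nonneg fun p _ => hCm0 _,
    fun Θ F hΘ hF x y hx hy r hr M k hM hk => ?_⟩
  have hb0 : 0 ≤ S.phi x ^ (-a) := Real.rpow_nonneg (S.phi_nonneg x) _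
  have hy0 : 0 ≤ S.phi y ^ (-a) := Real.rpow_nonneg (S.phi_nonneg y) _
  set A := M * Θ * (P (x - y) * (u x)⁻¹) with hA
  have hA0 : 0 ≤ A := by
    have := hP (x - y); have := hu x; positivity
  let D : ℝ × ℝ → Pt d → ℝ := fun p z => (A * (r ^ (p.2 / S.ℓ) * S.size (x - y) ^ (γ - p.1))) *
    (S.Gt r (y - z) * g (y - z) * S.size (y - z) ^ (p.1 - p.2) *
        (S.phi x ^ (-a) + S.phi y ^ (-a) + S.phi z ^ (-a)))
  have hTp : ∀ p ∈ T, 0 ≤ p.1 - p.2 := fun p hp => sub_nonneg.2 (Finset.mem_filter.1 hp).2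
  have hDI : ∀ p ∈ T, Integrable (D p) := fun p hp =>
    ((hCm _ (hTp p hp) r hr y hy _ hb0).1).const_mul _
  -- The off-centre bound is only available off the hyperplane z_1 = 0, which is a null set.
  have hle : ∀ᵐ z, ‖k z * F x r z‖ ≤ ∑ p ∈ T, D p z := by
    filter_upwards [ae_ne_zero (d := d)] with z hz
    have h1 := hF x y z hx hy hz r hr
    rw [Real.norm_eq_abs, abs_mul]
    have hG := S.Gt_nonneg hr.1 (y - z)
    refine (mul_le_mul (hk z) h1 (abs_nonneg _) (mul_nonneg hM hG)).trans (le_of_eq ?_)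
    rw [← hT, Finset.mul_sum, Finset.mul_sum]
    refine Finset.sum_congr rfl fun p _ => ?_
    simp only [D, hA]
    ring
  have h1 := norm_integral_le_of_norm_le (integrable_finsetSum T hDI) hle
  rw [Real.norm_eq_abs, integral_finsetSum T hDI] at h1
  refine h1.trans ?_
  have hX0 : ∀ α ∈ E, 0 ≤ r ^ (α / S.ℓ) * S.size (x - y) ^ (γ - α) := fun α _ =>
    mul_nonneg (Real.rpow_nonneg hr.1.le _) (Real.rpow_nonneg (S.size_nonneg _) _)
  calc ∑ p ∈ T, ∫ z, D p z
      ≤ ∑ p ∈ T, Cm (p.1 - p.2) * (A * (S.phi x ^ (-a) + S.phi y ^ (-a)) *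
          ∑ α ∈ E, r ^ (α / S.ℓ) * S.size (x - y) ^ (γ - α)) := by
        refine Finset.sum_le_sum fun p hp => ?_
        simp only [D]
        rw [integral_const_mul]
        have h2 := (hCm _ (hTp p hp) r hr y hy _ hb0).2
        have hs0 := Real.rpow_nonneg (S.size_nonneg (x - y)) (γ - p.1)
        have hr0 := Real.rpow_nonneg hr.1.le (p.2 / S.ℓ)
        have h3 : r ^ (p.2 / S.ℓ) * r ^ ((p.1 - p.2) / S.ℓ) = r ^ (p.1 / S.ℓ) := by
          rw [← Real.rpow_add hr.1]; congr 1; ring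
        have h4 := Finset.single_le_sum (f := fun α => r ^ (α / S.ℓ) * S.size (x - y) ^ (γ - α))
          hX0 (Finset.mem_product.1 (Finset.mem_filter.1 hp).1).1
        calc _ ≤ (A * (r ^ (p.2 / S.ℓ) * S.size (x - y) ^ (γ - p.1))) *
              (Cm (p.1 - p.2) * r ^ ((p.1 - p.2) / S.ℓ) *
                (S.phi x ^ (-a) + S.phi y ^ (-a))) :=
              mul_le_mul_of_nonneg_left h2 (by positivity)
          _ = Cm (p.1 - p.2) * (A * (S.phi x ^ (-a) + S.phi y ^ (-a)) *
              (r ^ (p.1 / S.ℓ) * S.size (x - y) ^ (γ - p.1))) := by rw [← h3]; ring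
          _ ≤ _ := mul_le_mul_of_nonneg_left (mul_le_mul_of_nonneg_left h4 (by positivity))
              (hCm0 _)
    _ = _ := by rw [← Finset.sum_mul, hA]; ring

-- At y = x all powers 0^{γ−α} vanish except 0^0 = 1 at α = γ. This is how the full order γ is
-- recovered at the base point.
omit [NeZero d] in
theorem sum_rpow_mul_zero_rpow (hγ : γ ∈ E) (r : ℝ) (x : Pt d) :
    ∑ α ∈ E, r ^ (α / S.ℓ) * S.size (x - x) ^ (γ - α) = r ^ (γ / S.ℓ) := by
  rw [Finset.sum_eq_single_of_mem γ hγ]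
  · rw [sub_self, sub_self, Real.rpow_zero, mul_one]
  · intro α hα hne
    have : γ - α ≠ 0 := fun h => hne (by linarith)
    rw [sub_self, S.size_zero, Real.zero_rpow this, mul_zero]

/-- The standing assumptions on the exponents and weights in the Schauder estimate. -/
structure SchauderData (S : GSemigroup d) (E : Finset ℝ) (γ a : ℝ) (g P u : Pt d → ℝ) : Prop where
  ctl : S.Controls g
  one_le : ∀ x, 1 ≤ P x
  pos : ∀ x, 0 < u x
  a_nonneg : 0 ≤ a
  a_lt : a < S.s 0
  mem : γ ∈ E

theorem half_rpow_le {r q q₀ : ℝ} (hr : 0 < r) (hq : q₀ ≤ q) :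
    (r / 2) ^ q ≤ (1 / 2) ^ q₀ * r ^ q := by
  rw [div_eq_mul_one_div, Real.mul_rpow hr.le (by norm_num), mul_comm]
  exact mul_le_mul_of_nonneg_right
    (Real.rpow_le_rpow_of_exponent_ge (by norm_num) (by norm_num) hq) (Real.rpow_nonneg hr.le _)

/-- The three bounds are one integration lemma applied to three kernels at time r/2: the derivative
at y, the derivative at x itself, and the Taylor remainder of the derivative. The last is again
dominated by a multiple of G_{r/2} centred at x. -/
theorem SchauderData.exists_kernelAt_le (h : S.SchauderData E γ a g P u) (βbar δ : ℝ) :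
    ∃ C : ℝ, 0 ≤ C ∧ ∀ (K : ℝ → Pt d → Pt d → ℝ) (CK : ℝ), S.IsRegularizingKernel βbar δ CK K →
      ∀ (Θ : ℝ) (F : Pt d → ℝ → Pt d → ℝ), 0 ≤ Θ → S.OffCentreBound E γ a g P u Θ F →
      ∀ x : Pt d, x 0 ≠ 0 → ∀ r ∈ Ioc (0 : ℝ) 1, ∀ k, S.wt k < δ →
        (∀ y : Pt d, y 0 ≠ 0 → |kernelAt K k r y (F x)| ≤ C * CK * Θ * (P (x - y) * (u x)⁻¹) *
          (S.phi x ^ (-a) + S.phi y ^ (-a)) *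
          ∑ α ∈ E, S.size (x - y) ^ (γ - α) * r ^ ((βbar - S.wt k + α) / S.ℓ - 1)) ∧
        (|kernelAt K k r x (F x)| ≤ C * CK * Θ * (u x)⁻¹ * S.phi x ^ (-a) *
          r ^ ((βbar - S.wt k + γ) / S.ℓ - 1)) ∧
        (S.KernelRegular δ K (F x) → ∀ y, S.size (y - x) ≤ (r / 2) ^ (1 / S.ℓ) →
          |kernelAt K k r y (F x) - ∑ l ∈ S.below (δ - S.wt k),
            mpow (y - x) l / mfact l * kernelAt K (k + l) r x (F x)| ≤
          C * CK * Θ * (u x)⁻¹ * S.phi x ^ (-a) * (S.size (y - x) ^ (δ - S.wt k) *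
            r ^ ((βbar - δ + γ) / S.ℓ - 1))) := by
  obtain ⟨C, hC0, hC⟩ := exists_integral_offCentre_le (E := E) (γ := γ) h.ctl
    (fun x => zero_le_one.trans (h.one_le x)) h.pos h.a_nonneg h.a_lt
  have hP0 : 0 < P 0 := zero_lt_one.trans_le (h.one_le 0)
  have hℓ := S.ℓ_pos
  -- A common lower bound for all exponents that occur, since |k| < δ. It makes the cost (1/2)^q of
  -- passing from r/2 to r uniform. The sum of the negative parts is such a bound.
  obtain ⟨q₀, hq0⟩ : ∃ q₀ : ℝ, ∀ α ∈ E, q₀ ≤ (βbar - δ + α) / S.ℓ - 1 := by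
    refine ⟨∑ α ∈ E, min 0 ((βbar - δ + α) / S.ℓ - 1), fun α hα => ?_⟩
    have := Finset.sum_le_sum_of_subset_of_nonneg (f := fun α => -min 0 ((βbar - δ + α) / S.ℓ - 1))
      (Finset.singleton_subset_iff.2 hα) fun i _ _ => by simp
    rw [Finset.sum_singleton, Finset.sum_neg_distrib, neg_le_neg_iff] at this
    exact this.trans (min_le_right _ _)
  have hc1 : 0 ≤ (1 / 2 : ℝ) ^ q₀ := by positivity
  have hc1le : 0 ≤ C * (1 / 2 : ℝ) ^ q₀ := by positivity
  -- At y = x the factor P(x−y) becomes P(0) and φ(x)^{-a} is counted twice, whence 2P(0); the 1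
  -- covers the case of general y.
  refine ⟨C * (1 / 2) ^ q₀ * (1 + 2 * P 0), by positivity,
    fun K CK hK Θ F hΘ hF x hx r hr k hk => ?_⟩
  have hCK := hK.CK_pos
  have hr2 := half_mem hr
  have hux := inv_pos.2 (h.pos x)
  have hφx : 0 ≤ S.phi x ^ (-a) := Real.rpow_nonneg (S.phi_nonneg x) _
  have hq1 : ∀ α ∈ E, ∀ e ≤ δ, (r / 2) ^ ((βbar - e) / S.ℓ - 1) * (r / 2) ^ (α / S.ℓ) ≤
      (1 / 2) ^ q₀ * r ^ ((βbar - e + α) / S.ℓ - 1) := by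
    intro α hα e he
    rw [← Real.rpow_add hr2.1]
    have e1 : (βbar - e) / S.ℓ - 1 + α / S.ℓ = (βbar - e + α) / S.ℓ - 1 := by ring
    rw [e1]
    refine half_rpow_le hr.1 ((hq0 α hα).trans ?_)
    have : (βbar - δ + α) / S.ℓ ≤ (βbar - e + α) / S.ℓ :=
      div_le_div_of_nonneg_right (by linarith) hℓ.le
    linarith
  have hgen : ∀ y : Pt d, y 0 ≠ 0 → |kernelAt K k r y (F x)| ≤
      C * (1 / 2) ^ q₀ * CK * Θ * (P (x - y) * (u x)⁻¹) *
          (S.phi x ^ (-a) + S.phi y ^ (-a)) *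
          ∑ α ∈ E, S.size (x - y) ^ (γ - α) * r ^ ((βbar - S.wt k + α) / S.ℓ - 1) := by
    intro y hy
    have hM : 0 ≤ CK * (r / 2) ^ ((βbar - S.wt k) / S.ℓ - 1) :=
      mul_nonneg hCK.le (Real.rpow_nonneg hr2.1.le _)
    have h1 := hC Θ F hΘ hF x y hx hy _ hr2 _ _ hM (hK.bound hk hr2.1 y)
    have hφy : 0 ≤ S.phi y ^ (-a) := Real.rpow_nonneg (S.phi_nonneg y) _
    have hPxy : 0 ≤ P (x - y) := zero_le_one.trans (h.one_le _)
    refine h1.trans ?_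
    have e2 : C * (CK * (r / 2) ^ ((βbar - S.wt k) / S.ℓ - 1)) * Θ * (P (x - y) * (u x)⁻¹) *
          (S.phi x ^ (-a) + S.phi y ^ (-a)) *
          ∑ α ∈ E, (r / 2) ^ (α / S.ℓ) * S.size (x - y) ^ (γ - α) =
        C * CK * Θ * (P (x - y) * (u x)⁻¹) * (S.phi x ^ (-a) + S.phi y ^ (-a)) *
          ∑ α ∈ E, S.size (x - y) ^ (γ - α) *
            ((r / 2) ^ ((βbar - S.wt k) / S.ℓ - 1) * (r / 2) ^ (α / S.ℓ)) := by
      simp only [Finset.mul_sum]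
      exact Finset.sum_congr rfl fun α _ => by ring
    rw [e2]
    calc _ ≤ C * CK * Θ * (P (x - y) * (u x)⁻¹) * (S.phi x ^ (-a) + S.phi y ^ (-a)) *
          ∑ α ∈ E, S.size (x - y) ^ (γ - α) *
            ((1 / 2) ^ q₀ * r ^ ((βbar - S.wt k + α) / S.ℓ - 1)) := by
          refine mul_le_mul_of_nonneg_left (Finset.sum_le_sum fun α hα => ?_) (by positivity)
          exact mul_le_mul_of_nonneg_left (hq1 α hα _ hk.le)
            (Real.rpow_nonneg (S.size_nonneg _) _)
      _ = _ := by
          simp only [Finset.mul_sum]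
          exact Finset.sum_congr rfl fun α _ => by ring
  refine ⟨fun y hy => (hgen y hy).trans ?_, ?_, fun hreg y hyx => ?_⟩
  · have hφy : 0 ≤ S.phi y ^ (-a) := Real.rpow_nonneg (S.phi_nonneg y) _
    have hPxy : 0 ≤ P (x - y) := zero_le_one.trans (h.one_le _)
    have hsum : 0 ≤ ∑ α ∈ E, S.size (x - y) ^ (γ - α) * r ^ ((βbar - S.wt k + α) / S.ℓ - 1) :=
      Finset.sum_nonneg fun α _ => mul_nonneg (Real.rpow_nonneg (S.size_nonneg _) _)
        (Real.rpow_nonneg hr.1.le _)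
    have : C * (1 / 2 : ℝ) ^ q₀ ≤ C * (1 / 2) ^ q₀ * (1 + 2 * P 0) :=
      le_mul_of_one_le_right hc1le (by linarith)
    gcongr
  · refine (hgen x hx).trans ?_
    have e3 : ∑ α ∈ E, S.size (x - x) ^ (γ - α) * r ^ ((βbar - S.wt k + α) / S.ℓ - 1) =
        r ^ ((βbar - S.wt k + γ) / S.ℓ - 1) := by
      rw [Finset.sum_eq_single_of_mem γ h.mem]
      · rw [sub_self, sub_self, Real.rpow_zero, one_mul]
      · intro α hα hne
        have : γ - α ≠ 0 := fun h => hne (by linarith)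
        rw [sub_self, S.size_zero, Real.zero_rpow this, zero_mul]
    rw [e3, sub_self]
    have : 0 ≤ C * (1 / 2) ^ q₀ * CK * Θ * (u x)⁻¹ * S.phi x ^ (-a) *
          r ^ ((βbar - S.wt k + γ) / S.ℓ - 1) := by
      have := Real.rpow_nonneg hr.1.le ((βbar - S.wt k + γ) / S.ℓ - 1)
      positivity
    calc _ = C * (1 / 2) ^ q₀ * CK * Θ * (u x)⁻¹ * S.phi x ^ (-a) *
          r ^ ((βbar - S.wt k + γ) / S.ℓ - 1) * (2 * P 0) := by ring
      _ ≤ C * (1 / 2) ^ q₀ * CK * Θ * (u x)⁻¹ * S.phi x ^ (-a) *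
          r ^ ((βbar - S.wt k + γ) / S.ℓ - 1) * (1 + 2 * P 0) :=
        mul_le_mul_of_nonneg_left (by linarith) this
      _ = _ := by ring
  · have hl : ∀ l ∈ S.below (δ - S.wt k), S.wt (k + l) < δ := fun l hl => by
      rw [S.wt_add]; linarith [S.mem_below.1 hl]
    -- Regularity of the kernel integrals allows the finite Taylor sum to be taken inside the
    -- z-integral, where it becomes the Taylor remainder of the kernel.
    have e4 : kernelAt K k r y (F x) - ∑ l ∈ S.below (δ - S.wt k),
            mpow (y - x) l / mfact l * kernelAt K (k + l) r x (F x) =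
        ∫ z, (kernelDeriv K k (r / 2) y z - ∑ l ∈ S.below (δ - S.wt k),
          mpow (y - x) l / mfact l * kernelDeriv K (k + l) (r / 2) x z) * F x (r / 2) z := by
      have hI : ∀ l ∈ S.below (δ - S.wt k), Integrable (fun z => mpow (y - x) l / mfact l *
          (kernelDeriv K (k + l) (r / 2) x z * F x (r / 2) z)) := fun l h2 =>
        ((hreg (k + l) (hl l h2) x).1 r hr).const_mul _
      unfold kernelAt
      simp only [← integral_const_mul]
      rw [← integral_finsetSum _ hI,
        ← integral_sub ((hreg k hk y).1 r hr) (integrable_finsetSum _ hI)]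
      refine integral_congr_ae (Eventually.of_forall fun z => ?_)
      simp only [sub_mul, Finset.sum_mul, mul_assoc]
    rw [e4]
    have hM : 0 ≤ CK * S.size (y - x) ^ (δ - S.wt k) * (r / 2) ^ ((βbar - δ) / S.ℓ - 1) :=
      mul_nonneg (mul_nonneg hCK.le (Real.rpow_nonneg (S.size_nonneg _) _))
        (Real.rpow_nonneg hr2.1.le _)
    have hk2 : ∀ z, |kernelDeriv K k (r / 2) y z - ∑ l ∈ S.below (δ - S.wt k),
          mpow (y - x) l / mfact l * kernelDeriv K (k + l) (r / 2) x z| ≤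
          CK * S.size (y - x) ^ (δ - S.wt k) * (r / 2) ^ ((βbar - δ) / S.ℓ - 1) *
            S.Gt (r / 2) (x - z) := fun z => by
      have := hK.taylor hk hr2.1 x z (y - x) hyx
      rwa [add_sub_cancel] at this
    have h1 := hC Θ F hΘ hF x x hx hx _ hr2 _ _ hM hk2
    rw [sum_rpow_mul_zero_rpow h.mem, sub_self] at h1
    refine h1.trans ?_
    have hs0 := Real.rpow_nonneg (S.size_nonneg (y - x)) (δ - S.wt k)
    have hr0 := Real.rpow_nonneg hr.1.le ((βbar - δ + γ) / S.ℓ - 1)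
    calc _ = C * CK * Θ * (u x)⁻¹ * S.phi x ^ (-a) * S.size (y - x) ^ (δ - S.wt k) * (2 * P 0) *
          ((r / 2) ^ ((βbar - δ) / S.ℓ - 1) * (r / 2) ^ (γ / S.ℓ)) := by ring
      _ ≤ C * CK * Θ * (u x)⁻¹ * S.phi x ^ (-a) * S.size (y - x) ^ (δ - S.wt k) * (1 + 2 * P 0) *
          ((1 / 2) ^ q₀ * r ^ ((βbar - δ + γ) / S.ℓ - 1)) := by
          have := hq1 γ h.mem δ le_rfl
          have h0 : 0 ≤ (r / 2) ^ ((βbar - δ) / S.ℓ - 1) * (r / 2) ^ (γ / S.ℓ) :=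
            mul_nonneg (Real.rpow_nonneg hr2.1.le _) (Real.rpow_nonneg hr2.1.le _)
          gcongr
          linarith
      _ = _ := by ring

end Core

end GSemigroup

theorem integrableOn_of_le_sum_powers {ι : Type*} (s : Finset ι) {g : ℝ → ℝ} {B p : ι → ℝ}
    (hp : ∀ i ∈ s, 0 < p i) (hm : AEStronglyMeasurable g (volume.restrict (Ioc 0 1)))
    (hg : ∀ r ∈ Ioc (0 : ℝ) 1, |g r| ≤ ∑ i ∈ s, B i * r ^ (p i - 1)) :
    IntegrableOn g (Ioc 0 1) := by
  have hint : ∀ i ∈ s, IntegrableOn (fun r : ℝ => B i * r ^ (p i - 1)) (Ioc 0 1) := fun i hi => by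
    have := hp i hi
    have := intervalIntegral.intervalIntegrable_rpow' (a := 0) (b := 1) (by linarith : -1 < p i - 1)
    exact ((intervalIntegrable_iff_integrableOn_Ioc_of_le zero_le_one).1 this).const_mul _
  exact Integrable.mono' (integrable_finsetSum s hint) hm
    ((ae_restrict_iff' measurableSet_Ioc).2 (Eventually.of_forall fun r hr => hg r hr))

theorem setIntegral_Ioc_split {g : ℝ → ℝ} {c : ℝ} (hc : 0 ≤ c) (hc1 : c ≤ 1)
    (hg : IntegrableOn g (Ioc 0 1)) :
    ∫ r in Ioc 0 1, g r = (∫ r in Ioc 0 c, g r) + ∫ r in Ioc c 1, g r := by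
  rw [← Ioc_union_Ioc_eq_Ioc hc hc1, setIntegral_union (Ioc_disjoint_Ioc_of_le le_rfl)
    measurableSet_Ioc (hg.mono_set (Ioc_subset_Ioc_right hc1))
    (hg.mono_set (Ioc_subset_Ioc_left hc))]

namespace GSemigroup

variable {d : ℕ} {S : GSemigroup d}

theorem below_subset {c c' : ℝ} (h : c ≤ c') : S.below c ⊆ S.below c' := fun _ hk =>
  S.mem_below.2 ((S.mem_below.1 hk).trans_le h)

theorem below_eq_empty {c : ℝ} (h : c ≤ 0) : S.below c = ∅ := by
  ext k
  simp only [S.mem_below, Finset.notMem_empty, iff_false, not_lt]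
  exact h.trans (S.wt_nonneg k)

theorem abs_mpow_div_le (h : Pt d) (k : Fin d → ℕ) :
    |mpow h k / mfact k| ≤ S.size h ^ S.wt k := by
  have h1 := one_le_mfact k
  rw [abs_div, abs_of_pos (by linarith : 0 < mfact k)]
  exact (div_le_self (abs_nonneg _) h1).trans (S.abs_mpow_le h k)

/-- The kernel is used at time r/2, so its Taylor estimate requires ‖y−x‖ ≤ (r/2)^{1/ℓ}. This
explains the cut-off 2‖y−x‖^ℓ throughout. -/
theorem size_le_half_rpow {x : Pt d} {r : ℝ} (hr : 2 * S.size x ^ S.ℓ ≤ r) :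
    S.size x ≤ (r / 2) ^ (1 / S.ℓ) := by
  have hℓ := S.ℓ_pos
  have h0 := S.size_nonneg x
  have h1 : S.size x = (S.size x ^ S.ℓ) ^ (1 / S.ℓ) := by
    rw [← Real.rpow_mul h0, mul_one_div_cancel hℓ.ne', Real.rpow_one]
  rw [h1]
  exact Real.rpow_le_rpow (Real.rpow_nonneg h0 _) (by linarith) (by positivity)

theorem two_mul_rpow_rpow {ρ q : ℝ} (hρ : 0 ≤ ρ) :
    (2 * ρ ^ S.ℓ) ^ (q / S.ℓ) = 2 ^ (q / S.ℓ) * ρ ^ q := by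
  rw [Real.mul_rpow (by norm_num) (Real.rpow_nonneg hρ _), ← Real.rpow_mul hρ,
    mul_div_cancel₀ _ S.ℓ_pos.ne']

/-! ### The Schauder estimate for an abstract family of generalized functions. -/

section Schauder

variable [NeZero d] {E : Finset ℝ} {γ a : ℝ} {g P u : Pt d → ℝ}

/-- On scales r > 2ρ^ℓ, with ρ = ‖y−x‖, the kernel is expanded to order δ. The error consists of the
Taylor remainder and of the surplus monomials with γ+β ≤ |k+l| < δ. Weakening β̄ to β makes the
powers of r negative, so the lower endpoint dominates and every term scales as ρ^{γ+β−|k|}. -/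
theorem SchauderData.exists_upper_le (h : S.SchauderData E γ a g P u) {β βbar δ : ℝ}
    (hβ : β ≤ βbar) (hδ : γ + βbar < δ) {k : Fin d → ℕ} (hk : S.wt k < δ) :
    ∃ C : ℝ, 0 ≤ C ∧ ∀ (K : ℝ → Pt d → Pt d → ℝ) (CK : ℝ), S.IsRegularizingKernel βbar δ CK K →
      (β < βbar ∨ ∀ k : Fin d → ℕ, γ + βbar ≠ S.wt k) →
      ∀ (Θ : ℝ) (F : Pt d → ℝ → Pt d → ℝ), 0 ≤ Θ → S.OffCentreBound E γ a g P u Θ F →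
      ∀ x : Pt d, x 0 ≠ 0 → S.KernelRegular δ K (F x) → ∀ y, y ≠ x →
        2 * S.size (y - x) ^ S.ℓ ≤ 1 →
        |∫ r in Ioc (2 * S.size (y - x) ^ S.ℓ) 1, (kernelAt K k r y (F x) -
          ∑ l ∈ S.below (γ + β - S.wt k),
            mpow (y - x) l / mfact l * kernelAt K (k + l) r x (F x))| ≤
        C * CK * Θ * (u x)⁻¹ * S.phi x ^ (-a) * S.size (y - x) ^ (γ + β - S.wt k) := by
  obtain ⟨C, hC0, hC⟩ := h.exists_kernelAt_le βbar δ
  have hℓ := S.ℓ_pos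
  -- `none` stands for the Taylor remainder, of order δ, and `some l` for a surplus monomial, of
  -- order |k+l|.
  let e : Option (Fin d → ℕ) → ℝ := fun o => o.elim δ fun l => S.wt (k + l)
  -- At the resonance e = γ+β, weakening β̄ to β would give the exponent 0 and a logarithm. There β̄
  -- is kept: the exponent (β̄−β)/ℓ is positive if β < β̄, and if β = β̄ the resonance is excluded.
  let p : Option (Fin d → ℕ) → ℝ := fun o =>
    if e o = γ + β then (βbar - β) / S.ℓ else (γ + β - e o) / S.ℓ
  set s : Finset (Option (Fin d → ℕ)) :=
    Finset.insertNone (S.below (δ - S.wt k) \ S.below (γ + β - S.wt k)) with hs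
  refine ⟨C * ∑ i ∈ s, |p i|⁻¹, by positivity, fun K CK hK hne Θ F hΘ hF x hx hreg y hyx hc1 => ?_⟩
  set ρ := S.size (y - x) with hρ
  have hρ0 : 0 < ρ := S.size_pos (sub_ne_zero.2 hyx)
  have hc : 0 < 2 * ρ ^ S.ℓ := mul_pos two_pos (Real.rpow_pos_of_pos hρ0 _)
  set M := C * CK * Θ * (u x)⁻¹ * S.phi x ^ (-a) with hM
  have hM0 : 0 ≤ M := by
    have := hK.CK_pos
    have := inv_pos.2 (h.pos x)
    have := Real.rpow_nonneg (S.phi_nonneg x) (-a)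
    positivity
  have he : ∀ i ∈ s, γ + β ≤ e i ∧ p i ≠ 0 := by
    intro i hi
    rcases i with _ | l
    · have h1 : e none = δ := rfl
      have h2 : e none ≠ γ + β := by rw [h1]; linarith
      refine ⟨by rw [h1]; linarith, ?_⟩
      simp only [p, if_neg h2, h1]
      exact div_ne_zero (by linarith) hℓ.ne'
    · rw [hs, Finset.some_mem_insertNone, Finset.mem_sdiff] at hi
      have h1 : e (some l) = S.wt (k + l) := rfl
      have h2 : γ + β ≤ e (some l) := by
        by_contra hcon
        refine hi.2 (S.mem_below.2 ?_)
        rw [h1, S.wt_add] at hcon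
        linarith
      refine ⟨h2, ?_⟩
      by_cases h3 : e (some l) = γ + β
      · simp only [p, if_pos h3]
        refine div_ne_zero ?_ hℓ.ne'
        rcases hne with h4 | h4
        · linarith
        · intro h5
          refine h4 (k + l) ?_
          rw [← h1, h3]; linarith
      · simp only [p, if_neg h3]
        exact div_ne_zero (sub_ne_zero.2 (Ne.symm h3)) hℓ.ne'
  have hpe : ∀ i, p i ≤ (βbar - e i + γ) / S.ℓ := by
    intro i
    simp only [p]
    split_ifs with h1
    · rw [h1]; exact le_of_eq (by ring)
    · exact div_le_div_of_nonneg_right (by linarith) hℓ.le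
  have hpow : ∀ i, ∀ r ∈ Ioc (2 * ρ ^ S.ℓ) 1, r ^ ((βbar - e i + γ) / S.ℓ - 1) ≤ r ^ (p i - 1) :=
    fun i r hr => Real.rpow_le_rpow_of_exponent_ge (hc.trans hr.1) hr.2 (by linarith [hpe i])
  have key := abs_setIntegral_upper_le_sum_powers s (c := 2 * ρ ^ S.ℓ)
    (g := fun r => kernelAt K k r y (F x) - ∑ l ∈ S.below (γ + β - S.wt k),
            mpow (y - x) l / mfact l * kernelAt K (k + l) r x (F x))
    (B := fun i => M * ρ ^ (e i - S.wt k)) (p := p)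
    (fun i _ => mul_nonneg hM0 (Real.rpow_nonneg hρ0.le _)) (fun i hi => (he i hi).2) hc hc1 ?_
  · refine key.trans ?_
    rw [show C * (∑ i ∈ s, |p i|⁻¹) * CK * Θ * (u x)⁻¹ * S.phi x ^ (-a) * ρ ^ (γ + β - S.wt k) =
      ∑ i ∈ s, M * ρ ^ (γ + β - S.wt k) * |p i|⁻¹ by rw [← Finset.mul_sum, hM]; ring]
    refine Finset.sum_le_sum fun i hi => ?_
    have h1 := he i hi
    have h2 : ρ ^ (e i - S.wt k) * (2 * ρ ^ S.ℓ) ^ min (p i) 0 ≤ ρ ^ (γ + β - S.wt k) := by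
      by_cases h3 : e i = γ + β
      · have : 0 ≤ p i := by
          simp only [p, if_pos h3]
          exact div_nonneg (by linarith) hℓ.le
        rw [min_eq_right this, Real.rpow_zero, mul_one, h3]
      · have h4 : p i = (γ + β - e i) / S.ℓ := by simp only [p, if_neg h3]
        have h5 : p i ≤ 0 := by
          rw [h4]; exact div_nonpos_of_nonpos_of_nonneg (by linarith [h1.1]) hℓ.le
        rw [min_eq_left h5, h4, two_mul_rpow_rpow hρ0.le, ← h4]
        have h6 : (2 : ℝ) ^ p i ≤ 1 := Real.rpow_le_one_of_one_le_of_nonpos (by norm_num) h5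
        have h7 : ρ ^ (e i - S.wt k) * ρ ^ (γ + β - e i) = ρ ^ (γ + β - S.wt k) := by
          rw [← Real.rpow_add hρ0]; congr 1; ring
        rw [← h7]
        have h8 := Real.rpow_nonneg hρ0.le (e i - S.wt k)
        have h9 := Real.rpow_nonneg hρ0.le (γ + β - e i)
        exact mul_le_mul_of_nonneg_left (mul_le_of_le_one_left h9 h6) h8
    calc _ = M * |p i|⁻¹ * (ρ ^ (e i - S.wt k) * (2 * ρ ^ S.ℓ) ^ min (p i) 0) := by ring
      _ ≤ M * |p i|⁻¹ * ρ ^ (γ + β - S.wt k) := mul_le_mul_of_nonneg_left h2 (by positivity)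
      _ = _ := by ring
  · intro r hr
    have hr1 : r ∈ Ioc (0 : ℝ) 1 := ⟨hc.trans hr.1, hr.2⟩
    have hsub : S.below (γ + β - S.wt k) ⊆ S.below (δ - S.wt k) := below_subset (by linarith)
    have e1 : kernelAt K k r y (F x) - ∑ l ∈ S.below (γ + β - S.wt k),
            mpow (y - x) l / mfact l * kernelAt K (k + l) r x (F x) =
        (kernelAt K k r y (F x) - ∑ l ∈ S.below (δ - S.wt k),
            mpow (y - x) l / mfact l * kernelAt K (k + l) r x (F x)) +
        ∑ l ∈ S.below (δ - S.wt k) \ S.below (γ + β - S.wt k),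
            mpow (y - x) l / mfact l * kernelAt K (k + l) r x (F x) := by
      rw [← Finset.sum_sdiff hsub]; ring
    rw [e1, hs, Finset.sum_insertNone]
    refine (abs_add_le _ _).trans (add_le_add ?_ ?_)
    · have h1 := (hC K CK hK Θ F hΘ hF x hx r hr1 k hk).2.2 hreg y (size_le_half_rpow hr.1.le)
      refine h1.trans ?_
      rw [← hM, mul_assoc M]
      refine mul_le_mul_of_nonneg_left ?_ hM0
      exact mul_le_mul_of_nonneg_left (hpow none r hr) (Real.rpow_nonneg hρ0.le _)
    · refine (Finset.abs_sum_le_sum_abs _ _).trans (Finset.sum_le_sum fun l hl => ?_)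
      have hl' : S.wt (k + l) < δ := by
        rw [S.wt_add]; linarith [S.mem_below.1 (Finset.mem_sdiff.1 hl).1]
      have h1 := (hC K CK hK Θ F hΘ hF x hx r hr1 (k + l) hl').2.1
      rw [abs_mul]
      have h2 := S.abs_mpow_div_le (y - x) l
      have h3 : e (some l) - S.wt k = S.wt l := by
        have : e (some l) = S.wt (k + l) := rfl
        rw [this, S.wt_add]; ring
      rw [h3]
      refine (mul_le_mul h2 h1 (abs_nonneg _) (Real.rpow_nonneg hρ0.le _)).trans ?_
      have h4 := hpow (some l) r hr
      have h5 := Real.rpow_nonneg hρ0.le (S.wt l)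
      calc _ = M * ρ ^ S.wt l * r ^ ((βbar - S.wt (k + l) + γ) / S.ℓ - 1) := by rw [hM]; ring
        _ ≤ _ := mul_le_mul_of_nonneg_left h4 (by positivity)

/-- `∂^k K(x, F_x)` converges. -/
theorem SchauderData.integrableOn_centre (h : S.SchauderData E γ a g P u) {βbar δ CK Θ : ℝ}
    {K : ℝ → Pt d → Pt d → ℝ} (hK : S.IsRegularizingKernel βbar δ CK K)
    {F : Pt d → ℝ → Pt d → ℝ} (hΘ : 0 ≤ Θ) (hF : S.OffCentreBound E γ a g P u Θ F) {x : Pt d}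
    (hx : x 0 ≠ 0) (hreg : S.KernelRegular δ K (F x)) {k : Fin d → ℕ} (hk : S.wt k < δ)
    (hkγ : S.wt k < γ + βbar) : IntegrableOn (fun r => kernelAt K k r x (F x)) (Ioc 0 1) := by
  obtain ⟨C, hC0, hC⟩ := h.exists_kernelAt_le βbar δ
  exact integrableOn_of_le_rpow (p := (βbar - S.wt k + γ) / S.ℓ)
    (div_pos (by linarith) S.ℓ_pos) (hreg k hk x).2
    fun r hr => (hC K CK hK Θ F hΘ hF x hx r hr k hk).2.1

/-- The small-scale part of `∂^k K(x, F_x)`. -/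
theorem SchauderData.exists_lower_centre_le (h : S.SchauderData E γ a g P u) {β βbar δ : ℝ}
    (hβ : β ≤ βbar) (hδ : γ + βbar < δ) (k : Fin d → ℕ) (hk : S.wt k < γ + β) :
    ∃ C : ℝ, 0 ≤ C ∧ ∀ (K : ℝ → Pt d → Pt d → ℝ) (CK : ℝ), S.IsRegularizingKernel βbar δ CK K →
      ∀ (Θ : ℝ) (F : Pt d → ℝ → Pt d → ℝ), 0 ≤ Θ → S.OffCentreBound E γ a g P u Θ F →
      ∀ x : Pt d, x 0 ≠ 0 → ∀ ρ : ℝ, 0 ≤ ρ →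
        |∫ r in Ioc 0 (min 1 (2 * ρ ^ S.ℓ)), kernelAt K k r x (F x)| ≤
        C * CK * Θ * (u x)⁻¹ * S.phi x ^ (-a) * ρ ^ (γ + β - S.wt k) := by
  obtain ⟨C, hC0, hC⟩ := h.exists_kernelAt_le βbar δ
  have hℓ := S.ℓ_pos
  have hp : 0 < (βbar - S.wt k + γ) / S.ℓ := div_pos (by linarith) hℓ
  refine ⟨C * (((βbar - S.wt k + γ) / S.ℓ)⁻¹ * 2 ^ ((γ + β - S.wt k) / S.ℓ)), by positivity,
    fun K CK hK Θ F hΘ hF x hx ρ hρ => ?_⟩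
  have hc : 0 ≤ min 1 (2 * ρ ^ S.ℓ) := le_min zero_le_one (by positivity)
  have h1 := abs_setIntegral_Ioc_zero_le hp hc fun r hr =>
    (hC K CK hK Θ F hΘ hF x hx r ⟨hr.1, hr.2.trans (min_le_left _ _)⟩ k (by linarith)).2.1
  refine h1.trans ?_
  have h2 : min 1 (2 * ρ ^ S.ℓ) ^ ((βbar - S.wt k + γ) / S.ℓ) ≤
      2 ^ ((γ + β - S.wt k) / S.ℓ) * ρ ^ (γ + β - S.wt k) := by
    rw [← two_mul_rpow_rpow hρ]
    calc _ ≤ min 1 (2 * ρ ^ S.ℓ) ^ ((γ + β - S.wt k) / S.ℓ) := by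
          refine Real.rpow_le_rpow_of_exponent_ge' hc (min_le_left _ _)
            (div_nonneg (by linarith) hℓ.le) (div_le_div_of_nonneg_right (by linarith) hℓ.le)
      _ ≤ _ := Real.rpow_le_rpow hc (min_le_right _ _) (div_nonneg (by linarith) hℓ.le)
  have h3 : 0 ≤ C * CK * Θ * (u x)⁻¹ * S.phi x ^ (-a) := by
    have := hK.CK_pos
    have := inv_pos.2 (h.pos x)
    have := Real.rpow_nonneg (S.phi_nonneg x) (-a)
    positivity
  calc _ ≤ C * CK * Θ * (u x)⁻¹ * S.phi x ^ (-a) * (((βbar - S.wt k + γ) / S.ℓ)⁻¹ *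
        (2 ^ ((γ + β - S.wt k) / S.ℓ) * ρ ^ (γ + β - S.wt k))) := by gcongr
    _ = _ := by ring

/-- The Taylor remainder of `K(·, F_x)` around `x`. -/
noncomputable def taylorRemainder (S : GSemigroup d) (K : ℝ → Pt d → Pt d → ℝ) (c : ℝ)
    (F : ℝ → Pt d → ℝ) (x y : Pt d) : ℝ :=
  kernelFun K F y - ∑ k ∈ S.below c, mpow (y - x) k / mfact k * kernelInt K k x F

/-- Below the cut-off the function and its Taylor coefficients are estimated separately, above it
their difference. The exponents γ+max(β,−α) are all at least γ+β. The value −α occurs where β+α < 0,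
so that the small-scale integral gains no power of ‖x−y‖ through the cut-off. -/
theorem SchauderData.exists_taylorRemainder_le (h : S.SchauderData E γ a g P u) {β βbar δ : ℝ}
    (hβ : β ≤ βbar) (hδ : γ + βbar < δ) (hδ0 : 0 < δ) (hE : ∀ α ∈ E, 0 < βbar + α)
    (hγβ : 0 ≤ γ + β) :
    ∃ C : ℝ, 0 ≤ C ∧ ∀ (K : ℝ → Pt d → Pt d → ℝ) (CK : ℝ), S.IsRegularizingKernel βbar δ CK K →
      (β < βbar ∨ ∀ k : Fin d → ℕ, γ + βbar ≠ S.wt k) →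
      ∀ (Θ : ℝ) (F : Pt d → ℝ → Pt d → ℝ), 0 ≤ Θ → S.OffCentreBound E γ a g P u Θ F →
      ∀ x : Pt d, x 0 ≠ 0 → S.KernelRegular δ K (F x) → ∀ y : Pt d, y 0 ≠ 0 → y ≠ x →
        |S.taylorRemainder K (γ + β) (F x) x y| ≤ C * CK * Θ * (P (x - y) * (u x)⁻¹) *
          (S.phi x ^ (-a) + S.phi y ^ (-a)) * ∑ α ∈ E, S.size (x - y) ^ (γ + max β (-α)) := by
  have hℓ := S.ℓ_pos
  have hk0 : S.wt 0 < δ := by rw [S.wt_zero]; exact hδ0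
  obtain ⟨C1, hC10, hC1⟩ := h.exists_kernelAt_le βbar δ
  obtain ⟨C2, hC20, hC2⟩ := h.exists_upper_le hβ hδ hk0
  have hlow : ∀ k, ∃ C : ℝ, 0 ≤ C ∧ (S.wt k < γ + β →
      ∀ (K : ℝ → Pt d → Pt d → ℝ) (CK : ℝ), S.IsRegularizingKernel βbar δ CK K →
      ∀ (Θ : ℝ) (F : Pt d → ℝ → Pt d → ℝ), 0 ≤ Θ → S.OffCentreBound E γ a g P u Θ F →
      ∀ x : Pt d, x 0 ≠ 0 → ∀ ρ : ℝ, 0 ≤ ρ →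
        |∫ r in Ioc 0 (min 1 (2 * ρ ^ S.ℓ)), kernelAt K k r x (F x)| ≤
        C * CK * Θ * (u x)⁻¹ * S.phi x ^ (-a) * ρ ^ (γ + β - S.wt k)) := by
    intro k
    by_cases hk : S.wt k < γ + β
    · obtain ⟨C, h0, h1⟩ := h.exists_lower_centre_le hβ hδ k hk
      exact ⟨C, h0, fun _ => h1⟩
    · exact ⟨0, le_rfl, fun h => absurd h hk⟩
  choose C3 hC30 hC3 using hlow
  set c3 := ∑ k ∈ S.below (γ + β), C3 k with hc3
  have hc30 : 0 ≤ c3 := Finset.sum_nonneg fun k _ => hC30 k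
  set c1 := ∑ α ∈ E, ((βbar + α) / S.ℓ)⁻¹ * 2 ^ (|β + α| / S.ℓ) with hc1
  have hpα : ∀ α ∈ E, 0 < (βbar + α) / S.ℓ := fun α hα => div_pos (hE α hα) hℓ
  have hc1t : ∀ α ∈ E, 0 ≤ ((βbar + α) / S.ℓ)⁻¹ * (2 : ℝ) ^ (|β + α| / S.ℓ) := fun α hα => by
    have := hpα α hα; positivity
  have hc10 : 0 ≤ c1 := Finset.sum_nonneg hc1t
  refine ⟨C1 * c1 + c3 + C2, by positivity, fun K CK hK hne Θ F hΘ hF x hx hreg y hy hyx => ?_⟩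
  set ρ := S.size (x - y) with hρ
  have hρ' : S.size (y - x) = ρ := S.size_sub_comm y x
  have hρ0 : 0 < ρ := S.size_pos (sub_ne_zero.2 hyx.symm)
  set c := min 1 (2 * ρ ^ S.ℓ) with hc
  have hcpos : 0 < c := lt_min one_pos (mul_pos two_pos (Real.rpow_pos_of_pos hρ0 _))
  have hcle : c ≤ 1 := min_le_left _ _
  set φs := S.phi x ^ (-a) + S.phi y ^ (-a) with hφs
  have hφx : 0 ≤ S.phi x ^ (-a) := Real.rpow_nonneg (S.phi_nonneg x) _
  have hφy : 0 ≤ S.phi y ^ (-a) := Real.rpow_nonneg (S.phi_nonneg y) _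
  have hP1 := h.one_le (x - y)
  have hux := inv_pos.2 (h.pos x)
  have hCK := hK.CK_pos
  set N := CK * Θ * (P (x - y) * (u x)⁻¹) * φs with hN
  have hN0 : 0 ≤ N := by positivity
  have hN1 : CK * Θ * (u x)⁻¹ * S.phi x ^ (-a) ≤ N := by
    have h1 : (u x)⁻¹ ≤ P (x - y) * (u x)⁻¹ := le_mul_of_one_le_left hux.le hP1
    have h2 : S.phi x ^ (-a) ≤ φs := by linarith
    calc _ = (CK * Θ * (u x)⁻¹) * S.phi x ^ (-a) := rfl
      _ ≤ (CK * Θ * (P (x - y) * (u x)⁻¹)) * φs := by gcongr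
      _ = _ := rfl
  set Y := ∑ α ∈ E, ρ ^ (γ + max β (-α)) with hY
  have hYt : ∀ α ∈ E, 0 ≤ ρ ^ (γ + max β (-α)) := fun α _ => Real.rpow_nonneg hρ0.le _
  have hYγ : ρ ^ (γ + β) ≤ Y := by
    have h1 := Finset.single_le_sum (f := fun α => ρ ^ (γ + max β (-α))) hYt h.mem
    rwa [max_eq_left (by linarith : -γ ≤ β)] at h1
  have hY0 : 0 ≤ Y := (Real.rpow_nonneg hρ0.le _).trans hYγ
  have hb1 : ∀ r ∈ Ioc (0 : ℝ) 1, |kernelAt K 0 r y (F x)| ≤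
      ∑ α ∈ E, (C1 * N * ρ ^ (γ - α)) * r ^ ((βbar + α) / S.ℓ - 1) := fun r hr => by
    have h1 := (hC1 K CK hK Θ F hΘ hF x hx r hr 0 hk0).1 y hy
    rw [S.wt_zero, sub_zero] at h1
    refine h1.trans (le_of_eq ?_)
    rw [Finset.mul_sum]
    exact Finset.sum_congr rfl fun α _ => by rw [hN]; ring
  have hI0 : IntegrableOn (fun r => kernelAt K 0 r y (F x)) (Ioc 0 1) :=
    integrableOn_of_le_sum_powers E hpα (hreg 0 hk0 y).2 hb1
  have hIk : ∀ k ∈ S.below (γ + β), IntegrableOn (fun r => kernelAt K k r x (F x)) (Ioc 0 1) :=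
    fun k hk => h.integrableOn_centre hK hΘ hF hx hreg
      (by linarith [S.mem_below.1 hk]) (by linarith [S.mem_below.1 hk])
  -- All the integrals over (0,1] converge absolutely, so each can be cut at c and the upper parts
  -- recombined under one integral.
  have hsplit : S.taylorRemainder K (γ + β) (F x) x y =
      (∫ r in Ioc 0 c, kernelAt K 0 r y (F x)) -
      (∑ k ∈ S.below (γ + β), mpow (y - x) k / mfact k * ∫ r in Ioc 0 c, kernelAt K k r x (F x)) +
      ∫ r in Ioc c 1, (kernelAt K 0 r y (F x) - ∑ k ∈ S.below (γ + β),
        mpow (y - x) k / mfact k * kernelAt K k r x (F x)) := by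
    have hsub : Ioc c 1 ⊆ Ioc 0 1 := Ioc_subset_Ioc_left hcpos.le
    have hI1 : ∀ k ∈ S.below (γ + β), IntegrableOn (fun r => mpow (y - x) k / mfact k *
        kernelAt K k r x (F x)) (Ioc c 1) := fun k hk =>
      ((hIk k hk).mono_set hsub).const_mul _
    rw [integral_sub (hI0.mono_set hsub) (integrable_finsetSum _ hI1), integral_finsetSum _ hI1]
    unfold taylorRemainder kernelFun kernelInt
    rw [setIntegral_Ioc_split hcpos.le hcle hI0]
    have : ∑ k ∈ S.below (γ + β), mpow (y - x) k / mfact k *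
        (∫ r in Ioc 0 1, kernelAt K k r x (F x)) =
        ∑ k ∈ S.below (γ + β), mpow (y - x) k / mfact k *
          (∫ r in Ioc 0 c, kernelAt K k r x (F x)) +
        ∑ k ∈ S.below (γ + β), ∫ r in Ioc c 1,
          mpow (y - x) k / mfact k * kernelAt K k r x (F x) := by
      rw [← Finset.sum_add_distrib]
      refine Finset.sum_congr rfl fun k hk => ?_
      rw [setIntegral_Ioc_split hcpos.le hcle (hIk k hk), integral_const_mul, mul_add]
    rw [this]
    ring
  have hA : |∫ r in Ioc 0 c, kernelAt K 0 r y (F x)| ≤ C1 * c1 * (N * Y) := by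
    have h1 := abs_setIntegral_le_sum_powers E hpα hcpos.le
      fun r hr => hb1 r ⟨hr.1, hr.2.trans hcle⟩
    refine h1.trans ?_
    rw [show C1 * c1 * (N * Y) = ∑ α ∈ E, C1 * N * ((((βbar + α) / S.ℓ)⁻¹ *
      2 ^ (|β + α| / S.ℓ)) * Y) by rw [← Finset.mul_sum, ← Finset.sum_mul, ← hc1]; ring]
    refine Finset.sum_le_sum fun α hα => ?_
    have h2 : ρ ^ (γ - α) * c ^ ((βbar + α) / S.ℓ) ≤ 2 ^ (|β + α| / S.ℓ) *
        ρ ^ (γ + max β (-α)) := by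
      have h20 : (1 : ℝ) ≤ 2 ^ (|β + α| / S.ℓ) :=
        Real.one_le_rpow (by norm_num) (div_nonneg (abs_nonneg _) hℓ.le)
      -- If β+α ≥ 0, the cut-off c ≤ 2ρ^ℓ contributes ρ^{β+α}. Otherwise c ≤ 1 suffices, since then
      -- γ−α is already at least γ+β.
      rcases le_total 0 (β + α) with h3 | h3
      · rw [max_eq_left (by linarith : -α ≤ β), abs_of_nonneg h3]
        have h4 : c ^ ((βbar + α) / S.ℓ) ≤ 2 ^ ((β + α) / S.ℓ) * ρ ^ (β + α) := by
          rw [← two_mul_rpow_rpow hρ0.le]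
          calc _ ≤ c ^ ((β + α) / S.ℓ) := Real.rpow_le_rpow_of_exponent_ge hcpos hcle
                (div_le_div_of_nonneg_right (by linarith) hℓ.le)
            _ ≤ _ := Real.rpow_le_rpow hcpos.le (min_le_right _ _) (div_nonneg h3 hℓ.le)
        have h5 : ρ ^ (γ - α) * ρ ^ (β + α) = ρ ^ (γ + β) := by
          rw [← Real.rpow_add hρ0]; congr 1; ring
        rw [← h5]
        calc _ ≤ ρ ^ (γ - α) * (2 ^ ((β + α) / S.ℓ) * ρ ^ (β + α)) :=
              mul_le_mul_of_nonneg_left h4 (Real.rpow_nonneg hρ0.le _)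
          _ = _ := by ring
      · rw [max_eq_right (by linarith : β ≤ -α), ← sub_eq_add_neg]
        have h4 : c ^ ((βbar + α) / S.ℓ) ≤ 1 := Real.rpow_le_one hcpos.le hcle (hpα α hα).le
        have h5 := Real.rpow_nonneg hρ0.le (γ - α)
        calc _ ≤ ρ ^ (γ - α) * 1 := mul_le_mul_of_nonneg_left h4 h5
          _ = 1 * ρ ^ (γ - α) := by ring
          _ ≤ _ := mul_le_mul_of_nonneg_right h20 h5
    have h6 := Finset.single_le_sum (f := fun α => ρ ^ (γ + max β (-α))) hYt hα
    have h7 := inv_pos.2 (hpα α hα)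
    calc _ = C1 * N * (((βbar + α) / S.ℓ)⁻¹ * (ρ ^ (γ - α) * c ^ ((βbar + α) / S.ℓ))) := by ring
      _ ≤ C1 * N * (((βbar + α) / S.ℓ)⁻¹ * (2 ^ (|β + α| / S.ℓ) * ρ ^ (γ + max β (-α)))) := by
          gcongr
      _ ≤ C1 * N * (((βbar + α) / S.ℓ)⁻¹ * (2 ^ (|β + α| / S.ℓ) * Y)) := by gcongr
      _ = _ := by ring
  have hB : |∑ k ∈ S.below (γ + β), mpow (y - x) k / mfact k *
      ∫ r in Ioc 0 c, kernelAt K k r x (F x)| ≤ c3 * (N * Y) := by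
    refine (Finset.abs_sum_le_sum_abs _ _).trans ?_
    rw [hc3, Finset.sum_mul]
    refine Finset.sum_le_sum fun k hk => ?_
    have h1 := hC3 k (S.mem_below.1 hk) K CK hK Θ F hΘ hF x hx ρ hρ0.le
    have h2 := S.abs_mpow_div_le (y - x) k
    rw [hρ'] at h2
    rw [abs_mul]
    refine (mul_le_mul h2 h1 (abs_nonneg _) (Real.rpow_nonneg hρ0.le _)).trans ?_
    have h3 : ρ ^ S.wt k * ρ ^ (γ + β - S.wt k) = ρ ^ (γ + β) := by
      rw [← Real.rpow_add hρ0]; congr 1; ring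
    calc _ = C3 k * ((CK * Θ * (u x)⁻¹ * S.phi x ^ (-a)) *
          (ρ ^ S.wt k * ρ ^ (γ + β - S.wt k))) := by ring
      _ ≤ C3 k * (N * Y) := by
          rw [h3]
          exact mul_le_mul_of_nonneg_left (mul_le_mul hN1 hYγ (Real.rpow_nonneg hρ0.le _) hN0)
            (hC30 k)
  have hD : |∫ r in Ioc c 1, (kernelAt K 0 r y (F x) - ∑ k ∈ S.below (γ + β),
        mpow (y - x) k / mfact k * kernelAt K k r x (F x))| ≤ C2 * (N * Y) := by
    -- If 2ρ^ℓ > 1, the cut-off is 1 and there are no large scales.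
    by_cases hc1 : 2 * ρ ^ S.ℓ ≤ 1
    · have h1 := hC2 K CK hK hne Θ F hΘ hF x hx hreg y hyx (by rw [hρ']; exact hc1)
      rw [hρ', S.wt_zero, sub_zero] at h1
      simp only [zero_add] at h1
      rw [hc, min_eq_right hc1]
      refine h1.trans ?_
      calc _ = C2 * ((CK * Θ * (u x)⁻¹ * S.phi x ^ (-a)) * ρ ^ (γ + β)) := by ring
        _ ≤ _ := mul_le_mul_of_nonneg_left (mul_le_mul hN1 hYγ (Real.rpow_nonneg hρ0.le _) hN0)
            hC20
    · rw [hc, min_eq_left (not_le.1 hc1).le, Ioc_self, setIntegral_empty, abs_zero]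
      positivity
  rw [hsplit]
  calc _ ≤ C1 * c1 * (N * Y) + c3 * (N * Y) + C2 * (N * Y) := by
        refine (abs_add_le _ _).trans (add_le_add ((abs_sub _ _).trans (add_le_add hA hB)) hD)
    _ = _ := by rw [hN]; ring

/-- The multilevel Schauder estimate for an abstract family of generalized functions. -/
theorem SchauderData.exists_bracket_le (h : S.SchauderData E γ a g P u) (hP : S.Controls P)
    {β βbar δ : ℝ} (hβ : β ≤ βbar) (hδ : γ + βbar < δ) (hE : ∀ α ∈ E, 0 < βbar + α) :
    ∃ C : ℝ, 0 ≤ C ∧ ∀ (K : ℝ → Pt d → Pt d → ℝ) (CK : ℝ), S.IsRegularizingKernel βbar δ CK K →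
      (β < βbar ∨ ∀ k : Fin d → ℕ, γ + βbar ≠ S.wt k) →
      ∀ (Θ : ℝ) (F : Pt d → ℝ → Pt d → ℝ), 0 ≤ Θ → S.OffCentreBound E γ a g P u Θ F →
      ∀ x : Pt d, x 0 ≠ 0 → S.KernelRegular δ K (F x) → ∀ t ∈ Ioc (0 : ℝ) 1,
        |∫ y, S.Q t x y * S.taylorRemainder K (γ + β) (F x) x y| ≤
          C * CK * Θ * (u x)⁻¹ * S.phi x ^ (-a) * t ^ ((γ + β) / S.ℓ) := by
  -- If γ+β < 0, the Taylor polynomial is empty, just as for β replaced by −γ. As −γ < β̄, the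
  -- estimate for −γ is available without a resonance condition, and its bound t^0 is at most
  -- t^{(γ+β)/ℓ}.
  wlog hγβ : 0 ≤ γ + β generalizing β
  · have h0 := hE γ h.mem
    obtain ⟨C, hC0, hC⟩ := this (β := -γ) (by linarith) (by linarith)
    refine ⟨C, hC0, fun K CK hK _ Θ F hΘ hF x hx hreg t ht => ?_⟩
    have h1 := hC K CK hK (Or.inl (by linarith)) Θ F hΘ hF x hx hreg t ht
    have e : ∀ y, S.taylorRemainder K (γ + β) (F x) x y =
        S.taylorRemainder K (γ + -γ) (F x) x y := fun y => by
      unfold taylorRemainder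
      rw [below_eq_empty (by linarith : γ + β ≤ 0), below_eq_empty (by linarith : γ + -γ ≤ 0)]
    simp only [e]
    refine h1.trans ?_
    have hCK := hK.CK_pos
    have hux := inv_pos.2 (h.pos x)
    have hφx : 0 ≤ S.phi x ^ (-a) := Real.rpow_nonneg (S.phi_nonneg x) _
    refine mul_le_mul_of_nonneg_left ?_ (by positivity)
    exact Real.rpow_le_rpow_of_exponent_ge ht.1 ht.2
      (div_le_div_of_nonneg_right (by linarith) S.ℓ_pos.le)
  have hδ0 : 0 < δ := by linarith
  obtain ⟨C, hC0, hC⟩ := h.exists_taylorRemainder_le hβ hδ hδ0 hE hγβ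
  obtain ⟨C₁, hC₁, hQ⟩ := S.Q_upper
  have hm : ∀ p : ℝ, ∃ C : ℝ, 0 ≤ C ∧ (0 ≤ p → ∀ t ∈ Ioc (0 : ℝ) 1, ∀ x : Pt d, x 0 ≠ 0 →
      ∀ b : ℝ, 0 ≤ b →
      Integrable (fun z => S.Gt t (x - z) * P (x - z) * S.size (x - z) ^ p *
        (b + S.phi x ^ (-a) + S.phi z ^ (-a))) ∧
      ∫ z, S.Gt t (x - z) * P (x - z) * S.size (x - z) ^ p *
        (b + S.phi x ^ (-a) + S.phi z ^ (-a)) ≤ C * t ^ (p / S.ℓ) * (b + S.phi x ^ (-a))) := by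
    intro p
    by_cases hp : 0 ≤ p
    · obtain ⟨C, h0, h'⟩ := hP.phi_moment hp h.a_nonneg h.a_lt
      exact ⟨C, h0, fun _ => h'⟩
    · exact ⟨0, le_rfl, fun h => absurd h hp⟩
  choose Cm hCm0 hCm using hm
  set cm := ∑ α ∈ E, Cm (γ + max β (-α)) with hcm
  have hcm0 : 0 ≤ cm := Finset.sum_nonneg fun _ _ => hCm0 _
  refine ⟨C * C₁ * cm, by positivity, fun K CK hK hne Θ F hΘ hF x hx hreg t ht => ?_⟩
  have hCK := hK.CK_pos
  have hux := inv_pos.2 (h.pos x)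
  have hφx : 0 ≤ S.phi x ^ (-a) := Real.rpow_nonneg (S.phi_nonneg x) _
  have hexp : ∀ α ∈ E, γ + β ≤ γ + max β (-α) := fun α _ => by
    have := le_max_left β (-α); linarith
  let D : ℝ → Pt d → ℝ := fun α y => (C₁ * (C * CK * Θ * (u x)⁻¹)) *
    (S.Gt t (x - y) * P (x - y) * S.size (x - y) ^ (γ + max β (-α)) *
      (0 + S.phi x ^ (-a) + S.phi y ^ (-a)))
  have hDI : ∀ α ∈ E, Integrable (D α) := fun α hα =>
    ((hCm _ (hγβ.trans (hexp α hα)) t ht x hx 0 le_rfl).1).const_mul _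
  have hle : ∀ᵐ y, ‖S.Q t x y * S.taylorRemainder K (γ + β) (F x) x y‖ ≤ ∑ α ∈ E, D α y := by
    -- The remainder estimate needs y ≠ x and y_1 ≠ 0; both exceptional sets are null.
    have hne' : ∀ᵐ y : Pt d, y ≠ x := by
      have : Nonempty (Fin d) := ⟨0⟩
      rw [ae_iff]; simp
    filter_upwards [ae_ne_zero (d := d), hne'] with y hy hyx
    have h1 := hC K CK hK hne Θ F hΘ hF x hx hreg y hy hyx
    have h2 := hQ t ht.1 x y
    rw [Real.norm_eq_abs, abs_mul]
    refine (mul_le_mul h2 h1 (abs_nonneg _) (mul_nonneg hC₁.le (S.Gt_nonneg ht.1 _))).trans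
      (le_of_eq ?_)
    rw [Finset.mul_sum, Finset.mul_sum]
    refine Finset.sum_congr rfl fun α _ => ?_
    have : rescale S.s S.ℓ S.G t (x - y) = S.Gt t (x - y) := rfl
    simp only [D, this, zero_add]
    ring
  have h1 := norm_integral_le_of_norm_le (integrable_finsetSum E hDI) hle
  rw [Real.norm_eq_abs, integral_finsetSum E hDI] at h1
  refine h1.trans ?_
  rw [show C * C₁ * cm * CK * Θ * (u x)⁻¹ * S.phi x ^ (-a) * t ^ ((γ + β) / S.ℓ) =
    ∑ α ∈ E, (C₁ * (C * CK * Θ * (u x)⁻¹)) * (Cm (γ + max β (-α)) * t ^ ((γ + β) / S.ℓ) *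
      S.phi x ^ (-a)) by
    rw [← Finset.mul_sum, ← Finset.sum_mul, ← Finset.sum_mul, ← hcm]; ring]
  refine Finset.sum_le_sum fun α hα => ?_
  simp only [D]
  rw [integral_const_mul]
  refine mul_le_mul_of_nonneg_left ?_ (by positivity)
  refine ((hCm _ (hγβ.trans (hexp α hα)) t ht x hx 0 le_rfl).2).trans ?_
  rw [zero_add]
  refine mul_le_mul_of_nonneg_right (mul_le_mul_of_nonneg_left ?_ (hCm0 _)) hφx
  exact Real.rpow_le_rpow_of_exponent_ge ht.1 ht.2
      (div_le_div_of_nonneg_right (hexp α hα) S.ℓ_pos.le)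

end Schauder

end GSemigroup

/-! ### Seminorms as pointwise bounds -/

namespace RegularityStructure

variable {A : Set ℝ} {𝒯 : RegularityStructure.{u₁} A} {d : ℕ} {S : GSemigroup d} {W : Weight d}

/-- The pointwise form of `‖Π‖_{γ,w} ≤ N`. -/
def PiBound (𝒯 : RegularityStructure.{u₁} A) (S : GSemigroup d) (W : Weight d) (γ : ℝ)
    (P : Pt d → 𝒯.Sp → ℝ → Pt d → ℝ) (N : ℝ) : Prop :=
  ∀ α ∈ A, α < γ → ∀ t ∈ Ioc (0 : ℝ) 1, ∀ (x : Pt d) (τ : 𝒯.T α),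
    W.w x * |P x (DFinsupp.single α τ) t x| ≤ N * t ^ (α / S.ℓ) * ‖τ‖

/-- The pointwise form of `‖Γ‖_{γ,w} ≤ N`. -/
def GamBound (𝒯 : RegularityStructure.{u₁} A) (S : GSemigroup d) (W : Weight d) (γ : ℝ)
    (Γ : Pt d → Pt d → 𝒯.Sp → 𝒯.Sp) (N : ℝ) : Prop :=
  ∀ α ∈ A, ∀ β ∈ A, β < α → α < γ → ∀ (x y : Pt d) (τ : 𝒯.T α),
    W.w x * ‖Γ y x (DFinsupp.single α τ) β‖ ≤
      N * (W.star (y - x) * S.size (y - x) ^ (α - β) * ‖τ‖)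

theorem piNorm_le {γ N : ℝ} {P : Pt d → 𝒯.Sp → ℝ → Pt d → ℝ}
    (h : 𝒯.PiBound S W γ P N) : 𝒯.piNorm S W γ P ≤ ENNReal.ofReal N := by
  unfold piNorm
  simp only [iSup_le_iff]
  intro α hα hαγ t ht x τ hτ
  refine ENNReal.ofReal_le_ofReal ?_
  have h1 := h α hα hαγ t ht x τ
  have h2 : 0 < ‖τ‖ := norm_pos_iff.2 hτ
  have h3 := Real.rpow_pos_of_pos ht.1 (α / S.ℓ)
  rw [neg_div, Real.rpow_neg ht.1.le]
  calc _ = (W.w x * |P x (DFinsupp.single α τ) t x|) / (t ^ (α / S.ℓ) * ‖τ‖) := by field_simp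
    _ ≤ N := by rw [div_le_iff₀ (by positivity), ← mul_assoc]; exact h1

theorem piBound_of_le {γ N : ℝ} {P : Pt d → 𝒯.Sp → ℝ → Pt d → ℝ} (hN : 0 ≤ N)
    (hP : ∀ x t y, P x 0 t y = 0) (h : 𝒯.piNorm S W γ P ≤ ENNReal.ofReal N) :
    𝒯.PiBound S W γ P N := by
  intro α hα hαγ t ht x τ
  by_cases hτ : τ = 0
  · subst hτ
    simp [hP]
  · unfold piNorm at h
    simp only [iSup_le_iff] at h
    have h1 := (ENNReal.ofReal_le_ofReal_iff hN).1 (h α hα hαγ t ht x τ hτ)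
    have h2 : 0 < ‖τ‖ := norm_pos_iff.2 hτ
    have h3 := Real.rpow_pos_of_pos ht.1 (α / S.ℓ)
    rw [neg_div, Real.rpow_neg ht.1.le] at h1
    calc _ = ((t ^ (α / S.ℓ))⁻¹ * W.w x * (|P x (DFinsupp.single α τ) t x| / ‖τ‖)) *
          (t ^ (α / S.ℓ) * ‖τ‖) := by field_simp
      _ ≤ N * (t ^ (α / S.ℓ) * ‖τ‖) := mul_le_mul_of_nonneg_right h1 (by positivity)
      _ = _ := by ring

theorem gammaNorm_le {γ N : ℝ} {Γ : Pt d → Pt d → 𝒯.Sp → 𝒯.Sp} (hW : S.IsGControlled W)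
    (h : 𝒯.GamBound S W γ Γ N) : 𝒯.gammaNorm S W γ Γ ≤ ENNReal.ofReal N := by
  unfold gammaNorm
  simp only [iSup_le_iff]
  intro α hα β hβ hβα hαγ x y hxy τ hτ
  refine ENNReal.ofReal_le_ofReal ?_
  have h2 : 0 < ‖τ‖ := norm_pos_iff.2 hτ
  have h3 : 0 < S.size (y - x) ^ (α - β) :=
    Real.rpow_pos_of_pos (S.size_pos (sub_ne_zero.2 hxy.symm)) _
  have h4 : 0 < W.star (y - x) := zero_lt_one.trans_le (hW.one_le_star _)
  rw [div_le_iff₀ (by positivity)]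
  exact h α hα β hβ hβα hαγ x y τ

/-- The supremum omits τ = 0 and x = y. On the diagonal the right-hand side of the pointwise bound
vanishes, so vanishing of the off-diagonal components there has to be supplied separately. -/
theorem gamBound_of_le {γ N : ℝ} {Γ : Pt d → Pt d → 𝒯.Sp → 𝒯.Sp} (hW : S.IsGControlled W)
    (hN : 0 ≤ N) (hΓ0 : ∀ x y, Γ y x 0 = 0)
    (hΓ : ∀ α β, β < α → ∀ x (τ : 𝒯.T α), Γ x x (DFinsupp.single α τ) β = 0)
    (h : 𝒯.gammaNorm S W γ Γ ≤ ENNReal.ofReal N) : 𝒯.GamBound S W γ Γ N := by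
  intro α hα β hβ hβα hαγ x y τ
  have h4 : 0 < W.star (y - x) := zero_lt_one.trans_le (hW.one_le_star _)
  have h5 := Real.rpow_nonneg (S.size_nonneg (y - x)) (α - β)
  have h0 : 0 ≤ N * (W.star (y - x) * S.size (y - x) ^ (α - β) * ‖τ‖) := by positivity
  by_cases hτ : τ = 0
  · subst hτ
    simp [hΓ0]
  by_cases hxy : x = y
  · subst hxy
    rw [hΓ α β hβα, norm_zero, mul_zero]
    exact h0
  · unfold gammaNorm at h
    simp only [iSup_le_iff] at h
    have h1 := (ENNReal.ofReal_le_ofReal_iff hN).1 (h α hα β hβ hβα hαγ x y hxy τ hτ)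
    have h2 : 0 < ‖τ‖ := norm_pos_iff.2 hτ
    have h3 : 0 < S.size (y - x) ^ (α - β) :=
      Real.rpow_pos_of_pos (S.size_pos (sub_ne_zero.2 (Ne.symm hxy))) _
    rwa [div_le_iff₀ (by positivity)] at h1

section Singular

variable [NeZero d] {V : Weight d}

/-- The pointwise form of `⦇f⦈_{γ,η,v} ≤ N`. -/
def GrowthBound (𝒯 : RegularityStructure.{u₁} A) (S : GSemigroup d) (V : Weight d) (γ η : ℝ)
    (f : Pt d → 𝒯.Sp) (N : ℝ) : Prop :=
  ∀ α < γ, ∀ x : Pt d, x 0 ≠ 0 → V.w x * ‖f x α‖ ≤ N * S.phi x ^ min (η - α) 0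

/-- The pointwise form of `‖D‖^#_{γ,η,v} ≤ N`. -/
def SharpBound (𝒯 : RegularityStructure.{u₁} A) (S : GSemigroup d) (V : Weight d) (γ η : ℝ)
    (D : Pt d → Pt d → 𝒯.Sp) (N : ℝ) : Prop :=
  ∀ α < γ, ∀ x y : Pt d, x 0 ≠ 0 → y 0 ≠ 0 → V.w x * ‖D y x α‖ ≤
    N * (min (S.phi x) (S.phi y) ^ (η - γ) * V.star (x - y) * S.size (y - x) ^ (γ - α))

theorem growthNorm_le_iff {γ η N : ℝ} {f : Pt d → 𝒯.Sp} (hN : 0 ≤ N) :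
    𝒯.growthNorm S V γ η f ≤ ENNReal.ofReal N ↔ 𝒯.GrowthBound S V γ η f N := by
  unfold growthNorm GrowthBound
  simp only [iSup_le_iff, ENNReal.ofReal_le_ofReal_iff hN]
  refine forall₄_congr fun α _ x hx => ?_
  rw [div_le_iff₀ (Real.rpow_pos_of_pos (S.phi_pos hx) _)]

theorem sharpNorm_le {γ η N : ℝ} {D : Pt d → Pt d → 𝒯.Sp} (hV : S.IsGControlled V)
    (h : 𝒯.SharpBound S V γ η D N) : 𝒯.sharpNorm S V γ η D ≤ ENNReal.ofReal N := by
  unfold sharpNorm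
  simp only [iSup_le_iff]
  intro α hα x hx y hy hxy
  refine ENNReal.ofReal_le_ofReal ?_
  have h1 := Real.rpow_pos_of_pos (lt_min (S.phi_pos hx) (S.phi_pos hy)) (η - γ)
  have h3 : 0 < S.size (y - x) ^ (γ - α) :=
    Real.rpow_pos_of_pos (S.size_pos (sub_ne_zero.2 hxy.symm)) _
  have h4 : 0 < V.star (x - y) := zero_lt_one.trans_le (hV.one_le_star _)
  rw [div_le_iff₀ (by positivity)]
  exact h α hα x y hx hy

/-- The omitted diagonal x = y is covered by the vanishing of D there. -/
theorem sharpBound_of_le {γ η N : ℝ} {D : Pt d → Pt d → 𝒯.Sp} (hV : S.IsGControlled V)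
    (hN : 0 ≤ N) (hD : ∀ x, D x x = 0) (h : 𝒯.sharpNorm S V γ η D ≤ ENNReal.ofReal N) :
    𝒯.SharpBound S V γ η D N := by
  intro α hα x y hx hy
  have h1 := Real.rpow_pos_of_pos (lt_min (S.phi_pos hx) (S.phi_pos hy)) (η - γ)
  have h4 : 0 < V.star (x - y) := zero_lt_one.trans_le (hV.one_le_star _)
  by_cases hxy : x = y
  · subst hxy
    have := Real.rpow_nonneg (S.size_nonneg (x - x)) (γ - α)
    rw [hD, DFinsupp.zero_apply, norm_zero, mul_zero]
    positivity
  · unfold sharpNorm at h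
    simp only [iSup_le_iff, ENNReal.ofReal_le_ofReal_iff hN] at h
    have h3 : 0 < S.size (y - x) ^ (γ - α) :=
      Real.rpow_pos_of_pos (S.size_pos (sub_ne_zero.2 (Ne.symm hxy))) _
    have h5 := h α hα x hx y hy hxy
    rwa [div_le_iff₀ (by positivity)] at h5

end Singular

end RegularityStructure

/-- The pointwise form of a bound on `bracketNorm`. -/
theorem GSemigroup.bracketNorm_le_iff {d : ℕ} [NeZero d] {S : GSemigroup d} {U : Weight d}
    {γ η N : ℝ} {F : Pt d → ℝ → Pt d → ℝ} (hN : 0 ≤ N) :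
    S.bracketNorm U γ η F ≤ ENNReal.ofReal N ↔
      ∀ t ∈ Ioc (0 : ℝ) 1, ∀ x : Pt d, x 0 ≠ 0 →
        U.w x * |F x t x| ≤ N * t ^ (γ / S.ℓ) * S.phi x ^ (-(γ - η)) := by
  unfold GSemigroup.bracketNorm
  simp only [iSup_le_iff, ENNReal.ofReal_le_ofReal_iff hN]
  refine forall₄_congr fun t ht x hx => ?_
  have h1 := Real.rpow_pos_of_pos ht.1 (γ / S.ℓ)
  have h2 := Real.rpow_pos_of_pos (S.phi_pos hx) (γ - η)
  rw [neg_div, Real.rpow_neg ht.1.le, Real.rpow_neg (S.phi_nonneg x)]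
  have e1 : (t ^ (γ / S.ℓ))⁻¹ * S.phi x ^ (γ - η) * U.w x * |F x t x| =
      (U.w x * |F x t x|) / (t ^ (γ / S.ℓ) * (S.phi x ^ (γ - η))⁻¹) := by field_simp
  rw [e1, div_le_iff₀ (by positivity), mul_assoc]

namespace RegularityStructure

variable {A : Set ℝ} {𝒯 : RegularityStructure.{u₁} A}

/-- The finite set of indices below `γ`. -/
noncomputable def idx (𝒯 : RegularityStructure.{u₁} A) (γ : ℝ) : Finset ℝ :=
  (𝒯.finite_lt γ).toFinset

theorem mem_idx {γ α : ℝ} : α ∈ 𝒯.idx γ ↔ α ∈ A ∧ α < γ := by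
  simp [idx]

theorem apply_eq_zero {α : ℝ} (hα : α ∉ A) (τ : 𝒯.T α) : τ = 0 :=
  (𝒯.subsingleton α hα).elim _ _

theorem sum_single_apply (s : Finset ℝ) (τ : ∀ α, 𝒯.T α) (β : ℝ) :
    (∑ α ∈ s, (DFinsupp.single α (τ α) : 𝒯.Sp)) β = if β ∈ s then τ β else 0 := by
  rw [DFinsupp.finsetSum_apply]
  split_ifs with h
  · rw [Finset.sum_eq_single_of_mem β h, DFinsupp.single_eq_same]
    intro b _ hb
    exact DFinsupp.single_eq_of_ne (Ne.symm hb)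
  · refine Finset.sum_eq_zero fun b hb => DFinsupp.single_eq_of_ne fun h' => h (h' ▸ hb)

theorem Below.eq_sum {γ : ℝ} {τ : 𝒯.Sp} (h : 𝒯.Below γ τ) :
    τ = ∑ α ∈ 𝒯.idx γ, DFinsupp.single α (τ α) := by
  ext β
  rw [sum_single_apply]
  split_ifs with hβ
  · rfl
  · rw [mem_idx, not_and_or, not_lt] at hβ
    rcases hβ with h1 | h1
    · exact apply_eq_zero h1 _
    · exact h β h1

theorem Below.sub {γ : ℝ} {τ σ : 𝒯.Sp} (h : 𝒯.Below γ τ) (h' : 𝒯.Below γ σ) :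
    𝒯.Below γ (τ - σ) := fun α hα => by
  rw [DFinsupp.sub_apply, h α hα, h' α hα, sub_zero]

theorem Below.mono {γ γ' : ℝ} {τ : 𝒯.Sp} (h : 𝒯.Below γ τ) (hγ : γ ≤ γ') : 𝒯.Below γ' τ :=
  fun α hα => h α (hγ.trans hα)

theorem below_single {α γ : ℝ} (h : α < γ) (τ : 𝒯.T α) : 𝒯.Below γ (DFinsupp.single α τ) :=
  fun β hβ => DFinsupp.single_eq_of_ne fun h' => absurd h' (by linarith [h, hβ] : α < β).ne'

theorem below_zero (γ : ℝ) : 𝒯.Below γ (0 : 𝒯.Sp) := fun _ _ => rfl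

namespace Model

variable {d : ℕ} {S : GSemigroup d} {W : Weight d}

theorem Gam_single_of_le (M : 𝒯.Model S W) (x y : Pt d) {α β : ℝ} (τ : 𝒯.T α) (h : α ≤ β) :
    M.Gam x y (DFinsupp.single α τ) β = DFinsupp.single (β := 𝒯.T) α τ β := by
  have := M.Gam_triangular x y α τ β h
  rwa [DFinsupp.sub_apply, sub_eq_zero] at this

theorem Gam_single_of_lt (M : 𝒯.Model S W) (x y : Pt d) {α β : ℝ} (τ : 𝒯.T α) (h : α < β) :
    M.Gam x y (DFinsupp.single α τ) β = 0 := by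
  rw [M.Gam_single_of_le x y τ h.le]
  exact DFinsupp.single_eq_of_ne h.ne'

theorem below_Gam (M : 𝒯.Model S W) (x y : Pt d) {γ : ℝ} {τ : 𝒯.Sp} (h : 𝒯.Below γ τ) :
    𝒯.Below γ (M.Gam x y τ) := by
  intro β hβ
  rw [h.eq_sum, map_sum, DFinsupp.finsetSum_apply]
  refine Finset.sum_eq_zero fun α hα => ?_
  exact M.Gam_single_of_lt x y _ (by linarith [(mem_idx.1 hα).2])

/-- Finiteness passes to the completion: compare with a smooth model at distance 1. -/
theorem exists_piBound (M : 𝒯.Model S W) (hW : S.IsGControlled W) (γ : ℝ) :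
    ∃ N : ℝ, 0 ≤ N ∧ 𝒯.PiBound S W γ (fun x τ => M.Pi x τ) N := by
  obtain ⟨N, hN⟩ := M.approx γ 1 one_pos
  have h1 := piBound_of_le (P := fun x τ => M.Pi x τ - S.ofFun (N.Pi x τ)) zero_le_one
    (fun x t y => by simp [GSemigroup.ofFun]) (le_trans (le_add_right le_rfl) hN)
  have h2 := piBound_of_le (P := fun x τ => S.ofFun (N.Pi x τ)) ENNReal.toReal_nonneg
    (fun x t y => by simp [GSemigroup.ofFun]) (ENNReal.ofReal_toReal (N.piNorm_lt γ).ne).ge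
  set B := (𝒯.piNorm S W γ fun x τ => S.ofFun (N.Pi x τ)).toReal
  refine ⟨1 + B, add_nonneg zero_le_one ENNReal.toReal_nonneg, fun α hα hαγ t ht x τ => ?_⟩
  have h3 := h1 α hα hαγ t ht x τ
  have h4 := h2 α hα hαγ t ht x τ
  have hw := (hW.w_pos x).le
  simp only [Pi.sub_apply] at h3
  have h5 : |M.Pi x (DFinsupp.single α τ) t x| ≤
      |M.Pi x (DFinsupp.single α τ) t x - S.ofFun (N.Pi x (DFinsupp.single α τ)) t x| +
        |S.ofFun (N.Pi x (DFinsupp.single α τ)) t x| := by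
    have := abs_add_le (M.Pi x (DFinsupp.single α τ) t x -
      S.ofFun (N.Pi x (DFinsupp.single α τ)) t x) (S.ofFun (N.Pi x (DFinsupp.single α τ)) t x)
    rwa [sub_add_cancel] at this
  have := mul_le_mul_of_nonneg_left h5 hw
  linarith

theorem exists_gamBound (M : 𝒯.Model S W) (hW : S.IsGControlled W) (γ : ℝ) :
    ∃ N : ℝ, 0 ≤ N ∧ 𝒯.GamBound S W γ (fun x y τ => M.Gam x y τ) N := by
  obtain ⟨N, hN⟩ := M.approx γ 1 one_pos
  have h1 := gamBound_of_le (Γ := fun x y τ => M.Gam x y τ - N.Gam x y τ) hW zero_le_one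
    (fun x y => by simp) (fun α β hβα x τ => by rw [M.Gam_self, N.Gam_self, sub_self]; rfl)
    (le_trans (le_add_left le_rfl) hN)
  have h2 := gamBound_of_le (Γ := fun x y τ => N.Gam x y τ) hW ENNReal.toReal_nonneg
    (fun x y => by simp) (fun α β hβα x τ => by
      rw [N.Gam_self]; exact DFinsupp.single_eq_of_ne hβα.ne)
    (ENNReal.ofReal_toReal (N.gammaNorm_lt γ).ne).ge
  set B := (𝒯.gammaNorm S W γ fun x y τ => N.Gam x y τ).toReal
  refine ⟨1 + B, add_nonneg zero_le_one ENNReal.toReal_nonneg,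
    fun α hα β hβ hβα hαγ x y τ => ?_⟩
  have h3 := h1 α hα β hβ hβα hαγ x y τ
  have h4 := h2 α hα β hβ hβα hαγ x y τ
  have hw := (hW.w_pos x).le
  simp only [DFinsupp.sub_apply] at h3
  have h5 : ‖M.Gam y x (DFinsupp.single α τ) β‖ ≤
      ‖M.Gam y x (DFinsupp.single α τ) β - N.Gam y x (DFinsupp.single α τ) β‖ +
        ‖N.Gam y x (DFinsupp.single α τ) β‖ := by
    have := norm_add_le (M.Gam y x (DFinsupp.single α τ) β - N.Gam y x (DFinsupp.single α τ) β)
      (N.Gam y x (DFinsupp.single α τ) β)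
    rwa [sub_add_cancel] at this
  have := mul_le_mul_of_nonneg_left h5 hw
  linarith

theorem normPi_lt (M : 𝒯.Model S W) (hW : S.IsGControlled W) (γ : ℝ) : M.normPi γ < ⊤ := by
  obtain ⟨N, -, hN⟩ := M.exists_piBound hW γ
  exact (piNorm_le hN).trans_lt ENNReal.ofReal_lt_top

theorem normGam_lt (M : 𝒯.Model S W) (hW : S.IsGControlled W) (γ : ℝ) : M.normGam γ < ⊤ := by
  obtain ⟨N, -, hN⟩ := M.exists_gamBound hW γ
  exact (gammaNorm_le hW hN).trans_lt ENNReal.ofReal_lt_top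

theorem piBound_of_normPi_le (M : 𝒯.Model S W) {γ N : ℝ} (hN : 0 ≤ N)
    (h : M.normPi γ ≤ ENNReal.ofReal N) : 𝒯.PiBound S W γ (fun x τ => M.Pi x τ) N :=
  piBound_of_le hN (fun x t y => by simp) h

theorem gamBound_of_normGam_le (M : 𝒯.Model S W) (hW : S.IsGControlled W) {γ N : ℝ} (hN : 0 ≤ N)
    (h : M.normGam γ ≤ ENNReal.ofReal N) : 𝒯.GamBound S W γ (fun x y τ => M.Gam x y τ) N :=
  gamBound_of_le hW hN (fun x y => by simp) (fun α β hβα x τ => by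
    rw [M.Gam_self]; exact DFinsupp.single_eq_of_ne hβα.ne) h

/-! ### Comparison of two models away from the base point -/

section Pair

variable {M₁ M₂ : 𝒯.Model S W} {γ N₁ N₁₂ : ℝ}

/-- Comparison of `Π¹_z σ₁` and `Π²_z σ₂` at the base point. -/
theorem abs_Pi_sub_le (hW : S.IsGControlled W)
    (h₁ : 𝒯.PiBound S W γ (fun x τ => M₁.Pi x τ) N₁)
    (h₁₂ : 𝒯.PiBound S W γ (fun x τ => M₁.Pi x τ - M₂.Pi x τ) N₁₂)
    {σ₁ σ₂ : 𝒯.Sp} (hσ₁ : 𝒯.Below γ σ₁) (hσ₂ : 𝒯.Below γ σ₂) {r : ℝ} (hr : r ∈ Ioc (0 : ℝ) 1)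
    (z : Pt d) :
    W.w z * |M₁.Pi z σ₁ r z - M₂.Pi z σ₂ r z| ≤
      ∑ α ∈ 𝒯.idx γ, r ^ (α / S.ℓ) * (N₁ * ‖(σ₁ - σ₂) α‖ + N₁₂ * ‖σ₂ α‖) := by
  -- Telescoping: Π¹σ₁ − Π²σ₂ = Π¹(σ₁−σ₂) + (Π¹−Π²)σ₂, in each homogeneous component.
  have e : M₁.Pi z σ₁ r z - M₂.Pi z σ₂ r z = ∑ α ∈ 𝒯.idx γ,
      (M₁.Pi z (DFinsupp.single α ((σ₁ - σ₂) α)) r z +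
        (M₁.Pi z (DFinsupp.single α (σ₂ α)) - M₂.Pi z (DFinsupp.single α (σ₂ α))) r z) := by
    have e1 : M₁.Pi z σ₁ r z - M₂.Pi z σ₂ r z =
        M₁.Pi z (σ₁ - σ₂) r z + (M₁.Pi z σ₂ r z - M₂.Pi z σ₂ r z) := by
      rw [map_sub]; simp only [Pi.sub_apply]; ring
    have q : ∀ (M : 𝒯.Model S W) {σ : 𝒯.Sp}, 𝒯.Below γ σ → M.Pi z σ r z =
        ∑ α ∈ 𝒯.idx γ, M.Pi z (DFinsupp.single α (σ α)) r z := fun M σ hσ => by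
      conv_lhs => rw [hσ.eq_sum]
      simp only [map_sum, Finset.sum_apply]
    rw [e1, q M₁ (hσ₁.sub hσ₂), q M₁ hσ₂, q M₂ hσ₂, ← Finset.sum_sub_distrib,
      ← Finset.sum_add_distrib]
    rfl
  have hw := (hW.w_pos z).le
  rw [e]
  refine (mul_le_mul_of_nonneg_left (Finset.abs_sum_le_sum_abs _ _) hw).trans ?_
  rw [Finset.mul_sum]
  refine Finset.sum_le_sum fun α hα => ?_
  obtain ⟨hαA, hαγ⟩ := mem_idx.1 hα
  have a1 := h₁ α hαA hαγ r hr z ((σ₁ - σ₂) α)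
  have a2 := h₁₂ α hαA hαγ r hr z (σ₂ α)
  have a3 := mul_le_mul_of_nonneg_left (abs_add_le (M₁.Pi z (DFinsupp.single α ((σ₁ - σ₂) α)) r z)
    ((M₁.Pi z (DFinsupp.single α (σ₂ α)) - M₂.Pi z (DFinsupp.single α (σ₂ α))) r z)) hw
  refine a3.trans ?_
  rw [mul_add]
  refine (add_le_add a1 a2).trans (le_of_eq (by ring))

/-- Comparison of `Γ¹_{zy} σ₁` and `Γ²_{zy} σ₂`. -/
theorem norm_Gam_sub_le (hW : S.IsGControlled W) {L₁ L₁₂ : ℝ}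
    (hL₁ : 0 ≤ L₁) (hL₁₂ : 0 ≤ L₁₂)
    (h₁ : 𝒯.GamBound S W γ (fun x y τ => M₁.Gam x y τ) L₁)
    (h₁₂ : 𝒯.GamBound S W γ (fun x y τ => M₁.Gam x y τ - M₂.Gam x y τ) L₁₂)
    {σ₁ σ₂ : 𝒯.Sp} (hσ₁ : 𝒯.Below γ σ₁) (hσ₂ : 𝒯.Below γ σ₂) (y z : Pt d) {β : ℝ}
    (hβ : β ∈ 𝒯.idx γ) :
    W.w y * ‖(M₁.Gam z y σ₁ - M₂.Gam z y σ₂) β‖ ≤ W.star (z - y) *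
      ∑ α ∈ (𝒯.idx γ).filter (fun α => β ≤ α), S.size (z - y) ^ (α - β) *
        ((1 + L₁) * ‖(σ₁ - σ₂) α‖ + L₁₂ * ‖σ₂ α‖) := by
  obtain ⟨hβA, hβγ⟩ := mem_idx.1 hβ
  have hw := (hW.w_pos y).le
  have e : (M₁.Gam z y σ₁ - M₂.Gam z y σ₂) β = ∑ α ∈ (𝒯.idx γ).filter (fun α => β ≤ α),
      (M₁.Gam z y (DFinsupp.single α ((σ₁ - σ₂) α)) β +
        (M₁.Gam z y (DFinsupp.single α (σ₂ α)) - M₂.Gam z y (DFinsupp.single α (σ₂ α))) β) := by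
    rw [Finset.sum_filter_of_ne]
    · have e1 : M₁.Gam z y σ₁ - M₂.Gam z y σ₂ =
          M₁.Gam z y (σ₁ - σ₂) + (M₁.Gam z y σ₂ - M₂.Gam z y σ₂) := by
        rw [map_sub]; abel
      have q : ∀ (M : 𝒯.Model S W) {σ : 𝒯.Sp}, 𝒯.Below γ σ → M.Gam z y σ β =
          ∑ α ∈ 𝒯.idx γ, M.Gam z y (DFinsupp.single α (σ α)) β := fun M σ hσ => by
        conv_lhs => rw [hσ.eq_sum]
        simp only [map_sum, DFinsupp.finsetSum_apply]
      rw [e1, DFinsupp.add_apply, DFinsupp.sub_apply (M₁.Gam z y σ₂), q M₁ (hσ₁.sub hσ₂),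
        q M₁ hσ₂, q M₂ hσ₂, ← Finset.sum_sub_distrib, ← Finset.sum_add_distrib]
      rfl
    · intro α hα hne
      by_contra hcon
      have hlt := not_le.1 hcon
      refine hne ?_
      rw [DFinsupp.sub_apply (M₁.Gam z y _), M₁.Gam_single_of_lt z y ((σ₁ - σ₂) α) hlt,
        M₁.Gam_single_of_lt z y (σ₂ α) hlt, M₂.Gam_single_of_lt z y _ hlt, sub_self, add_zero]
  rw [e]
  refine (mul_le_mul_of_nonneg_left (norm_sum_le _ _) hw).trans ?_
  rw [Finset.mul_sum, Finset.mul_sum]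
  refine Finset.sum_le_sum fun α hα => ?_
  obtain ⟨hα1, hβα⟩ := Finset.mem_filter.1 hα
  obtain ⟨hαA, hαγ⟩ := mem_idx.1 hα1
  have hst := hW.one_le_star (z - y)
  refine (mul_le_mul_of_nonneg_left (norm_add_le _ _) hw).trans ?_
  rcases hβα.eq_or_lt with h | h
  -- In the component of the same degree both Γ's act as the identity. Their difference drops out,
  -- and the remaining σ₁−σ₂ accounts for the 1 in 1+L₁.
  · subst h
    rw [DFinsupp.sub_apply (M₁.Gam z y _), M₁.Gam_single_of_le z y ((σ₁ - σ₂) β) le_rfl,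
      M₁.Gam_single_of_le z y (σ₂ β) le_rfl, M₂.Gam_single_of_le z y _ le_rfl, sub_self, norm_zero, add_zero, sub_self, Real.rpow_zero,
      one_mul, DFinsupp.single_eq_same]
    have hw1 := hW.w_le_one y
    have n1 := norm_nonneg ((σ₁ - σ₂) β)
    have n2 := norm_nonneg (σ₂ β)
    calc _ ≤ 1 * ‖(σ₁ - σ₂) β‖ := mul_le_mul_of_nonneg_right hw1 n1
      _ ≤ 1 * ((1 + L₁) * ‖(σ₁ - σ₂) β‖ + L₁₂ * ‖σ₂ β‖) := by
        have : 0 ≤ L₁ * ‖(σ₁ - σ₂) β‖ + L₁₂ * ‖σ₂ β‖ := by positivity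
        linarith
      _ ≤ _ := mul_le_mul_of_nonneg_right hst (by positivity)
  · have a1 := h₁ α hαA β hβA h hαγ y z ((σ₁ - σ₂) α)
    have a2 := h₁₂ α hαA β hβA h hαγ y z (σ₂ α)
    rw [mul_add]
    refine (add_le_add a1 a2).trans ?_
    have n3 : 0 ≤ W.star (z - y) * (S.size (z - y) ^ (α - β) * ‖(σ₁ - σ₂) α‖) := by
      have := Real.rpow_nonneg (S.size_nonneg (z - y)) (α - β)
      positivity
    calc _ ≤ L₁ * (W.star (z - y) * S.size (z - y) ^ (α - β) * ‖(σ₁ - σ₂) α‖) +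
          L₁₂ * (W.star (z - y) * S.size (z - y) ^ (α - β) * ‖σ₂ α‖) +
          W.star (z - y) * (S.size (z - y) ^ (α - β) * ‖(σ₁ - σ₂) α‖) := by linarith
      _ = _ := by ring

/-- Comparison of `Π¹_y σ₁` and `Π²_y σ₂` at a point `z` away from the base point. -/
theorem abs_Pi_sub_offCentre_le (hW : S.IsGControlled W) {L₁ L₂ L₁₂ : ℝ}
    (hN₁ : 0 ≤ N₁) (hN₁₂ : 0 ≤ N₁₂) (hL₁ : 0 ≤ L₁) (hL₂ : 0 ≤ L₂) (hL₁₂ : 0 ≤ L₁₂)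
    (h₁ : 𝒯.PiBound S W γ (fun x τ => M₁.Pi x τ) N₁)
    (h₁₂ : 𝒯.PiBound S W γ (fun x τ => M₁.Pi x τ - M₂.Pi x τ) N₁₂)
    (hΓ₁ : 𝒯.GamBound S W γ (fun x y τ => M₁.Gam x y τ) L₁)
    (hΓ₂ : 𝒯.GamBound S W γ (fun x y τ => M₂.Gam x y τ) L₂)
    (hΓ₁₂ : 𝒯.GamBound S W γ (fun x y τ => M₁.Gam x y τ - M₂.Gam x y τ) L₁₂)
    {σ₁ σ₂ : 𝒯.Sp} (hσ₁ : 𝒯.Below γ σ₁) (hσ₂ : 𝒯.Below γ σ₂) {r : ℝ} (hr : r ∈ Ioc (0 : ℝ) 1)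
    (y z : Pt d) :
    W.w z * W.w y * |M₁.Pi y σ₁ r z - M₂.Pi y σ₂ r z| ≤ W.star (z - y) *
      ∑ p ∈ (𝒯.idx γ ×ˢ 𝒯.idx γ).filter (fun p => p.2 ≤ p.1),
        r ^ (p.2 / S.ℓ) * S.size (z - y) ^ (p.1 - p.2) *
          (N₁ * ((1 + L₁) * ‖(σ₁ - σ₂) p.1‖ + L₁₂ * ‖σ₂ p.1‖) +
            N₁₂ * ((1 + L₂) * ‖σ₂ p.1‖)) := by
  -- Recentring Π_y = Π_z Γ_{zy} brings the evaluation back to the base point, where the seminorm of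
  -- Π applies.
  rw [← M₁.Pi_Gam z y σ₁ r hr z, ← M₂.Pi_Gam z y σ₂ r hr z]
  have b1 := abs_Pi_sub_le hW h₁ h₁₂ (M₁.below_Gam z y hσ₁) (M₂.below_Gam z y hσ₂) hr z
  have hwy := (hW.w_pos y).le
  have b2 := mul_le_mul_of_nonneg_left b1 hwy
  rw [show W.w z * W.w y * |M₁.Pi z (M₁.Gam z y σ₁) r z - M₂.Pi z (M₂.Gam z y σ₂) r z| =
    W.w y * (W.w z * |M₁.Pi z (M₁.Gam z y σ₁) r z - M₂.Pi z (M₂.Gam z y σ₂) r z|) by ring]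
  refine b2.trans ?_
  rw [Finset.sum_filter, Finset.sum_product_right, Finset.mul_sum, Finset.mul_sum]
  refine Finset.sum_le_sum fun β hβ => ?_
  have c1 := norm_Gam_sub_le hW hL₁ hL₁₂ hΓ₁ hΓ₁₂ hσ₁ hσ₂ y z hβ
  -- The comparison of the second model with itself, at σ₂ against 0, yields the plain bound on
  -- Γ²σ₂.
  have hΓ0 : 𝒯.GamBound S W γ (fun x y τ => M₂.Gam x y τ - M₂.Gam x y τ) 0 := by
    intro α _ β' _ _ _ x' y' τ
    simp
  have c2 := norm_Gam_sub_le hW hL₂ le_rfl hΓ₂ hΓ0 hσ₂ (below_zero (𝒯 := 𝒯) γ) y z hβ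
  simp only [map_zero, sub_zero, zero_mul, add_zero] at c2
  have hr0 := Real.rpow_nonneg hr.1.le (β / S.ℓ)
  calc W.w y * (r ^ (β / S.ℓ) * (N₁ * ‖(M₁.Gam z y σ₁ - M₂.Gam z y σ₂) β‖ +
        N₁₂ * ‖M₂.Gam z y σ₂ β‖))
      = r ^ (β / S.ℓ) * (N₁ * (W.w y * ‖(M₁.Gam z y σ₁ - M₂.Gam z y σ₂) β‖) +
        N₁₂ * (W.w y * ‖M₂.Gam z y σ₂ β‖)) := by ring
    _ ≤ r ^ (β / S.ℓ) * (N₁ * _ + N₁₂ * _) :=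
      mul_le_mul_of_nonneg_left (add_le_add (mul_le_mul_of_nonneg_left c1 hN₁)
        (mul_le_mul_of_nonneg_left c2 hN₁₂)) hr0
    _ = _ := by
      rw [← Finset.sum_filter]
      simp only [Finset.mul_sum]
      rw [← Finset.sum_add_distrib, Finset.mul_sum]
      exact Finset.sum_congr rfl fun α _ => by ring

end Pair

end Model

end RegularityStructure

/-! ### Products and reflections of controlled weights. -/

namespace GSemigroup

variable {d : ℕ} {S : GSemigroup d}

theorem Controls.const_mul {g : Pt d → ℝ} (hg : S.Controls g) {c : ℝ} (hc : 0 ≤ c) :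
    S.Controls (fun x => c * g x) := by
  refine ⟨continuous_const.mul hg.1, fun x => mul_nonneg hc (hg.2.1 x), fun n => ?_⟩
  obtain ⟨B, hB⟩ := hg.2.2 n
  refine ⟨c * B, fun t ht ht1 x => ?_⟩
  have h1 := mul_le_mul_of_nonneg_left (hB t ht ht1 x) hc
  linarith

variable {W V : Weight d}

theorem star_mul (W V : Weight d) (x : Pt d) : (W * V).star x = W.star x * V.star x := rfl

theorem w_mul (W V : Weight d) (x : Pt d) : (W * V).w x = W.w x * V.w x := rfl

/-- A product of weights is controlled if a larger product is. -/
theorem IsGControlled.mul_of_le (hW : S.IsGControlled W) (hV : S.IsGControlled V) {U : Weight d}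
    (hU : S.IsGControlled U) (h : ∀ x, (W * V).star x ≤ U.star x) : S.IsGControlled (W * V) := by
  refine ⟨hW.1.mul hV.1, fun x => ⟨mul_pos (hW.w_pos x) (hV.w_pos x),
    mul_le_one₀ (hW.w_le_one x) (hV.w_pos x).le (hV.w_le_one x)⟩, hW.2.2.1.mul hV.2.2.1,
    fun x => one_le_mul_of_one_le_of_one_le (hW.one_le_star x) (hV.one_le_star x),
    fun x y => ?_, fun n T hT => ?_⟩
  · rw [w_mul, w_mul, star_mul, mul_mul_mul_comm]
    exact mul_le_mul (hW.2.2.2.2.1 x y) (hV.2.2.2.2.1 x y) (hV.w_pos _).le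
      (mul_nonneg (zero_le_one.trans (hW.one_le_star x)) (hW.w_pos _).le)
  · obtain ⟨B, hB⟩ := hU.2.2.2.2.2 n T hT
    refine ⟨B, fun t ht htT x => le_trans ?_ (hB t ht htT x)⟩
    have := pow_nonneg (S.size_nonneg x) n
    have := S.G_nonneg x
    gcongr
    exact h _

theorem IsGControlled.mul_of_mul_mul (hW : S.IsGControlled W) (hV : S.IsGControlled V)
    (hWWV : S.IsGControlled (W * W * V)) : S.IsGControlled (W * V) :=
  hW.mul_of_le hV hWWV fun x => by
    rw [star_mul, star_mul, star_mul, mul_assoc]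
    exact le_mul_of_one_le_left (mul_nonneg (zero_le_one.trans (hW.one_le_star x))
      (zero_le_one.trans (hV.one_le_star x))) (hW.one_le_star x)

/-- The controlling function of a weight with auxiliary weights can be reflected. -/
theorem exists_star_neg_le {W₁ : Weight d} (hW₁ : S.IsGControlled W₁) {B : ℝ}
    (hB : ∀ x, W.star x * W₁.w x ≤ B) : ∃ B' : ℝ, 0 ≤ B' ∧ ∀ x, W.star (-x) ≤ B' * W₁.star x := by
  have h0 := hW₁.w_pos 0
  refine ⟨|B| * (W₁.w 0)⁻¹, by positivity, fun x => ?_⟩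
  -- The bound on w*w₁ gives w*(−x) ≤ B/w₁(−x), and comparison with the origin gives 1/w₁(−x) ≤
  -- w₁*(x)/w₁(0).
  have h1 := hW₁.inv_le 0 (-x)
  rw [sub_neg_eq_add, zero_add] at h1
  have h2 := (hB (-x)).trans (le_abs_self B)
  have h3 := hW₁.w_pos (-x)
  calc W.star (-x) = (W.star (-x) * W₁.w (-x)) * (W₁.w (-x))⁻¹ := by field_simp
    _ ≤ |B| * (W₁.star x * (W₁.w 0)⁻¹) := by gcongr
    _ = _ := by ring

/-! ### Off-centre bounds for remainders -/

/-- The sum over pairs of indices which occurs in `OffCentreBound`. -/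
noncomputable def pairSum (S : GSemigroup d) (E : Finset ℝ) (γ r : ℝ) (x y z : Pt d) : ℝ :=
  ∑ p ∈ (E ×ˢ E).filter (fun p => p.2 ≤ p.1),
    r ^ (p.2 / S.ℓ) * S.size (y - z) ^ (p.1 - p.2) * S.size (x - y) ^ (γ - p.1)

theorem pair_term_nonneg {γ r : ℝ} (hr : 0 < r) (x y z : Pt d) (p : ℝ × ℝ) :
    0 ≤ r ^ (p.2 / S.ℓ) * S.size (y - z) ^ (p.1 - p.2) * S.size (x - y) ^ (γ - p.1) := by
  have := Real.rpow_nonneg (S.size_nonneg (y - z)) (p.1 - p.2)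
  have := Real.rpow_nonneg (S.size_nonneg (x - y)) (γ - p.1)
  have := Real.rpow_nonneg hr.le (p.2 / S.ℓ)
  positivity

/-- A selection α ↦ (e(α)₁, α) is injective, so the single sum is a subsum of nonnegative terms. The
selections (γ,α) and (α,α) retain only ‖y−z‖, respectively only ‖x−y‖ up to a power zero. -/
theorem sum_le_pairSum {E E₀ : Finset ℝ} {γ r : ℝ} (hr : 0 < r) (x y z : Pt d) (e : ℝ → ℝ × ℝ)
    (he : ∀ α, (e α).2 = α) (hmem : ∀ α ∈ E₀, α ∈ E ∧ (e α).1 ∈ E ∧ α ≤ (e α).1) :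
    ∑ α ∈ E₀, r ^ (α / S.ℓ) * S.size (y - z) ^ ((e α).1 - α) * S.size (x - y) ^ (γ - (e α).1) ≤
      S.pairSum E γ r x y z := by
  have hinj : Set.InjOn e E₀ := fun a _ b _ hab => by rw [← he a, hab, he b]
  have h1 : ∑ α ∈ E₀, r ^ (α / S.ℓ) * S.size (y - z) ^ ((e α).1 - α) *
      S.size (x - y) ^ (γ - (e α).1) = ∑ p ∈ E₀.image e, r ^ (p.2 / S.ℓ) *
        S.size (y - z) ^ (p.1 - p.2) * S.size (x - y) ^ (γ - p.1) := by
    rw [Finset.sum_image hinj]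
    simp only [he]
  rw [h1]
  refine Finset.sum_le_sum_of_subset_of_nonneg (fun p hp => ?_)
    fun p _ _ => pair_term_nonneg hr x y z p
  obtain ⟨α, hα, rfl⟩ := Finset.mem_image.1 hp
  obtain ⟨h2, h3, h4⟩ := hmem α hα
  rw [Finset.mem_filter, Finset.mem_product, he]
  exact ⟨⟨h3, h2⟩, h4⟩

theorem min_phi_rpow_le [NeZero d] (x y : Pt d) (c : ℝ) :
    min (S.phi x) (S.phi y) ^ c ≤ S.phi x ^ c + S.phi y ^ c := by
  have h1 := Real.rpow_nonneg (S.phi_nonneg x) c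
  have h2 := Real.rpow_nonneg (S.phi_nonneg y) c
  rcases le_total (S.phi x) (S.phi y) with h | h
  · rw [min_eq_left h]; linarith
  · rw [min_eq_right h]; linarith

end GSemigroup

namespace RegularityStructure.Model

variable {A : Set ℝ} {𝒯 : RegularityStructure.{u₁} A} {d : ℕ} [NeZero d] {S : GSemigroup d}
  {W V : Weight d}

theorem below_incr (M : 𝒯.Model S W) {γ : ℝ} {f : Pt d → 𝒯.Sp} (y x : Pt d)
    (hy : 𝒯.Below γ (f y)) (hx : 𝒯.Below γ (f x)) : 𝒯.Below γ (M.incr f y x) :=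
  hy.sub (M.below_Gam y x hx)

theorem incr_self (M : 𝒯.Model S W) (f : Pt d → 𝒯.Sp) (x : Pt d) : M.incr f x x = 0 := by
  rw [incr, M.Gam_self, sub_self]

/-- Λ drops out of Λ_x − Λ_z, and Π_x = Π_z Γ_{zx} leaves Π_z applied to an increment of f. So the
increments of f govern the change of base point. -/
theorem remainder_sub_remainder (M : 𝒯.Model S W) (f : Pt d → 𝒯.Sp) (Λ : ℝ → Pt d → ℝ)
    (x z y : Pt d) {r : ℝ} (hr : r ∈ Ioc (0 : ℝ) 1) :
    M.remainder f Λ x r y - M.remainder f Λ z r y = M.Pi z (M.incr f z x) r y := by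
  simp only [remainder, incr, map_sub, Pi.sub_apply, M.Pi_Gam z x (f x) r hr y]
  ring

/-- Bounds on a pair of models with modelled distributions and reconstructions. -/
structure PairBounds (M₁ M₂ : 𝒯.Model S W) (V : Weight d) (γ η : ℝ) (f₁ f₂ : Pt d → 𝒯.Sp)
    (Λ₁ Λ₂ : ℝ → Pt d → ℝ) (Nb Nd N₂ N₁ N₁₂ L₁ L₂ L₁₂ : ℝ) : Prop where
  Nb_nonneg : 0 ≤ Nb
  Nd_nonneg : 0 ≤ Nd
  N₂_nonneg : 0 ≤ N₂
  N₁_nonneg : 0 ≤ N₁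
  N₁₂_nonneg : 0 ≤ N₁₂
  L₁_nonneg : 0 ≤ L₁
  L₂_nonneg : 0 ≤ L₂
  L₁₂_nonneg : 0 ≤ L₁₂
  below₁ : ∀ x, x 0 ≠ 0 → 𝒯.Below γ (f₁ x)
  below₂ : ∀ x, x 0 ≠ 0 → 𝒯.Below γ (f₂ x)
  bracket : ∀ t ∈ Ioc (0 : ℝ) 1, ∀ x : Pt d, x 0 ≠ 0 →
    (W * V).w x * |(M₁.remainder f₁ Λ₁ x - M₂.remainder f₂ Λ₂ x) t x| ≤
      Nb * t ^ (γ / S.ℓ) * S.phi x ^ (-(γ - η))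
  sharp₁₂ : 𝒯.SharpBound S V γ η (fun y x => M₁.incr f₁ y x - M₂.incr f₂ y x) Nd
  sharp₂ : 𝒯.SharpBound S V γ η (M₂.incr f₂) N₂
  pi₁ : 𝒯.PiBound S W γ (fun x τ => M₁.Pi x τ) N₁
  pi₁₂ : 𝒯.PiBound S W γ (fun x τ => M₁.Pi x τ - M₂.Pi x τ) N₁₂
  gam₁ : 𝒯.GamBound S W γ (fun x y τ => M₁.Gam x y τ) L₁
  gam₂ : 𝒯.GamBound S W γ (fun x y τ => M₂.Gam x y τ) L₂
  gam₁₂ : 𝒯.GamBound S W γ (fun x y τ => M₁.Gam x y τ - M₂.Gam x y τ) L₁₂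

variable {M₁ M₂ : 𝒯.Model S W} {γ η : ℝ} {f₁ f₂ : Pt d → 𝒯.Sp} {Λ₁ Λ₂ : ℝ → Pt d → ℝ}
  {Nb Nd N₂ N₁ N₁₂ L₁ L₂ L₁₂ : ℝ}

namespace PairBounds

theorem sub_apply_eq {x z : Pt d} (y : Pt d) {r : ℝ} (hr : r ∈ Ioc (0 : ℝ) 1) :
    (M₁.remainder f₁ Λ₁ x - M₂.remainder f₂ Λ₂ x) r y =
      (M₁.remainder f₁ Λ₁ z - M₂.remainder f₂ Λ₂ z) r y +
        (M₁.Pi z (M₁.incr f₁ z x) r y - M₂.Pi z (M₂.incr f₂ z x) r y) := by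
  rw [← M₁.remainder_sub_remainder f₁ Λ₁ x z y hr, ← M₂.remainder_sub_remainder f₂ Λ₂ x z y hr]
  simp only [Pi.sub_apply]
  ring

/-- The recentred remainder at its new base point. -/
theorem centre_le (h : PairBounds M₁ M₂ V γ η f₁ f₂ Λ₁ Λ₂ Nb Nd N₂ N₁ N₁₂ L₁ L₂ L₁₂)
    (hW : S.IsGControlled W) (hV : S.IsGControlled V) {y z : Pt d} (hy : y 0 ≠ 0) (hz : z 0 ≠ 0)
    {r : ℝ} (hr : r ∈ Ioc (0 : ℝ) 1) :
    |M₁.Pi z (M₁.incr f₁ z y) r z - M₂.Pi z (M₂.incr f₂ z y) r z| ≤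
      (N₁ * Nd + N₁₂ * N₂) * ((W.w z)⁻¹ * (V.w y)⁻¹ * V.star (y - z)) *
        (S.phi y ^ (-(γ - η)) + S.phi z ^ (-(γ - η))) *
        ∑ α ∈ 𝒯.idx γ, r ^ (α / S.ℓ) * S.size (y - z) ^ (γ - α) := by
  have h1 := abs_Pi_sub_le hW h.pi₁ h.pi₁₂ (M₁.below_incr z y (h.below₁ z hz) (h.below₁ y hy))
    (M₂.below_incr z y (h.below₂ z hz) (h.below₂ y hy)) hr z
  have hwz := hW.w_pos z
  have hvy := hV.w_pos y
  have hN₁ := h.N₁_nonneg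
  have hN₁₂ := h.N₁₂_nonneg
  have hmin := S.min_phi_rpow_le y z (-(γ - η))
  have hφ := add_nonneg (Real.rpow_nonneg (S.phi_nonneg y) (-(γ - η)))
    (Real.rpow_nonneg (S.phi_nonneg z) (-(γ - η)))
  have hst := zero_le_one.trans (hV.one_le_star (y - z))
  set φ := S.phi y ^ (-(γ - η)) + S.phi z ^ (-(γ - η))
  have h2 : W.w z * V.w y * |M₁.Pi z (M₁.incr f₁ z y) r z - M₂.Pi z (M₂.incr f₂ z y) r z| ≤
      ∑ α ∈ 𝒯.idx γ, r ^ (α / S.ℓ) * ((N₁ * Nd + N₁₂ * N₂) * (φ * V.star (y - z) *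
        S.size (y - z) ^ (γ - α))) := by
    have h3 := mul_le_mul_of_nonneg_left h1 hvy.le
    rw [Finset.mul_sum] at h3
    rw [mul_comm (W.w z), mul_assoc]
    refine h3.trans (Finset.sum_le_sum fun α hα => ?_)
    have hα' := (mem_idx.1 hα).2
    have b1 := h.sharp₁₂ α hα' y z hy hz
    have b2 := h.sharp₂ α hα' y z hy hz
    rw [S.size_sub_comm z y, show η - γ = -(γ - η) by ring] at b1 b2
    have hsz := Real.rpow_nonneg (S.size_nonneg (y - z)) (γ - α)
    have hr0 := Real.rpow_nonneg hr.1.le (α / S.ℓ)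
    have b3 : min (S.phi y) (S.phi z) ^ (-(γ - η)) * V.star (y - z) * S.size (y - z) ^ (γ - α) ≤
        φ * V.star (y - z) * S.size (y - z) ^ (γ - α) := by gcongr
    have b1' := b1.trans (mul_le_mul_of_nonneg_left b3 h.Nd_nonneg)
    have b2' := b2.trans (mul_le_mul_of_nonneg_left b3 h.N₂_nonneg)
    calc _ = r ^ (α / S.ℓ) * (N₁ * (V.w y * ‖(M₁.incr f₁ z y - M₂.incr f₂ z y) α‖) +
          N₁₂ * (V.w y * ‖M₂.incr f₂ z y α‖)) := by ring
      _ ≤ r ^ (α / S.ℓ) * (N₁ * (Nd * (φ * V.star (y - z) * S.size (y - z) ^ (γ - α))) +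
          N₁₂ * (N₂ * (φ * V.star (y - z) * S.size (y - z) ^ (γ - α)))) := by gcongr
      _ = _ := by ring
  calc _ = (W.w z)⁻¹ * (V.w y)⁻¹ * (W.w z * V.w y *
        |M₁.Pi z (M₁.incr f₁ z y) r z - M₂.Pi z (M₂.incr f₂ z y) r z|) := by field_simp
    _ ≤ (W.w z)⁻¹ * (V.w y)⁻¹ * _ := mul_le_mul_of_nonneg_left h2 (by positivity)
    _ = _ := by
      rw [Finset.mul_sum, Finset.mul_sum]
      exact Finset.sum_congr rfl fun α _ => by ring

/-- The recentred remainder away from its new base point. -/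
theorem offCentre_le (h : PairBounds M₁ M₂ V γ η f₁ f₂ Λ₁ Λ₂ Nb Nd N₂ N₁ N₁₂ L₁ L₂ L₁₂)
    (hW : S.IsGControlled W) (hV : S.IsGControlled V) {x y : Pt d} (z : Pt d) (hx : x 0 ≠ 0)
    (hy : y 0 ≠ 0) {r : ℝ} (hr : r ∈ Ioc (0 : ℝ) 1) :
    |M₁.Pi y (M₁.incr f₁ y x) r z - M₂.Pi y (M₂.incr f₂ y x) r z| ≤
      (N₁ * ((1 + L₁) * Nd + L₁₂ * N₂) + N₁₂ * ((1 + L₂) * N₂)) *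
        ((W.w z)⁻¹ * (W.w y)⁻¹ * (V.w x)⁻¹ * W.star (z - y) * V.star (x - y)) *
        (S.phi x ^ (-(γ - η)) + S.phi y ^ (-(γ - η))) *
        ∑ p ∈ (𝒯.idx γ ×ˢ 𝒯.idx γ).filter (fun p => p.2 ≤ p.1),
          r ^ (p.2 / S.ℓ) * S.size (y - z) ^ (p.1 - p.2) * S.size (x - y) ^ (γ - p.1) := by
  have h1 := abs_Pi_sub_offCentre_le hW h.N₁_nonneg h.N₁₂_nonneg h.L₁_nonneg h.L₂_nonneg
    h.L₁₂_nonneg h.pi₁ h.pi₁₂ h.gam₁ h.gam₂ h.gam₁₂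
    (M₁.below_incr y x (h.below₁ y hy) (h.below₁ x hx))
    (M₂.below_incr y x (h.below₂ y hy) (h.below₂ x hx)) hr y z
  have hwz := hW.w_pos z
  have hwy := hW.w_pos y
  have hvx := hV.w_pos x
  have hN₁ := h.N₁_nonneg
  have hN₁₂ := h.N₁₂_nonneg
  have hL₁ := h.L₁_nonneg
  have hL₂ := h.L₂_nonneg
  have hL₁₂ := h.L₁₂_nonneg
  have hmin := S.min_phi_rpow_le x y (-(γ - η))
  have hφ := add_nonneg (Real.rpow_nonneg (S.phi_nonneg x) (-(γ - η)))
    (Real.rpow_nonneg (S.phi_nonneg y) (-(γ - η)))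
  have hst := zero_le_one.trans (hV.one_le_star (x - y))
  have hsw := zero_le_one.trans (hW.one_le_star (z - y))
  set φ := S.phi x ^ (-(γ - η)) + S.phi y ^ (-(γ - η))
  set Θ := N₁ * ((1 + L₁) * Nd + L₁₂ * N₂) + N₁₂ * ((1 + L₂) * N₂) with hΘ
  have h2 : W.w z * W.w y * V.w x *
      |M₁.Pi y (M₁.incr f₁ y x) r z - M₂.Pi y (M₂.incr f₂ y x) r z| ≤
      W.star (z - y) * ∑ p ∈ (𝒯.idx γ ×ˢ 𝒯.idx γ).filter (fun p => p.2 ≤ p.1),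
        r ^ (p.2 / S.ℓ) * S.size (y - z) ^ (p.1 - p.2) *
          (Θ * (φ * V.star (x - y) * S.size (x - y) ^ (γ - p.1))) := by
    have h3 := mul_le_mul_of_nonneg_left h1 hvx.le
    rw [show W.w z * W.w y * V.w x *
      |M₁.Pi y (M₁.incr f₁ y x) r z - M₂.Pi y (M₂.incr f₂ y x) r z| = V.w x * (W.w z * W.w y *
      |M₁.Pi y (M₁.incr f₁ y x) r z - M₂.Pi y (M₂.incr f₂ y x) r z|) by ring]
    refine h3.trans ?_
    rw [mul_left_comm, Finset.mul_sum]
    refine mul_le_mul_of_nonneg_left (Finset.sum_le_sum fun p hp => ?_) hsw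
    have hp1 := (mem_idx.1 (Finset.mem_product.1 (Finset.mem_filter.1 hp).1).1).2
    have b1 := h.sharp₁₂ p.1 hp1 x y hx hy
    have b2 := h.sharp₂ p.1 hp1 x y hx hy
    rw [S.size_sub_comm y x, show η - γ = -(γ - η) by ring] at b1 b2
    have hsz := Real.rpow_nonneg (S.size_nonneg (x - y)) (γ - p.1)
    have hsz' := Real.rpow_nonneg (S.size_nonneg (y - z)) (p.1 - p.2)
    have hr0 := Real.rpow_nonneg hr.1.le (p.2 / S.ℓ)
    have b3 : min (S.phi x) (S.phi y) ^ (-(γ - η)) * V.star (x - y) * S.size (x - y) ^ (γ - p.1) ≤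
        φ * V.star (x - y) * S.size (x - y) ^ (γ - p.1) := by gcongr
    have b1' := b1.trans (mul_le_mul_of_nonneg_left b3 h.Nd_nonneg)
    have b2' := b2.trans (mul_le_mul_of_nonneg_left b3 h.N₂_nonneg)
    rw [S.size_sub_comm z y]
    set X := φ * V.star (x - y) * S.size (x - y) ^ (γ - p.1)
    calc _ = r ^ (p.2 / S.ℓ) * S.size (y - z) ^ (p.1 - p.2) *
          (N₁ * ((1 + L₁) * (V.w x * ‖(M₁.incr f₁ y x - M₂.incr f₂ y x) p.1‖) +
            L₁₂ * (V.w x * ‖M₂.incr f₂ y x p.1‖)) +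
          N₁₂ * ((1 + L₂) * (V.w x * ‖M₂.incr f₂ y x p.1‖))) := by ring
      _ ≤ r ^ (p.2 / S.ℓ) * S.size (y - z) ^ (p.1 - p.2) *
          (N₁ * ((1 + L₁) * (Nd * X) + L₁₂ * (N₂ * X)) + N₁₂ * ((1 + L₂) * (N₂ * X))) := by
        gcongr
      _ = _ := by rw [hΘ]; ring
  calc _ = (W.w z)⁻¹ * (W.w y)⁻¹ * (V.w x)⁻¹ * (W.w z * W.w y * V.w x *
        |M₁.Pi y (M₁.incr f₁ y x) r z - M₂.Pi y (M₂.incr f₂ y x) r z|) := by field_simp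
    _ ≤ (W.w z)⁻¹ * (W.w y)⁻¹ * (V.w x)⁻¹ * _ := mul_le_mul_of_nonneg_left h2 (by positivity)
    _ = _ := by
      rw [Finset.mul_sum, Finset.mul_sum, Finset.mul_sum]
      exact Finset.sum_congr rfl fun α _ => by ring

theorem abs_bracket_le (h : PairBounds M₁ M₂ V γ η f₁ f₂ Λ₁ Λ₂ Nb Nd N₂ N₁ N₁₂ L₁ L₂ L₁₂)
    (hW : S.IsGControlled W) (hV : S.IsGControlled V) {z : Pt d} (hz : z 0 ≠ 0)
    {r : ℝ} (hr : r ∈ Ioc (0 : ℝ) 1) :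
    |(M₁.remainder f₁ Λ₁ z - M₂.remainder f₂ Λ₂ z) r z| ≤
      Nb * ((W.w z)⁻¹ * (V.w z)⁻¹) * S.phi z ^ (-(γ - η)) * r ^ (γ / S.ℓ) := by
  have h1 := h.bracket r hr z hz
  rw [GSemigroup.w_mul] at h1
  have hwz := hW.w_pos z
  have hvz := hV.w_pos z
  calc _ = (W.w z)⁻¹ * (V.w z)⁻¹ * (W.w z * V.w z *
        |(M₁.remainder f₁ Λ₁ z - M₂.remainder f₂ Λ₂ z) r z|) := by field_simp
    _ ≤ (W.w z)⁻¹ * (V.w z)⁻¹ * _ := mul_le_mul_of_nonneg_left h1 (by positivity)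
    _ = _ := by ring

/-- `1/(wv)(z)` compared with `1/(w²v)(x)` through `y`. -/
theorem inv_mul_inv_le (hW : S.IsGControlled W) (hV : S.IsGControlled V) (x y z : Pt d) :
    (W.w z)⁻¹ * (V.w y)⁻¹ * V.star (y - z) ≤
        (W * V).star (y - z) * ((W * W * V).star (x - y) * ((W * W * V).w x)⁻¹) ∧
      (W.w z)⁻¹ * (V.w z)⁻¹ ≤
        (W * V).star (y - z) * ((W * W * V).star (x - y) * ((W * W * V).w x)⁻¹) := by
  simp only [GSemigroup.w_mul, GSemigroup.star_mul, mul_inv]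
  have w0 := inv_pos.2 (hW.w_pos x)
  have w1 := inv_pos.2 (hW.w_pos y)
  have w2 := inv_pos.2 (hW.w_pos z)
  have v0 := inv_pos.2 (hV.w_pos x)
  have v1 := inv_pos.2 (hV.w_pos y)
  have v2 := inv_pos.2 (hV.w_pos z)
  have a1 := hW.inv_le y z
  have a2 := hW.inv_le x y
  have a3 := hV.inv_le x y
  have a4 := hV.inv_le y z
  have s1 := hW.one_le_star (x - y)
  have s2 := hV.one_le_star (x - y)
  have s3 := hV.one_le_star (y - z)
  have s4 := hW.one_le_star (y - z)
  have o1 : 1 ≤ (W.w x)⁻¹ := (one_le_inv₀ (hW.w_pos x)).2 (hW.w_le_one x)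
  have key : (W.w z)⁻¹ * (V.w y)⁻¹ * V.star (y - z) ≤
        W.star (y - z) * V.star (y - z) * (W.star (x - y) * W.star (x - y) * V.star (x - y) *
          ((W.w x)⁻¹ * (W.w x)⁻¹ * (V.w x)⁻¹)) := by
    calc _ ≤ (W.star (y - z) * (W.star (x - y) * (W.w x)⁻¹)) *
          (V.star (x - y) * (V.w x)⁻¹) * V.star (y - z) := by
          gcongr
          exact a1.trans (mul_le_mul_of_nonneg_left a2 (by linarith))
      -- The two placeholders 1 are then enlarged to w*(x−y) and 1/w(x), to reach the weight w²v
      -- that the term with two factors 1/w requires.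
      _ = W.star (y - z) * V.star (y - z) * (W.star (x - y) * 1 * V.star (x - y) *
          ((W.w x)⁻¹ * 1 * (V.w x)⁻¹)) := by ring
      _ ≤ _ := by gcongr
  refine ⟨key, le_trans ?_ key⟩
  rw [mul_assoc]
  exact mul_le_mul_of_nonneg_left (a4.trans (le_of_eq (mul_comm _ _))) w2.le


/-- The base point is moved from x to y and from y to z. The first move leaves Π_y Δ_{yx}f evaluated
at z, off its own base point. This costs a factor 1+‖Γ‖ and both w*(y−z) and w*(z−y), which is why g
has to dominate w*(x)w*(−x) besides the controlling function of wv. -/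
theorem offCentreBound (h : PairBounds M₁ M₂ V γ η f₁ f₂ Λ₁ Λ₂ Nb Nd N₂ N₁ N₁₂ L₁ L₂ L₁₂)
    (hW : S.IsGControlled W) (hV : S.IsGControlled V) {g : Pt d → ℝ}
    (hg₁ : ∀ x, (W * V).star x ≤ g x) (hg₂ : ∀ x, W.star x * W.star (-x) ≤ g x) :
    S.OffCentreBound (insert γ (𝒯.idx γ)) γ (γ - η) g (W * W * V).star (W * W * V).w
      (Nb + (N₁ * Nd + N₁₂ * N₂) +
        (N₁ * ((1 + L₁) * Nd + L₁₂ * N₂) + N₁₂ * ((1 + L₂) * N₂)))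
      (fun x => M₁.remainder f₁ Λ₁ x - M₂.remainder f₂ Λ₂ x) := by
  intro x y z hx hy hz r hr
  change _ ≤ _ * S.pairSum (insert γ (𝒯.idx γ)) γ r x y z
  beta_reduce
  rw [sub_apply_eq (M₁ := M₁) (M₂ := M₂) (x := x) (z := y) z hr,
    sub_apply_eq (M₁ := M₁) (M₂ := M₂) (x := y) (z := z) z hr]
  have hφx := Real.rpow_nonneg (S.phi_nonneg x) (-(γ - η))
  have hφy := Real.rpow_nonneg (S.phi_nonneg y) (-(γ - η))
  have hφz := Real.rpow_nonneg (S.phi_nonneg z) (-(γ - η))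
  obtain ⟨k1, k2⟩ := inv_mul_inv_le hW hV x y z
  have hPu : 0 ≤ (W * W * V).star (x - y) * ((W * W * V).w x)⁻¹ := by
    have := hW.one_le_star (x - y)
    have := hV.one_le_star (x - y)
    have := hW.w_pos x
    have := hV.w_pos x
    simp only [GSemigroup.w_mul, GSemigroup.star_mul]
    positivity
  have k3 : (W.w z)⁻¹ * (W.w y)⁻¹ * (V.w x)⁻¹ * W.star (z - y) * V.star (x - y) ≤
      g (y - z) * ((W * W * V).star (x - y) * ((W * W * V).w x)⁻¹) := by
    have g1 := hg₂ (y - z)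
    rw [neg_sub] at g1
    refine le_trans ?_ (mul_le_mul_of_nonneg_right g1 hPu)
    simp only [GSemigroup.w_mul, GSemigroup.star_mul, mul_inv]
    have w1 := inv_pos.2 (hW.w_pos y)
    have w2 := inv_pos.2 (hW.w_pos z)
    have w3 := inv_pos.2 (hW.w_pos x)
    have v0 := inv_pos.2 (hV.w_pos x)
    have a1 := hW.inv_le y z
    have a2 := hW.inv_le x y
    have s1 := hW.one_le_star (x - y)
    have s2 := hV.one_le_star (x - y)
    have s3 := hW.one_le_star (z - y)
    have s4 := hW.one_le_star (y - z)
    calc _ ≤ (W.star (y - z) * (W.star (x - y) * (W.w x)⁻¹)) * (W.star (x - y) * (W.w x)⁻¹) *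
          (V.w x)⁻¹ * W.star (z - y) * V.star (x - y) := by
          gcongr
          exact a1.trans (mul_le_mul_of_nonneg_left a2 (by linarith))
      _ = _ := by ring
  have k1' := k1.trans (mul_le_mul_of_nonneg_right (hg₁ (y - z)) hPu)
  have k2' := k2.trans (mul_le_mul_of_nonneg_right (hg₁ (y - z)) hPu)
  set Y := g (y - z) * ((W * W * V).star (x - y) * ((W * W * V).w x)⁻¹)
  set Φ := S.phi x ^ (-(γ - η)) + S.phi y ^ (-(γ - η)) + S.phi z ^ (-(γ - η)) with hΦ
  have hY0 : 0 ≤ Y := by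
    refine le_trans ?_ k2'
    have := hW.w_pos z
    have := hV.w_pos z
    positivity
  have hΦ0 : 0 ≤ Φ := by positivity
  have hS0 : 0 ≤ S.pairSum (insert γ (𝒯.idx γ)) γ r x y z :=
    Finset.sum_nonneg fun p _ => GSemigroup.pair_term_nonneg hr.1 x y z p
  have t1 : r ^ (γ / S.ℓ) ≤ S.pairSum (insert γ (𝒯.idx γ)) γ r x y z := by
    have := S.sum_le_pairSum (E := insert γ (𝒯.idx γ)) (E₀ := {γ}) (γ := γ) hr.1 x y z
      (fun α => (γ, α)) (fun _ => rfl) (by simp)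
    simpa using this
  have t2 : ∑ α ∈ 𝒯.idx γ, r ^ (α / S.ℓ) * S.size (y - z) ^ (γ - α) ≤
      S.pairSum (insert γ (𝒯.idx γ)) γ r x y z := by
    have := S.sum_le_pairSum (E := insert γ (𝒯.idx γ)) (E₀ := 𝒯.idx γ) (γ := γ) hr.1 x y z
      (fun α => (γ, α)) (fun _ => rfl)
      (fun α hα => ⟨Finset.mem_insert_of_mem hα, Finset.mem_insert_self _ _, (mem_idx.1 hα).2.le⟩)
    simpa using this
  have t3 : ∑ p ∈ (𝒯.idx γ ×ˢ 𝒯.idx γ).filter (fun p => p.2 ≤ p.1),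
      r ^ (p.2 / S.ℓ) * S.size (y - z) ^ (p.1 - p.2) * S.size (x - y) ^ (γ - p.1) ≤
      S.pairSum (insert γ (𝒯.idx γ)) γ r x y z :=
    Finset.sum_le_sum_of_subset_of_nonneg (Finset.filter_subset_filter _
      (Finset.product_subset_product (Finset.subset_insert _ _) (Finset.subset_insert _ _)))
      fun p _ _ => GSemigroup.pair_term_nonneg hr.1 x y z p
  set T := S.pairSum (insert γ (𝒯.idx γ)) γ r x y z
  have hN₁ := h.N₁_nonneg
  have hN₁₂ := h.N₁₂_nonneg
  have hN₂ := h.N₂_nonneg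
  have hNd := h.Nd_nonneg
  have hNb := h.Nb_nonneg
  have hL₁ := h.L₁_nonneg
  have hL₂ := h.L₂_nonneg
  have hL₁₂ := h.L₁₂_nonneg
  have b1 : |(M₁.remainder f₁ Λ₁ z - M₂.remainder f₂ Λ₂ z) r z| ≤ Nb * Y * Φ * T := by
    refine (h.abs_bracket_le hW hV hz hr).trans ?_
    have : S.phi z ^ (-(γ - η)) ≤ Φ := by rw [hΦ]; linarith
    have := Real.rpow_nonneg hr.1.le (γ / S.ℓ)
    gcongr
  have b2 : |M₁.Pi z (M₁.incr f₁ z y) r z - M₂.Pi z (M₂.incr f₂ z y) r z| ≤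
      (N₁ * Nd + N₁₂ * N₂) * Y * Φ * T := by
    refine (h.centre_le hW hV hy hz hr).trans ?_
    have : S.phi y ^ (-(γ - η)) + S.phi z ^ (-(γ - η)) ≤ Φ := by rw [hΦ]; linarith
    refine mul_le_mul (by gcongr) t2 (Finset.sum_nonneg fun α _ => mul_nonneg
      (Real.rpow_nonneg hr.1.le _) (Real.rpow_nonneg (S.size_nonneg _) _)) (by positivity)
  have b3 : |M₁.Pi y (M₁.incr f₁ y x) r z - M₂.Pi y (M₂.incr f₂ y x) r z| ≤
      (N₁ * ((1 + L₁) * Nd + L₁₂ * N₂) + N₁₂ * ((1 + L₂) * N₂)) * Y * Φ * T := by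
    refine (h.offCentre_le hW hV z hx hy hr).trans ?_
    have : S.phi x ^ (-(γ - η)) + S.phi y ^ (-(γ - η)) ≤ Φ := by rw [hΦ]; linarith
    refine mul_le_mul (by gcongr) t3 (Finset.sum_nonneg fun p _ =>
      GSemigroup.pair_term_nonneg hr.1 x y z p) (by positivity)
  refine (abs_add_le _ _).trans ((add_le_add ((abs_add_le _ _).trans (add_le_add b1 b2)) b3).trans
    (le_of_eq ?_))
  ring

/-- If `v*` is submultiplicative, the off-centre bound does not involve `Γ`. -/
theorem offCentreBound_of_submul
    (h : PairBounds M₁ M₂ V γ η f₁ f₂ Λ₁ Λ₂ Nb Nd N₂ N₁ N₁₂ L₁ L₂ L₁₂)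
    (hW : S.IsGControlled W) (hV : S.IsGControlled V) {c₀ : ℝ} (hc₀ : 0 ≤ c₀)
    (hsub : ∀ x y, V.star (x + y) ≤ c₀ * V.star x * V.star y) {c : ℝ} (hc : 0 ≤ c)
    (hcα : ∀ α ∈ 𝒯.idx γ, (2 : ℝ) ^ (γ - α) ≤ c) :
    S.OffCentreBound (insert γ (𝒯.idx γ)) γ (γ - η) (fun x => (1 + 2 * c₀ * c) * (W * V).star x)
      (W * W * V).star (W * W * V).w (Nb + (N₁ * Nd + N₁₂ * N₂))
      (fun x => M₁.remainder f₁ Λ₁ x - M₂.remainder f₂ Λ₂ x) := by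
  intro x y z hx hy hz r hr
  change _ ≤ _ * S.pairSum (insert γ (𝒯.idx γ)) γ r x y z
  beta_reduce
  -- The base point jumps from x to z directly, so Π_z is only evaluated at its own base point and Γ
  -- does not enter.
  rw [sub_apply_eq (M₁ := M₁) (M₂ := M₂) (x := x) (z := z) z hr]
  have hφx := Real.rpow_nonneg (S.phi_nonneg x) (-(γ - η))
  have hφy := Real.rpow_nonneg (S.phi_nonneg y) (-(γ - η))
  have hφz := Real.rpow_nonneg (S.phi_nonneg z) (-(γ - η))
  obtain ⟨-, k2⟩ := inv_mul_inv_le hW hV x y z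
  have k1 : (W.w z)⁻¹ * (V.w x)⁻¹ * V.star (x - z) ≤
      c₀ * ((W * V).star (y - z) * ((W * W * V).star (x - y) * ((W * W * V).w x)⁻¹)) := by
    simp only [GSemigroup.w_mul, GSemigroup.star_mul, mul_inv]
    have w0 := inv_pos.2 (hW.w_pos x)
    have w1 := inv_pos.2 (hW.w_pos y)
    have w2 := inv_pos.2 (hW.w_pos z)
    have v0 := inv_pos.2 (hV.w_pos x)
    have a1 := hW.inv_le y z
    have a2 := hW.inv_le x y
    have s1 := hW.one_le_star (x - y)
    have s2 := hV.one_le_star (x - y)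
    have s3 := hV.one_le_star (y - z)
    have s4 := hW.one_le_star (y - z)
    have s5 := hV.one_le_star (x - z)
    have o1 : 1 ≤ (W.w x)⁻¹ := (one_le_inv₀ (hW.w_pos x)).2 (hW.w_le_one x)
    have e := hsub (x - y) (y - z)
    rw [sub_add_sub_cancel] at e
    calc _ ≤ (W.star (y - z) * (W.star (x - y) * (W.w x)⁻¹)) * (V.w x)⁻¹ *
          (c₀ * V.star (x - y) * V.star (y - z)) := by
          gcongr
          exact a1.trans (mul_le_mul_of_nonneg_left a2 (by linarith))
      _ = c₀ * (W.star (y - z) * V.star (y - z) * (W.star (x - y) * 1 * V.star (x - y) *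
          ((W.w x)⁻¹ * 1 * (V.w x)⁻¹))) := by ring
      _ ≤ _ := by gcongr
  set Y := (W * V).star (y - z) * ((W * W * V).star (x - y) * ((W * W * V).w x)⁻¹) with hY
  set Φ := S.phi x ^ (-(γ - η)) + S.phi y ^ (-(γ - η)) + S.phi z ^ (-(γ - η)) with hΦ
  have hY0 : 0 ≤ Y := by
    refine le_trans ?_ k2
    have := hW.w_pos z
    have := hV.w_pos z
    positivity
  have hΦ0 : 0 ≤ Φ := by positivity
  have hS0 : 0 ≤ S.pairSum (insert γ (𝒯.idx γ)) γ r x y z :=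
    Finset.sum_nonneg fun p _ => GSemigroup.pair_term_nonneg hr.1 x y z p
  have t1 : r ^ (γ / S.ℓ) ≤ S.pairSum (insert γ (𝒯.idx γ)) γ r x y z := by
    have := S.sum_le_pairSum (E := insert γ (𝒯.idx γ)) (E₀ := {γ}) (γ := γ) hr.1 x y z
      (fun α => (γ, α)) (fun _ => rfl) (by simp)
    simpa using this
  have t2 : ∑ α ∈ 𝒯.idx γ, r ^ (α / S.ℓ) * S.size (y - z) ^ (γ - α) ≤
      S.pairSum (insert γ (𝒯.idx γ)) γ r x y z := by
    have := S.sum_le_pairSum (E := insert γ (𝒯.idx γ)) (E₀ := 𝒯.idx γ) (γ := γ) hr.1 x y z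
      (fun α => (γ, α)) (fun _ => rfl)
      (fun α hα => ⟨Finset.mem_insert_of_mem hα, Finset.mem_insert_self _ _, (mem_idx.1 hα).2.le⟩)
    simpa using this
  have t3 : ∑ α ∈ 𝒯.idx γ, r ^ (α / S.ℓ) * S.size (x - y) ^ (γ - α) ≤
      S.pairSum (insert γ (𝒯.idx γ)) γ r x y z := by
    have := S.sum_le_pairSum (E := insert γ (𝒯.idx γ)) (E₀ := 𝒯.idx γ) (γ := γ) hr.1 x y z
      (fun α => (α, α)) (fun _ => rfl)
      (fun α hα => ⟨Finset.mem_insert_of_mem hα, Finset.mem_insert_of_mem hα, le_rfl⟩)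
    simpa using this
  set T := S.pairSum (insert γ (𝒯.idx γ)) γ r x y z
  -- The point y is reinserted by ‖x−z‖ ≤ ‖x−y‖ + ‖y−z‖; the two resulting sums correspond to the
  -- selections (α,α) and (γ,α) in the pair sum.
  have t4 : ∑ α ∈ 𝒯.idx γ, r ^ (α / S.ℓ) * S.size (x - z) ^ (γ - α) ≤ 2 * c * T := by
    calc _ ≤ ∑ α ∈ 𝒯.idx γ, c * (r ^ (α / S.ℓ) * S.size (x - y) ^ (γ - α) +
          r ^ (α / S.ℓ) * S.size (y - z) ^ (γ - α)) := by
          refine Finset.sum_le_sum fun α hα => ?_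
          have hα' := sub_pos.2 (mem_idx.1 hα).2
          have e1 := Real.rpow_le_rpow (S.size_nonneg _) (S.size_sub_le x y z) hα'.le
          have e2 := rpow_add_le_two_rpow (S.size_nonneg (x - y)) (S.size_nonneg (y - z)) hα'.le
          have n1 := Real.rpow_nonneg (S.size_nonneg (x - y)) (γ - α)
          have n2 := Real.rpow_nonneg (S.size_nonneg (y - z)) (γ - α)
          have e3 := e1.trans (e2.trans (mul_le_mul_of_nonneg_right (hcα α hα) (add_nonneg n1 n2)))
          calc _ ≤ r ^ (α / S.ℓ) * _ :=
                mul_le_mul_of_nonneg_left e3 (Real.rpow_nonneg hr.1.le _)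
            _ = _ := by ring
      _ = c * (_ + _) := by rw [← Finset.mul_sum, Finset.sum_add_distrib]
      _ ≤ c * (T + T) := mul_le_mul_of_nonneg_left (add_le_add t3 t2) hc
      _ = _ := by ring
  have hN₁ := h.N₁_nonneg
  have hN₁₂ := h.N₁₂_nonneg
  have hN₂ := h.N₂_nonneg
  have hNd := h.Nd_nonneg
  have hNb := h.Nb_nonneg
  have b1 : |(M₁.remainder f₁ Λ₁ z - M₂.remainder f₂ Λ₂ z) r z| ≤ Nb * Y * Φ * T := by
    refine (h.abs_bracket_le hW hV hz hr).trans ?_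
    have : S.phi z ^ (-(γ - η)) ≤ Φ := by rw [hΦ]; linarith
    have := Real.rpow_nonneg hr.1.le (γ / S.ℓ)
    gcongr
  have b2 : |M₁.Pi z (M₁.incr f₁ z x) r z - M₂.Pi z (M₂.incr f₂ z x) r z| ≤
      (N₁ * Nd + N₁₂ * N₂) * (c₀ * Y) * Φ * (2 * c * T) := by
    refine (h.centre_le hW hV hx hz hr).trans ?_
    have : S.phi x ^ (-(γ - η)) + S.phi z ^ (-(γ - η)) ≤ Φ := by rw [hΦ]; linarith
    refine mul_le_mul (by gcongr) t4 (Finset.sum_nonneg fun α _ => mul_nonneg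
      (Real.rpow_nonneg hr.1.le _) (Real.rpow_nonneg (S.size_nonneg _) _)) (by positivity)
  refine (abs_add_le _ _).trans ((add_le_add b1 b2).trans ?_)
  -- Nonnegative terms that complete the sum to the product of (1 + 2c₀c) with the full constant.
  have z1 : 0 ≤ (N₁ * Nd + N₁₂ * N₂) * Y * Φ * T := by positivity
  have z2 : 0 ≤ Nb * (2 * c₀ * c) * Y * Φ * T := by positivity
  calc _ ≤ (Nb * Y * Φ * T + (N₁ * Nd + N₁₂ * N₂) * (c₀ * Y) * Φ * (2 * c * T)) +
        ((N₁ * Nd + N₁₂ * N₂) * Y * Φ * T + Nb * (2 * c₀ * c) * Y * Φ * T) := by linarith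
    _ = _ := by rw [hY]; ring

end PairBounds

end RegularityStructure.Model

/-! ### Models as elements of Besov spaces. -/

namespace RegularityStructure

variable {A : Set ℝ} {𝒯 : RegularityStructure.{u₁} A} {d : ℕ} {S : GSemigroup d} {W : Weight d}

/-- A smooth model as a model. -/
noncomputable def SmoothModel.toModel (N : 𝒯.SmoothModel S W) (hW : S.IsGControlled W) :
    𝒯.Model S W where
  Pi x :=
    -- The cut-off to (0,1] is needed for linearity in τ: integrability of Q_t against functions in
    -- C(w) is only known for these times.
    { toFun := fun τ t y => (Ioc (0 : ℝ) 1).indicator (fun t => S.ofFun (N.Pi x τ) t y) t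
      map_add' := fun τ σ => by
        ext t y
        by_cases ht : t ∈ Ioc (0 : ℝ) 1
        · simp only [Pi.add_apply, indicator_of_mem ht, map_add, GSemigroup.ofFun, mul_add]
          obtain ⟨h1, B, h2⟩ := N.Pi_memC x τ
          obtain ⟨h3, B', h4⟩ := N.Pi_memC x σ
          exact integral_add (GSemigroup.integrable_Q_mul hW h1.measurable h2 ht y)
            (GSemigroup.integrable_Q_mul hW h3.measurable h4 ht y)
        · simp [indicator_of_notMem ht]
      map_smul' := fun c τ => by
        ext t y
        by_cases ht : t ∈ Ioc (0 : ℝ) 1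
        · simp only [Pi.smul_apply, indicator_of_mem ht, map_smul, GSemigroup.ofFun, smul_eq_mul,
            RingHom.id_apply]
          rw [← integral_const_mul]
          exact integral_congr_ae (Eventually.of_forall fun z => by simp only; ring)
        · simp [indicator_of_notMem ht] }
  Gam x y := (N.Gam x y).toLinearMap
  Pi_Gam x y τ t ht z := by
    simp only [LinearMap.coe_mk, AddHom.coe_mk, LinearEquiv.coe_coe, N.Pi_Gam]
  Gam_self := N.Gam_self
  Gam_comp := N.Gam_comp
  Gam_triangular x y α τ β h := 𝒯.G_triangular _ (N.Gam_mem x y) α τ β h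
  approx γ ε hε := by
    refine ⟨N, ?_⟩
    refine (add_le_add (piNorm_le (N := 0) fun α _ _ t ht x τ => ?_)
      (gammaNorm_le (N := 0) hW fun α _ β _ _ _ x y τ => ?_)).trans (by simp)
    · simp [indicator_of_mem ht]
    · simp

theorem SmoothModel.toModel_Pi (N : 𝒯.SmoothModel S W) (hW : S.IsGControlled W) (x : Pt d)
    (τ : 𝒯.Sp) {t : ℝ} (ht : t ∈ Ioc (0 : ℝ) 1) (y : Pt d) :
    (N.toModel hW).Pi x τ t y = S.ofFun (N.Pi x τ) t y :=
  indicator_of_mem ht fun t => S.ofFun (N.Pi x τ) t y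

namespace Model

/-- A model is approximated by smooth models, in the form of pointwise bounds. -/
theorem exists_approx (M : 𝒯.Model S W) (hW : S.IsGControlled W) (γ : ℝ) {ε : ℝ} (hε : 0 < ε) :
    ∃ N : 𝒯.SmoothModel S W,
      𝒯.PiBound S W γ (fun x τ => M.Pi x τ - (N.toModel hW).Pi x τ) ε ∧
      𝒯.GamBound S W γ (fun x y τ => M.Gam x y τ - (N.toModel hW).Gam x y τ) ε := by
  obtain ⟨N, hN⟩ := M.approx γ ε hε
  refine ⟨N, fun α hα hαγ t ht x τ => ?_, ?_⟩
  · have := piBound_of_le (P := fun x τ => M.Pi x τ - S.ofFun (N.Pi x τ)) hε.le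
      (fun x t y => by simp [GSemigroup.ofFun]) (le_trans (le_add_right le_rfl) hN) α hα hαγ t ht x τ
    simpa only [Pi.sub_apply, N.toModel_Pi hW x _ ht] using this
  · exact gamBound_of_le hW hε.le (fun x y => by simp)
      (fun α β hβα x τ => by rw [M.Gam_self, Model.Gam_self, sub_self]; rfl)
      (le_trans (le_add_left le_rfl) hN)

theorem rpow_le_one_add_pow {q s : ℝ} (hs : 0 ≤ s) {n : ℕ} (hq : 0 ≤ q) (hn : q ≤ n) :
    s ^ q ≤ 1 + s ^ n := by
  rcases le_total s 1 with h | h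
  · have := Real.rpow_le_one hs h hq
    have := pow_nonneg hs n
    linarith
  · have := Real.rpow_le_rpow_of_exponent_le h hn
    rw [Real.rpow_natCast] at this
    linarith

/-- `Π_x τ` lies in a Besov space with a weight that absorbs the growth of `w*`. -/
theorem memBesov_Pi (M : 𝒯.Model S W) (hW : S.IsGControlled W) {W₁ : Weight d}
    (hW₁ : S.IsGControlled W₁)
    (haux : ∀ n : ℕ, ∃ B : ℝ, ∀ x, S.size x ^ n * W.star x * W₁.w x ≤ B) {ζ : ℝ} (hζ : ζ ≤ 0)
    (hζA : ∀ α ∈ A, ζ ≤ α) {γ : ℝ} {τ : 𝒯.Sp} (hτ : 𝒯.Below γ τ) (x : Pt d) :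
    S.MemBesov ζ (W * W₁) (M.Pi x τ) := by
  refine ⟨hζ, fun ε' hε' => ?_⟩
  obtain ⟨N₁, hN₁, hP₁⟩ := M.exists_piBound hW γ
  obtain ⟨L₁, hL₁, hG₁⟩ := M.exists_gamBound hW γ
  have haux' : ∀ q : ℝ, ∃ B : ℝ, 0 ≤ B ∧ (0 ≤ q → ∀ z, S.size z ^ q * W.star z * W₁.w z ≤ B) := by
    intro q
    obtain ⟨n, hn⟩ := exists_nat_ge q
    obtain ⟨B, hB⟩ := haux 0
    obtain ⟨B', hB'⟩ := haux n
    refine ⟨|B| + |B'|, by positivity, fun hq z => ?_⟩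
    have h1 := rpow_le_one_add_pow (S.size_nonneg z) hq hn
    have h2 := mul_nonneg (zero_le_one.trans (hW.one_le_star z)) (hW₁.w_pos z).le
    have h3 := hB z
    rw [pow_zero, one_mul] at h3
    calc _ = S.size z ^ q * (W.star z * W₁.w z) := by ring
      _ ≤ (1 + S.size z ^ n) * (W.star z * W₁.w z) := mul_le_mul_of_nonneg_right h1 h2
      _ = W.star z * W₁.w z + S.size z ^ n * W.star z * W₁.w z := by ring
      _ ≤ _ := add_le_add (h3.trans (le_abs_self B)) ((hB' z).trans (le_abs_self B'))
  choose B hB0 hB using haux'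
  set T := (𝒯.idx γ ×ˢ 𝒯.idx γ).filter (fun p : ℝ × ℝ => p.2 ≤ p.1)
  set D := (W.w x)⁻¹ * W₁.star x * ∑ p ∈ T, B (p.1 - p.2) * ((N₁ + (2 + L₁)) * ‖τ p.1‖)
  have hwx := hW.w_pos x
  have hs1 := hW₁.one_le_star x
  have hD0 : 0 ≤ D := mul_nonneg (by positivity) (Finset.sum_nonneg fun p _ =>
    mul_nonneg (hB0 _) (by positivity))
  -- The bound ε ≤ 1 keeps the approximant's ‖Γ‖ below 1+L₁, so D can be fixed before the
  -- approximant is chosen; the other bound makes εD at most ε'.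
  set ε := min 1 (ε' / (D + 1)) with hε
  have hε0 : 0 < ε := lt_min one_pos (by positivity)
  have hεD : ε * D ≤ ε' := by
    calc ε * D ≤ ε' / (D + 1) * (D + 1) :=
          mul_le_mul (min_le_right _ _) (by linarith) hD0 (by positivity)
      _ = ε' := by field_simp
  obtain ⟨N, hP₁₂, hG₁₂⟩ := M.exists_approx hW γ hε0
  have hG₂ : 𝒯.GamBound S W γ (fun x y τ => (N.toModel hW).Gam x y τ) (1 + L₁) := by
    intro α hα β hβ hβα hαγ x' y' σ
    have h1 := hG₁ α hα β hβ hβα hαγ x' y' σ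
    have h2 := hG₁₂ α hα β hβ hβα hαγ x' y' σ
    simp only [DFinsupp.sub_apply] at h2
    have h3 : ‖(N.toModel hW).Gam y' x' (DFinsupp.single α σ) β‖ ≤
        ‖M.Gam y' x' (DFinsupp.single α σ) β‖ + ‖M.Gam y' x' (DFinsupp.single α σ) β -
          (N.toModel hW).Gam y' x' (DFinsupp.single α σ) β‖ := by
      have := norm_sub_le (M.Gam y' x' (DFinsupp.single α σ) β)
        (M.Gam y' x' (DFinsupp.single α σ) β - (N.toModel hW).Gam y' x' (DFinsupp.single α σ) β)
      rwa [sub_sub_cancel] at this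
    have h4 := mul_le_mul_of_nonneg_left h3 (hW.w_pos x').le
    have h5 : 0 ≤ W.star (y' - x') * S.size (y' - x') ^ (α - β) * ‖σ‖ := by
      have := Real.rpow_nonneg (S.size_nonneg (y' - x')) (α - β)
      have := hW.one_le_star (y' - x')
      positivity
    have h6 : ε * (W.star (y' - x') * S.size (y' - x') ^ (α - β) * ‖σ‖) ≤
        1 * (W.star (y' - x') * S.size (y' - x') ^ (α - β) * ‖σ‖) :=
      mul_le_mul_of_nonneg_right (min_le_left _ _) h5
    linarith
  obtain ⟨hc, Bf, hBf⟩ := N.Pi_memC x τ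
  refine ⟨N.Pi x τ, ⟨hc, Bf, fun z => le_trans ?_ (hBf z)⟩, fun t ht z => ?_⟩
  · exact mul_le_mul_of_nonneg_left (mul_le_of_le_one_right (hW.w_pos z).le (hW₁.w_le_one z))
      (abs_nonneg _)
  -- With the same τ on both sides only the distances of the two models survive, so the right-hand
  -- side is proportional to ε.
  have h1 := abs_Pi_sub_offCentre_le hW hN₁ hε0.le hL₁ (by positivity : 0 ≤ 1 + L₁) hε0.le hP₁ hP₁₂
    hG₁ hG₂ hG₁₂ hτ hτ ht x z
  rw [N.toModel_Pi hW x τ ht, sub_self] at h1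
  simp only [DFinsupp.zero_apply, norm_zero, mul_zero, zero_add] at h1
  -- The auxiliary weight is transported to z−x, where it absorbs both w*(z−x) and the powers of
  -- ‖z−x‖.
  have hw1 : W₁.w z ≤ W₁.star x * W₁.w (z - x) := by
    have := hW₁.2.2.2.2.1 x (z - x)
    rwa [add_sub_cancel] at this
  set Δ := |M.Pi x τ t z - S.ofFun (N.Pi x τ) t z|
  have hwz := hW.w_pos z
  have hw1z := hW₁.w_pos z
  have hwd := hW₁.w_pos (z - x)
  have hst := hW.one_le_star (z - x)
  have h2 : Δ * (W * W₁).w z ≤ ε * D * t ^ (ζ / S.ℓ) := by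
    calc Δ * (W * W₁).w z = (W.w x)⁻¹ * (W₁.w z * (W.w z * W.w x * Δ)) := by
          rw [GSemigroup.w_mul]; field_simp
      _ ≤ (W.w x)⁻¹ * ((W₁.star x * W₁.w (z - x)) * _) :=
        mul_le_mul_of_nonneg_left (mul_le_mul hw1 h1 (by positivity) (by positivity))
          (by positivity)
      _ = (W.w x)⁻¹ * W₁.star x * ∑ p ∈ T, t ^ (p.2 / S.ℓ) *
          ((S.size (z - x) ^ (p.1 - p.2) * W.star (z - x) * W₁.w (z - x)) *
            (ε * ((N₁ + (2 + L₁)) * ‖τ p.1‖))) := by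
          simp only [Finset.mul_sum]
          exact Finset.sum_congr rfl fun p _ => by ring
      _ ≤ (W.w x)⁻¹ * W₁.star x * ∑ p ∈ T, t ^ (ζ / S.ℓ) *
          (B (p.1 - p.2) * (ε * ((N₁ + (2 + L₁)) * ‖τ p.1‖))) := by
          refine mul_le_mul_of_nonneg_left (Finset.sum_le_sum fun p hp => ?_) (by positivity)
          obtain ⟨hp1, hp2⟩ := Finset.mem_filter.1 hp
          have hA := (mem_idx.1 (Finset.mem_product.1 hp1).2).1
          have e1 : t ^ (p.2 / S.ℓ) ≤ t ^ (ζ / S.ℓ) :=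
            Real.rpow_le_rpow_of_exponent_ge ht.1 ht.2
              (div_le_div_of_nonneg_right (hζA _ hA) S.ℓ_pos.le)
          have e2 := hB (p.1 - p.2) (sub_nonneg.2 hp2) (z - x)
          have e3 := Real.rpow_nonneg ht.1.le (ζ / S.ℓ)
          have e4 := Real.rpow_nonneg (S.size_nonneg (z - x)) (p.1 - p.2)
          gcongr
      _ = _ := by
        simp only [D, Finset.mul_sum, Finset.sum_mul]
        exact Finset.sum_congr rfl fun p _ => by ring
  rw [neg_div, Real.rpow_neg ht.1.le]
  have h3 := Real.rpow_pos_of_pos ht.1 (ζ / S.ℓ)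
  rw [inv_mul_le_iff₀ h3, mul_comm (t ^ (ζ / S.ℓ))]
  exact h2.trans (mul_le_mul_of_nonneg_right hεD h3.le)

end Model

end RegularityStructure

/-! ### Linearity of the kernel integrals and polynomial moments. -/

namespace GSemigroup

variable {d : ℕ} {S : GSemigroup d} {K : ℝ → Pt d → Pt d → ℝ} {δ : ℝ}

theorem KernelRegular.kernelInt_sub {F F' : ℝ → Pt d → ℝ} (hF : S.KernelRegular δ K F)
    (hF' : S.KernelRegular δ K F') {k : Fin d → ℕ} (hk : S.wt k < δ) {x : Pt d}
    (hI : IntegrableOn (fun r => kernelAt K k r x F) (Ioc 0 1))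
    (hI' : IntegrableOn (fun r => kernelAt K k r x F') (Ioc 0 1)) :
    kernelInt K k x (F - F') = kernelInt K k x F - kernelInt K k x F' := by
  unfold kernelInt
  rw [← integral_sub hI hI']
  exact setIntegral_congr_fun measurableSet_Ioc fun r hr => hF.kernelAt_sub hF' hk hr x

theorem KernelRegular.kernelInt_sum {ι : Type*} (s : Finset ι) {F : ι → ℝ → Pt d → ℝ}
    (hF : ∀ i ∈ s, S.KernelRegular δ K (F i)) {k : Fin d → ℕ} (hk : S.wt k < δ) {x : Pt d}
    (hI : ∀ i ∈ s, IntegrableOn (fun r => kernelAt K k r x (F i)) (Ioc 0 1)) :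
    kernelInt K k x (∑ i ∈ s, F i) = ∑ i ∈ s, kernelInt K k x (F i) := by
  unfold kernelInt
  rw [← integral_finsetSum s hI]
  exact setIntegral_congr_fun measurableSet_Ioc fun r hr => KernelRegular.kernelAt_sum s hF hk hr x

theorem kernelInt_zero (k : Fin d → ℕ) (x : Pt d) : kernelInt K k x 0 = 0 := by
  simp [kernelInt, kernelAt]

theorem integrable_Q_mpow (h1 : S.Controls (fun _ => 1)) {t : ℝ} (ht : t ∈ Ioc (0 : ℝ) 1)
    (x : Pt d) (k : Fin d → ℕ) : Integrable fun z => S.Q t x z * mpow (z - x) k := by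
  obtain ⟨C₁, hC₁, hQ⟩ := S.Q_upper
  obtain ⟨C, -, hC⟩ := h1.moment (S.wt_nonneg k)
  refine Integrable.mono' ((hC t ht x).1.const_mul C₁) ?_ (Eventually.of_forall fun z => ?_)
  · refine ((S.Q_meas ht.1 x).mul ?_).aestronglyMeasurable
    unfold mpow
    fun_prop
  · rw [Real.norm_eq_abs, abs_mul]
    have h2 := hQ t ht.1 x z
    have h3 := S.abs_mpow_le (z - x) k
    rw [S.size_sub_comm z x] at h3
    calc _ ≤ C₁ * S.Gt t (x - z) * S.size (x - z) ^ S.wt k :=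
          mul_le_mul h2 h3 (abs_nonneg _) (mul_nonneg hC₁.le (S.Gt_nonneg ht.1 _))
      _ = _ := by ring

end GSemigroup

namespace AbstractIntegration

variable {A Abar : Set ℝ} {𝒯 : RegularityStructure.{u₁} A} {𝒯bar : RegularityStructure.{u₂} Abar}
  {β : ℝ}

theorem map_single (I : AbstractIntegration 𝒯 𝒯bar β) (α : ℝ) (τ : 𝒯.T α) :
    I.map (DFinsupp.single α τ) = DFinsupp.single (α + β) (I α τ) := by
  simp [map]

theorem map_apply (I : AbstractIntegration 𝒯 𝒯bar β) (α : ℝ) (τ : 𝒯.Sp) :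
    I.map τ (α + β) = I α (τ α) := by
  induction τ using DFinsupp.induction with
  | h0 => simp
  | ha i b f _ _ ih =>
    rw [map_add, DFinsupp.add_apply, DFinsupp.add_apply, ih, map_single, map_add]
    congr 1
    by_cases h : i = α
    · subst h
      simp
    · rw [DFinsupp.single_eq_of_ne (Ne.symm h), map_zero, DFinsupp.single_eq_of_ne]
      exact fun h' => h (by linarith)

end AbstractIntegration

/-! ### The remainder of 𝒦f as a convolved Taylor remainder. -/

namespace RegularityStructure.Model

variable {A Abar : Set ℝ} {𝒯 : RegularityStructure.{u₁} A} {𝒯bar : RegularityStructure.{u₂} Abar}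
  {d : ℕ} [NeZero d] {S : GSemigroup d} {W U U' : Weight d}

/-- The analytic facts about a model, a modelled distribution and a reconstruction which make
convolution with the kernel well defined. -/
structure KernelInput (M : 𝒯.Model S W) (K : ℝ → Pt d → Pt d → ℝ) (βbar δ CK ζ γ : ℝ)
    (U U' : Weight d) (f : Pt d → 𝒯.Sp) (Λ : ℝ → Pt d → ℝ) : Prop where
  kernel : S.IsRegularizingKernel βbar δ CK K
  weight : S.IsGControlled U
  weight' : S.IsGControlled U'
  besov : S.MemBesov ζ U Λ
  besov_Pi : ∀ {τ : 𝒯.Sp}, 𝒯.Below γ τ → ∀ x, S.MemBesov ζ U' (M.Pi x τ)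
  pos : 0 < βbar + ζ
  below : ∀ x, x 0 ≠ 0 → 𝒯.Below γ (f x)

variable {M : 𝒯.Model S W} {Mbar : 𝒯bar.Model S W} {K : ℝ → Pt d → Pt d → ℝ}
  {β βbar δ CK ζ γ : ℝ} {f : Pt d → 𝒯.Sp} {Λ : ℝ → Pt d → ℝ} {X : PolynomialSector 𝒯bar S}
  {I : AbstractIntegration 𝒯 𝒯bar β}

theorem Pi_eq_sum (M : 𝒯.Model S W) (x : Pt d) {τ : 𝒯.Sp} (h : 𝒯.Below γ τ) :
    M.Pi x τ = ∑ α ∈ 𝒯.idx γ, M.Pi x (DFinsupp.single α (τ α)) := by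
  conv_lhs => rw [h.eq_sum]
  rw [map_sum]

namespace KernelInput

theorem regular_Pi (h : KernelInput M K βbar δ CK ζ γ U U' f Λ) {τ : 𝒯.Sp} (hτ : 𝒯.Below γ τ)
    (x : Pt d) : S.KernelRegular δ K (M.Pi x τ) :=
  (h.besov_Pi hτ x).kernelRegular h.weight' h.kernel

theorem regular_single (h : KernelInput M K βbar δ CK ζ γ U U' f Λ) (τ : 𝒯.Sp)
    {α : ℝ} (hα : α ∈ 𝒯.idx γ) (x : Pt d) :
    S.KernelRegular δ K (M.Pi x (DFinsupp.single α (τ α))) :=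
  h.regular_Pi (below_single (mem_idx.1 hα).2 _) x

theorem regular (h : KernelInput M K βbar δ CK ζ γ U U' f Λ) : S.KernelRegular δ K Λ :=
  h.besov.kernelRegular h.weight h.kernel

theorem regular_remainder (h : KernelInput M K βbar δ CK ζ γ U U' f Λ) {x : Pt d} (hx : x 0 ≠ 0) :
    S.KernelRegular δ K (M.remainder f Λ x) :=
  h.regular.sub (h.regular_Pi (h.below x hx) x)

theorem delta_pos (h : KernelInput M K βbar δ CK ζ γ U U' f Λ) : S.wt (0 : Fin d → ℕ) < δ := by
  rw [S.wt_zero]; exact h.kernel.2.1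

theorem integrableOn_zero (h : KernelInput M K βbar δ CK ζ γ U U' f Λ) (y : Pt d) :
    IntegrableOn (fun r => kernelAt K 0 r y Λ) (Ioc 0 1) :=
  (h.besov.kernelConverges h.weight h.kernel h.delta_pos
    (by rw [S.wt_zero, sub_zero]; exact h.pos) y).2

theorem integrableOn_Pi_zero (h : KernelInput M K βbar δ CK ζ γ U U' f Λ) {τ : 𝒯.Sp}
    (hτ : 𝒯.Below γ τ) (x y : Pt d) :
    IntegrableOn (fun r => kernelAt K 0 r y (M.Pi x τ)) (Ioc 0 1) :=
  ((h.besov_Pi hτ x).kernelConverges h.weight' h.kernel h.delta_pos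
    (by rw [S.wt_zero, sub_zero]; exact h.pos) y).2

theorem integrableOn_remainder_zero (h : KernelInput M K βbar δ CK ζ γ U U' f Λ) {x : Pt d}
    (hx : x 0 ≠ 0) (y : Pt d) :
    IntegrableOn (fun r => kernelAt K 0 r y (M.remainder f Λ x)) (Ioc 0 1) :=
  ((h.integrableOn_zero y).sub (h.integrableOn_Pi_zero (h.below x hx) x y)).congr_fun
    (fun _ hr => (h.regular.kernelAt_sub (h.regular_Pi (h.below x hx) x) h.delta_pos hr y).symm)
    measurableSet_Ioc

theorem integrable_Q_kernelFun_Pi (h : KernelInput M K βbar δ CK ζ γ U U' f Λ) {τ : 𝒯.Sp}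
    (hτ : 𝒯.Below γ τ) (x : Pt d) {t : ℝ} (ht : t ∈ Ioc (0 : ℝ) 1) (y : Pt d) :
    Integrable fun z => S.Q t y z * kernelFun K (M.Pi x τ) z := by
  obtain ⟨hc, B, hB⟩ := (h.besov_Pi hτ x).kernelFun_memC h.weight' h.kernel h.pos
  exact GSemigroup.integrable_Q_mul h.weight' hc.measurable hB ht y

theorem integrable_Q_kernelFun (h : KernelInput M K βbar δ CK ζ γ U U' f Λ) {t : ℝ}
    (ht : t ∈ Ioc (0 : ℝ) 1) (y : Pt d) :
    Integrable fun z => S.Q t y z * kernelFun K Λ z := by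
  obtain ⟨hc, B, hB⟩ := h.besov.kernelFun_memC h.weight h.kernel h.pos
  exact GSemigroup.integrable_Q_mul h.weight hc.measurable hB ht y

theorem kernelFun_remainder (h : KernelInput M K βbar δ CK ζ γ U U' f Λ) {x : Pt d}
    (hx : x 0 ≠ 0) (y : Pt d) : kernelFun K (M.remainder f Λ x) y =
      kernelFun K Λ y - ∑ α ∈ 𝒯.idx γ, kernelFun K (M.Pi x (DFinsupp.single α (f x α))) y := by
  have hb := h.below x hx
  unfold kernelFun remainder
  rw [h.regular.kernelInt_sub (h.regular_Pi hb x) h.delta_pos (h.integrableOn_zero y)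
    (h.integrableOn_Pi_zero hb x y), M.Pi_eq_sum x hb,
    GSemigroup.KernelRegular.kernelInt_sum _ (fun α hα => h.regular_single (f x) hα x) h.delta_pos]
  exact fun α hα => h.integrableOn_Pi_zero (below_single (mem_idx.1 hα).2 _) x y

theorem integrable_Q_sum_mpow (h : KernelInput M K βbar δ CK ζ γ U U' f Λ) {t : ℝ}
    (ht : t ∈ Ioc (0 : ℝ) 1) (x : Pt d) (s : Finset (Fin d → ℕ)) (c : (Fin d → ℕ) → ℝ) :
    Integrable (fun z => S.Q t x z * ∑ k ∈ s, mpow (z - x) k / mfact k * c k) ∧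
      ∫ z, S.Q t x z * ∑ k ∈ s, mpow (z - x) k / mfact k * c k =
        ∑ k ∈ s, c k / mfact k * S.ofFun (fun z => mpow (z - x) k) t x := by
  have h1 : ∀ k ∈ s, Integrable fun z => c k / mfact k * (S.Q t x z * mpow (z - x) k) :=
    fun k _ => (GSemigroup.integrable_Q_mpow h.weight.controls_one ht x k).const_mul _
  have h2 : (fun z => S.Q t x z * ∑ k ∈ s, mpow (z - x) k / mfact k * c k) =
      fun z => ∑ k ∈ s, c k / mfact k * (S.Q t x z * mpow (z - x) k) := by
    funext z
    rw [Finset.mul_sum]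
    exact Finset.sum_congr rfl fun k _ => by ring
  rw [h2, integral_finsetSum s h1]
  exact ⟨integrable_finsetSum s h1, Finset.sum_congr rfl fun k _ => integral_const_mul _ _⟩

theorem integrable_Q_taylorRemainder (h : KernelInput M K βbar δ CK ζ γ U U' f Λ) {x : Pt d}
    (hx : x 0 ≠ 0) {t : ℝ} (ht : t ∈ Ioc (0 : ℝ) 1) (c : ℝ) :
    Integrable fun y => S.Q t x y * S.taylorRemainder K c (M.remainder f Λ x) x y := by
  have h1 := (h.integrable_Q_kernelFun ht x).sub (integrable_finsetSum (𝒯.idx γ) fun α hα =>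
    h.integrable_Q_kernelFun_Pi (below_single (mem_idx.1 hα).2 (f x α)) x ht x)
  have h2 := (h.integrable_Q_sum_mpow ht x (S.below c)
    fun k => kernelInt K k x (M.remainder f Λ x)).1
  refine (h1.sub h2).congr (Eventually.of_forall fun y => ?_)
  simp only [Pi.sub_apply, GSemigroup.taylorRemainder, h.kernelFun_remainder hx]
  rw [← Finset.mul_sum]
  ring

/-- Indices between γ and δ−β contribute nothing, since the corresponding components of τ vanish. -/
theorem schauderJ_eq (M : 𝒯.Model S W) (hβ : β ≤ βbar) (hδ : γ + βbar < δ) (x : Pt d) {τ : 𝒯.Sp}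
    (hτ : 𝒯.Below γ τ) : schauderJ K β δ X M x τ = ∑ α ∈ 𝒯.idx γ, ∑ k ∈ S.below (α + β),
      (kernelInt K k x (M.Pi x (DFinsupp.single α (τ α))) / mfact k) • X.mono k := by
  symm
  refine Finset.sum_subset (fun α hα => ?_) fun α hα hα' => ?_
  · obtain ⟨h1, h2⟩ := mem_idx.1 hα
    exact (mem_idx (𝒯 := 𝒯)).2 ⟨h1, by linarith⟩
  · have h1 : τ α = 0 := by
      by_contra hne
      refine hα' (mem_idx.2 ⟨((mem_idx (𝒯 := 𝒯)).1 hα).1, ?_⟩)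
      by_contra hcon
      exact hne (hτ α (not_lt.1 hcon))
    refine Finset.sum_eq_zero fun k _ => ?_
    rw [h1, DFinsupp.single_zero, map_zero, GSemigroup.kernelInt_zero, zero_div, zero_smul]

/-- The remainder of `𝒦f` is the convolution of a Taylor remainder. -/
theorem remainder_schauderK (h : KernelInput M K βbar δ CK ζ γ U U' f Λ) (hβ : β ≤ βbar)
    (hδ : γ + βbar < δ) (hadm : IsKAdmissible K βbar β δ X I M Mbar) {x : Pt d} (hx : x 0 ≠ 0)
    {t : ℝ} (ht : t ∈ Ioc (0 : ℝ) 1) :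
    Mbar.remainder (schauderK K β δ γ X I M f Λ) (S.ofFun (kernelFun K Λ)) x t x =
      ∫ y, S.Q t x y * S.taylorRemainder K (γ + β) (M.remainder f Λ x) x y := by
  have hb := h.below x hx
  have hX : ∀ k, Mbar.Pi x (X.mono k) t x = S.ofFun (fun z => mpow (z - x) k) t x :=
    fun k => hadm.1.1 k x t ht x
  have hI : Mbar.Pi x (I.map (f x)) t x = ∑ α ∈ 𝒯.idx γ,
      ((∫ z, S.Q t x z * kernelFun K (M.Pi x (DFinsupp.single α (f x α))) z) -
        ∑ k ∈ S.below (α + β), kernelInt K k x (M.Pi x (DFinsupp.single α (f x α))) / mfact k *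
          S.ofFun (fun z => mpow (z - x) k) t x) := by
    conv_lhs => rw [hb.eq_sum]
    rw [map_sum, map_sum, Finset.sum_apply, Finset.sum_apply]
    refine Finset.sum_congr rfl fun α hα => ?_
    obtain ⟨hA, hlt⟩ := mem_idx.1 hα
    rw [hadm.2.2 α hA (by linarith) (f x α) x t ht x]
    obtain ⟨i1, i2⟩ := h.integrable_Q_sum_mpow ht x (S.below (α + β))
      fun k => kernelInt K k x (M.Pi x (DFinsupp.single α (f x α)))
    rw [← i2, ← integral_sub (h.integrable_Q_kernelFun_Pi (below_single hlt _) x ht x) i1]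
    exact integral_congr_ae (Eventually.of_forall fun z => by simp only; ring)
  have hJ : Mbar.Pi x (schauderJ K β δ X M x (f x)) t x = ∑ α ∈ 𝒯.idx γ,
      ∑ k ∈ S.below (α + β), kernelInt K k x (M.Pi x (DFinsupp.single α (f x α))) / mfact k *
          S.ofFun (fun z => mpow (z - x) k) t x := by
    rw [schauderJ_eq M hβ hδ x hb]
    simp only [map_sum, map_smul, Finset.sum_apply, Pi.smul_apply, smul_eq_mul, hX]
  have hN : Mbar.Pi x (schauderN K β γ X M f Λ x) t x = ∑ k ∈ S.below (γ + β),
      kernelInt K k x (M.remainder f Λ x) / mfact k *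
          S.ofFun (fun z => mpow (z - x) k) t x := by
    simp only [schauderN, map_sum, map_smul, Finset.sum_apply, Pi.smul_apply, smul_eq_mul, hX]
    rfl
  -- The polynomials with |k| < α+β subtracted in Π̄_x ℐ cancel against those of 𝒥. What remains is
  -- K applied to the components of Π_x f(x), and the Taylor polynomial of K(·,Λ_x).
  have hK : Mbar.Pi x (schauderK K β δ γ X I M f Λ x) t x =
      (∑ α ∈ 𝒯.idx γ, ∫ z, S.Q t x z * kernelFun K (M.Pi x (DFinsupp.single α (f x α))) z) +
        ∑ k ∈ S.below (γ + β), kernelInt K k x (M.remainder f Λ x) / mfact k *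
          S.ofFun (fun z => mpow (z - x) k) t x := by
    rw [schauderK, map_add, map_add, Pi.add_apply, Pi.add_apply, Pi.add_apply, Pi.add_apply, hI, hJ,
      hN, Finset.sum_sub_distrib]
    ring
  have i0 := h.integrable_Q_kernelFun ht x
  have i1 : ∀ α ∈ 𝒯.idx γ, Integrable fun z =>
      S.Q t x z * kernelFun K (M.Pi x (DFinsupp.single α (f x α))) z :=
    fun α hα => h.integrable_Q_kernelFun_Pi (below_single (mem_idx.1 hα).2 _) x ht x
  obtain ⟨i2, i3⟩ := h.integrable_Q_sum_mpow ht x (S.below (γ + β))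
    fun k => kernelInt K k x (M.remainder f Λ x)
  have e : ∀ z, S.Q t x z * S.taylorRemainder K (γ + β) (M.remainder f Λ x) x z =
      S.Q t x z * kernelFun K Λ z -
        ∑ α ∈ 𝒯.idx γ, S.Q t x z * kernelFun K (M.Pi x (DFinsupp.single α (f x α))) z -
        S.Q t x z * ∑ k ∈ S.below (γ + β), mpow (z - x) k / mfact k *
          kernelInt K k x (M.remainder f Λ x) := fun z => by
    rw [GSemigroup.taylorRemainder, h.kernelFun_remainder hx, ← Finset.mul_sum]
    ring
  simp only [e]
  have i01 : Integrable fun z => S.Q t x z * kernelFun K Λ z -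
      ∑ α ∈ 𝒯.idx γ, S.Q t x z * kernelFun K (M.Pi x (DFinsupp.single α (f x α))) z :=
    i0.sub (integrable_finsetSum _ i1)
  rw [integral_sub i01 i2,
    integral_sub i0 (integrable_finsetSum _ i1), integral_finsetSum _ i1, i3]
  change S.ofFun (kernelFun K Λ) t x - Mbar.Pi x (schauderK K β δ γ X I M f Λ x) t x = _
  rw [hK, GSemigroup.ofFun]
  ring

end KernelInput

end RegularityStructure.Model

theorem mchoose_add_div {d : ℕ} (k l : Fin d → ℕ) :
    mchoose (k + l) l / mfact (k + l) = 1 / (mfact k * mfact l) := by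
  unfold mchoose mfact
  rw [← Finset.prod_mul_distrib, ← Finset.prod_div_distrib, one_div, ← Finset.prod_inv_distrib]
  refine Finset.prod_congr rfl fun i _ => ?_
  have h := Nat.add_choose_mul_factorial_mul_factorial (k i) (l i)
  have h' : (((k i + l i).choose (l i) : ℕ) : ℝ) * (k i).factorial * (l i).factorial =
      (k i + l i).factorial := by exact_mod_cast h
  have h1 : ((k i).factorial : ℝ) ≠ 0 := by positivity
  have h2 : ((l i).factorial : ℝ) ≠ 0 := by positivity
  have h3 : ((k i + l i).factorial : ℝ) ≠ 0 := by positivity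
  simp only [Pi.add_apply]
  field_simp
  linarith

/-! ### Polynomial coefficients of 𝒦f and of its increments. -/

namespace RegularityStructure.Model

variable {A Abar : Set ℝ} {𝒯 : RegularityStructure.{u₁} A} {𝒯bar : RegularityStructure.{u₂} Abar}
  {d : ℕ} {S : GSemigroup d} {W U U' : Weight d}

/-- Convolution of `Π_y τ` with the kernel at the base point. -/
theorem exists_kernelAt_Pi_le (M : 𝒯.Model S W) (hW : S.IsGControlled W)
    (hg : S.Controls (fun x => W.star x * W.star (-x))) {βbar δ CK : ℝ}
    {K : ℝ → Pt d → Pt d → ℝ} (hK : S.IsRegularizingKernel βbar δ CK K) (γ : ℝ) {k : Fin d → ℕ}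
    (hk : S.wt k < δ) :
    ∃ C : ℝ, 0 ≤ C ∧ ∀ α ∈ 𝒯.idx γ, ∀ (τ : 𝒯.T α), ∀ r ∈ Ioc (0 : ℝ) 1, ∀ y,
      |kernelAt K k r y (M.Pi y (DFinsupp.single α τ))| ≤
        C * ((W.w y)⁻¹ * (W.w y)⁻¹) * ‖τ‖ * r ^ ((βbar - S.wt k + α) / S.ℓ - 1) := by
  obtain ⟨N, hN, hP⟩ := M.exists_piBound hW γ
  obtain ⟨L, hL, hG⟩ := M.exists_gamBound hW γ
  have hm : ∀ p : ℝ, ∃ C : ℝ, 0 ≤ C ∧ (0 ≤ p → ∀ t ∈ Ioc (0 : ℝ) 1, ∀ x,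
      Integrable (fun z => S.Gt t (x - z) * (W.star (x - z) * W.star (-(x - z))) *
        S.size (x - z) ^ p) ∧
      ∫ z, S.Gt t (x - z) * (W.star (x - z) * W.star (-(x - z))) * S.size (x - z) ^ p ≤
        C * t ^ (p / S.ℓ)) := fun p => by
    by_cases hp : 0 ≤ p
    · obtain ⟨C, h0, h⟩ := hg.moment hp
      exact ⟨C, h0, fun _ => h⟩
    · exact ⟨0, le_rfl, fun h => absurd h hp⟩
  choose Cm hCm0 hCm using hm
  set T := (𝒯.idx γ ×ˢ 𝒯.idx γ).filter (fun p : ℝ × ℝ => p.2 ≤ p.1)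
  have hCK := hK.CK_pos
  refine ⟨∑ p ∈ T, CK * (N * (1 + L)) * Cm (p.1 - p.2) *
    (1 / 2) ^ ((βbar - S.wt k + p.1) / S.ℓ - 1), Finset.sum_nonneg fun p _ => by
      have := hCm0 (p.1 - p.2); positivity, fun α hα τ r hr y => ?_⟩
  have hs := GSemigroup.half_mem hr
  have hspos := hs.1
  set s := r / 2 with hsdef
  set σ : 𝒯.Sp := DFinsupp.single α τ with hσ
  have hσb : 𝒯.Below γ σ := below_single (mem_idx.1 hα).2 τ
  have hwy := inv_pos.2 (hW.w_pos y)
  set κ := (βbar - S.wt k) / S.ℓ - 1 with hκ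
  have hΓ0 : 𝒯.GamBound S W γ (fun x y τ => M.Gam x y τ - M.Gam x y τ) 0 := by
    intro α _ β' _ _ _ x' y' τ
    simp
  have hP0 : 𝒯.PiBound S W γ (fun x τ => M.Pi x τ - M.Pi x τ) 0 := by
    intro α _ _ t _ x' τ
    simp
  let D : ℝ × ℝ → Pt d → ℝ := fun p z =>
    (CK * s ^ κ * ((W.w y)⁻¹ * (W.w y)⁻¹) * (N * (1 + L)) * (s ^ (p.2 / S.ℓ) * ‖σ p.1‖)) *
      (S.Gt s (y - z) * (W.star (y - z) * W.star (-(y - z))) * S.size (y - z) ^ (p.1 - p.2))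
  have hTp : ∀ p ∈ T, 0 ≤ p.1 - p.2 := fun p hp => sub_nonneg.2 (Finset.mem_filter.1 hp).2
  have hDI : ∀ p ∈ T, Integrable (D p) := fun p hp =>
    ((hCm _ (hTp p hp) s hs y).1).const_mul _
  have hle : ∀ z, ‖kernelDeriv K k s y z * M.Pi y σ s z‖ ≤ ∑ p ∈ T, D p z := fun z => by
    -- The model is compared with itself and σ with 0, which turns the difference estimate into a
    -- bound on Π_yσ away from y.
    have h1 := abs_Pi_sub_offCentre_le hW hN le_rfl hL hL le_rfl hP hP0 hG hG hΓ0 hσb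
      (below_zero (𝒯 := 𝒯) γ) hs y z
    simp only [map_zero, sub_zero, Pi.zero_apply, DFinsupp.zero_apply, norm_zero, mul_zero,
      add_zero] at h1
    have h2 := hK.bound hk hs.1 y z
    have hwz := inv_pos.2 (hW.w_pos z)
    have hwz' := hW.w_pos z
    have hwy' := hW.w_pos y
    have a1 := hW.inv_le y z
    have hG0 := S.Gt_nonneg hs.1 (y - z)
    have hst := hW.one_le_star (z - y)
    have hst2 := hW.one_le_star (y - z)
    have hs0 := Real.rpow_nonneg hs.1.le κ
    set Z := ∑ p ∈ T, s ^ (p.2 / S.ℓ) * S.size (z - y) ^ (p.1 - p.2) *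
      (N * ((1 + L) * ‖σ p.1‖)) with hZ
    have hZ0 : 0 ≤ Z := Finset.sum_nonneg fun p _ => by
      have := Real.rpow_nonneg (S.size_nonneg (z - y)) (p.1 - p.2)
      have := Real.rpow_nonneg hs.1.le (p.2 / S.ℓ)
      positivity
    rw [Real.norm_eq_abs, abs_mul]
    calc |kernelDeriv K k s y z| * |M.Pi y σ s z|
        = |kernelDeriv K k s y z| * ((W.w z)⁻¹ * (W.w y)⁻¹ *
          (W.w z * W.w y * |M.Pi y σ s z|)) := by field_simp
      _ ≤ (CK * s ^ κ * S.Gt s (y - z)) * ((W.star (y - z) * (W.w y)⁻¹) * (W.w y)⁻¹ *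
          (W.star (z - y) * Z)) := by gcongr
      _ = _ := by
        rw [hZ, Finset.mul_sum, Finset.mul_sum, Finset.mul_sum]
        refine Finset.sum_congr rfl fun p _ => ?_
        simp only [D]
        rw [S.size_sub_comm z y, neg_sub]
        ring
  have h3 := norm_integral_le_of_norm_le (integrable_finsetSum T hDI)
    (Eventually.of_forall hle)
  rw [Real.norm_eq_abs, integral_finsetSum T hDI] at h3
  refine h3.trans ?_
  rw [Finset.sum_mul, Finset.sum_mul, Finset.sum_mul]
  refine Finset.sum_le_sum fun p hp => ?_
  rw [integral_const_mul]
  have h4 := (hCm _ (hTp p hp) s hs y).2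
  have hs0 := Real.rpow_nonneg hs.1.le κ
  have hs1 := Real.rpow_nonneg hs.1.le (p.2 / S.ℓ)
  have h5 : s ^ (p.2 / S.ℓ) * s ^ ((p.1 - p.2) / S.ℓ) * s ^ κ =
      s ^ ((βbar - S.wt k + p.1) / S.ℓ - 1) := by
    rw [← Real.rpow_add hs.1, ← Real.rpow_add hs.1]
    congr 1
    rw [hκ]
    ring
  have h6 : s ^ ((βbar - S.wt k + p.1) / S.ℓ - 1) * ‖σ p.1‖ ≤
      (1 / 2) ^ ((βbar - S.wt k + p.1) / S.ℓ - 1) *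
        (r ^ ((βbar - S.wt k + α) / S.ℓ - 1) * ‖τ‖) := by
    -- σ is homogeneous, so only the pairs with first entry α contribute, and the exponent of r is
    -- the expected one.
    by_cases hpα : p.1 = α
    · have : ‖σ p.1‖ = ‖τ‖ := by
        rw [hpα, hσ, DFinsupp.single_eq_same]
      rw [this, ← mul_assoc, hpα]
      refine mul_le_mul_of_nonneg_right (GSemigroup.half_rpow_le hr.1 le_rfl) (norm_nonneg _)
    · rw [hσ, DFinsupp.single_eq_of_ne hpα, norm_zero, mul_zero]
      have := Real.rpow_nonneg hr.1.le ((βbar - S.wt k + α) / S.ℓ - 1)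
      positivity
  have hC0 := hCm0 (p.1 - p.2)
  calc _ ≤ (CK * s ^ κ * ((W.w y)⁻¹ * (W.w y)⁻¹) * (N * (1 + L)) *
        (s ^ (p.2 / S.ℓ) * ‖σ p.1‖)) * (Cm (p.1 - p.2) * s ^ ((p.1 - p.2) / S.ℓ)) :=
        mul_le_mul_of_nonneg_left h4 (by positivity)
    _ = CK * (N * (1 + L)) * Cm (p.1 - p.2) * ((W.w y)⁻¹ * (W.w y)⁻¹) *
        ((s ^ (p.2 / S.ℓ) * s ^ ((p.1 - p.2) / S.ℓ) * s ^ κ) * ‖σ p.1‖) := by ring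
    _ ≤ CK * (N * (1 + L)) * Cm (p.1 - p.2) * ((W.w y)⁻¹ * (W.w y)⁻¹) *
        ((1 / 2) ^ ((βbar - S.wt k + p.1) / S.ℓ - 1) *
          (r ^ ((βbar - S.wt k + α) / S.ℓ - 1) * ‖τ‖)) := by
        rw [h5]
        exact mul_le_mul_of_nonneg_left h6 (by positivity)
    _ = _ := by ring

variable [NeZero d]

/-- The polynomial coefficients of `𝒦f`. -/
noncomputable def polyCoeff (M : 𝒯.Model S W) (K : ℝ → Pt d → Pt d → ℝ) (β γ : ℝ)
    (f : Pt d → 𝒯.Sp) (Λ : ℝ → Pt d → ℝ) (k : Fin d → ℕ) (x : Pt d) : ℝ :=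
  ∑ α ∈ (𝒯.idx γ).filter (fun α => S.wt k < α + β),
      kernelInt K k x (M.Pi x (DFinsupp.single α (f x α))) +
    kernelInt K k x (M.remainder f Λ x)

/-- The polynomial coefficients of the increments of `𝒦f`. -/
noncomputable def incrCoeff (M : 𝒯.Model S W) (K : ℝ → Pt d → Pt d → ℝ) (β γ : ℝ)
    (f : Pt d → 𝒯.Sp) (Λ : ℝ → Pt d → ℝ) (k : Fin d → ℕ) (y x : Pt d) : ℝ :=
  ∑ α ∈ (𝒯.idx γ).filter (fun α => S.wt k < α + β),
      kernelInt K k y (M.Pi y (DFinsupp.single α (M.incr f y x α))) +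
    (kernelInt K k y (M.remainder f Λ y) -
      ∑ l ∈ S.below (γ + β - S.wt k),
        mpow (y - x) l / mfact l * kernelInt K (k + l) x (M.remainder f Λ x))

variable {M : 𝒯.Model S W} {Mbar : 𝒯bar.Model S W} {K : ℝ → Pt d → Pt d → ℝ}
  {β βbar δ CK ζ γ : ℝ} {f : Pt d → 𝒯.Sp} {Λ : ℝ → Pt d → ℝ} {X : PolynomialSector 𝒯bar S}
  {I : AbstractIntegration 𝒯 𝒯bar β}

theorem schauderJ_eq_sum_mono (M : 𝒯.Model S W) (hβ : β ≤ βbar) (hδ : γ + βbar < δ) (x : Pt d)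
    {τ : 𝒯.Sp} (hτ : 𝒯.Below γ τ) : schauderJ K β δ X M x τ = ∑ k ∈ S.below (γ + β),
      ((∑ α ∈ (𝒯.idx γ).filter (fun α => S.wt k < α + β),
        kernelInt K k x (M.Pi x (DFinsupp.single α (τ α)))) / mfact k) • X.mono k := by
  rw [KernelInput.schauderJ_eq M hβ hδ x hτ]
  have h1 : ∀ α ∈ 𝒯.idx γ, S.below (α + β) =
      (S.below (γ + β)).filter fun k => S.wt k < α + β := fun α hα => by
    ext k
    rw [Finset.mem_filter, S.mem_below, S.mem_below]
    have := (mem_idx.1 hα).2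
    exact ⟨fun h => ⟨by linarith, h⟩, fun h => h.2⟩
  rw [Finset.sum_congr rfl fun α hα => by rw [h1 α hα, Finset.sum_filter], Finset.sum_comm]
  refine Finset.sum_congr rfl fun k _ => ?_
  rw [Finset.sum_div, Finset.sum_smul, Finset.sum_filter]

theorem schauderK_eq (hβ : β ≤ βbar) (hδ : γ + βbar < δ) {x : Pt d} (hx : 𝒯.Below γ (f x)) :
    schauderK K β δ γ X I M f Λ x = I.map (f x) +
      ∑ k ∈ S.below (γ + β), (M.polyCoeff K β γ f Λ k x / mfact k) • X.mono k := by
  rw [schauderK, schauderJ_eq_sum_mono M hβ hδ x hx, add_assoc, schauderN,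
    ← Finset.sum_add_distrib]
  congr 1
  refine Finset.sum_congr rfl fun k _ => ?_
  rw [polyCoeff, add_div, add_smul]
  rfl

/-- Γ̄ acts on polynomials by the binomial formula, so it re-expands the Taylor polynomial about y:
the coefficient at k collects the derivatives of order k+l. -/
theorem Gam_schauderN (hcomp : IsCompatible K β δ X I M Mbar) (x y : Pt d) :
    Mbar.Gam y x (schauderN K β γ X M f Λ x) = ∑ k ∈ S.below (γ + β),
      ((∑ l ∈ S.below (γ + β - S.wt k),
        mpow (y - x) l / mfact l * kernelInt K (k + l) x (M.remainder f Λ x)) / mfact k) •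
        X.mono k := by
  simp only [schauderN, map_sum, map_smul, hcomp.2.1, Finset.smul_sum, smul_smul, Finset.sum_div,
    Finset.sum_smul]
  rw [Finset.sum_sigma', Finset.sum_sigma']
  -- Substitution m = k+l. The condition l ≤ m is built in, and |m| < γ+β becomes |l| < γ+β−|k|.
  refine Finset.sum_bij' (fun p _ => ⟨p.1 - p.2, p.2⟩) (fun p _ => ⟨p.1 + p.2, p.2⟩) ?_ ?_ ?_ ?_ ?_
  · rintro ⟨m, l⟩ hp
    simp only [Finset.mem_sigma, S.mem_below, Finset.mem_Iic] at hp ⊢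
    obtain ⟨hm, hl⟩ := hp
    have e := S.wt_add (m - l) l
    rw [tsub_add_cancel_of_le hl] at e
    have := S.wt_nonneg l
    exact ⟨by linarith, by linarith⟩
  · rintro ⟨k, l⟩ hp
    simp only [Finset.mem_sigma, S.mem_below, Finset.mem_Iic] at hp ⊢
    rw [S.wt_add]
    exact ⟨by linarith [hp.2], le_add_self⟩
  · rintro ⟨m, l⟩ hp
    simp only [Finset.mem_sigma, Finset.mem_Iic] at hp
    simp only [tsub_add_cancel_of_le hp.2]
  · rintro ⟨k, l⟩ _
    simp only [add_tsub_cancel_right]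
  · rintro ⟨m, l⟩ hp
    simp only [Finset.mem_sigma, Finset.mem_Iic] at hp
    obtain ⟨k, rfl⟩ : ∃ k, m = k + l := ⟨m - l, (tsub_add_cancel_of_le hp.2).symm⟩
    simp only [add_tsub_cancel_right]
    congr 1
    have h1 := mchoose_add_div k l
    have e : M.remainder f Λ x = Λ - M.Pi x (f x) := rfl
    rw [e]
    calc _ = (mchoose (k + l) l / mfact (k + l)) * (mpow (y - x) l *
          kernelInt K (k + l) x (Λ - M.Pi x (f x))) := by ring
      _ = _ := by
        rw [h1]
        have := GSemigroup.one_le_mfact k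
        have := GSemigroup.one_le_mfact l
        field_simp

namespace KernelInput

/-- By compatibility Γ̄_{yx}(ℐ+𝒥(x)) = (ℐ+𝒥(y))Γ_{yx}, so this part of the increment is (ℐ+𝒥(y))
applied to the increment of f. The rest is 𝒩(y) − Γ̄_{yx}𝒩(x), a Taylor remainder of derivatives. -/
theorem incr_schauderK (h : KernelInput M K βbar δ CK ζ γ U U' f Λ) (hβ : β ≤ βbar)
    (hδ : γ + βbar < δ) (hcomp : IsCompatible K β δ X I M Mbar)
    (hint : ∀ α ∈ 𝒯.idx γ, ∀ (τ : 𝒯.T α) (k : Fin d → ℕ), S.wt k < α + β → ∀ y,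
      IntegrableOn (fun r => kernelAt K k r y (M.Pi y (DFinsupp.single α τ))) (Ioc 0 1))
    {x y : Pt d} (hx : x 0 ≠ 0) (hy : y 0 ≠ 0) :
    Mbar.incr (schauderK K β δ γ X I M f Λ) y x = I.map (M.incr f y x) +
      ∑ k ∈ S.below (γ + β), (M.incrCoeff K β γ f Λ k y x / mfact k) • X.mono k := by
  have hbx := h.below x hx
  have hby := h.below y hy
  have hbΓ := M.below_Gam y x hbx
  have e1 := hcomp.2.2 x y (f x) (hbx.mono (by linarith))
  have e2 : schauderJ K β δ X M y (f y) - schauderJ K β δ X M y (M.Gam y x (f x)) =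
      ∑ k ∈ S.below (γ + β), ((∑ α ∈ (𝒯.idx γ).filter (fun α => S.wt k < α + β),
        kernelInt K k y (M.Pi y (DFinsupp.single α (M.incr f y x α)))) / mfact k) • X.mono k := by
    rw [schauderJ_eq_sum_mono M hβ hδ y hby, schauderJ_eq_sum_mono M hβ hδ y hbΓ,
      ← Finset.sum_sub_distrib]
    refine Finset.sum_congr rfl fun k hk => ?_
    rw [← sub_smul, ← sub_div, ← Finset.sum_sub_distrib]
    congr 2
    refine Finset.sum_congr rfl fun α hα => ?_
    obtain ⟨hα1, hα2⟩ := Finset.mem_filter.1 hα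
    have hkδ : S.wt k < δ := by linarith [(mem_idx.1 hα1).2]
    rw [incr, DFinsupp.sub_apply, DFinsupp.single_sub, map_sub,
      (h.regular_single _ hα1 y).kernelInt_sub (h.regular_single _ hα1 y) hkδ
        (hint α hα1 _ k hα2 y) (hint α hα1 _ k hα2 y)]
  have e3 := Gam_schauderN (γ := γ) (f := f) (Λ := Λ) hcomp x y
  have e4 : Mbar.incr (schauderK K β δ γ X I M f Λ) y x = I.map (M.incr f y x) +
      ((schauderJ K β δ X M y (f y) - schauderJ K β δ X M y (M.Gam y x (f x))) +
        (schauderN K β γ X M f Λ y - Mbar.Gam y x (schauderN K β γ X M f Λ x))) := by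
    rw [incr, schauderK, schauderK, map_add (Mbar.Gam y x), e1, incr, map_sub]
    abel
  rw [e4, e2, e3, schauderN, ← Finset.sum_sub_distrib, ← Finset.sum_add_distrib]
  congr 1
  refine Finset.sum_congr rfl fun k _ => ?_
  rw [← sub_smul, ← add_smul, ← sub_div, ← add_div]
  rfl

end KernelInput

end RegularityStructure.Model

/-! ### Power integrals on either side of a cut-off scale. -/

namespace GSemigroup

variable {d : ℕ} {S : GSemigroup d}

/-- The integration uses the exponents with β̄, and c ≤ 1 then permits the loss from β̄ to β. -/
theorem exists_lower_power_le (S : GSemigroup d) {ι : Type*} (s : Finset ι) (e : ι → ℝ)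
    {β βbar : ℝ} (hβ : β ≤ βbar) (he : ∀ i ∈ s, 0 < β + e i) :
    ∃ C : ℝ, 0 ≤ C ∧ ∀ c ∈ Ioc (0 : ℝ) 1, ∀ (B : ι → ℝ) (g : ℝ → ℝ), (∀ i ∈ s, 0 ≤ B i) →
      (∀ r ∈ Ioc 0 c, |g r| ≤ ∑ i ∈ s, B i * r ^ ((βbar + e i) / S.ℓ - 1)) →
      |∫ r in Ioc 0 c, g r| ≤ C * ∑ i ∈ s, B i * c ^ ((β + e i) / S.ℓ) := by
  have hp : ∀ i ∈ s, 0 < (βbar + e i) / S.ℓ := fun i hi =>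
    div_pos (by linarith [he i hi]) S.ℓ_pos
  refine ⟨∑ i ∈ s, |((βbar + e i) / S.ℓ)⁻¹|, Finset.sum_nonneg fun i _ => abs_nonneg _,
    fun c hc B g hB hg => ?_⟩
  refine (abs_setIntegral_le_sum_powers s hp hc.1.le hg).trans ?_
  rw [Finset.mul_sum]
  refine Finset.sum_le_sum fun i hi => ?_
  have h1 : ((βbar + e i) / S.ℓ)⁻¹ ≤ ∑ i ∈ s, |((βbar + e i) / S.ℓ)⁻¹| :=
    (le_abs_self _).trans (Finset.single_le_sum (f := fun i => |((βbar + e i) / S.ℓ)⁻¹|)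
      (fun i _ => abs_nonneg _) hi)
  have h2 : c ^ ((βbar + e i) / S.ℓ) ≤ c ^ ((β + e i) / S.ℓ) :=
    Real.rpow_le_rpow_of_exponent_ge hc.1 hc.2
      (div_le_div_of_nonneg_right (by linarith) S.ℓ_pos.le)
  have h3 := Real.rpow_nonneg hc.1.le ((βbar + e i) / S.ℓ)
  have h4 := inv_nonneg.2 (hp i hi).le
  have h5 := mul_le_mul h1 h2 h3 (h4.trans h1)
  calc _ ≤ B i * _ := mul_le_mul_of_nonneg_left h5 (hB i hi)
    _ = _ := by ring

theorem exists_upper_power_le (S : GSemigroup d) {ι : Type*} (s : Finset ι) (e : ι → ℝ)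
    {β βbar : ℝ} (hβ : β ≤ βbar) (he : ∀ i ∈ s, β < βbar ∨ βbar + e i ≠ 0) :
    ∃ C : ℝ, 0 ≤ C ∧ ∀ c ∈ Ioc (0 : ℝ) 1, ∀ (B : ι → ℝ) (g : ℝ → ℝ), (∀ i ∈ s, 0 ≤ B i) →
      (∀ r ∈ Ioc c 1, |g r| ≤ ∑ i ∈ s, B i * r ^ ((βbar + e i) / S.ℓ - 1)) →
      |∫ r in Ioc c 1, g r| ≤ C * ∑ i ∈ s, B i * c ^ min ((β + e i) / S.ℓ) 0 := by
  -- Each exponent may be lowered from β̄ to any b ≥ β because r ≤ 1. The value β̄ is kept unless it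
  -- gives the exponent 0, and in that case β < β̄ makes b = β admissible.
  have h' : ∀ i, ∃ b, i ∈ s → β ≤ b ∧ b ≤ βbar ∧ b + e i ≠ 0 := fun i => by
    by_cases hi : i ∈ s
    · by_cases h0 : βbar + e i = 0
      · rcases he i hi with h | h
        · exact ⟨β, fun _ => ⟨le_rfl, hβ, by linarith⟩⟩
        · exact absurd h0 h
      · exact ⟨βbar, fun _ => ⟨hβ, le_rfl, h0⟩⟩
    · exact ⟨0, fun h => absurd h hi⟩
  choose b hb using h'
  have hp : ∀ i ∈ s, (b i + e i) / S.ℓ ≠ 0 := fun i hi => div_ne_zero (hb i hi).2.2 S.ℓ_pos.ne'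
  refine ⟨∑ i ∈ s, |(b i + e i) / S.ℓ|⁻¹, Finset.sum_nonneg fun i _ => by positivity,
    fun c hc B g hB hg => ?_⟩
  have hg' : ∀ r ∈ Ioc c 1, |g r| ≤ ∑ i ∈ s, B i * r ^ ((b i + e i) / S.ℓ - 1) := fun r hr => by
    refine (hg r hr).trans (Finset.sum_le_sum fun i hi => mul_le_mul_of_nonneg_left ?_ (hB i hi))
    refine Real.rpow_le_rpow_of_exponent_ge (hc.1.trans hr.1) hr.2 ?_
    have := div_le_div_of_nonneg_right (by linarith [(hb i hi).2.1] : b i + e i ≤ βbar + e i)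
      S.ℓ_pos.le
    linarith
  refine (abs_setIntegral_upper_le_sum_powers s hB hp hc.1 hc.2 hg').trans ?_
  rw [Finset.mul_sum]
  refine Finset.sum_le_sum fun i hi => ?_
  have h1 : |(b i + e i) / S.ℓ|⁻¹ ≤ ∑ i ∈ s, |(b i + e i) / S.ℓ|⁻¹ :=
    Finset.single_le_sum (f := fun i => |(b i + e i) / S.ℓ|⁻¹) (fun i _ => by positivity) hi
  have h2 : c ^ min ((b i + e i) / S.ℓ) 0 ≤ c ^ min ((β + e i) / S.ℓ) 0 :=
    Real.rpow_le_rpow_of_exponent_ge hc.1 hc.2 (min_le_min_right _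
      (div_le_div_of_nonneg_right (by linarith [(hb i hi).1]) S.ℓ_pos.le))
  have h3 := Real.rpow_nonneg hc.1.le (min ((b i + e i) / S.ℓ) 0)
  have h5 := mul_le_mul h1 h2 h3 (Finset.sum_nonneg fun i _ => by positivity)
  calc _ ≤ B i * _ := mul_le_mul_of_nonneg_left h5 (hB i hi)
    _ = _ := by ring

end GSemigroup

theorem integrableOn_Ioc_of_le_rpow {g : ℝ → ℝ} {B p c : ℝ} (hc : 0 < c) (hc1 : c ≤ 1)
    (hm : AEStronglyMeasurable g (volume.restrict (Ioc 0 1)))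
    (hg : ∀ r ∈ Ioc (0 : ℝ) 1, |g r| ≤ B * r ^ p) : IntegrableOn g (Ioc c 1) := by
  have h0 : (0 : ℝ) ∉ uIcc c 1 := by
    rw [uIcc_of_le hc1]; exact fun h => absurd h.1 (not_le.2 hc)
  have h1 := intervalIntegral.intervalIntegrable_rpow (μ := volume) (r := p) (Or.inr h0)
  have hsub : Ioc c 1 ⊆ Ioc (0 : ℝ) 1 := Ioc_subset_Ioc_left hc.le
  refine Integrable.mono' (((intervalIntegrable_iff_integrableOn_Ioc_of_le hc1).1 h1).const_mul B)
    (hm.mono_measure (Measure.restrict_mono hsub le_rfl)) ?_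
  exact (ae_restrict_iff' measurableSet_Ioc).2 (Eventually.of_forall fun r hr => hg r (hsub hr))

/-! ### Homogeneous components of ℐτ plus a polynomial. -/

namespace RegularityStructure

variable {A Abar : Set ℝ} {𝒯 : RegularityStructure.{u₁} A} {𝒯bar : RegularityStructure.{u₂} Abar}
  {d : ℕ} {S : GSemigroup d} {β γ : ℝ}

theorem norm_mono_apply_le (X : PolynomialSector 𝒯bar S) (c : ℝ) (k : Fin d → ℕ) (b : ℝ) :
    ‖((c / mfact k) • X.mono k) b‖ ≤ if S.wt k = b then ‖X.X k‖ * |c| else 0 := by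
  rw [DFinsupp.smul_apply, norm_smul]
  split_ifs with h
  · subst h
    rw [PolynomialSector.mono, DFinsupp.single_eq_same, mul_comm, Real.norm_eq_abs, abs_div]
    refine mul_le_mul_of_nonneg_left (div_le_self (abs_nonneg _) ?_) (norm_nonneg _)
    exact (GSemigroup.one_le_mfact k).trans (le_abs_self _)
  · rw [PolynomialSector.mono, DFinsupp.single_eq_of_ne (Ne.symm h), norm_zero, mul_zero]

theorem norm_map_add_sum_mono_le (X : PolynomialSector 𝒯bar S) (I : AbstractIntegration 𝒯 𝒯bar β)
    {τ : 𝒯.Sp} (hτ : 𝒯.Below γ τ) (s : Finset (Fin d → ℕ)) (c : (Fin d → ℕ) → ℝ) (α : ℝ) :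
    ‖(I.map τ + ∑ k ∈ s, (c k / mfact k) • X.mono k) (α + β)‖ ≤
      (∑ α ∈ 𝒯.idx γ, ‖I α‖) * ‖τ α‖ +
        ∑ k ∈ s, if S.wt k = α + β then ‖X.X k‖ * |c k| else 0 := by
  rw [DFinsupp.add_apply, DFinsupp.finsetSum_apply, I.map_apply]
  refine (norm_add_le _ _).trans (add_le_add ?_ ((norm_sum_le _ _).trans
    (Finset.sum_le_sum fun k _ => norm_mono_apply_le X (c k) k _)))
  by_cases hα : α ∈ 𝒯.idx γ
  · exact ((I α).le_opNorm _).trans (mul_le_mul_of_nonneg_right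
      (Finset.single_le_sum (f := fun α => ‖I α‖) (fun _ _ => norm_nonneg _) hα) (norm_nonneg _))
  · have : τ α = 0 := by
      rw [mem_idx, not_and_or, not_lt] at hα
      rcases hα with h | h
      · exact apply_eq_zero h _
      · exact hτ α h
    rw [this, map_zero, norm_zero, norm_zero, mul_zero]

theorem below_map_add_sum_mono (X : PolynomialSector 𝒯bar S) (I : AbstractIntegration 𝒯 𝒯bar β)
    {τ : 𝒯.Sp} (hτ : 𝒯.Below γ τ) (c : (Fin d → ℕ) → ℝ) :
    𝒯bar.Below (γ + β) (I.map τ + ∑ k ∈ S.below (γ + β), (c k / mfact k) • X.mono k) := by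
  intro b hb
  obtain ⟨α, rfl⟩ : ∃ α, b = α + β := ⟨b - β, by ring⟩
  rw [← norm_le_zero_iff]
  refine (norm_map_add_sum_mono_le X I hτ _ c α).trans (le_of_eq ?_)
  rw [hτ α (by linarith), norm_zero, mul_zero, zero_add]
  refine Finset.sum_eq_zero fun k hk => if_neg ?_
  have := S.mem_below.1 hk
  linarith

end RegularityStructure

/-! ### Growth of 𝒦f near the singular hyperplane. -/

namespace RegularityStructure.Model

variable {A Abar : Set ℝ} {𝒯 : RegularityStructure.{u₁} A} {𝒯bar : RegularityStructure.{u₂} Abar}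
  {d : ℕ} [NeZero d] {S : GSemigroup d} {W V U' : Weight d}
  {M : 𝒯.Model S W} {Mbar : 𝒯bar.Model S W} {K : ℝ → Pt d → Pt d → ℝ}
  {β βbar δ CK ζ γ η Θ Nf : ℝ} {f : Pt d → 𝒯.Sp} {Λ : ℝ → Pt d → ℝ} {X : PolynomialSector 𝒯bar S}
  {I : AbstractIntegration 𝒯 𝒯bar β} {E : Finset ℝ} {g P : Pt d → ℝ}

theorem KernelInput.kernelAt_remainder (h : KernelInput M K βbar δ CK ζ γ (W * V) U' f Λ)
    {x y : Pt d} (hy : y 0 ≠ 0) {k : Fin d → ℕ} (hk : S.wt k < δ) {r : ℝ}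
    (hr : r ∈ Ioc (0 : ℝ) 1) :
    kernelAt K k r x (M.remainder f Λ y) = kernelAt K k r x Λ -
      ∑ α ∈ 𝒯.idx γ, kernelAt K k r x (M.Pi y (DFinsupp.single α (f y α))) := by
  have hb := h.below y hy
  rw [remainder, h.regular.kernelAt_sub (h.regular_Pi hb y) hk hr, M.Pi_eq_sum y hb,
    GSemigroup.KernelRegular.kernelAt_sum _ (fun α hα => h.regular_single _ hα y) hk hr]

/-- The Besov exponent ζ would give convergence only for |k| < ζ+β̄. At its own base point Π_yτ
scales like t^{α/ℓ}, which is enough for all |k| < α+β. -/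
theorem KernelInput.integrableOn_single (h : KernelInput M K βbar δ CK ζ γ (W * V) U' f Λ)
    (hW : S.IsGControlled W) (hg : S.Controls (fun x => W.star x * W.star (-x)))
    (hβ : β ≤ βbar) (hδ : γ + βbar < δ) {α : ℝ} (hα : α ∈ 𝒯.idx γ) (τ : 𝒯.T α)
    (k : Fin d → ℕ) (hk : S.wt k < α + β) (y : Pt d) :
    IntegrableOn (fun r => kernelAt K k r y (M.Pi y (DFinsupp.single α τ))) (Ioc 0 1) := by
  have hαγ := (mem_idx.1 hα).2
  have hkδ : S.wt k < δ := by linarith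
  obtain ⟨C, -, hC⟩ := M.exists_kernelAt_Pi_le hW hg h.kernel γ hkδ
  exact integrableOn_of_le_rpow (div_pos (by linarith : 0 < βbar - S.wt k + α) S.ℓ_pos)
    (h.regular_Pi (below_single hαγ τ) y k hkδ y).2 fun r hr => hC α hα τ r hr y

/-- The growth of the polynomial coefficients of `𝒦f`. -/
theorem KernelInput.exists_polyCoeff_le (h : KernelInput M K βbar δ CK ζ γ (W * V) U' f Λ)
    (hW : S.IsGControlled W) (hV : S.IsGControlled V)
    (hg : S.Controls (fun x => W.star x * W.star (-x)))
    (hsd : S.SchauderData E γ (γ - η) g P (W * W * V).w) (hΘ : 0 ≤ Θ)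
    (hoc : S.OffCentreBound E γ (γ - η) g P (W * W * V).w Θ (M.remainder f Λ))
    (hNf : 0 ≤ Nf) (hf : 𝒯.GrowthBound S V γ η f Nf)
    (hβ : β ≤ βbar) (hδ : γ + βbar < δ) (hζη : ζ ≤ η) (hζA : ∀ α ∈ A, ζ ≤ α)
    (hcrit : β < βbar ∨ ∀ α ∈ A ∪ {γ, ζ}, ∀ k : Fin d → ℕ, α + βbar ≠ S.wt k)
    {k : Fin d → ℕ} (hk : S.wt k < γ + β) :
    ∃ C : ℝ, 0 ≤ C ∧ ∀ x : Pt d, x 0 ≠ 0 → (W * W * V).w x * |M.polyCoeff K β γ f Λ k x| ≤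
      C * S.phi x ^ min (ζ + β - S.wt k) 0 := by
  have hkδ : S.wt k < δ := by linarith
  set q := S.wt k with hq
  obtain ⟨C₁, hC₁0, hC₁⟩ := M.exists_kernelAt_Pi_le hW hg h.kernel γ hkδ
  obtain ⟨C₂, hC₂0, hC₂⟩ := hsd.exists_kernelAt_le βbar δ
  obtain ⟨B, hB0, hB⟩ := h.besov.kernelAt_bound h.weight h.kernel hkδ
  have hCK := h.kernel.CK_pos
  -- F consists of the indices whose Taylor coefficient at k is present in 𝒥; for those in F' the
  -- integral need not converge at small scales.
  set F := (𝒯.idx γ).filter (fun α => q < α + β) with hF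
  set F' := (𝒯.idx γ).filter (fun α => ¬ q < α + β) with hF'
  -- `none` is the remainder Λ_x, of order γ, on small scales, and Λ itself, of order ζ, on large
  -- scales.
  let e : Option ℝ → ℝ := fun o => o.elim (γ - q) (fun α => α - q)
  let e' : Option ℝ → ℝ := fun o => o.elim (ζ - q) (fun α => α - q)
  have he : ∀ i ∈ Finset.insertNone F, 0 < β + e i := by
    rintro (_ | α) hi
    · simp only [e, Option.elim]; linarith
    · have := (Finset.mem_filter.1 (Finset.some_mem_insertNone.1 hi)).2
      simp only [e, Option.elim]; linarith
  have he' : ∀ i ∈ Finset.insertNone F', β < βbar ∨ βbar + e' i ≠ 0 := by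
    refine fun i hi => hcrit.imp_right fun hc => ?_
    rcases i with (_ | α)
    · have := hc ζ (by simp) k
      simp only [e', Option.elim]
      exact fun h0 => this (by rw [← hq]; linarith)
    · have := hc α (Or.inl (mem_idx.1 (Finset.mem_filter.1
        (Finset.some_mem_insertNone.1 hi)).1).1) k
      simp only [e', Option.elim]
      exact fun h0 => this (by rw [← hq]; linarith)
  obtain ⟨D, hD0, hD⟩ := S.exists_lower_power_le (Finset.insertNone F) e hβ he
  obtain ⟨D', hD'0, hD'⟩ := S.exists_upper_power_le (Finset.insertNone F') e' hβ he'
  refine ⟨D * (C₂ * CK * Θ + ∑ α ∈ F, C₁ * Nf) + D' * (B + ∑ α ∈ F', C₁ * Nf), by positivity,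
    fun x hx => ?_⟩
  have hw := hW.w_pos x
  have hv := hV.w_pos x
  have hφ := S.phi_pos hx
  have hφ1 := S.phi_le_one x
  set φ := S.phi x with hφdef
  -- The cut-off is the scale at which the hyperplane x_1 = 0 is seen. Below it the bound on Λ_x is
  -- effective; above it the bound on Λ is better.
  set c := φ ^ S.ℓ with hc
  have hc0 : 0 < c := Real.rpow_pos_of_pos hφ _
  have hc1 : c ≤ 1 := Real.rpow_le_one hφ.le hφ1 S.ℓ_pos.le
  have hcp : ∀ p : ℝ, c ^ (p / S.ℓ) = φ ^ p := fun p => by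
    rw [hc, ← Real.rpow_mul hφ.le, mul_div_cancel₀ _ S.ℓ_pos.ne']
  set u := (W * W * V).w x with hu
  have huE : u = W.w x * W.w x * V.w x := rfl
  have hu0 : 0 < u := by rw [huE]; positivity
  let G : ℝ → ℝ → ℝ := fun α r => kernelAt K k r x (M.Pi x (DFinsupp.single α (f x α)))
  let R : ℝ → ℝ := fun r => kernelAt K k r x (M.remainder f Λ x)
  let bα : ℝ → ℝ := fun α => C₁ * ((W.w x)⁻¹ * (W.w x)⁻¹) * ‖f x α‖
  have hbα : ∀ α, 0 ≤ bα α := fun α => by positivity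
  have hint : ∀ α ∈ F, IntegrableOn (G α) (Ioc 0 1) := fun α hα => by
    obtain ⟨hα1, hα2⟩ := Finset.mem_filter.1 hα
    exact h.integrableOn_single hW hg hβ hδ hα1 _ k hα2 x
  have hintR : IntegrableOn R (Ioc 0 1) :=
    hsd.integrableOn_centre h.kernel hΘ hoc hx (h.regular_remainder hx) hkδ (by linarith)
  have hcoef : M.polyCoeff K β γ f Λ k x = ∫ r in Ioc 0 1, (∑ α ∈ F, G α r + R r) := by
    rw [integral_add (integrable_finsetSum F hint) hintR, integral_finsetSum F hint]
    rfl
  -- The two factors 1/w(x) are cancelled by w² in the weight. The resulting exponent of φ is η+β−q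
  -- or α+β−q, and ζ lies below both η and α.
  have hbnd : ∀ α ∈ 𝒯.idx γ, u * (bα α * φ ^ (β - q + α)) ≤
      C₁ * Nf * φ ^ min (ζ + β - q) 0 := fun α hα => by
    obtain ⟨hαA, hαγ⟩ := mem_idx.1 hα
    have h1 := hf α hαγ x hx
    have h2 : φ ^ min (η - α) 0 * φ ^ (β - q + α) ≤ φ ^ min (ζ + β - q) 0 := by
      rw [← Real.rpow_add hφ]
      refine Real.rpow_le_rpow_of_exponent_ge hφ hφ1 ?_
      have h3 := hζA α hαA
      rcases le_total (η - α) 0 with h4 | h4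
      · rw [min_eq_left h4]; exact (min_le_left _ _).trans (by linarith)
      · rw [min_eq_right h4]; exact (min_le_left _ _).trans (by linarith)
    have h5 := Real.rpow_nonneg hφ.le (β - q + α)
    calc u * (bα α * φ ^ (β - q + α)) = C₁ * (V.w x * ‖f x α‖) * φ ^ (β - q + α) := by
          simp only [bα, huE]; field_simp
      _ ≤ C₁ * (Nf * φ ^ min (η - α) 0) * φ ^ (β - q + α) := by gcongr
      _ = C₁ * Nf * (φ ^ min (η - α) 0 * φ ^ (β - q + α)) := by ring
      _ ≤ _ := mul_le_mul_of_nonneg_left h2 (by positivity)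
  have hlow : u * |∫ r in Ioc 0 c, (∑ α ∈ F, G α r + R r)| ≤
      D * (C₂ * CK * Θ + ∑ α ∈ F, C₁ * Nf) * φ ^ min (ζ + β - q) 0 := by
    let b : Option ℝ → ℝ := fun o => o.elim (C₂ * CK * Θ * u⁻¹ * φ ^ (-(γ - η))) bα
    have hb : ∀ i ∈ Finset.insertNone F, 0 ≤ b i := by
      rintro (_ | α) -
      · have := Real.rpow_nonneg hφ.le (-(γ - η))
        simp only [b, Option.elim]; positivity
      · exact hbα α
    have h1 := hD c ⟨hc0, hc1⟩ b (fun r => ∑ α ∈ F, G α r + R r) hb fun r hr => by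
      have hr1 : r ∈ Ioc (0 : ℝ) 1 := ⟨hr.1, hr.2.trans hc1⟩
      rw [Finset.sum_insertNone, add_comm]
      refine (abs_add_le _ _).trans (add_le_add ?_ ((Finset.abs_sum_le_sum_abs _ _).trans
        (Finset.sum_le_sum fun α hα => ?_)))
      · have := (hC₂ K CK h.kernel Θ _ hΘ hoc x hx r hr1 k hkδ).2.1
        refine this.trans (le_of_eq ?_)
        simp only [b, e, Option.elim]
        rw [show βbar - S.wt k + γ = βbar + (γ - q) by ring]
      · refine (hC₁ α (Finset.mem_filter.1 hα).1 (f x α) r hr1 x).trans (le_of_eq ?_)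
        simp only [b, e, Option.elim, bα]
        rw [show βbar - S.wt k + α = βbar + (α - q) by ring]
    rw [Finset.sum_insertNone] at h1
    simp only [b, e, Option.elim, hcp] at h1
    have h2 : u * (C₂ * CK * Θ * u⁻¹ * φ ^ (-(γ - η)) * φ ^ (β + (γ - q))) ≤
        C₂ * CK * Θ * φ ^ min (ζ + β - q) 0 := by
      have : φ ^ (-(γ - η)) * φ ^ (β + (γ - q)) ≤ φ ^ min (ζ + β - q) 0 := by
        rw [← Real.rpow_add hφ]
        exact Real.rpow_le_rpow_of_exponent_ge hφ hφ1 ((min_le_left _ _).trans (by linarith))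
      calc _ = C₂ * CK * Θ * (φ ^ (-(γ - η)) * φ ^ (β + (γ - q))) := by field_simp
        _ ≤ _ := mul_le_mul_of_nonneg_left this (by positivity)
    have h3 : ∑ α ∈ F, u * (bα α * φ ^ (β + (α - q))) ≤
        ∑ α ∈ F, C₁ * Nf * φ ^ min (ζ + β - q) 0 := Finset.sum_le_sum fun α hα => by
      have := hbnd α (Finset.mem_filter.1 hα).1
      rwa [show β - q + α = β + (α - q) by ring] at this
    calc _ ≤ u * _ := mul_le_mul_of_nonneg_left h1 hu0.le
      _ = D * (u * (C₂ * CK * Θ * u⁻¹ * φ ^ (-(γ - η)) * φ ^ (β + (γ - q))) +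
          ∑ α ∈ F, u * (bα α * φ ^ (β + (α - q)))) := by rw [← Finset.mul_sum]; ring
      _ ≤ D * (C₂ * CK * Θ * φ ^ min (ζ + β - q) 0 +
          ∑ α ∈ F, C₁ * Nf * φ ^ min (ζ + β - q) 0) :=
        mul_le_mul_of_nonneg_left (add_le_add h2 h3) hD0
      _ = _ := by rw [← Finset.sum_mul]; ring
  have hup : u * |∫ r in Ioc c 1, (∑ α ∈ F, G α r + R r)| ≤
      D' * (B + ∑ α ∈ F', C₁ * Nf) * φ ^ min (ζ + β - q) 0 := by
    let b : Option ℝ → ℝ := fun o => o.elim (B * (W.w x * V.w x)⁻¹) bα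
    have hb : ∀ i ∈ Finset.insertNone F', 0 ≤ b i := by
      rintro (_ | α) -
      · simp only [b, Option.elim]; positivity
      · exact hbα α
    have h1 := hD' c ⟨hc0, hc1⟩ b (fun r => ∑ α ∈ F, G α r + R r) hb fun r hr => by
      have hr1 : r ∈ Ioc (0 : ℝ) 1 := ⟨hc0.trans hr.1, hr.2⟩
      -- The terms from F cancel the corresponding part of Π_x f(x) in Λ_x. What is left are terms
      -- whose exponents at large scales favour the lower endpoint.
      have e1 : ∑ α ∈ F, G α r + R r = kernelAt K k r x Λ - ∑ α ∈ F', G α r := by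
        simp only [R, h.kernelAt_remainder hx hkδ hr1]
        rw [← Finset.sum_filter_add_sum_filter_not (𝒯.idx γ) (fun α => q < α + β)]
        ring
      rw [Finset.sum_insertNone, e1]
      refine (abs_sub _ _).trans (add_le_add ?_ ((Finset.abs_sum_le_sum_abs _ _).trans
        (Finset.sum_le_sum fun α hα => ?_)))
      · have := hB r hr1 x
        rw [← le_div_iff₀ (h.weight.w_pos x)] at this
        refine this.trans (le_of_eq ?_)
        simp only [b, e', Option.elim]
        rw [show βbar - S.wt k + ζ = βbar + (ζ - q) by ring, GSemigroup.w_mul]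
        ring
      · refine (hC₁ α (Finset.mem_filter.1 hα).1 (f x α) r hr1 x).trans (le_of_eq ?_)
        simp only [b, e', Option.elim, bα]
        rw [show βbar - S.wt k + α = βbar + (α - q) by ring]
    have hcm : ∀ p : ℝ, c ^ min (p / S.ℓ) 0 = φ ^ min p 0 := fun p => by
      rw [← zero_div S.ℓ, min_div_div_right S.ℓ_pos.le, zero_div, hcp]
    rw [Finset.sum_insertNone] at h1
    simp only [b, e', Option.elim, hcm] at h1
    have h2 : u * (B * (W.w x * V.w x)⁻¹ * φ ^ min (β + (ζ - q)) 0) ≤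
        B * φ ^ min (ζ + β - q) 0 := by
      rw [show β + (ζ - q) = ζ + β - q by ring]
      have := hW.w_le_one x
      have h3 := Real.rpow_nonneg hφ.le (min (ζ + β - q) 0)
      calc _ = W.w x * (B * φ ^ min (ζ + β - q) 0) := by rw [huE]; field_simp
        _ ≤ 1 * (B * φ ^ min (ζ + β - q) 0) := mul_le_mul_of_nonneg_right this (by positivity)
        _ = _ := one_mul _
    have h3 : ∑ α ∈ F', u * (bα α * φ ^ min (β + (α - q)) 0) ≤
        ∑ α ∈ F', C₁ * Nf * φ ^ min (ζ + β - q) 0 := Finset.sum_le_sum fun α hα => by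
      obtain ⟨hα1, hα2⟩ := Finset.mem_filter.1 hα
      have := hbnd α hα1
      rwa [show β - q + α = min (β + (α - q)) 0 by
        rw [min_eq_left (by linarith [not_lt.1 hα2])]; ring] at this
    calc _ ≤ u * _ := mul_le_mul_of_nonneg_left h1 hu0.le
      _ = D' * (u * (B * (W.w x * V.w x)⁻¹ * φ ^ min (β + (ζ - q)) 0) +
          ∑ α ∈ F', u * (bα α * φ ^ min (β + (α - q)) 0)) := by rw [← Finset.mul_sum]; ring
      _ ≤ D' * (B * φ ^ min (ζ + β - q) 0 +
          ∑ α ∈ F', C₁ * Nf * φ ^ min (ζ + β - q) 0) :=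
        mul_le_mul_of_nonneg_left (add_le_add h2 h3) hD'0
      _ = _ := by rw [← Finset.sum_mul]; ring
  rw [hcoef, setIntegral_Ioc_split (g := fun r => ∑ α ∈ F, G α r + R r) hc0.le hc1
    ((integrable_finsetSum F hint).add hintR)]
  calc _ ≤ u * (_ + _) := mul_le_mul_of_nonneg_left (abs_add_le _ _) hu0.le
    _ = _ + _ := mul_add _ _ _
    _ ≤ _ := add_le_add hlow hup
    _ = _ := by ring

/-- `𝒦f` has finite growth norm. -/
theorem KernelInput.exists_growthBound (h : KernelInput M K βbar δ CK ζ γ (W * V) U' f Λ)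
    (hW : S.IsGControlled W) (hV : S.IsGControlled V)
    (hg : S.Controls (fun x => W.star x * W.star (-x)))
    (hsd : S.SchauderData E γ (γ - η) g P (W * W * V).w) (hΘ : 0 ≤ Θ)
    (hoc : S.OffCentreBound E γ (γ - η) g P (W * W * V).w Θ (M.remainder f Λ))
    (hNf : 0 ≤ Nf) (hf : 𝒯.GrowthBound S V γ η f Nf)
    (hβ : β ≤ βbar) (hδ : γ + βbar < δ) (hζη : ζ ≤ η) (hζA : ∀ α ∈ A, ζ ≤ α)
    (hcrit : β < βbar ∨ ∀ α ∈ A ∪ {γ, ζ}, ∀ k : Fin d → ℕ, α + βbar ≠ S.wt k) :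
    ∃ N : ℝ, 0 ≤ N ∧ 𝒯bar.GrowthBound S (W * W * V) (γ + β) (ζ + β)
      (schauderK K β δ γ X I M f Λ) N := by
  have hC : ∀ k, ∃ C : ℝ, 0 ≤ C ∧ (k ∈ S.below (γ + β) → ∀ x : Pt d, x 0 ≠ 0 →
      (W * W * V).w x * |M.polyCoeff K β γ f Λ k x| ≤
        C * S.phi x ^ min (ζ + β - S.wt k) 0) := fun k => by
    by_cases hk : k ∈ S.below (γ + β)
    · obtain ⟨C, h0, h1⟩ := h.exists_polyCoeff_le hW hV hg hsd hΘ hoc hNf hf hβ hδ hζη hζA hcrit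
        (S.mem_below.1 hk)
      exact ⟨C, h0, fun _ => h1⟩
    · exact ⟨0, le_rfl, fun h => absurd h hk⟩
  choose C hC0 hC using hC
  refine ⟨(∑ α ∈ 𝒯.idx γ, ‖I α‖) * Nf + ∑ k ∈ S.below (γ + β), ‖X.X k‖ * C k,
    add_nonneg (mul_nonneg (Finset.sum_nonneg fun _ _ => norm_nonneg _) hNf)
      (Finset.sum_nonneg fun k _ => mul_nonneg (norm_nonneg _) (hC0 k)), fun b hb x hx => ?_⟩
  obtain ⟨α, rfl⟩ : ∃ α, b = α + β := ⟨b - β, by ring⟩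
  rw [schauderK_eq hβ hδ (h.below x hx)]
  have h1 := norm_map_add_sum_mono_le X I (h.below x hx) (S.below (γ + β))
    (fun k => M.polyCoeff K β γ f Λ k x) α
  have hw := hW.w_pos x
  have hv := hV.w_pos x
  have hu0 : 0 < (W * W * V).w x := mul_pos (mul_pos hw hw) hv
  have hφ := S.phi_pos hx
  have hφ1 := S.phi_le_one x
  have hI0 : 0 ≤ ∑ α ∈ 𝒯.idx γ, ‖I α‖ := Finset.sum_nonneg fun _ _ => norm_nonneg _
  set φ := S.phi x
  have hφ0 := Real.rpow_nonneg hφ.le (min (ζ + β - (α + β)) 0)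
  have h2 : (W * W * V).w x * ‖f x α‖ ≤ Nf * φ ^ min (ζ + β - (α + β)) 0 := by
    have h3 := hf α (by linarith) x hx
    have h4 : φ ^ min (η - α) 0 ≤ φ ^ min (ζ + β - (α + β)) 0 :=
      Real.rpow_le_rpow_of_exponent_ge hφ hφ1 (min_le_min_right _ (by linarith))
    have h5 : (W * W * V).w x ≤ V.w x :=
      mul_le_of_le_one_left hv.le (mul_le_one₀ (hW.w_le_one x) hw.le (hW.w_le_one x))
    exact (mul_le_mul_of_nonneg_right h5 (norm_nonneg _)).trans
      (h3.trans (mul_le_mul_of_nonneg_left h4 hNf))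
  calc _ ≤ (W * W * V).w x * _ := mul_le_mul_of_nonneg_left h1 hu0.le
    _ = (∑ α ∈ 𝒯.idx γ, ‖I α‖) * ((W * W * V).w x * ‖f x α‖) +
        ∑ k ∈ S.below (γ + β), (W * W * V).w x *
          (if S.wt k = α + β then ‖X.X k‖ * |M.polyCoeff K β γ f Λ k x| else 0) := by
      rw [mul_add, Finset.mul_sum]; ring
    _ ≤ (∑ α ∈ 𝒯.idx γ, ‖I α‖) * (Nf * φ ^ min (ζ + β - (α + β)) 0) +
        ∑ k ∈ S.below (γ + β), ‖X.X k‖ * C k * φ ^ min (ζ + β - (α + β)) 0 := by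
      refine add_le_add (mul_le_mul_of_nonneg_left h2 hI0) (Finset.sum_le_sum fun k hk => ?_)
      split_ifs with hkb
      · rw [← hkb]
        calc _ = ‖X.X k‖ * ((W * W * V).w x * |M.polyCoeff K β γ f Λ k x|) := by ring
          _ ≤ ‖X.X k‖ * _ := mul_le_mul_of_nonneg_left (hC k hk x hx) (norm_nonneg _)
          _ = _ := by ring
      · rw [mul_zero]
        exact mul_nonneg (mul_nonneg (norm_nonneg _) (hC0 k)) hφ0
    _ = _ := by rw [← Finset.sum_mul]; ring

end RegularityStructure.Model

/-! ### Increments of 𝒦f. -/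

namespace RegularityStructure.Model

variable {A Abar : Set ℝ} {𝒯 : RegularityStructure.{u₁} A} {𝒯bar : RegularityStructure.{u₂} Abar}
  {d : ℕ} [NeZero d] {S : GSemigroup d} {W V U' : Weight d}
  {M : 𝒯.Model S W} {Mbar : 𝒯bar.Model S W} {K : ℝ → Pt d → Pt d → ℝ}
  {β βbar δ CK ζ γ η Θ Nf : ℝ} {f : Pt d → 𝒯.Sp} {Λ : ℝ → Pt d → ℝ} {X : PolynomialSector 𝒯bar S}
  {I : AbstractIntegration 𝒯 𝒯bar β} {E : Finset ℝ} {g P : Pt d → ℝ}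

/-- The change of base point in `kernelAt` of a remainder. -/
theorem KernelInput.kernelAt_remainder_sub (h : KernelInput M K βbar δ CK ζ γ (W * V) U' f Λ)
    {x y : Pt d} (hx : x 0 ≠ 0) (hy : y 0 ≠ 0) {k : Fin d → ℕ} (hk : S.wt k < δ) {r : ℝ}
    (hr : r ∈ Ioc (0 : ℝ) 1) :
    kernelAt K k r y (M.remainder f Λ y) = kernelAt K k r y (M.remainder f Λ x) -
      ∑ α ∈ 𝒯.idx γ, kernelAt K k r y (M.Pi y (DFinsupp.single α (M.incr f y x α))) := by
  have hb := M.below_incr y x (h.below y hy) (h.below x hx)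
  have h1 : kernelAt K k r y (M.remainder f Λ y) =
      kernelAt K k r y (M.remainder f Λ x - M.Pi y (M.incr f y x)) := by
    refine GSemigroup.kernelAt_congr (fun t ht z => ?_) k hr y
    rw [Pi.sub_apply, Pi.sub_apply, ← M.remainder_sub_remainder f Λ x y z ht]
    ring
  rw [h1, (h.regular_remainder hx).kernelAt_sub (h.regular_Pi hb y) hk hr, M.Pi_eq_sum y hb,
    GSemigroup.KernelRegular.kernelAt_sum _ (fun α hα => h.regular_single _ hα y) hk hr]

theorem min_phi_rpow_anti {x y : Pt d} (hx : x 0 ≠ 0) (hy : y 0 ≠ 0) {p p' : ℝ} (hp : p ≤ 0)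
    (hp' : p' ≤ p) : S.phi x ^ p ≤ min (S.phi x) (S.phi y) ^ p' ∧
      S.phi y ^ p ≤ min (S.phi x) (S.phi y) ^ p' := by
  have hm := lt_min (S.phi_pos hx) (S.phi_pos hy)
  have h1 : min (S.phi x) (S.phi y) ^ p ≤ min (S.phi x) (S.phi y) ^ p' :=
    Real.rpow_le_rpow_of_exponent_ge hm ((min_le_left _ _).trans (S.phi_le_one x)) hp'
  exact ⟨(Real.rpow_le_rpow_of_nonpos hm (min_le_left _ _) hp).trans h1,
    (Real.rpow_le_rpow_of_nonpos hm (min_le_right _ _) hp).trans h1⟩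

/-- The increments of the polynomial coefficients of `𝒦f`. -/
theorem KernelInput.exists_incrCoeff_le (h : KernelInput M K βbar δ CK ζ γ (W * V) U' f Λ)
    (hW : S.IsGControlled W) (hV : S.IsGControlled V) (hWWV : S.IsGControlled (W * W * V))
    (hg : S.Controls (fun x => W.star x * W.star (-x)))
    (hsd : S.SchauderData E γ (γ - η) g P (W * W * V).w) (hΘ : 0 ≤ Θ)
    (hoc : S.OffCentreBound E γ (γ - η) g P (W * W * V).w Θ (M.remainder f Λ))
    (hNf : 0 ≤ Nf) (hf : 𝒯.SharpBound S V γ η (M.incr f) Nf)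
    (hβ : β ≤ βbar) (hδ : γ + βbar < δ) (hηγ : η ≤ γ) (hζη : ζ ≤ η)
    (hcrit : β < βbar ∨ ∀ α ∈ A ∪ {γ, ζ}, ∀ k : Fin d → ℕ, α + βbar ≠ S.wt k)
    {k : Fin d → ℕ} (hk : S.wt k < γ + β) :
    ∃ C : ℝ, 0 ≤ C ∧ ∀ x y : Pt d, x 0 ≠ 0 → y 0 ≠ 0 → x ≠ y →
      (W * W * V).w x * |M.incrCoeff K β γ f Λ k y x| ≤
      C * (min (S.phi x) (S.phi y) ^ (ζ - γ) * (W * W * V).star (x - y) *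
        S.size (y - x) ^ (γ + β - S.wt k)) := by
  have hkδ : S.wt k < δ := by linarith
  have hcritγ : β < βbar ∨ ∀ k : Fin d → ℕ, γ + βbar ≠ S.wt k :=
    hcrit.imp_right fun hc => hc γ (by simp)
  set q := S.wt k with hq
  obtain ⟨C₁, hC₁0, hC₁⟩ := M.exists_kernelAt_Pi_le hW hg h.kernel γ hkδ
  have hR : ∀ l : Fin d → ℕ, ∃ C : ℝ, 0 ≤ C ∧ (l ∈ S.below (γ + β - q) →
      ∀ x : Pt d, x 0 ≠ 0 → ∀ ρ : ℝ, 0 ≤ ρ →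
        |∫ r in Ioc 0 (min 1 (2 * ρ ^ S.ℓ)), kernelAt K (k + l) r x (M.remainder f Λ x)| ≤
        C * ((W * W * V).w x)⁻¹ * S.phi x ^ (-(γ - η)) * ρ ^ (γ + β - S.wt (k + l))) := by
    intro l
    by_cases hl : l ∈ S.below (γ + β - q)
    · have hl' : S.wt (k + l) < γ + β := by
        rw [S.wt_add]
        linarith [S.mem_below.1 hl]
      obtain ⟨C, h0, h1⟩ := hsd.exists_lower_centre_le hβ hδ (k + l) hl'
      exact ⟨C * CK * Θ, mul_nonneg (mul_nonneg h0 h.kernel.CK_pos.le) hΘ,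
        fun _ x hx ρ hρ => h1 K CK h.kernel Θ _ hΘ hoc x hx ρ hρ⟩
    · exact ⟨0, le_rfl, fun h => absurd h hl⟩
  choose C₂ hC₂0 hC₂ using hR
  obtain ⟨C₃, hC₃0, hC₃⟩ := hsd.exists_upper_le hβ hδ hkδ
  have hCK := h.kernel.CK_pos
  set F := (𝒯.idx γ).filter (fun α => q < α + β) with hF
  set F' := (𝒯.idx γ).filter (fun α => ¬ q < α + β) with hF'
  -- Indices in F have β+α−q > 0 and are integrated from 0 to c; indices in F' have β+α−q ≤ 0 and
  -- are integrated from c to 1. Either way the cut-off enters with the power (β+α−q)/ℓ.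
  have hD : ∀ α : ℝ, ∃ D : ℝ, 0 ≤ D ∧ (α ∈ F → ∀ c ∈ Ioc (0 : ℝ) 1, ∀ (B : ℝ) (G : ℝ → ℝ), 0 ≤ B →
      (∀ r ∈ Ioc 0 c, |G r| ≤ B * r ^ ((βbar + (α - q)) / S.ℓ - 1)) →
      |∫ r in Ioc 0 c, G r| ≤ D * (B * c ^ ((β + (α - q)) / S.ℓ))) ∧
      (α ∈ F' → ∀ c ∈ Ioc (0 : ℝ) 1, ∀ (B : ℝ) (G : ℝ → ℝ), 0 ≤ B →
      (∀ r ∈ Ioc c 1, |G r| ≤ B * r ^ ((βbar + (α - q)) / S.ℓ - 1)) →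
      |∫ r in Ioc c 1, G r| ≤ D * (B * c ^ ((β + (α - q)) / S.ℓ))) := by
    intro α
    by_cases hα : α ∈ F
    · obtain ⟨D, h0, h1⟩ := S.exists_lower_power_le {()} (fun _ => α - q) hβ
        (fun _ _ => by linarith [(Finset.mem_filter.1 hα).2])
      refine ⟨D, h0, fun _ c hc B G hB hG => ?_, fun h' =>
        absurd (Finset.mem_filter.1 hα).2 (Finset.mem_filter.1 h').2⟩
      simpa using h1 c hc (fun _ => B) G (fun _ _ => hB) (by simpa using hG)
    · by_cases hα' : α ∈ F'
      · obtain ⟨D, h0, h1⟩ := S.exists_upper_power_le {()} (fun _ => α - q) hβ (fun _ _ =>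
          hcrit.imp_right fun hc h0 => hc α (Or.inl (mem_idx.1 (Finset.mem_filter.1 hα').1).1) k
            (by rw [← hq]; linarith))
        refine ⟨D, h0, fun h' => absurd h' hα, fun _ c hc B G hB hG => ?_⟩
        have h2 := h1 c hc (fun _ => B) G (fun _ _ => hB) (by simpa using hG)
        rw [Finset.sum_singleton, min_eq_left (div_nonpos_of_nonpos_of_nonneg
          (by linarith [not_lt.1 (Finset.mem_filter.1 hα').2]) S.ℓ_pos.le)] at h2
        exact h2
      · exact ⟨0, le_rfl, fun h' => absurd h' hα, fun h' => absurd h' hα'⟩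
  choose D hD0 hDl hDu using hD
  -- The power of 2 comes from the cut-off 2ρ^ℓ.
  let κ : ℝ → ℝ := fun α => D α * (C₁ * Nf) * 2 ^ ((β + (α - q)) / S.ℓ)
  have hκ0 : ∀ α, 0 ≤ κ α := fun α => by have := hD0 α; positivity
  refine ⟨(∑ α ∈ F, κ α + (C₂ 0 + ∑ l ∈ S.below (γ + β - q), C₂ l)) +
    (C₃ * CK * Θ + ∑ α ∈ F', κ α), by
      have h1 := Finset.sum_nonneg fun α (_ : α ∈ F) => hκ0 α
      have h2 := Finset.sum_nonneg fun α (_ : α ∈ F') => hκ0 α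
      have h3 := Finset.sum_nonneg fun l (_ : l ∈ S.below (γ + β - q)) => hC₂0 l
      have h4 := hC₂0 0
      positivity, fun x y hx hy hxy => ?_⟩
  have hρ : 0 < S.size (y - x) := S.size_pos (sub_ne_zero.2 hxy.symm)
  set ρ := S.size (y - x) with hρdef
  obtain ⟨hφx, hφy⟩ := min_phi_rpow_anti (S := S) hx hy (p := -(γ - η)) (p' := ζ - γ) (by linarith)
    (by linarith)
  have hφm := (min_phi_rpow_anti (S := S) hx hy (p := η - γ) (p' := ζ - γ) (by linarith)
    (by linarith))
  have hm : min (S.phi x) (S.phi y) ^ (η - γ) ≤ min (S.phi x) (S.phi y) ^ (ζ - γ) :=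
    Real.rpow_le_rpow_of_exponent_ge (lt_min (S.phi_pos hx) (S.phi_pos hy))
      ((min_le_left _ _).trans (S.phi_le_one x)) (by linarith)
  have hm0 : 0 ≤ min (S.phi x) (S.phi y) ^ (η - γ) :=
    Real.rpow_nonneg (le_min (S.phi_nonneg x) (S.phi_nonneg y)) _
  set m := min (S.phi x) (S.phi y) ^ (ζ - γ) with hmdef
  have hP1 := hWWV.one_le_star (x - y)
  set p := (W * W * V).star (x - y) with hp
  have hu0 := hWWV.w_pos x
  set u := (W * W * V).w x with hu
  have hm0' : 0 ≤ m := hm0.trans hm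
  set T := m * p * ρ ^ (γ + β - q) with hT
  have hT0 : 0 ≤ T := by positivity
  have hcpos : 0 < min 1 (2 * ρ ^ S.ℓ) := lt_min one_pos (by positivity)
  set c := min 1 (2 * ρ ^ S.ℓ) with hc
  have hc1 : c ≤ 1 := min_le_left _ _
  let G : ℝ → ℝ → ℝ := fun α r => kernelAt K k r y (M.Pi y (DFinsupp.single α (M.incr f y x α)))
  let L : ℝ → ℝ := fun r => kernelAt K k r y (M.remainder f Λ y)
  let Q : (Fin d → ℕ) → ℝ → ℝ := fun l r =>
    mpow (y - x) l / mfact l * kernelAt K (k + l) r x (M.remainder f Λ x)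
  let bα : ℝ → ℝ := fun α => C₁ * ((W.w y)⁻¹ * (W.w y)⁻¹) * ‖M.incr f y x α‖
  have hwy := hW.w_pos y
  have hbα : ∀ α, 0 ≤ bα α := fun α => by positivity
  have hG : ∀ α ∈ 𝒯.idx γ, ∀ r ∈ Ioc (0 : ℝ) 1,
      |G α r| ≤ bα α * r ^ ((βbar + (α - q)) / S.ℓ - 1) := fun α hα r hr => by
    have := hC₁ α hα (M.incr f y x α) r hr y
    rwa [show βbar - S.wt k + α = βbar + (α - q) by ring] at this
  have hint : ∀ α ∈ F, IntegrableOn (G α) (Ioc 0 1) := fun α hα => by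
    obtain ⟨hα1, hα2⟩ := Finset.mem_filter.1 hα
    exact h.integrableOn_single hW hg hβ hδ hα1 _ k hα2 y
  have hintL : IntegrableOn L (Ioc 0 1) :=
    hsd.integrableOn_centre h.kernel hΘ hoc hy (h.regular_remainder hy) hkδ (by linarith)
  have hintQ : ∀ l ∈ S.below (γ + β - q), IntegrableOn (Q l) (Ioc 0 1) := fun l hl => by
    have hl' : S.wt (k + l) < γ + β := by
      rw [S.wt_add]
      linarith [S.mem_below.1 hl]
    exact (hsd.integrableOn_centre h.kernel hΘ hoc hx (h.regular_remainder hx) (by linarith)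
      (by linarith)).const_mul _
  have hintLQ : IntegrableOn (fun r => L r - ∑ l ∈ S.below (γ + β - q), Q l r) (Ioc 0 1) :=
    hintL.sub (integrable_finsetSum _ hintQ)
  have hcoef : M.incrCoeff K β γ f Λ k y x = ∫ r in Ioc 0 1,
      (∑ α ∈ F, G α r + (L r - ∑ l ∈ S.below (γ + β - q), Q l r)) := by
    rw [integral_add (integrable_finsetSum F hint) hintLQ, integral_finsetSum F hint,
      integral_sub hintL (integrable_finsetSum _ hintQ), integral_finsetSum _ hintQ]
    simp only [Q, integral_const_mul]
    rfl
  have hintAll : IntegrableOn (fun r => ∑ α ∈ F, G α r + (L r - ∑ l ∈ S.below (γ + β - q), Q l r))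
      (Ioc 0 1) :=
    (integrable_finsetSum F hint).add hintLQ
  -- Π_y costs two factors 1/w(y), whereas the weight is taken at x. Using w(x)/w(y) ≤ w*(x−y) twice
  -- produces exactly the controlling function of w²v.
  have hbnd : ∀ α ∈ 𝒯.idx γ, u * (bα α * ρ ^ (β + (α - q))) ≤ C₁ * Nf * T := fun α hα => by
    obtain ⟨hαA, hαγ⟩ := mem_idx.1 hα
    have h1 := hf α hαγ x y hx hy
    have hwx := hW.w_pos x
    have hinv := hW.inv_le x y
    have hs := hW.one_le_star (x - y)
    have hsv := hV.one_le_star (x - y)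
    have hρ1 := Real.rpow_nonneg hρ.le (γ - α)
    have hρ2 := Real.rpow_nonneg hρ.le (β + (α - q))
    have h4 : W.w x * (W.w y)⁻¹ ≤ W.star (x - y) := by
      calc _ ≤ W.w x * (W.star (x - y) * (W.w x)⁻¹) := mul_le_mul_of_nonneg_left hinv hwx.le
        _ = _ := by field_simp
    have hv := hV.w_pos x
    have hwyi := inv_pos.2 hwy
    calc u * (bα α * ρ ^ (β + (α - q)))
        = C₁ * ((W.w x * (W.w y)⁻¹) * (W.w x * (W.w y)⁻¹)) * (V.w x * ‖M.incr f y x α‖) *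
          ρ ^ (β + (α - q)) := by
          simp only [bα, hu, GSemigroup.w_mul]; ring
      _ ≤ C₁ * (W.star (x - y) * W.star (x - y)) *
          (Nf * (m * V.star (x - y) * ρ ^ (γ - α))) * ρ ^ (β + (α - q)) := by
          refine mul_le_mul_of_nonneg_right (mul_le_mul (by gcongr) (h1.trans (by gcongr))
            (by positivity) (by positivity)) hρ2
      _ = C₁ * Nf * (m * p * (ρ ^ (γ - α) * ρ ^ (β + (α - q)))) := by
          simp only [hp, GSemigroup.star_mul]; ring
      _ = C₁ * Nf * T := by
          rw [← Real.rpow_add hρ, hT, show γ - α + (β + (α - q)) = γ + β - q by ring]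
  have hinvu : u * ((W * W * V).w y)⁻¹ ≤ p := by
    calc _ ≤ u * (p * u⁻¹) := mul_le_mul_of_nonneg_left (hWWV.inv_le x y) hu0.le
      _ = p := by field_simp
  have hlowG : ∀ α ∈ F, u * |∫ r in Ioc 0 c, G α r| ≤ κ α * T := fun α hα => by
    obtain ⟨hα1, hα2⟩ := Finset.mem_filter.1 hα
    have h1 := hDl α hα c ⟨hcpos, hc1⟩ (bα α) (G α) (hbα α)
      fun r hr => hG α hα1 r ⟨hr.1, hr.2.trans hc1⟩
    have h2 : c ^ ((β + (α - q)) / S.ℓ) ≤ 2 ^ ((β + (α - q)) / S.ℓ) * ρ ^ (β + (α - q)) := by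
      rw [← GSemigroup.two_mul_rpow_rpow hρ.le]
      exact Real.rpow_le_rpow hcpos.le (min_le_right _ _)
        (div_nonneg (by linarith) S.ℓ_pos.le)
    have h3 := hD0 α
    have h4 := hbα α
    calc _ ≤ u * (D α * (bα α * (2 ^ ((β + (α - q)) / S.ℓ) * ρ ^ (β + (α - q))))) := by
          refine mul_le_mul_of_nonneg_left (h1.trans ?_) hu0.le
          gcongr
      _ = D α * 2 ^ ((β + (α - q)) / S.ℓ) * (u * (bα α * ρ ^ (β + (α - q)))) := by ring
      _ ≤ D α * 2 ^ ((β + (α - q)) / S.ℓ) * (C₁ * Nf * T) :=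
          mul_le_mul_of_nonneg_left (hbnd α hα1) (by positivity)
      _ = _ := by simp only [κ]; ring
  have hlowL : u * |∫ r in Ioc 0 c, L r| ≤ C₂ 0 * T := by
    have h1 := hC₂ 0 (S.mem_below.2 (by rw [S.wt_zero]; linarith)) y hy ρ hρ.le
    simp only [add_zero] at h1
    have h2 := hC₂0 0
    have h3 := inv_pos.2 (hWWV.w_pos y)
    have h5 := Real.rpow_nonneg (S.phi_nonneg y) (-(γ - η))
    calc _ ≤ u * _ := mul_le_mul_of_nonneg_left h1 hu0.le
      _ = C₂ 0 * ((u * ((W * W * V).w y)⁻¹) * S.phi y ^ (-(γ - η)) * ρ ^ (γ + β - S.wt k)) := by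
          ring
      _ ≤ C₂ 0 * (p * m * ρ ^ (γ + β - S.wt k)) := by gcongr
      _ = _ := by rw [hT]; ring
  have hlowQ : ∀ l ∈ S.below (γ + β - q), u * |∫ r in Ioc 0 c, Q l r| ≤ C₂ l * T := fun l hl => by
    have h1 := hC₂ l hl x hx ρ hρ.le
    have h2 := hC₂0 l
    have h3 := S.abs_mpow_div_le (y - x) l
    have h5 := Real.rpow_nonneg (S.phi_nonneg x) (-(γ - η))
    have h6 : ρ ^ S.wt l * ρ ^ (γ + β - S.wt (k + l)) = ρ ^ (γ + β - q) := by
      rw [← Real.rpow_add hρ, S.wt_add]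
      congr 1
      ring
    rw [integral_const_mul, abs_mul]
    calc _ ≤ u * (ρ ^ S.wt l * (C₂ l * u⁻¹ * S.phi x ^ (-(γ - η)) *
          ρ ^ (γ + β - S.wt (k + l)))) := by gcongr
      _ = C₂ l * (S.phi x ^ (-(γ - η)) * 1 * (ρ ^ S.wt l * ρ ^ (γ + β - S.wt (k + l)))) := by
          field_simp
      _ ≤ C₂ l * (m * p * ρ ^ (γ + β - q)) := by rw [h6]; gcongr
  have hlow : u * |∫ r in Ioc 0 c, (∑ α ∈ F, G α r + (L r - ∑ l ∈ S.below (γ + β - q), Q l r))| ≤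
      (∑ α ∈ F, κ α + (C₂ 0 + ∑ l ∈ S.below (γ + β - q), C₂ l)) * T := by
    have hsub : Ioc 0 c ⊆ Ioc (0 : ℝ) 1 := Ioc_subset_Ioc_right hc1
    have i1 : ∀ α ∈ F, IntegrableOn (G α) (Ioc 0 c) := fun α hα => (hint α hα).mono_set hsub
    have i2 := hintL.mono_set hsub
    have i3 : ∀ l ∈ S.below (γ + β - q), IntegrableOn (Q l) (Ioc 0 c) :=
      fun l hl => (hintQ l hl).mono_set hsub
    have i23 : IntegrableOn (fun r => L r - ∑ l ∈ S.below (γ + β - q), Q l r) (Ioc 0 c) :=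
      i2.sub (integrable_finsetSum _ i3)
    rw [integral_add (integrable_finsetSum F i1) i23,
      integral_finsetSum F i1, integral_sub i2 (integrable_finsetSum _ i3),
      integral_finsetSum _ i3]
    refine (mul_le_mul_of_nonneg_left ((abs_add_le _ _).trans (add_le_add
      (Finset.abs_sum_le_sum_abs _ _) ((abs_sub _ _).trans (add_le_add le_rfl
      (Finset.abs_sum_le_sum_abs _ _))))) hu0.le).trans ?_
    rw [mul_add, mul_add, Finset.mul_sum, Finset.mul_sum, add_mul, add_mul, Finset.sum_mul,
      Finset.sum_mul]
    exact add_le_add (Finset.sum_le_sum hlowG) (add_le_add hlowL (Finset.sum_le_sum hlowQ))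
  have hup : u * |∫ r in Ioc c 1, (∑ α ∈ F, G α r + (L r - ∑ l ∈ S.below (γ + β - q), Q l r))| ≤
      (C₃ * CK * Θ + ∑ α ∈ F', κ α) * T := by
    have hκs : 0 ≤ ∑ α ∈ F', κ α := Finset.sum_nonneg fun α _ => hκ0 α
    -- If 2ρ^ℓ ≥ 1 there are no large scales.
    rcases le_or_gt 1 (2 * ρ ^ S.ℓ) with h1 | h1
    · rw [hc, min_eq_left h1, Ioc_self, setIntegral_empty, abs_zero, mul_zero]
      positivity
    · have hcE : c = 2 * ρ ^ S.ℓ := min_eq_right h1.le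
      have hsub : Ioc c 1 ⊆ Ioc (0 : ℝ) 1 := Ioc_subset_Ioc_left hcpos.le
      have i1 : ∀ α ∈ F', IntegrableOn (G α) (Ioc c 1) := fun α hα => by
        have hα1 := (Finset.mem_filter.1 hα).1
        exact integrableOn_Ioc_of_le_rpow hcpos hc1
          (h.regular_single _ hα1 y k hkδ y).2 (hG α hα1)
      have i2 := hintAll.mono_set hsub
      -- On large scales Λ_y is rewritten through Λ_x. The terms from F cancel, a Taylor remainder
      -- of the single family member Λ_x appears, and only the terms from F' are left over.
      have e1 : ∀ r ∈ Ioc c 1, ∑ α ∈ F, G α r + (L r - ∑ l ∈ S.below (γ + β - q), Q l r) =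
          (kernelAt K k r y (M.remainder f Λ x) - ∑ l ∈ S.below (γ + β - q), Q l r) -
            ∑ α ∈ F', G α r := fun r hr => by
        simp only [L, h.kernelAt_remainder_sub hx hy hkδ (hsub hr)]
        rw [← Finset.sum_filter_add_sum_filter_not (𝒯.idx γ) (fun α => q < α + β)]
        ring
      have i3 : IntegrableOn (fun r => kernelAt K k r y (M.remainder f Λ x) -
          ∑ l ∈ S.below (γ + β - q), Q l r) (Ioc c 1) := by
        refine (i2.add (integrable_finsetSum F' i1)).congr_fun (fun r hr => ?_) measurableSet_Ioc
        simp only [Pi.add_apply, e1 r hr, sub_add_cancel]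
      rw [setIntegral_congr_fun measurableSet_Ioc e1,
        integral_sub i3 (integrable_finsetSum F' i1), integral_finsetSum F' i1]
      have h2 := hC₃ K CK h.kernel hcritγ Θ _ hΘ hoc x hx (h.regular_remainder hx) y hxy.symm h1.le
      rw [← hρdef, ← hcE] at h2
      have h3 : ∀ α ∈ F', u * |∫ r in Ioc c 1, G α r| ≤ κ α * T := fun α hα => by
        have hα1 := (Finset.mem_filter.1 hα).1
        have h4 := hDu α hα c ⟨hcpos, hc1⟩ (bα α) (G α) (hbα α)
          fun r hr => hG α hα1 r (hsub hr)
        rw [hcE, GSemigroup.two_mul_rpow_rpow hρ.le, ← hcE] at h4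
        have h5 := hD0 α
        calc _ ≤ u * (D α * (bα α * (2 ^ ((β + (α - q)) / S.ℓ) * ρ ^ (β + (α - q))))) :=
              mul_le_mul_of_nonneg_left h4 hu0.le
          _ = D α * 2 ^ ((β + (α - q)) / S.ℓ) * (u * (bα α * ρ ^ (β + (α - q)))) := by ring
          _ ≤ D α * 2 ^ ((β + (α - q)) / S.ℓ) * (C₁ * Nf * T) :=
              mul_le_mul_of_nonneg_left (hbnd α hα1) (by positivity)
          _ = _ := by simp only [κ]; ring
      have h6 : u * |∫ r in Ioc c 1, (kernelAt K k r y (M.remainder f Λ x) -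
          ∑ l ∈ S.below (γ + β - q), Q l r)| ≤ C₃ * CK * Θ * T := by
        have h5 := Real.rpow_nonneg (S.phi_nonneg x) (-(γ - η))
        calc _ ≤ u * _ := mul_le_mul_of_nonneg_left h2 hu0.le
          _ = C₃ * CK * Θ * (S.phi x ^ (-(γ - η)) * 1 * ρ ^ (γ + β - q)) := by
            rw [show ∀ a b c : ℝ, u * (a * u⁻¹ * b * c) = a * (b * 1 * c) * (u * u⁻¹) by
              intros; ring, mul_inv_cancel₀ hu0.ne', mul_one]
          _ ≤ C₃ * CK * Θ * (m * p * ρ ^ (γ + β - q)) := by gcongr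
      refine (mul_le_mul_of_nonneg_left ((abs_sub _ _).trans (add_le_add le_rfl
        (Finset.abs_sum_le_sum_abs _ _))) hu0.le).trans ?_
      rw [mul_add, Finset.mul_sum, add_mul, Finset.sum_mul]
      exact add_le_add h6 (Finset.sum_le_sum h3)
  rw [hcoef, setIntegral_Ioc_split hcpos.le hc1 hintAll]
  calc _ ≤ u * (_ + _) := mul_le_mul_of_nonneg_left (abs_add_le _ _) hu0.le
    _ = _ + _ := mul_add _ _ _
    _ ≤ _ := add_le_add hlow hup
    _ = _ := by ring

/-- `𝒦f` has finite increments. -/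
theorem KernelInput.exists_sharpBound (h : KernelInput M K βbar δ CK ζ γ (W * V) U' f Λ)
    (hW : S.IsGControlled W) (hV : S.IsGControlled V) (hWWV : S.IsGControlled (W * W * V))
    (hg : S.Controls (fun x => W.star x * W.star (-x)))
    (hsd : S.SchauderData E γ (γ - η) g P (W * W * V).w) (hΘ : 0 ≤ Θ)
    (hoc : S.OffCentreBound E γ (γ - η) g P (W * W * V).w Θ (M.remainder f Λ))
    (hNf : 0 ≤ Nf) (hf : 𝒯.SharpBound S V γ η (M.incr f) Nf)
    (hβ : β ≤ βbar) (hδ : γ + βbar < δ) (hηγ : η ≤ γ) (hζη : ζ ≤ η)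
    (hcrit : β < βbar ∨ ∀ α ∈ A ∪ {γ, ζ}, ∀ k : Fin d → ℕ, α + βbar ≠ S.wt k)
    (hcomp : IsCompatible K β δ X I M Mbar) :
    ∃ N : ℝ, 0 ≤ N ∧ 𝒯bar.SharpBound S (W * W * V) (γ + β) (ζ + β)
      (Mbar.incr (schauderK K β δ γ X I M f Λ)) N := by
  have hC : ∀ k, ∃ C : ℝ, 0 ≤ C ∧ (k ∈ S.below (γ + β) →
      ∀ x y : Pt d, x 0 ≠ 0 → y 0 ≠ 0 → x ≠ y →
      (W * W * V).w x * |M.incrCoeff K β γ f Λ k y x| ≤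
      C * (min (S.phi x) (S.phi y) ^ (ζ - γ) * (W * W * V).star (x - y) *
        S.size (y - x) ^ (γ + β - S.wt k))) := fun k => by
    by_cases hk : k ∈ S.below (γ + β)
    · obtain ⟨C, h0, h1⟩ := h.exists_incrCoeff_le hW hV hWWV hg hsd hΘ hoc hNf hf hβ hδ hηγ hζη
        hcrit (S.mem_below.1 hk)
      exact ⟨C, h0, fun _ => h1⟩
    · exact ⟨0, le_rfl, fun h => absurd h hk⟩
  choose C hC0 hC using hC
  have hI0 : 0 ≤ ∑ α ∈ 𝒯.idx γ, ‖I α‖ := Finset.sum_nonneg fun _ _ => norm_nonneg _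
  have hN0 : 0 ≤ (∑ α ∈ 𝒯.idx γ, ‖I α‖) * Nf + ∑ k ∈ S.below (γ + β), ‖X.X k‖ * C k :=
    add_nonneg (mul_nonneg hI0 hNf)
      (Finset.sum_nonneg fun k _ => mul_nonneg (norm_nonneg _) (hC0 k))
  refine ⟨_, hN0, fun b hb x y hx hy => ?_⟩
  have hm0 : ∀ q : ℝ, 0 ≤ min (S.phi x) (S.phi y) ^ q := fun q =>
    Real.rpow_nonneg (le_min (S.phi_nonneg x) (S.phi_nonneg y)) _
  have hP1 := hWWV.one_le_star (x - y)
  by_cases hxy : x = y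
  · subst hxy
    rw [incr_self, DFinsupp.zero_apply, norm_zero, mul_zero]
    have := hm0 (ζ + β - (γ + β))
    have := Real.rpow_nonneg (S.size_nonneg (x - x)) (γ + β - b)
    exact mul_nonneg hN0 (by positivity)
  obtain ⟨α, rfl⟩ : ∃ α, b = α + β := ⟨b - β, by ring⟩
  have hbelow := M.below_incr y x (h.below y hy) (h.below x hx)
  rw [h.incr_schauderK hβ hδ hcomp
    (fun α hα τ k hk y => h.integrableOn_single hW hg hβ hδ hα τ k hk y) hx hy]
  have h1 := norm_map_add_sum_mono_le X I hbelow (S.below (γ + β))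
    (fun k => M.incrCoeff K β γ f Λ k y x) α
  have hw := hW.w_pos x
  have hv := hV.w_pos x
  have hu0 := hWWV.w_pos x
  have hρ0 := Real.rpow_nonneg (S.size_nonneg (y - x)) (γ + β - (α + β))
  rw [show ζ + β - (γ + β) = ζ - γ by ring]
  have hm0' := hm0 (ζ - γ)
  set T := min (S.phi x) (S.phi y) ^ (ζ - γ) * (W * W * V).star (x - y) *
    S.size (y - x) ^ (γ + β - (α + β)) with hT
  have hT0 : 0 ≤ T := by positivity
  have h2 : (W * W * V).w x * ‖M.incr f y x α‖ ≤ Nf * T := by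
    have h3 := hf α (by linarith) x y hx hy
    have h4 : min (S.phi x) (S.phi y) ^ (η - γ) ≤ min (S.phi x) (S.phi y) ^ (ζ - γ) :=
      Real.rpow_le_rpow_of_exponent_ge (lt_min (S.phi_pos hx) (S.phi_pos hy))
        ((min_le_left _ _).trans (S.phi_le_one x)) (by linarith)
    have h5 : (W * W * V).w x ≤ V.w x :=
      mul_le_of_le_one_left hv.le (mul_le_one₀ (hW.w_le_one x) hw.le (hW.w_le_one x))
    have h6 : V.star (x - y) ≤ (W * W * V).star (x - y) :=
      le_mul_of_one_le_left (zero_le_one.trans (hV.one_le_star _))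
        (one_le_mul_of_one_le_of_one_le (hW.one_le_star _) (hW.one_le_star _))
    refine (mul_le_mul_of_nonneg_right h5 (norm_nonneg _)).trans
      (h3.trans (mul_le_mul_of_nonneg_left ?_ hNf))
    have hsv := hV.one_le_star (x - y)
    rw [hT, show γ + β - (α + β) = γ - α by ring] at *
    gcongr
  calc _ ≤ (W * W * V).w x * _ := mul_le_mul_of_nonneg_left h1 hu0.le
    _ = (∑ α ∈ 𝒯.idx γ, ‖I α‖) * ((W * W * V).w x * ‖M.incr f y x α‖) +
        ∑ k ∈ S.below (γ + β), (W * W * V).w x *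
          (if S.wt k = α + β then ‖X.X k‖ * |M.incrCoeff K β γ f Λ k y x| else 0) := by
      rw [mul_add, Finset.mul_sum]; ring
    _ ≤ (∑ α ∈ 𝒯.idx γ, ‖I α‖) * (Nf * T) +
        ∑ k ∈ S.below (γ + β), ‖X.X k‖ * C k * T := by
      refine add_le_add (mul_le_mul_of_nonneg_left h2 hI0) (Finset.sum_le_sum fun k hk => ?_)
      split_ifs with hkb
      · have h3 := hC k hk x y hx hy hxy
        rw [hkb] at h3
        calc _ = ‖X.X k‖ * ((W * W * V).w x * |M.incrCoeff K β γ f Λ k y x|) := by ring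
          _ ≤ ‖X.X k‖ * _ := mul_le_mul_of_nonneg_left h3 (norm_nonneg _)
          _ = _ := by ring
      · rw [mul_zero]
        exact mul_nonneg (mul_nonneg (norm_nonneg _) (hC0 k)) hT0
    _ = _ := by rw [← Finset.sum_mul]; ring

end RegularityStructure.Model

/-! ### Differences of two data and the improvement for γ > 0. -/

namespace GSemigroup

variable {d : ℕ} {S : GSemigroup d} {K : ℝ → Pt d → Pt d → ℝ} {δ : ℝ}

theorem taylorRemainder_sub {F F' : ℝ → Pt d → ℝ} (hF : S.KernelRegular δ K F)
    (hF' : S.KernelRegular δ K F') (hδ : S.wt (0 : Fin d → ℕ) < δ) {c : ℝ} {x y : Pt d}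
    (hc : ∀ k ∈ S.below c, S.wt k < δ)
    (h0 : IntegrableOn (fun r => kernelAt K 0 r y F) (Ioc 0 1))
    (h0' : IntegrableOn (fun r => kernelAt K 0 r y F') (Ioc 0 1))
    (hk : ∀ k ∈ S.below c, IntegrableOn (fun r => kernelAt K k r x F) (Ioc 0 1))
    (hk' : ∀ k ∈ S.below c, IntegrableOn (fun r => kernelAt K k r x F') (Ioc 0 1)) :
    S.taylorRemainder K c (F - F') x y =
      S.taylorRemainder K c F x y - S.taylorRemainder K c F' x y := by
  unfold taylorRemainder kernelFun
  rw [hF.kernelInt_sub hF' hδ h0 h0', Finset.sum_congr rfl fun k hkc =>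
    (by rw [hF.kernelInt_sub hF' (hc k hkc) (hk k hkc) (hk' k hkc), mul_sub] :
      mpow (y - x) k / mfact k * kernelInt K k x (F - F') =
      mpow (y - x) k / mfact k * kernelInt K k x F -
        mpow (y - x) k / mfact k * kernelInt K k x F'), Finset.sum_sub_distrib]
  ring

end GSemigroup

namespace RegularityStructure.Model

variable {A Abar : Set ℝ} {𝒯 : RegularityStructure.{u₁} A} {𝒯bar : RegularityStructure.{u₂} Abar}
  {d : ℕ} [NeZero d] {S : GSemigroup d} {W V U U' : Weight d}

/-- The difference of two remainders of `𝒦f`. -/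
theorem remainder_schauderK_sub {M₁ M₂ : 𝒯.Model S W} {Mbar₁ Mbar₂ : 𝒯bar.Model S W}
    {K : ℝ → Pt d → Pt d → ℝ} {β βbar δ CK ζ γ a Θ₁ Θ₂ : ℝ} {f₁ f₂ : Pt d → 𝒯.Sp}
    {Λ₁ Λ₂ : ℝ → Pt d → ℝ} {X : PolynomialSector 𝒯bar S} {I : AbstractIntegration 𝒯 𝒯bar β}
    {E : Finset ℝ} {g P u : Pt d → ℝ}
    (h₁ : KernelInput M₁ K βbar δ CK ζ γ U U' f₁ Λ₁)
    (h₂ : KernelInput M₂ K βbar δ CK ζ γ U U' f₂ Λ₂)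
    (hsd : S.SchauderData E γ a g P u) (hΘ₁ : 0 ≤ Θ₁) (hΘ₂ : 0 ≤ Θ₂)
    (hoc₁ : S.OffCentreBound E γ a g P u Θ₁ (M₁.remainder f₁ Λ₁))
    (hoc₂ : S.OffCentreBound E γ a g P u Θ₂ (M₂.remainder f₂ Λ₂))
    (hβ : β ≤ βbar) (hδ : γ + βbar < δ) (hadm₁ : IsKAdmissible K βbar β δ X I M₁ Mbar₁)
    (hadm₂ : IsKAdmissible K βbar β δ X I M₂ Mbar₂) {x : Pt d} (hx : x 0 ≠ 0) {t : ℝ}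
    (ht : t ∈ Ioc (0 : ℝ) 1) :
    (Mbar₁.remainder (schauderK K β δ γ X I M₁ f₁ Λ₁) (S.ofFun (kernelFun K Λ₁)) x -
      Mbar₂.remainder (schauderK K β δ γ X I M₂ f₂ Λ₂) (S.ofFun (kernelFun K Λ₂)) x) t x =
      ∫ y, S.Q t x y *
        S.taylorRemainder K (γ + β) (M₁.remainder f₁ Λ₁ x - M₂.remainder f₂ Λ₂ x) x y := by
  rw [Pi.sub_apply, Pi.sub_apply, h₁.remainder_schauderK hβ hδ hadm₁ hx ht,
    h₂.remainder_schauderK hβ hδ hadm₂ hx ht,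
    ← integral_sub (h₁.integrable_Q_taylorRemainder hx ht _)
      (h₂.integrable_Q_taylorRemainder hx ht _)]
  refine integral_congr_ae (Eventually.of_forall fun y => ?_)
  have hlt : ∀ k ∈ S.below (γ + β), S.wt k < γ + βbar := fun k hk => by
    linarith [S.mem_below.1 hk]
  beta_reduce
  -- The off-centre bounds of the two single families serve only to make the coefficient integrals
  -- converge separately; they do not enter the final constant.
  rw [GSemigroup.taylorRemainder_sub (h₁.regular_remainder hx) (h₂.regular_remainder hx)
    h₁.delta_pos (fun k hk => (hlt k hk).trans hδ) (h₁.integrableOn_remainder_zero hx y)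
    (h₂.integrableOn_remainder_zero hx y)
    (fun k hk => hsd.integrableOn_centre h₁.kernel hΘ₁ hoc₁ hx (h₁.regular_remainder hx)
      ((hlt k hk).trans hδ) (hlt k hk))
    (fun k hk => hsd.integrableOn_centre h₂.kernel hΘ₂ hoc₂ hx (h₂.regular_remainder hx)
      ((hlt k hk).trans hδ) (hlt k hk)), mul_sub]

theorem KernelInput.remainder_semigroup {M : 𝒯.Model S W} {K : ℝ → Pt d → Pt d → ℝ}
    {βbar δ CK ζ γ : ℝ} {f : Pt d → 𝒯.Sp} {Λ : ℝ → Pt d → ℝ}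
    (h : KernelInput M K βbar δ CK ζ γ U U' f Λ) {x : Pt d} (hx : x 0 ≠ 0) {r t : ℝ}
    (hr : 0 < r) (hrt : r < t) (ht : t ≤ 1) :
    Integrable (fun z => S.Q (t - r) x z * M.remainder f Λ x r z) ∧
      ∫ z, S.Q (t - r) x z * M.remainder f Λ x r z = M.remainder f Λ x t x := by
  obtain ⟨i1, e1⟩ := h.besov.semigroup h.weight hr hrt ht x
  obtain ⟨i2, e2⟩ := (h.besov_Pi (h.below x hx) x).semigroup h.weight' hr hrt ht x
  have e : ∀ z, S.Q (t - r) x z * M.remainder f Λ x r z =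
      S.Q (t - r) x z * Λ r z - S.Q (t - r) x z * M.Pi x (f x) r z := fun z => by
    rw [remainder, Pi.sub_apply, Pi.sub_apply, mul_sub]
  simp only [e]
  refine ⟨i1.sub i2, ?_⟩
  rw [integral_sub i1 i2, e1, e2]
  rfl

/-- For `γ > 0`, the bracket of a reconstruction is controlled by the increments. -/
theorem PairBounds.exists_bracket_improve (hW : S.IsGControlled W) (hV : S.IsGControlled V)
    (hWV : S.IsGControlled (W * V)) {γ η : ℝ} (hη : γ - S.s 0 < η) (hηγ : η ≤ γ) (hγ : 0 < γ)
    {E : Finset ℝ} (hE : ∀ α ∈ E, α < γ) :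
    ∃ C : ℝ, 0 ≤ C ∧ ∀ {A : Set ℝ} {𝒯 : RegularityStructure.{u₁} A}, 𝒯.idx γ = E →
      ∀ {M₁ M₂ : 𝒯.Model S W} {f₁ f₂ : Pt d → 𝒯.Sp} {Λ₁ Λ₂ : ℝ → Pt d → ℝ}
        {Nb Nd N₂ N₁ N₁₂ L₁ L₂ L₁₂ : ℝ},
      PairBounds M₁ M₂ V γ η f₁ f₂ Λ₁ Λ₂ Nb Nd N₂ N₁ N₁₂ L₁ L₂ L₁₂ →
      (∀ x : Pt d, x 0 ≠ 0 → ∀ r t : ℝ, 0 < r → r < t → t ≤ 1 →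
        ∫ z, S.Q (t - r) x z * (M₁.remainder f₁ Λ₁ x - M₂.remainder f₂ Λ₂ x) r z =
          (M₁.remainder f₁ Λ₁ x - M₂.remainder f₂ Λ₂ x) t x) →
      ∀ t ∈ Ioc (0 : ℝ) 1, ∀ x : Pt d, x 0 ≠ 0 →
        (W * V).w x * |(M₁.remainder f₁ Λ₁ x - M₂.remainder f₂ Λ₂ x) t x| ≤
          (Nb / 2 + C * (N₁ * Nd + N₁₂ * N₂)) * t ^ (γ / S.ℓ) * S.phi x ^ (-(γ - η)) := by
  have hℓ := S.ℓ_pos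
  obtain ⟨C₁, hC₁, hQ⟩ := S.Q_upper
  have hmom : ∀ p : ℝ, ∃ C : ℝ, 0 ≤ C ∧ (0 ≤ p → ∀ t ∈ Ioc (0 : ℝ) 1, ∀ x : Pt d, x 0 ≠ 0 →
      ∀ b : ℝ, 0 ≤ b →
      Integrable (fun z => S.Gt t (x - z) * (W * V).star (x - z) * S.size (x - z) ^ p *
        (b + S.phi x ^ (-(γ - η)) + S.phi z ^ (-(γ - η)))) ∧
      ∫ z, S.Gt t (x - z) * (W * V).star (x - z) * S.size (x - z) ^ p *
        (b + S.phi x ^ (-(γ - η)) + S.phi z ^ (-(γ - η))) ≤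
          C * t ^ (p / S.ℓ) * (b + S.phi x ^ (-(γ - η)))) := fun p => by
    by_cases hp : 0 ≤ p
    · obtain ⟨C, h0, h1⟩ := hWV.controls.phi_moment hp (a := γ - η) (by linarith) (by linarith)
      exact ⟨C, h0, fun _ => h1⟩
    · exact ⟨0, le_rfl, fun h => absurd h hp⟩
  choose D hD0 hD using hmom
  -- After recentring at z, the bracket at time θt reappears with the factor θ^{γ/ℓ}. Because γ > 0
  -- this can be made small enough to be absorbed.
  obtain ⟨θ, hθ0, hθ1, hθ⟩ : ∃ θ : ℝ, 0 < θ ∧ θ < 1 ∧ C₁ * (D 0 * θ ^ (γ / S.ℓ)) ≤ 1 / 2 := by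
    have hp : 0 < γ / S.ℓ := div_pos hγ hℓ
    have h1 : Tendsto (fun θ : ℝ => C₁ * (D 0 * θ ^ (γ / S.ℓ))) (𝓝 0) (𝓝 0) := by
      have h2 : Tendsto (fun θ : ℝ => θ ^ (γ / S.ℓ)) (𝓝 0) (𝓝 (0 ^ (γ / S.ℓ))) :=
        (Real.continuousAt_rpow_const _ _ (Or.inr hp.le)).tendsto
      rw [Real.zero_rpow hp.ne'] at h2
      simpa using (h2.const_mul (D 0)).const_mul C₁
    have h3 : ∀ᶠ θ : ℝ in 𝓝[>] 0, C₁ * (D 0 * θ ^ (γ / S.ℓ)) < 1 / 2 :=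
      (h1.mono_left nhdsWithin_le_nhds).eventually_lt_const (by norm_num)
    have h4 : ∀ᶠ θ : ℝ in 𝓝[>] 0, θ ∈ Ioo (0 : ℝ) 1 := Ioo_mem_nhdsGT one_pos
    obtain ⟨θ, h5, h6⟩ := (h3.and h4).exists
    exact ⟨θ, h6.1, h6.2, h5.le⟩
  refine ⟨C₁ * ∑ α ∈ E, D (γ - α) * θ ^ (α / S.ℓ), mul_nonneg hC₁.le (Finset.sum_nonneg fun α _ =>
    mul_nonneg (hD0 _) (Real.rpow_nonneg hθ0.le _)), ?_⟩
  intro A 𝒯 hidx M₁ M₂ f₁ f₂ Λ₁ Λ₂ Nb Nd N₂ N₁ N₁₂ L₁ L₂ L₁₂ h hsg t ht x hx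
  have hs0 : 0 < θ * t := mul_pos hθ0 ht.1
  have hst : θ * t < t := mul_lt_of_lt_one_left ht.1 hθ1
  have hs : θ * t ∈ Ioc (0 : ℝ) 1 := ⟨hs0, hst.le.trans ht.2⟩
  have hts : t - θ * t ∈ Ioc (0 : ℝ) 1 := ⟨by linarith, by linarith [ht.2]⟩
  set F := M₁.remainder f₁ Λ₁ x - M₂.remainder f₂ Λ₂ x with hF
  set s := θ * t with hsdef
  set Θ := N₁ * Nd + N₁₂ * N₂ with hΘdef
  have hΘ : 0 ≤ Θ := add_nonneg (mul_nonneg h.N₁_nonneg h.Nd_nonneg)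
    (mul_nonneg h.N₁₂_nonneg h.N₂_nonneg)
  have hNb := h.Nb_nonneg
  have hwx := hWV.w_pos x
  set u := (W * V).w x with hu
  let m : ℝ → Pt d → ℝ := fun p z => S.Gt (t - s) (x - z) * (W * V).star (x - z) *
    S.size (x - z) ^ p * (0 + S.phi x ^ (-(γ - η)) + S.phi z ^ (-(γ - η)))
  -- Recentring F_x at the integration variable z leaves the bracket at time s = θt and a term with
  -- Π_z at its own base point, so no Γ is needed.
  have hpt : ∀ z : Pt d, z 0 ≠ 0 → |S.Q (t - s) x z * F s z| ≤
      C₁ * u⁻¹ * (Nb * s ^ (γ / S.ℓ) * m 0 z + ∑ α ∈ E, Θ * s ^ (α / S.ℓ) * m (γ - α) z) := by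
    intro z hz
    have b0 : |S.Q (t - s) x z| ≤ C₁ * S.Gt (t - s) (x - z) := hQ (t - s) hts.1 x z
    have b1 := h.abs_bracket_le hW hV hz hs
    have b2 := h.centre_le hW hV hx hz hs
    have e : F s z = _ := sub_apply_eq (M₁ := M₁) (M₂ := M₂) (f₁ := f₁) (f₂ := f₂) (Λ₁ := Λ₁)
      (Λ₂ := Λ₂) (x := x) (z := z) z hs
    have hG := S.Gt_nonneg hts.1 (x - z)
    have hφx := Real.rpow_nonneg (S.phi_nonneg x) (-(γ - η))
    have hφz := Real.rpow_nonneg (S.phi_nonneg z) (-(γ - η))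
    have w2 := inv_pos.2 (hW.w_pos z)
    have v2 := inv_pos.2 (hV.w_pos z)
    have w0 := inv_pos.2 (hW.w_pos x)
    have v0 := inv_pos.2 (hV.w_pos x)
    have a1 := hW.inv_le x z
    have a2 := hV.inv_le x z
    have s1 := hW.one_le_star (x - z)
    have s2 := hV.one_le_star (x - z)
    have hsγ := Real.rpow_nonneg hs0.le (γ / S.ℓ)
    set Φ := S.phi x ^ (-(γ - η)) + S.phi z ^ (-(γ - η)) with hΦ
    have k1 : (W.w z)⁻¹ * (V.w z)⁻¹ ≤ (W * V).star (x - z) * u⁻¹ := by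
      simp only [hu, GSemigroup.w_mul, GSemigroup.star_mul, mul_inv]
      calc _ ≤ (W.star (x - z) * (W.w x)⁻¹) * (V.star (x - z) * (V.w x)⁻¹) := by gcongr
        _ = _ := by ring
    have k2 : (W.w z)⁻¹ * (V.w x)⁻¹ * V.star (x - z) ≤ (W * V).star (x - z) * u⁻¹ := by
      simp only [hu, GSemigroup.w_mul, GSemigroup.star_mul, mul_inv]
      calc _ ≤ (W.star (x - z) * (W.w x)⁻¹) * (V.w x)⁻¹ * V.star (x - z) := by gcongr
        _ = _ := by ring
    have hst0 : 0 ≤ (W * V).star (x - z) := zero_le_one.trans (hWV.one_le_star _)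
    have hui := (inv_pos.2 hwx).le
    have hsum : 0 ≤ ∑ α ∈ 𝒯.idx γ, s ^ (α / S.ℓ) * S.size (x - z) ^ (γ - α) :=
      Finset.sum_nonneg fun α _ => mul_nonneg (Real.rpow_nonneg hs0.le _)
        (Real.rpow_nonneg (S.size_nonneg _) _)
    have b3 : |F s z| ≤ Nb * ((W * V).star (x - z) * u⁻¹) * Φ * s ^ (γ / S.ℓ) +
        Θ * ((W * V).star (x - z) * u⁻¹) * Φ *
          ∑ α ∈ 𝒯.idx γ, s ^ (α / S.ℓ) * S.size (x - z) ^ (γ - α) := by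
      rw [e]
      refine (abs_add_le _ _).trans (add_le_add (b1.trans ?_) (b2.trans ?_))
      · have : S.phi z ^ (-(γ - η)) ≤ Φ := by rw [hΦ]; linarith
        gcongr
      · gcongr
    rw [abs_mul]
    refine (mul_le_mul b0 b3 (abs_nonneg _) (by positivity)).trans (le_of_eq ?_)
    simp only [m, zero_add, Real.rpow_zero, hidx]
    rw [mul_add (C₁ * S.Gt (t - s) (x - z)), Finset.mul_sum, Finset.mul_sum, mul_add (C₁ * u⁻¹),
      Finset.mul_sum]
    congr 1
    · ring
    · exact Finset.sum_congr rfl fun α _ => by ring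
  obtain ⟨i0, j0⟩ := hD 0 le_rfl (t - s) hts x hx 0 le_rfl
  have hα : ∀ α ∈ E, Integrable (m (γ - α)) ∧
      ∫ z, m (γ - α) z ≤ D (γ - α) * (t - s) ^ ((γ - α) / S.ℓ) * (0 + S.phi x ^ (-(γ - η))) :=
    fun α hα => hD (γ - α) (by linarith [hE α hα]) (t - s) hts x hx 0 le_rfl
  change Integrable (m 0) at i0
  change ∫ z, m 0 z ≤ _ at j0
  rw [zero_add] at j0
  simp only [zero_add] at hα
  have I0 : Integrable fun z => Nb * s ^ (γ / S.ℓ) * m 0 z := i0.const_mul _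
  have Iα : ∀ α ∈ E, Integrable fun z => Θ * s ^ (α / S.ℓ) * m (γ - α) z :=
    fun α h => (hα α h).1.const_mul _
  have I1 : Integrable fun z =>
      C₁ * u⁻¹ * (Nb * s ^ (γ / S.ℓ) * m 0 z + ∑ α ∈ E, Θ * s ^ (α / S.ℓ) * m (γ - α) z) :=
    (I0.add (integrable_finsetSum E Iα)).const_mul _
  have hint : |F t x| ≤ ∫ z, C₁ * u⁻¹ *
      (Nb * s ^ (γ / S.ℓ) * m 0 z + ∑ α ∈ E, Θ * s ^ (α / S.ℓ) * m (γ - α) z) := by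
    have e := hsg x hx s t hs0 hst ht.2
    rw [← hF] at e
    rw [← e, ← Real.norm_eq_abs]
    refine norm_integral_le_of_norm_le I1 ?_
    filter_upwards [GSemigroup.ae_ne_zero] with z hz
    exact hpt z hz
  rw [integral_const_mul, integral_add I0 (integrable_finsetSum E Iα), integral_finsetSum E Iα,
    integral_const_mul, Finset.sum_congr rfl fun α _ => integral_const_mul _ _] at hint
  have hφ := Real.rpow_nonneg (S.phi_nonneg x) (-(γ - η))
  set φ := S.phi x ^ (-(γ - η)) with hφdef
  have htγ := Real.rpow_nonneg ht.1.le (γ / S.ℓ)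
  have hsγ : s ^ (γ / S.ℓ) = θ ^ (γ / S.ℓ) * t ^ (γ / S.ℓ) := Real.mul_rpow hθ0.le ht.1.le
  have t0 : Nb * s ^ (γ / S.ℓ) * ∫ z, m 0 z ≤ Nb * (D 0 * θ ^ (γ / S.ℓ)) * t ^ (γ / S.ℓ) * φ := by
    have h1 := Real.rpow_nonneg hs0.le (γ / S.ℓ)
    rw [zero_div, Real.rpow_zero, mul_one] at j0
    calc _ ≤ Nb * s ^ (γ / S.ℓ) * (D 0 * φ) := by gcongr
      _ = _ := by rw [hsγ]; ring
  have tα : ∀ α ∈ E, Θ * s ^ (α / S.ℓ) * ∫ z, m (γ - α) z ≤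
      Θ * (D (γ - α) * θ ^ (α / S.ℓ)) * (t ^ (γ / S.ℓ) * φ) := fun α h => by
    have h1 := Real.rpow_nonneg hs0.le (α / S.ℓ)
    have h2 : (t - s) ^ ((γ - α) / S.ℓ) ≤ t ^ ((γ - α) / S.ℓ) :=
      Real.rpow_le_rpow hts.1.le (by linarith) (div_nonneg (by linarith [hE α h]) hℓ.le)
    have h3 : t ^ (α / S.ℓ) * t ^ ((γ - α) / S.ℓ) = t ^ (γ / S.ℓ) := by
      rw [← Real.rpow_add ht.1]; congr 1; ring
    have h4 : s ^ (α / S.ℓ) = θ ^ (α / S.ℓ) * t ^ (α / S.ℓ) := Real.mul_rpow hθ0.le ht.1.le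
    have h5 := hD0 (γ - α)
    calc _ ≤ Θ * s ^ (α / S.ℓ) * (D (γ - α) * t ^ ((γ - α) / S.ℓ) * φ) :=
          mul_le_mul_of_nonneg_left ((hα α h).2.trans (by gcongr)) (by positivity)
      _ = Θ * (D (γ - α) * θ ^ (α / S.ℓ)) * ((t ^ (α / S.ℓ) * t ^ ((γ - α) / S.ℓ)) * φ) := by
          rw [h4]; ring
      _ = _ := by rw [h3]
  have hfin := hint.trans (mul_le_mul_of_nonneg_left (add_le_add t0 (Finset.sum_le_sum tα))
    (mul_nonneg hC₁.le (inv_pos.2 hwx).le))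
  rw [← Finset.sum_mul, ← Finset.mul_sum] at hfin
  calc u * |F t x| ≤ u * _ := mul_le_mul_of_nonneg_left hfin hwx.le
    _ = (Nb * (C₁ * (D 0 * θ ^ (γ / S.ℓ))) +
        (C₁ * ∑ α ∈ E, D (γ - α) * θ ^ (α / S.ℓ)) * Θ) * t ^ (γ / S.ℓ) * φ * (u * u⁻¹) := by ring
    _ ≤ _ := by
      rw [mul_inv_cancel₀ hwx.ne', mul_one]
      have : Nb * (C₁ * (D 0 * θ ^ (γ / S.ℓ))) ≤ Nb / 2 := by
        have := mul_le_mul_of_nonneg_left hθ hNb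
        linarith
      gcongr

end RegularityStructure.Model

/-! ### From seminorms to the final bounds. -/

namespace GSemigroup

variable {d : ℕ} {S : GSemigroup d} {W V : Weight d}

/-- The auxiliary weights yield a function which controls `wv` and the reflections of `w`. -/
theorem exists_absorbing (hW : S.IsGControlled W) (hWV : S.IsGControlled (W * V))
    (hWaux : S.HasAuxiliaryWeights W) :
    ∃ W₁ : Weight d, S.IsGControlled W₁ ∧ S.IsGControlled (W * W₁) ∧
      (∀ n : ℕ, ∃ B : ℝ, ∀ x, S.size x ^ n * W.star x * W₁.w x ≤ B) ∧
      S.Controls (fun x => W.star x * W.star (-x)) ∧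
      ∃ g : Pt d → ℝ, S.Controls g ∧ (∀ x, (W * V).star x ≤ g x) ∧
        ∀ x, W.star x * W.star (-x) ≤ g x := by
  obtain ⟨W₁, W₂, hW₁, hW₂, hWW₁, -, haux⟩ := hWaux
  have haux' : ∀ n : ℕ, ∃ B : ℝ, ∀ x, S.size x ^ n * W.star x * W₁.w x ≤ B := fun n => by
    obtain ⟨B, hB⟩ := haux n
    refine ⟨B, fun x => le_trans (le_add_of_nonneg_right ?_) (hB x)⟩
    exact mul_nonneg (mul_nonneg (pow_nonneg (S.size_nonneg x) n)
      (zero_le_one.trans (hW₁.one_le_star x))) (hW₂.w_pos x).le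
  obtain ⟨B, hB⟩ := haux' 0
  simp only [pow_zero, one_mul] at hB
  obtain ⟨B', hB'0, hB'⟩ := exists_star_neg_le hW₁ hB
  have hle : ∀ x, W.star x * W.star (-x) ≤ B' * (W * W₁).star x := fun x => by
    calc _ ≤ W.star x * (B' * W₁.star x) :=
          mul_le_mul_of_nonneg_left (hB' x) (zero_le_one.trans (hW.one_le_star x))
      _ = _ := by rw [star_mul]; ring
  have hc := hWW₁.controls.const_mul hB'0
  have h1 := hW.2.2.1
  have h0 : ∀ x, 0 ≤ W.star x * W.star (-x) := fun x =>
    mul_nonneg (zero_le_one.trans (hW.one_le_star x)) (zero_le_one.trans (hW.one_le_star _))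
  refine ⟨W₁, hW₁, hWW₁, haux', hc.mono (by fun_prop) h0 hle, _, hWV.controls.add hc, fun x => ?_,
    fun x => ?_⟩
  · exact le_add_of_nonneg_right ((h0 x).trans (hle x))
  · exact (hle x).trans (le_add_of_nonneg_left (zero_le_one.trans (hWV.one_le_star x)))

variable [NeZero d]

/-- The Schauder estimate yields φ^{-(γ−η)}, which is stronger than the required φ^{-(γ−ζ)} because
φ ≤ 1 and ζ ≤ η. -/
theorem bracketNorm_le_of_abs_le {β γ η ζ N : ℝ} (hWWV : S.IsGControlled (W * W * V)) (hN : 0 ≤ N)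
    (hζη : ζ ≤ η) {F : Pt d → ℝ → Pt d → ℝ}
    (h : ∀ x : Pt d, x 0 ≠ 0 → ∀ t ∈ Ioc (0 : ℝ) 1, |F x t x| ≤
      N * ((W * W * V).w x)⁻¹ * S.phi x ^ (-(γ - η)) * t ^ ((γ + β) / S.ℓ)) :
    S.bracketNorm (W * W * V) (γ + β) (ζ + β) F ≤ ENNReal.ofReal N := by
  refine (bracketNorm_le_iff hN).2 fun t ht x hx => ?_
  have hu := hWWV.w_pos x
  have h1 : S.phi x ^ (-(γ - η)) ≤ S.phi x ^ (-(γ + β - (ζ + β))) :=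
    Real.rpow_le_rpow_of_exponent_ge (S.phi_pos hx) (S.phi_le_one x) (by linarith)
  have h2 := Real.rpow_nonneg ht.1.le ((γ + β) / S.ℓ)
  set u := (W * W * V).w x
  calc u * |F x t x| ≤ u * _ := mul_le_mul_of_nonneg_left (h x hx t ht) hu.le
    _ = (u * u⁻¹) * (N * t ^ ((γ + β) / S.ℓ) * S.phi x ^ (-(γ - η))) := by ring
    _ = N * t ^ ((γ + β) / S.ℓ) * S.phi x ^ (-(γ - η)) := by
      rw [mul_inv_cancel₀ hu.ne', one_mul]
    _ ≤ _ := mul_le_mul_of_nonneg_left h1 (by positivity)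

end GSemigroup

namespace RegularityStructure.Model

variable {A Abar : Set ℝ} {𝒯 : RegularityStructure.{u₁} A} {𝒯bar : RegularityStructure.{u₂} Abar}
  {d : ℕ} [NeZero d] {S : GSemigroup d} {W V : Weight d}

theorem remainder_zero (M : 𝒯.Model S W) (x : Pt d) :
    M.remainder (fun _ => 0) 0 x = 0 := by
  rw [remainder, map_zero, sub_zero]

theorem incr_zero (M : 𝒯.Model S W) (x y : Pt d) : M.incr (fun _ => 0) y x = 0 := by
  rw [incr, map_zero, sub_zero]

/-- The bounds on a single model, as a pair with the trivial modelled distribution. -/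
theorem pairBounds_single (M : 𝒯.Model S W) (hW : S.IsGControlled W) (hV : S.IsGControlled V)
    {γ η b n p l : ℝ} {f : Pt d → 𝒯.Sp} {Λ : ℝ → Pt d → ℝ} (hf : ∀ x, x 0 ≠ 0 → 𝒯.Below γ (f x))
    (hb : 0 ≤ b) (hn : 0 ≤ n) (hp : 0 ≤ p) (hl : 0 ≤ l)
    (hbr : M.bracket (W * V) γ η f Λ ≤ ENNReal.ofReal b)
    (hsh : M.normSharp V γ η f ≤ ENNReal.ofReal n) (hpi : M.normPi γ ≤ ENNReal.ofReal p)
    (hga : M.normGam γ ≤ ENNReal.ofReal l) :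
    PairBounds M M V γ η f (fun _ => 0) Λ 0 b n 0 p 0 l l 0 where
  Nb_nonneg := hb
  Nd_nonneg := hn
  N₂_nonneg := le_rfl
  N₁_nonneg := hp
  N₁₂_nonneg := le_rfl
  L₁_nonneg := hl
  L₂_nonneg := hl
  L₁₂_nonneg := le_rfl
  below₁ := hf
  below₂ _ _ := below_zero γ
  bracket := by
    simp only [remainder_zero, sub_zero]
    exact (GSemigroup.bracketNorm_le_iff hb).1 hbr
  sharp₁₂ := by
    simp only [incr_zero, sub_zero]
    exact sharpBound_of_le hV hn (M.incr_self f) hsh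
  sharp₂ := fun α _ x y _ _ => by
    rw [incr_zero, DFinsupp.zero_apply, norm_zero, mul_zero, zero_mul]
  pi₁ := M.piBound_of_normPi_le hp hpi
  pi₁₂ := fun α _ _ t _ x τ => by simp
  gam₁ := M.gamBound_of_normGam_le hW hl hga
  gam₂ := M.gamBound_of_normGam_le hW hl hga
  gam₁₂ := fun α _ β _ _ _ x y τ => by simp

/-- The bounds on two models in terms of their distance. -/
theorem pairBounds_of_dist (M₁ M₂ : 𝒯.Model S W) (hW : S.IsGControlled W) (hV : S.IsGControlled V)
    {γ η b n D R : ℝ} {f₁ f₂ : Pt d → 𝒯.Sp} {Λ₁ Λ₂ : ℝ → Pt d → ℝ}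
    (hf₁ : ∀ x, x 0 ≠ 0 → 𝒯.Below γ (f₁ x)) (hf₂ : ∀ x, x 0 ≠ 0 → 𝒯.Below γ (f₂ x))
    (hb : 0 ≤ b) (hn : 0 ≤ n) (hD : 0 ≤ D) (hR : 0 ≤ R)
    (hbr : M₁.bracketDist M₂ (W * V) γ η f₁ f₂ Λ₁ Λ₂ ≤ ENNReal.ofReal b)
    (hsh : M₁.distSharp M₂ V γ η f₁ f₂ ≤ ENNReal.ofReal n)
    (hdist : M₁.dist M₂ γ ≤ ENNReal.ofReal D) (hM₁ : M₁.size γ ≤ ENNReal.ofReal R)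
    (hM₂ : M₂.size γ ≤ ENNReal.ofReal R) (hfR : M₂.fullSharp V γ η f₂ ≤ ENNReal.ofReal R) :
    PairBounds M₁ M₂ V γ η f₁ f₂ Λ₁ Λ₂ b n R R D R R D where
  Nb_nonneg := hb
  Nd_nonneg := hn
  N₂_nonneg := hR
  N₁_nonneg := hR
  N₁₂_nonneg := hD
  L₁_nonneg := hR
  L₂_nonneg := hR
  L₁₂_nonneg := hD
  below₁ := hf₁
  below₂ := hf₂
  bracket := (GSemigroup.bracketNorm_le_iff hb).1 hbr
  sharp₁₂ := sharpBound_of_le hV hn (fun x => by rw [M₁.incr_self, M₂.incr_self, sub_self])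
    (le_trans (le_add_left le_rfl) hsh)
  sharp₂ := sharpBound_of_le hV hR (M₂.incr_self f₂) (le_trans (le_add_left le_rfl) hfR)
  pi₁ := M₁.piBound_of_normPi_le hR (le_trans (le_add_right le_rfl) hM₁)
  pi₁₂ := piBound_of_le hD (fun x t y => by simp) (le_trans (le_add_right le_rfl) hdist)
  gam₁ := M₁.gamBound_of_normGam_le hW hR (le_trans (le_add_left le_rfl) hM₁)
  gam₂ := M₂.gamBound_of_normGam_le hW hR (le_trans (le_add_left le_rfl) hM₂)
  gam₁₂ := gamBound_of_le hW hD (fun x y => by simp)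
    (fun α β _ x τ => by rw [M₁.Gam_self, M₂.Gam_self, sub_self]; rfl)
    (le_trans (le_add_left le_rfl) hdist)

/-- Two reconstructions have finite distance. -/
theorem bracketDist_lt_top {M₁ M₂ : 𝒯.Model S W} {U : Weight d} (hU : S.IsGControlled U)
    {γ η : ℝ} {f₁ f₂ : Pt d → 𝒯.Sp} {Λ₁ Λ₂ : ℝ → Pt d → ℝ} (h₁ : M₁.bracket U γ η f₁ Λ₁ < ⊤)
    (h₂ : M₂.bracket U γ η f₂ Λ₂ < ⊤) : M₁.bracketDist M₂ U γ η f₁ f₂ Λ₁ Λ₂ < ⊤ := by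
  have b₁ := (GSemigroup.bracketNorm_le_iff ENNReal.toReal_nonneg).1
    (ENNReal.ofReal_toReal h₁.ne).ge
  have b₂ := (GSemigroup.bracketNorm_le_iff ENNReal.toReal_nonneg).1
    (ENNReal.ofReal_toReal h₂.ne).ge
  set r₁ := (M₁.bracket U γ η f₁ Λ₁).toReal with hr₁
  set r₂ := (M₂.bracket U γ η f₂ Λ₂).toReal with hr₂
  have h0 : 0 ≤ r₁ + r₂ := add_nonneg ENNReal.toReal_nonneg ENNReal.toReal_nonneg
  refine lt_of_le_of_lt ((GSemigroup.bracketNorm_le_iff h0).2 fun t ht x hx => ?_)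
    ENNReal.ofReal_lt_top
  have h3 := b₁ t ht x hx
  have h4 := b₂ t ht x hx
  simp only [Pi.sub_apply]
  calc _ ≤ U.w x * (|M₁.remainder f₁ Λ₁ x t x| + |M₂.remainder f₂ Λ₂ x t x|) :=
        mul_le_mul_of_nonneg_left (abs_sub _ _) (hU.w_pos x).le
    _ ≤ _ := by rw [mul_add, add_mul, add_mul]; exact add_le_add h3 h4

/-- If `γ > 0`, the distance of two reconstructions is controlled by the increments. -/
theorem exists_bracketDist_le (hW : S.IsGControlled W) (hV : S.IsGControlled V)
    (hWV : S.IsGControlled (W * V)) {γ η : ℝ} (hη : γ - S.s 0 < η) (hηγ : η ≤ γ) (hγ : 0 < γ)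
    {E : Finset ℝ} (hE : ∀ α ∈ E, α < γ) :
    ∃ C : ℝ, 0 ≤ C ∧ ∀ {A : Set ℝ} {𝒯 : RegularityStructure.{u₁} A}, 𝒯.idx γ = E →
      ∀ {M₁ M₂ : 𝒯.Model S W} {f₁ f₂ : Pt d → 𝒯.Sp} {Λ₁ Λ₂ : ℝ → Pt d → ℝ}
        {K : ℝ → Pt d → Pt d → ℝ} {βbar δ CK ζ : ℝ} {U U' : Weight d}
        {Nd N₂ N₁ N₁₂ L₁ L₂ L₁₂ : ℝ},
      KernelInput M₁ K βbar δ CK ζ γ U U' f₁ Λ₁ → KernelInput M₂ K βbar δ CK ζ γ U U' f₂ Λ₂ →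
      M₁.bracketDist M₂ (W * V) γ η f₁ f₂ Λ₁ Λ₂ < ⊤ →
      PairBounds M₁ M₂ V γ η f₁ f₂ Λ₁ Λ₂ (M₁.bracketDist M₂ (W * V) γ η f₁ f₂ Λ₁ Λ₂).toReal
        Nd N₂ N₁ N₁₂ L₁ L₂ L₁₂ →
      (M₁.bracketDist M₂ (W * V) γ η f₁ f₂ Λ₁ Λ₂).toReal ≤ C * (N₁ * Nd + N₁₂ * N₂) := by
  obtain ⟨C, hC0, hC⟩ := PairBounds.exists_bracket_improve.{u₁} hW hV hWV hη hηγ hγ hE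
  refine ⟨2 * C, by positivity, ?_⟩
  intro A 𝒯 hidx M₁ M₂ f₁ f₂ Λ₁ Λ₂ K βbar δ CK ζ U U' Nd N₂ N₁ N₁₂ L₁ L₂ L₁₂ h₁ h₂ hfin h
  have h0 : 0 ≤ C * (N₁ * Nd + N₁₂ * N₂) := mul_nonneg hC0 (add_nonneg
    (mul_nonneg h.N₁_nonneg h.Nd_nonneg) (mul_nonneg h.N₁₂_nonneg h.N₂_nonneg))
  set b := (M₁.bracketDist M₂ (W * V) γ η f₁ f₂ Λ₁ Λ₂).toReal with hb
  have hb0 : 0 ≤ b := ENNReal.toReal_nonneg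
  have hN : 0 ≤ b / 2 + C * (N₁ * Nd + N₁₂ * N₂) := by positivity
  have h1 := (GSemigroup.bracketNorm_le_iff (S := S) (U := W * V) (γ := γ) (η := η)
    (F := fun x => M₁.remainder f₁ Λ₁ x - M₂.remainder f₂ Λ₂ x) hN).2
    (hC hidx h fun x hx r t hr hrt ht => by
      obtain ⟨i1, e1⟩ := h₁.remainder_semigroup hx hr hrt ht
      obtain ⟨i2, e2⟩ := h₂.remainder_semigroup hx hr hrt ht
      simp only [Pi.sub_apply, mul_sub]
      rw [integral_sub i1 i2, e1, e2])
  -- Absorption of b/2 on the left is legitimate because the bracket distance is known to be finite.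
  have h2 : b ≤ b / 2 + C * (N₁ * Nd + N₁₂ * N₂) := by
    rw [hb]
    exact ENNReal.toReal_le_of_le_ofReal hN h1
  linarith

/-- The input data of the Schauder estimate from a reconstruction. -/
theorem kernelInput_of_isReconstruction (M : 𝒯.Model S W) (hW : S.IsGControlled W)
    (hWV : S.IsGControlled (W * V)) {W₁ : Weight d} (hW₁ : S.IsGControlled W₁)
    (hWW₁ : S.IsGControlled (W * W₁))
    (haux : ∀ n : ℕ, ∃ B : ℝ, ∀ x, S.size x ^ n * W.star x * W₁.w x ≤ B)
    {K : ℝ → Pt d → Pt d → ℝ} {βbar δ CK ζ γ η : ℝ} {f : Pt d → 𝒯.Sp} {Λ : ℝ → Pt d → ℝ}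
    (hK : S.IsRegularizingKernel βbar δ CK K) (hζA : ∀ α ∈ A, ζ ≤ α) (hζ : 0 < ζ + βbar)
    (hf : ∀ x, x 0 ≠ 0 → 𝒯.Below γ (f x)) (hΛ : M.IsReconstruction ζ (W * V) γ η f Λ) :
    KernelInput M K βbar δ CK ζ γ (W * V) (W * W₁) f Λ where
  kernel := hK
  weight := hWV
  weight' := hWW₁
  besov := hΛ.1
  besov_Pi hτ x := M.memBesov_Pi hW hW₁ haux hΛ.1.1 hζA hτ x
  pos := by linarith
  below := hf

end RegularityStructure.Model

/-- The estimate of the convolved Taylor remainder with constant `C`. -/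
def GSemigroup.SchauderBound {d : ℕ} [NeZero d] (S : GSemigroup d) (E : Finset ℝ) (γ a : ℝ)
    (g P u : Pt d → ℝ) (β βbar δ C : ℝ) : Prop :=
  ∀ (K : ℝ → Pt d → Pt d → ℝ) (CK : ℝ), S.IsRegularizingKernel βbar δ CK K →
    (β < βbar ∨ ∀ k : Fin d → ℕ, γ + βbar ≠ S.wt k) →
    ∀ (Θ : ℝ) (F : Pt d → ℝ → Pt d → ℝ), 0 ≤ Θ → S.OffCentreBound E γ a g P u Θ F →
    ∀ x : Pt d, x 0 ≠ 0 → S.KernelRegular δ K (F x) → ∀ t ∈ Ioc (0 : ℝ) 1,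
      |∫ y, S.Q t x y * S.taylorRemainder K (γ + β) (F x) x y| ≤
        C * CK * Θ * (u x)⁻¹ * S.phi x ^ (-a) * t ^ ((γ + β) / S.ℓ)

namespace RegularityStructure.Model

variable {A Abar : Set ℝ} {𝒯 : RegularityStructure.{u₁} A} {𝒯bar : RegularityStructure.{u₂} Abar}
  {d : ℕ} [NeZero d] {S : GSemigroup d} {W V U' : Weight d} {K : ℝ → Pt d → Pt d → ℝ}
  {β βbar δ CK C ζ γ η Θ Θ₁ Θ₂ : ℝ} {X : PolynomialSector 𝒯bar S}
  {I : AbstractIntegration 𝒯 𝒯bar β} {E : Finset ℝ} {g g' P : Pt d → ℝ}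

/-- The reconstruction bound for `KΛ`. -/
theorem KernelInput.bracket_schauderK_le {M : 𝒯.Model S W} {Mbar : 𝒯bar.Model S W}
    {f : Pt d → 𝒯.Sp} {Λ : ℝ → Pt d → ℝ} (h : KernelInput M K βbar δ CK ζ γ (W * V) U' f Λ)
    (hWWV : S.IsGControlled (W * W * V)) (hC : 0 ≤ C)
    (H : S.SchauderBound E γ (γ - η) g P (W * W * V).w β βbar δ C) (hβ : β ≤ βbar)
    (hδ : γ + βbar < δ) (hζη : ζ ≤ η) (hcrit : β < βbar ∨ ∀ k : Fin d → ℕ, γ + βbar ≠ S.wt k)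
    (hadm : IsKAdmissible K βbar β δ X I M Mbar) (hΘ : 0 ≤ Θ)
    (hoc : S.OffCentreBound E γ (γ - η) g P (W * W * V).w Θ (M.remainder f Λ)) :
    Mbar.bracket (W * W * V) (γ + β) (ζ + β) (schauderK K β δ γ X I M f Λ)
      (S.ofFun (kernelFun K Λ)) ≤ ENNReal.ofReal (C * CK * Θ) := by
  have hCK := h.kernel.CK_pos
  refine GSemigroup.bracketNorm_le_of_abs_le hWWV (by positivity) hζη fun x hx t ht => ?_
  rw [h.remainder_schauderK hβ hδ hadm hx ht]
  exact H K CK h.kernel hcrit Θ _ hΘ hoc x hx (h.regular_remainder hx) t ht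

/-- The reconstruction bound for a difference `KΛ₁ - KΛ₂`. -/
theorem KernelInput.bracketDist_schauderK_le {M₁ M₂ : 𝒯.Model S W} {Mbar₁ Mbar₂ : 𝒯bar.Model S W}
    {f₁ f₂ : Pt d → 𝒯.Sp} {Λ₁ Λ₂ : ℝ → Pt d → ℝ}
    (h₁ : KernelInput M₁ K βbar δ CK ζ γ (W * V) U' f₁ Λ₁)
    (h₂ : KernelInput M₂ K βbar δ CK ζ γ (W * V) U' f₂ Λ₂)
    (hWWV : S.IsGControlled (W * W * V)) (hC : 0 ≤ C)
    (hsd : S.SchauderData E γ (γ - η) g P (W * W * V).w)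
    (H : S.SchauderBound E γ (γ - η) g P (W * W * V).w β βbar δ C) (hβ : β ≤ βbar)
    (hδ : γ + βbar < δ) (hζη : ζ ≤ η) (hcrit : β < βbar ∨ ∀ k : Fin d → ℕ, γ + βbar ≠ S.wt k)
    (hadm₁ : IsKAdmissible K βbar β δ X I M₁ Mbar₁)
    (hadm₂ : IsKAdmissible K βbar β δ X I M₂ Mbar₂) (hΘ₁ : 0 ≤ Θ₁) (hΘ₂ : 0 ≤ Θ₂) (hΘ : 0 ≤ Θ)
    (hoc₁ : S.OffCentreBound E γ (γ - η) g P (W * W * V).w Θ₁ (M₁.remainder f₁ Λ₁))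
    (hoc₂ : S.OffCentreBound E γ (γ - η) g P (W * W * V).w Θ₂ (M₂.remainder f₂ Λ₂))
    (hoc : S.OffCentreBound E γ (γ - η) g P (W * W * V).w Θ
      (fun x => M₁.remainder f₁ Λ₁ x - M₂.remainder f₂ Λ₂ x)) :
    Mbar₁.bracketDist Mbar₂ (W * W * V) (γ + β) (ζ + β) (schauderK K β δ γ X I M₁ f₁ Λ₁)
      (schauderK K β δ γ X I M₂ f₂ Λ₂) (S.ofFun (kernelFun K Λ₁)) (S.ofFun (kernelFun K Λ₂)) ≤
      ENNReal.ofReal (C * CK * Θ) := by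
  have hCK := h₁.kernel.CK_pos
  refine GSemigroup.bracketNorm_le_of_abs_le hWWV (by positivity) hζη fun x hx t ht => ?_
  rw [remainder_schauderK_sub h₁ h₂ hsd hΘ₁ hΘ₂ hoc₁ hoc₂ hβ hδ hadm₁ hadm₂ hx ht]
  exact H K CK h₁.kernel hcrit Θ _ hΘ hoc x hx
    ((h₁.regular_remainder hx).sub (h₂.regular_remainder hx)) t ht

/-- `𝒦f` is a modelled distribution. -/
theorem KernelInput.memDSharp_schauderK {M : 𝒯.Model S W} {Mbar : 𝒯bar.Model S W}
    {f : Pt d → 𝒯.Sp} {Λ : ℝ → Pt d → ℝ} (h : KernelInput M K βbar δ CK ζ γ (W * V) U' f Λ)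
    (hW : S.IsGControlled W) (hV : S.IsGControlled V) (hWWV : S.IsGControlled (W * W * V))
    (hg : S.Controls (fun x => W.star x * W.star (-x)))
    (hsd : S.SchauderData E γ (γ - η) g P (W * W * V).w) (hΘ : 0 ≤ Θ)
    (hoc : S.OffCentreBound E γ (γ - η) g P (W * W * V).w Θ (M.remainder f Λ))
    (hf : M.MemDSharp V γ η f) (hβ : β ≤ βbar) (hδ : γ + βbar < δ) (hζη : ζ ≤ η)
    (hζA : ∀ α ∈ A, ζ ≤ α)
    (hcrit : β < βbar ∨ ∀ α ∈ A ∪ {γ, ζ}, ∀ k : Fin d → ℕ, α + βbar ≠ S.wt k)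
    (hcomp : IsCompatible K β δ X I M Mbar) :
    Mbar.MemDSharp (W * W * V) (γ + β) (ζ + β) (schauderK K β δ γ X I M f Λ) := by
  obtain ⟨hηγ, hbelow, hfin⟩ := hf
  obtain ⟨hfg, hfs⟩ := ENNReal.add_lt_top.1 hfin
  have b₁ := (growthNorm_le_iff ENNReal.toReal_nonneg).1 (ENNReal.ofReal_toReal hfg.ne).ge
  have b₂ := sharpBound_of_le hV ENNReal.toReal_nonneg (M.incr_self f)
    (ENNReal.ofReal_toReal hfs.ne).ge
  obtain ⟨N, hN0, hN⟩ := h.exists_growthBound (X := X) (I := I) hW hV hg hsd hΘ hoc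
    ENNReal.toReal_nonneg b₁ hβ hδ hζη hζA hcrit
  obtain ⟨N', hN'0, hN'⟩ := h.exists_sharpBound (X := X) (I := I) hW hV hWWV hg hsd hΘ hoc
    ENNReal.toReal_nonneg b₂ hβ hδ hηγ hζη hcrit hcomp
  refine ⟨by linarith, fun x hx => ?_, ENNReal.add_lt_top.2 ⟨?_, ?_⟩⟩
  · rw [schauderK_eq hβ hδ (hbelow x hx)]
    exact below_map_add_sum_mono X I (hbelow x hx) _
  · exact ((growthNorm_le_iff hN0).2 hN).trans_lt ENNReal.ofReal_lt_top
  · exact (sharpNorm_le hWWV hN').trans_lt ENNReal.ofReal_lt_top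

theorem KernelInput.memC_kernelFun {M : 𝒯.Model S W} {f : Pt d → 𝒯.Sp} {Λ : ℝ → Pt d → ℝ}
    {U : Weight d} (h : KernelInput M K βbar δ CK ζ γ U U' f Λ) : U.MemC (kernelFun K Λ) :=
  h.besov.kernelFun_memC h.weight h.kernel h.pos

/-- KΛ is an honest function in C(wv), hence in C(w²v), and serves as its own approximant. -/
theorem KernelInput.memBesov_kernelFun {M : 𝒯.Model S W} {f : Pt d → 𝒯.Sp} {Λ : ℝ → Pt d → ℝ}
    (h : KernelInput M K βbar δ CK ζ γ (W * V) U' f Λ) (hW : S.IsGControlled W) :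
    S.MemBesov 0 (W * W * V) (S.ofFun (kernelFun K Λ)) := by
  obtain ⟨hc, B, hB⟩ := h.memC_kernelFun
  refine ⟨le_rfl, fun ε hε => ⟨kernelFun K Λ, ⟨hc, B, fun x => le_trans ?_ (hB x)⟩,
    fun t _ x => by simpa using hε.le⟩⟩
  refine mul_le_mul_of_nonneg_left ?_ (abs_nonneg _)
  have h1 := (h.weight.w_pos x).le
  have h2 : (W * W * V).w x = W.w x * (W * V).w x := mul_assoc _ _ _
  rw [h2]
  exact mul_le_of_le_one_left h1 (hW.w_le_one x)

end RegularityStructure.Model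

namespace RegularityStructure.Model

variable {A : Set ℝ} {𝒯 : RegularityStructure.{u₁} A} {d : ℕ} [NeZero d] {S : GSemigroup d}
  {W V : Weight d}

/-- The off-centre bound of a single remainder. -/
theorem offCentreBound_single (M : 𝒯.Model S W) (hW : S.IsGControlled W) (hV : S.IsGControlled V)
    {γ η b n p l : ℝ} {f : Pt d → 𝒯.Sp} {Λ : ℝ → Pt d → ℝ} (hf : ∀ x, x 0 ≠ 0 → 𝒯.Below γ (f x))
    (hb : 0 ≤ b) (hn : 0 ≤ n) (hp : 0 ≤ p) (hl : 0 ≤ l)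
    (hbr : M.bracket (W * V) γ η f Λ ≤ ENNReal.ofReal b)
    (hsh : M.normSharp V γ η f ≤ ENNReal.ofReal n) (hpi : M.normPi γ ≤ ENNReal.ofReal p)
    (hga : M.normGam γ ≤ ENNReal.ofReal l) {g : Pt d → ℝ}
    (hg₁ : ∀ x, (W * V).star x ≤ g x) (hg₂ : ∀ x, W.star x * W.star (-x) ≤ g x) :
    S.OffCentreBound (insert γ (𝒯.idx γ)) γ (γ - η) g (W * W * V).star (W * W * V).w
      (b + p * n + p * ((1 + l) * n)) (M.remainder f Λ) := by
  have := (M.pairBounds_single hW hV hf hb hn hp hl hbr hsh hpi hga).offCentreBound hW hV hg₁ hg₂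
  simpa only [remainder_zero, sub_zero, mul_zero, zero_mul, add_zero] using this

/-- The off-centre bound of a single remainder if `v*` is submultiplicative. -/
theorem offCentreBound_single_of_submul (M : 𝒯.Model S W) (hW : S.IsGControlled W)
    (hV : S.IsGControlled V) {γ η b n p l : ℝ} {f : Pt d → 𝒯.Sp} {Λ : ℝ → Pt d → ℝ}
    (hf : ∀ x, x 0 ≠ 0 → 𝒯.Below γ (f x)) (hb : 0 ≤ b) (hn : 0 ≤ n) (hp : 0 ≤ p) (hl : 0 ≤ l)
    (hbr : M.bracket (W * V) γ η f Λ ≤ ENNReal.ofReal b)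
    (hsh : M.normSharp V γ η f ≤ ENNReal.ofReal n) (hpi : M.normPi γ ≤ ENNReal.ofReal p)
    (hga : M.normGam γ ≤ ENNReal.ofReal l) {c₀ : ℝ} (hc₀ : 0 ≤ c₀)
    (hsub : ∀ x y, V.star (x + y) ≤ c₀ * V.star x * V.star y) {c : ℝ} (hc : 0 ≤ c)
    (hcα : ∀ α ∈ 𝒯.idx γ, (2 : ℝ) ^ (γ - α) ≤ c) :
    S.OffCentreBound (insert γ (𝒯.idx γ)) γ (γ - η) (fun x => (1 + 2 * c₀ * c) * (W * V).star x)
      (W * W * V).star (W * W * V).w (b + p * n) (M.remainder f Λ) := by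
  have := (M.pairBounds_single hW hV hf hb hn hp hl hbr hsh hpi hga).offCentreBound_of_submul
    hW hV hc₀ hsub hc hcα
  simpa only [remainder_zero, sub_zero, mul_zero, zero_mul, add_zero] using this

end RegularityStructure.Model

/-! ### The theorem: choice of the constants and assembly. -/

theorem theorem4 {d : ℕ} [NeZero d] (S : GSemigroup d) (W V : Weight d)
    (hW : S.IsGControlled W) (hV : S.IsGControlled V) (hWWV : S.IsGControlled (W * W * V))
    (hWaux : S.HasAuxiliaryWeights W)
    (A : Set ℝ) (γ η β βbar δ : ℝ) (hβ : 0 < β) (hβle : β ≤ βbar) (hδ : γ + βbar < δ)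
    (hη : γ - S.s 0 < η) (hηγ : η ≤ γ) :
    ∃ C a b c : ℝ, ∀ (K : ℝ → Pt d → Pt d → ℝ) (CK : ℝ), S.IsRegularizingKernel βbar δ CK K →
      ∀ {Abar : Set ℝ} (𝒯 : RegularityStructure.{u₁} A) (𝒯bar : RegularityStructure.{u₂} Abar)
        (X : PolynomialSector 𝒯bar S) (I : AbstractIntegration 𝒯 𝒯bar β) (ζ : ℝ),
        ζ ≤ η → (∀ α ∈ A, ζ ≤ α) → 0 < ζ + βbar →
        (β < βbar ∨ ∀ α ∈ A ∪ {γ, ζ}, ∀ k : Fin d → ℕ, α + βbar ≠ S.wt k) →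
        (∀ (M : 𝒯.Model S W) (Mbar : 𝒯bar.Model S W), IsKAdmissible K βbar β δ X I M Mbar →
          ∀ (f : Pt d → 𝒯.Sp) (Λ : ℝ → Pt d → ℝ), M.MemDSharp V γ η f →
            M.IsReconstruction ζ (W * V) γ η f Λ →
            (∀ x, KernelConverges K 0 x Λ) ∧
            (W * V).MemC (kernelFun K Λ) ∧
            Mbar.MemDSharp (W * W * V) (γ + β) (ζ + β) (schauderK K β δ γ X I M f Λ) ∧
            Mbar.IsReconstruction 0 (W * W * V) (γ + β) (ζ + β)
              (schauderK K β δ γ X I M f Λ) (S.ofFun (kernelFun K Λ)) ∧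
            Mbar.bracket (W * W * V) (γ + β) (ζ + β)
              (schauderK K β δ γ X I M f Λ) (S.ofFun (kernelFun K Λ)) ≤
              ENNReal.ofReal (C * CK) * (M.bracket (W * V) γ η f Λ +
                M.normPi γ * (1 + M.normGam γ) * M.normSharp V γ η f) ∧
            ((∃ c₀ : ℝ, ∀ x y, V.star (x + y) ≤ c₀ * V.star x * V.star y) →
              Mbar.bracket (W * W * V) (γ + β) (ζ + β)
              (schauderK K β δ γ X I M f Λ) (S.ofFun (kernelFun K Λ)) ≤
                ENNReal.ofReal (C * CK) * (M.bracket (W * V) γ η f Λ +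
                  M.normPi γ * M.normSharp V γ η f))) ∧
        (∀ (M₁ M₂ : 𝒯.Model S W) (Mbar₁ Mbar₂ : 𝒯bar.Model S W),
          IsKAdmissible K βbar β δ X I M₁ Mbar₁ → IsKAdmissible K βbar β δ X I M₂ Mbar₂ →
          ∀ (f₁ f₂ : Pt d → 𝒯.Sp) (Λ₁ Λ₂ : ℝ → Pt d → ℝ),
            M₁.MemDSharp V γ η f₁ → M₂.MemDSharp V γ η f₂ →
            M₁.IsReconstruction ζ (W * V) γ η f₁ Λ₁ →
            M₂.IsReconstruction ζ (W * V) γ η f₂ Λ₂ →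
          ∀ R : ℝ, 0 < R →
            M₁.size γ ≤ ENNReal.ofReal R → M₂.size γ ≤ ENNReal.ofReal R →
            M₁.fullSharp V γ η f₁ ≤ ENNReal.ofReal R →
            M₂.fullSharp V γ η f₂ ≤ ENNReal.ofReal R →
            Mbar₁.bracketDist Mbar₂ (W * W * V) (γ + β) (ζ + β)
              (schauderK K β δ γ X I M₁ f₁ Λ₁) (schauderK K β δ γ X I M₂ f₂ Λ₂)
              (S.ofFun (kernelFun K Λ₁)) (S.ofFun (kernelFun K Λ₂)) ≤
              ENNReal.ofReal (CK * (a + b * R + c * R ^ 2)) *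
              (M₁.dist M₂ γ + M₁.distSharp M₂ V γ η f₁ f₂ +
                M₁.bracketDist M₂ (W * V) γ η f₁ f₂ Λ₁ Λ₂) ∧
            (0 < γ → Mbar₁.bracketDist Mbar₂ (W * W * V) (γ + β) (ζ + β)
              (schauderK K β δ γ X I M₁ f₁ Λ₁) (schauderK K β δ γ X I M₂ f₂ Λ₂)
              (S.ofFun (kernelFun K Λ₁)) (S.ofFun (kernelFun K Λ₂)) ≤
              ENNReal.ofReal (CK * (a + b * R + c * R ^ 2)) *
              (M₁.dist M₂ γ + M₁.distSharp M₂ V γ η f₁ f₂))) := by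
  have hWV := hW.mul_of_mul_mul hV hWWV
  obtain ⟨W₁, hW₁, hWW₁, haux, hgW, g, hg, hg₁, hg₂⟩ :=
    GSemigroup.exists_absorbing hW hWV hWaux
  -- The constants must be chosen before any regularity structure is given. If A is not finite below
  -- γ, no structure with this index set exists and the claim is void.
  by_cases hfin : (A ∩ Iio γ).Finite
  swap
  · exact ⟨0, 0, 0, 0, fun K CK _ Abar 𝒯 => absurd (𝒯.finite_lt γ) hfin⟩
  -- If this fails, no ζ can satisfy ζ ≤ η ≤ γ, ζ ≤ α for all α ∈ A, and ζ+β̄ > 0, so the claim is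
  -- again void.
  by_cases hE : ∀ α ∈ insert γ hfin.toFinset, 0 < βbar + α
  swap
  · refine ⟨0, 0, 0, 0, fun K CK _ Abar 𝒯 𝒯bar X I ζ hζη hζA hζ => absurd (fun α hα => ?_) hE⟩
    rcases Finset.mem_insert.1 hα with rfl | h
    · linarith
    · linarith [hζA α ((Set.Finite.mem_toFinset hfin).1 h).1]
  have hEγ : ∀ α ∈ hfin.toFinset, α < γ := fun α hα => ((Set.Finite.mem_toFinset hfin).1 hα).2
  have hsd : ∀ g, S.Controls g → S.SchauderData (insert γ hfin.toFinset) γ (γ - η) g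
      (W * W * V).star (W * W * V).w := fun g hg =>
    ⟨hg, hWWV.one_le_star, hWWV.w_pos, by linarith, by linarith, Finset.mem_insert_self _ _⟩
  obtain ⟨C₀, hC₀, H₀⟩ : ∃ C, 0 ≤ C ∧ S.SchauderBound (insert γ hfin.toFinset) γ (γ - η) g
      (W * W * V).star (W * W * V).w β βbar δ C :=
    (hsd g hg).exists_bracket_le hWWV.controls hβle hδ hE
  set c := ∑ α ∈ hfin.toFinset, (2 : ℝ) ^ (γ - α)
  have hc2 : ∀ α ∈ hfin.toFinset, 0 ≤ (2 : ℝ) ^ (γ - α) := fun α _ =>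
    Real.rpow_nonneg zero_le_two _
  have hc0 : 0 ≤ c := Finset.sum_nonneg hc2
  have hcα : ∀ α ∈ hfin.toFinset, (2 : ℝ) ^ (γ - α) ≤ c := fun α hα =>
    Finset.single_le_sum hc2 hα
  -- Submultiplicativity is a property of v* alone, so its constant may be fixed before the data; if
  -- it fails, 0 is a harmless value.
  obtain ⟨C₁, hC₁, H₁⟩ : ∃ C, 0 ≤ C ∧
      ((∃ c₀ : ℝ, ∀ x y, V.star (x + y) ≤ c₀ * V.star x * V.star y) →
      ∃ c₀ : ℝ, 0 ≤ c₀ ∧ (∀ x y, V.star (x + y) ≤ c₀ * V.star x * V.star y) ∧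
        S.SchauderBound (insert γ hfin.toFinset) γ (γ - η)
          (fun x => (1 + 2 * c₀ * c) * (W * V).star x) (W * W * V).star (W * W * V).w β βbar δ C) := by
    by_cases hsub : ∃ c₀ : ℝ, ∀ x y, V.star (x + y) ≤ c₀ * V.star x * V.star y
    · obtain ⟨c₀, hc₀⟩ := hsub
      obtain ⟨C, h0, h1⟩ := (hsd _ (hWV.controls.const_mul
        (by positivity : 0 ≤ 1 + 2 * |c₀| * c))).exists_bracket_le hWWV.controls hβle hδ hE
      refine ⟨C, h0, fun _ => ⟨|c₀|, abs_nonneg _, fun x y => (hc₀ x y).trans ?_, h1⟩⟩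
      have h2 := zero_le_one.trans (hV.one_le_star x)
      have h3 := zero_le_one.trans (hV.one_le_star y)
      have h4 := le_abs_self c₀
      gcongr
    · exact ⟨0, le_rfl, fun h => absurd h hsub⟩
  obtain ⟨C₂, hC₂, H₂⟩ : ∃ C, 0 ≤ C ∧ (0 < γ → ∀ {A : Set ℝ} {𝒯 : RegularityStructure.{u₁} A},
      𝒯.idx γ = hfin.toFinset →
      ∀ {M₁ M₂ : 𝒯.Model S W} {f₁ f₂ : Pt d → 𝒯.Sp} {Λ₁ Λ₂ : ℝ → Pt d → ℝ}
        {K : ℝ → Pt d → Pt d → ℝ} {βbar δ CK ζ : ℝ} {U U' : Weight d}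
        {Nd N₂ N₁ N₁₂ L₁ L₂ L₁₂ : ℝ},
      M₁.KernelInput K βbar δ CK ζ γ U U' f₁ Λ₁ → M₂.KernelInput K βbar δ CK ζ γ U U' f₂ Λ₂ →
      M₁.bracketDist M₂ (W * V) γ η f₁ f₂ Λ₁ Λ₂ < ⊤ →
      M₁.PairBounds M₂ V γ η f₁ f₂ Λ₁ Λ₂ (M₁.bracketDist M₂ (W * V) γ η f₁ f₂ Λ₁ Λ₂).toReal
        Nd N₂ N₁ N₁₂ L₁ L₂ L₁₂ →
      (M₁.bracketDist M₂ (W * V) γ η f₁ f₂ Λ₁ Λ₂).toReal ≤ C * (N₁ * Nd + N₁₂ * N₂)) := by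
    by_cases hγ : 0 < γ
    · obtain ⟨C, h0, h1⟩ :=
        RegularityStructure.Model.exists_bracketDist_le.{u₁} hW hV hWV hη hηγ hγ hEγ
      exact ⟨C, h0, fun _ => h1⟩
    · exact ⟨0, le_rfl, fun h => absurd h hγ⟩
  -- In the first constant, 2C₀ pays for the two terms with ‖Π‖‖f‖^# in the off-centre bound, and C₁
  -- for the submultiplicative case. The 1 added to C₀ keeps the quadratic polynomial positive even
  -- if C₀ = 0, and the term with C₂ covers the replacement of the bracket distance when γ > 0.
  refine ⟨2 * C₀ + C₁, C₀ + 1, C₀ * (2 + 2 * C₂), 2 * C₀, fun K CK hK Abar 𝒯 𝒯bar X I ζ hζη hζA hζ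
    hcrit => ?_⟩
  have hCK := hK.CK_pos
  have hcritγ : β < βbar ∨ ∀ k : Fin d → ℕ, γ + βbar ≠ S.wt k :=
    hcrit.imp_right fun h => h γ (by simp)
  have hin : ∀ (M : 𝒯.Model S W) (f : Pt d → 𝒯.Sp) (Λ : ℝ → Pt d → ℝ), M.MemDSharp V γ η f →
      M.IsReconstruction ζ (W * V) γ η f Λ →
      M.KernelInput K βbar δ CK ζ γ (W * V) (W * W₁) f Λ := fun M f Λ hf hΛ =>
    M.kernelInput_of_isReconstruction hW hWV hW₁ hWW₁ haux hK hζA hζ hf.2.1 hΛ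
  have hoc : ∀ (M : 𝒯.Model S W) (f : Pt d → 𝒯.Sp) (Λ : ℝ → Pt d → ℝ), M.MemDSharp V γ η f →
      M.IsReconstruction ζ (W * V) γ η f Λ → S.OffCentreBound (insert γ hfin.toFinset) γ (γ - η) g
        (W * W * V).star (W * W * V).w ((M.bracket (W * V) γ η f Λ).toReal +
          (M.normPi γ).toReal * (M.normSharp V γ η f).toReal +
          (M.normPi γ).toReal * ((1 + (M.normGam γ).toReal) * (M.normSharp V γ η f).toReal))
        (M.remainder f Λ) := fun M f Λ hf hΛ =>
    M.offCentreBound_single hW hV hf.2.1 ENNReal.toReal_nonneg ENNReal.toReal_nonneg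
      ENNReal.toReal_nonneg ENNReal.toReal_nonneg (ENNReal.ofReal_toReal hΛ.2.ne).ge
      (ENNReal.ofReal_toReal (ENNReal.add_lt_top.1 hf.2.2).2.ne).ge
      (ENNReal.ofReal_toReal (M.normPi_lt hW γ).ne).ge
      (ENNReal.ofReal_toReal (M.normGam_lt hW γ).ne).ge hg₁ hg₂
  refine ⟨fun M Mbar hadm f Λ hf hΛ => ?_, ?_⟩
  · have h := hin M f Λ hf hΛ
    have hoc := hoc M f Λ hf hΛ
    have hb := ENNReal.ofReal_toReal hΛ.2.ne
    have hn := ENNReal.ofReal_toReal (ENNReal.add_lt_top.1 hf.2.2).2.ne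
    have hp := ENNReal.ofReal_toReal (M.normPi_lt hW γ).ne
    have hl := ENNReal.ofReal_toReal (M.normGam_lt hW γ).ne
    have b0 : 0 ≤ (M.bracket (W * V) γ η f Λ).toReal := ENNReal.toReal_nonneg
    have n0 : 0 ≤ (M.normSharp V γ η f).toReal := ENNReal.toReal_nonneg
    have p0 : 0 ≤ (M.normPi γ).toReal := ENNReal.toReal_nonneg
    have l0 : 0 ≤ (M.normGam γ).toReal := ENNReal.toReal_nonneg
    have hΘ : 0 ≤ (M.bracket (W * V) γ η f Λ).toReal +
        (M.normPi γ).toReal * (M.normSharp V γ η f).toReal +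
        (M.normPi γ).toReal * ((1 + (M.normGam γ).toReal) * (M.normSharp V γ η f).toReal) := by
      positivity
    have hbr := h.bracket_schauderK_le hWWV hC₀ H₀ hβle hδ hζη hcritγ hadm hΘ hoc
    refine ⟨fun x => h.besov.kernelConverges hWV hK h.delta_pos
      (by rw [S.wt_zero, sub_zero]; exact h.pos) x, h.memC_kernelFun,
      h.memDSharp_schauderK hW hV hWWV hgW (hsd g hg) hΘ hoc hf hβle hδ hζη hζA hcrit hadm.1,
      ⟨h.memBesov_kernelFun hW, hbr.trans_lt ENNReal.ofReal_lt_top⟩, hbr.trans ?_, fun hsub => ?_⟩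
    · rw [← hb, ← hn, ← hp, ← hl, ← ENNReal.ofReal_one, ← ENNReal.ofReal_add zero_le_one l0,
        ← ENNReal.ofReal_mul p0, ← ENNReal.ofReal_mul (by positivity),
        ← ENNReal.ofReal_add b0 (by positivity), ← ENNReal.ofReal_mul (by positivity)]
      simp only [ENNReal.toReal_ofReal, b0, n0, p0, l0]
      refine ENNReal.ofReal_le_ofReal ?_
      set b := (M.bracket (W * V) γ η f Λ).toReal
      set n := (M.normSharp V γ η f).toReal
      set p := (M.normPi γ).toReal
      set l := (M.normGam γ).toReal
      have e1 : 0 ≤ C₁ * CK * (b + p * (1 + l) * n) := by positivity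
      have e2 : 0 ≤ C₀ * CK * (b + p * l * n) := by positivity
      linarith
    · obtain ⟨c₀, hc₀, hsub, H⟩ := H₁ hsub
      have hoc' := M.offCentreBound_single_of_submul hW hV hf.2.1 b0 n0 p0 l0 hb.ge hn.ge hp.ge
        hl.ge hc₀ hsub hc0 hcα
      refine (h.bracket_schauderK_le hWWV hC₁ H hβle hδ hζη hcritγ hadm (by positivity)
        hoc').trans ?_
      rw [← hb, ← hn, ← hp, ← ENNReal.ofReal_mul p0, ← ENNReal.ofReal_add b0 (by positivity),
        ← ENNReal.ofReal_mul (by positivity)]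
      simp only [ENNReal.toReal_ofReal, b0, n0, p0]
      refine ENNReal.ofReal_le_ofReal ?_
      gcongr
      linarith
  · intro M₁ M₂ Mbar₁ Mbar₂ hadm₁ hadm₂ f₁ f₂ Λ₁ Λ₂ hf₁ hf₂ hΛ₁ hΛ₂ R hR hM₁ hM₂ hR₁ hR₂
    have h₁ := hin M₁ f₁ Λ₁ hf₁ hΛ₁
    have h₂ := hin M₂ f₂ Λ₂ hf₂ hΛ₂
    have hoc₁ := hoc M₁ f₁ Λ₁ hf₁ hΛ₁
    have hoc₂ := hoc M₂ f₂ Λ₂ hf₂ hΛ₂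
    have hk : 0 < CK * (C₀ + 1 + C₀ * (2 + 2 * C₂) * R + 2 * C₀ * R ^ 2) := by positivity
    have hbfin := RegularityStructure.Model.bracketDist_lt_top hWV hΛ₁.2 hΛ₂.2
    have hb := ENNReal.ofReal_toReal hbfin.ne
    have hb0 : 0 ≤ (M₁.bracketDist M₂ (W * V) γ η f₁ f₂ Λ₁ Λ₂).toReal := ENNReal.toReal_nonneg
    -- A positive factor times ⊤ is ⊤, so both inequalities are trivial if the distances are
    -- infinite.
    by_cases htop : M₁.dist M₂ γ + M₁.distSharp M₂ V γ η f₁ f₂ = ⊤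
    · rw [htop, top_add, ENNReal.mul_top (ENNReal.ofReal_pos.2 hk).ne']
      exact ⟨le_top, fun _ => le_top⟩
    obtain ⟨hDt, hnt⟩ := ENNReal.add_ne_top.1 htop
    have hD := ENNReal.ofReal_toReal hDt
    have hn := ENNReal.ofReal_toReal hnt
    have hD0 : 0 ≤ (M₁.dist M₂ γ).toReal := ENNReal.toReal_nonneg
    have hn0 : 0 ≤ (M₁.distSharp M₂ V γ η f₁ f₂).toReal := ENNReal.toReal_nonneg
    have hpb := M₁.pairBounds_of_dist M₂ hW hV hf₁.2.1 hf₂.2.1 hb0 hn0 hD0 hR.le hb.ge hn.ge hD.ge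
      hM₁ hM₂ hR₂
    have hoc₁₂ := hpb.offCentreBound hW hV hg₁ hg₂
    have key := h₁.bracketDist_schauderK_le h₂ hWWV hC₀ (hsd g hg) H₀ hβle hδ hζη hcritγ hadm₁
      hadm₂ (by positivity) (by positivity) (by positivity) hoc₁ hoc₂ hoc₁₂
    have hγb := fun hγ : 0 < γ => H₂ hγ rfl h₁ h₂ hbfin hpb
    set b := (M₁.bracketDist M₂ (W * V) γ η f₁ f₂ Λ₁ Λ₂).toReal
    set n := (M₁.distSharp M₂ V γ η f₁ f₂).toReal
    set D := (M₁.dist M₂ γ).toReal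
    rw [← hb, ← hn, ← hD, ← ENNReal.ofReal_add hD0 hn0,
      ← ENNReal.ofReal_add (add_nonneg hD0 hn0) hb0, ← ENNReal.ofReal_mul hk.le,
      ← ENNReal.ofReal_mul hk.le]
    -- With all seminorms bounded by R, the distance n of the modelled distributions has coefficient
    -- 2R+R² and the distance D of the models has 2R+2R²; this is the source of the quadratic
    -- polynomial.
    have hsum : b + (R * n + D * R) + (R * ((1 + R) * n + D * R) + D * ((1 + R) * R)) ≤
        b + (2 * R + 2 * R ^ 2) * (D + n) := by
      have : 0 ≤ R ^ 2 * n := by positivity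
      linarith
    refine ⟨key.trans (ENNReal.ofReal_le_ofReal ?_), fun hγ =>
      key.trans (ENNReal.ofReal_le_ofReal ?_)⟩
    · calc _ ≤ C₀ * CK * (b + (2 * R + 2 * R ^ 2) * (D + n)) := by gcongr
        _ ≤ C₀ * CK * ((1 + 2 * R + 2 * R ^ 2) * (D + n + b)) := by
            refine mul_le_mul_of_nonneg_left ?_ (by positivity)
            have : 0 ≤ (2 * R + 2 * R ^ 2) * b := by positivity
            linarith
        _ = CK * (C₀ * (1 + 2 * R + 2 * R ^ 2)) * (D + n + b) := by ring
        _ ≤ _ := by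
            gcongr
            have : 0 ≤ C₀ * C₂ * R := by positivity
            linarith
    · calc _ ≤ C₀ * CK * (b + (2 * R + 2 * R ^ 2) * (D + n)) := by gcongr
        _ ≤ C₀ * CK * (C₂ * (R * n + D * R) + (2 * R + 2 * R ^ 2) * (D + n)) := by
            have := hγb hγ
            gcongr
        _ = CK * (C₀ * (C₂ * R + 2 * R + 2 * R ^ 2)) * (D + n) := by ring
        _ ≤ _ := by
            gcongr
            have : 0 ≤ C₀ * C₂ * R := by positivity
            linarith
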